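/- **Theorem (uniqueness).** Let $d\ge 2$, let $\Omega\subset\mathbb R^d$ be a bounded connected open set with Lipschitz boundary, let $T>0$, $\mathfrak{Re}>0$, $\mathfrak{We}>0$, $0\le\omega<1$, let $m:(0,\infty)\to\mathbb R$ be measurable and nonnegative with $\int_0^\infty m(s)\,ds=1$, and let $\mathcal S:\mathbb R^{d\times d}\to\mathbb R^{d\times d}$ be of class $\mathcal C^1$. Let $H(\Omega)=\{v\in L^2(\Omega)^d:\operatorname{div}v=0 \text{ in }\Omega,\ v\cdot n=0\text{ on }\partial\Omega\}$ and $V(\Omega)=\{v\in H^1_0(\Omega)^d:\operatorname{div}v=0\}$, with dual $V'(\Omega)$. Let $u_0\in H(\Omega)$, $G_{\rm old}\in L^\infty(\mathbb R^+;L^2(\Omega))$, $f\in L^1(0,T;V'(\Omega))$. Consider the system, for $t\in(0,T)$, $s>0$, $x\in\Omega$, $$\mathfrak{Re}(\partial_t u+u\cdot\nabla u)+\nabla p-(1-\omega)\Delta u=\operatorname{div}\tau+f,\qquad \operatorname{div}u=0,$$ $$\tau(t,x)=\frac{\omega}{\mathfrak{We}}\int_0^\infty m(s)\,\mathcal S(G(s,t,x))\,ds,\qquad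 \partial_tG+\frac1{\mathfrak{We}}\partial_sG+u\cdot\nabla G=G\cdot\nabla u,$$ with $u|_{t=0}=u_0$, $u|_{\partial\Omega}=0$, $G|_{t=0}=G_{\rm old}$, $G|_{s=0}=\delta$ (the identity matrix), where $(\nabla u)_{ij}=\partial_iu_j$ and $(\operatorname{div}\tau)_j=\sum_i\partial_i\tau_{ij}$. A weak solution is a quadruple $(u,p,\tau,G)$ such that: $u(t)\in V(\Omega)$ for a.e. $t$; for every $v\in V(\Omega)$, $$\frac{d}{dt}\,\mathfrak{Re}\,(u,v)_{L^2}+\mathfrak{Re}\,(u\cdot\nabla u,v)_{L^2}+(1-\omega)(\nabla u,\nabla v)_{L^2}+(\tau,\nabla v)_{L^2}=\langle f,v\rangle$$ holds weakly on $[0,T)$ with initial value $(u_0,v)_{L^2}$ of $(u,v)_{L^2}$; $p$ is a distribution on $(0,T)\times\Omega$ and the momentum equation with $\nabla p$ holds in the sense of distributions, the force being represented there by an extension of $f(t)$ from $V(\Omega)$ to $H^1_0(\Omega)^d$, the same one for all solutions; the integral law for $\tau$ holds a.e.; and the equation for $G$ holds weakly, tested by smooth compactly supported functions on $[0,\infty)\times[0,T)\times\Omega$,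 so that the conditions at $s=0$ and $t=0$ are included. Let $(u_1,p_1,\tau_1,G_1)$ and $(u_2,p_2,\tau_2,G_2)$ be two weak solutions for the same data such that, for $i\in\{1,2\}$, $$u_i\in L^\infty(0,T;L^2(\Omega))\cap L^2(0,T;H^1(\Omega))\cap L^1(0,T;W^{1,\infty}(\Omega)),$$ $$G_i\in L^\infty(\mathbb R^+\times(0,T);W^{1,d}(\Omega))\cap L^\infty(\mathbb R^+\times(0,T)\times\Omega).$$ Then $u_1=u_2$ and $\tau_1=\tau_2$ a.e. in $(0,T)\times\Omega$, $G_1=G_2$ a.e. in $\mathbb R^+\times(0,T)\times\Omega$, and $p_1-p_2$ depends on $t$ only: there is a distribution $c$ on $(0,T)$ with $\langle p_1-p_2,\chi\rangle=\langle c,\int_\Omega\chi(\cdot,x)\,dx\rangle$ for all $\chi\in\mathcal C_c^\infty((0,T)\times\Omega)$; if $p_1$ and $p_2$ are locally integrable functions, there is $c\in L^1_{\rm loc}(0,T)$ with $p_1(t,x)-p_2(t,x)=c(t)$ for a.e. $(t,x)$. -/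

import Mathlib

open MeasureTheory Set TopologicalSpace
open scoped Distributions ENNReal NNReal

noncomputable section

/-! ### Vectors, tensors and elementary algebra -/

/-- The space `ℝ^d` with its Euclidean norm. -/
abbrev Vec (d : ℕ) := EuclideanSpace ℝ (Fin d)

/-- The space `𝓛(ℝ^d)` of real `d × d` matrices, with the Frobenius norm `|A|² = Tr(ᵀA A)` and the
Frobenius inner product `A : B`. The coefficient `A_{ij}` is `A (i, j)`. -/
abbrev Ten (d : ℕ) := EuclideanSpace ℝ (Fin d × Fin d)

/-- The identity tensor `δ`. -/
def idTen (d : ℕ) : Ten d := WithLp.toLp 2 fun ij => if ij.1 = ij.2 then 1 else 0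

/-- The product `A · B` of two tensors. -/
def tenMul {d : ℕ} (A B : Ten d) : Ten d :=
  WithLp.toLp 2 fun ij => ∑ k, A (ij.1, k) * B (k, ij.2)

/-- The contraction `a · B`, `(a · B)_k = ∑ i, a_i B_{ik}`. If `B = ∇g`, where
`(∇g)_{ik} = ∂_i g_k`, then it is `a · ∇g = ∑ i, a_i ∂_i g`. -/
def advect {d : ℕ} {ι : Type} [Fintype ι] (a : Vec d) (B : EuclideanSpace ℝ (Fin d × ι)) :
    EuclideanSpace ℝ ι :=
  WithLp.toLp 2 fun k => ∑ i, a i * B (i, k)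

/-- The classical gradient, `(∇g)_{ik} = ∂_i g_k`. -/
def grad {d : ℕ} {ι : Type} [Fintype ι] (g : Vec d → EuclideanSpace ℝ ι) (x : Vec d) :
    EuclideanSpace ℝ (Fin d × ι) :=
  WithLp.toLp 2 fun ik => fderiv ℝ g x (EuclideanSpace.single ik.1 1) ik.2

/-! ### The domain -/

/-- `Ω` has a Lipschitz continuous boundary: near each boundary point there are a unit vector `n`
and a Lipschitz function `γ` of the coordinates orthogonal to `n` such that `Ω` is the part of
space that lies above the graph of `γ` in the direction `n`. -/
def HasLipschitzBoundary {d : ℕ} (Ω : Set (Vec d)) : Prop :=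
  ∀ x ∈ frontier Ω, ∃ (n : Vec d) (γ : Vec d → ℝ) (K : ℝ≥0) (U : Set (Vec d)),
    ‖n‖ = 1 ∧ LipschitzWith K γ ∧ (∀ (y : Vec d) (r : ℝ), γ (y + r • n) = γ y) ∧
      IsOpen U ∧ x ∈ U ∧ ∀ y ∈ U, y ∈ Ω ↔ γ y < inner ℝ y n

/-- The time interval `(0, T)` as an open set. -/
def timeInterval (T : ℝ) : Opens ℝ := ⟨Ioo 0 T, isOpen_Ioo⟩

/-- The open half line `(-∞, T)`; its test functions need not vanish at `0`. -/
def timeBefore (T : ℝ) : Opens ℝ := ⟨Iio T, isOpen_Iio⟩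

/-- The space-time cylinder `(0, T) × Ω`. -/
def spaceTime {d : ℕ} (Ω : Opens (Vec d)) (T : ℝ) : Opens (ℝ × Vec d) :=
  ⟨Ioo 0 T ×ˢ (Ω : Set (Vec d)), isOpen_Ioo.prod Ω.isOpen⟩

/-- The set `(0, ∞) × (0, T) × Ω` of all `(s, t, x)`: age, time, position. -/
def ageCylinder {d : ℕ} (Ω : Opens (Vec d)) (T : ℝ) : Set (ℝ × ℝ × Vec d) :=
  Ioi 0 ×ˢ (Ioo 0 T ×ˢ (Ω : Set (Vec d)))

/-- The open set `ℝ × (-∞, T) × Ω`; its test functions need not vanish at `s = 0` or at `t = 0`. -/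
def ageTestDomain {d : ℕ} (Ω : Opens (Vec d)) (T : ℝ) : Opens (ℝ × ℝ × Vec d) :=
  ⟨univ ×ˢ (Iio T ×ˢ (Ω : Set (Vec d))), isOpen_univ.prod (isOpen_Iio.prod Ω.isOpen)⟩

/-! ### Test functions -/

/-- The function `φ(t, ·)` of a test function `φ` on `(0, T) × Ω`. -/
def slice {d : ℕ} {Ω : Opens (Vec d)} {T : ℝ} (φ : 𝓓(spaceTime Ω T, Vec d)) (t : ℝ) :
    𝓓(Ω, Vec d) where
  toFun x := φ (t, x)
  contDiff' := φ.contDiff.comp (contDiff_const.prodMk contDiff_id)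
  hasCompactSupport' := by
    refine HasCompactSupport.intro (φ.hasCompactSupport.image continuous_snd) fun x hx => ?_
    by_contra h
    exact hx ⟨(t, x), subset_tsupport _ h, rfl⟩
  tsupport_subset' := by
    intro x hx
    have h1 : tsupport (fun x => φ (t, x)) ⊆ (fun x => (t, x)) ⁻¹' tsupport φ :=
      closure_minimal (fun y hy => subset_tsupport _ hy)
        ((isClosed_tsupport _).preimage (by fun_prop))
    exact (φ.tsupport_subset (h1 hx)).2

/-- The spatial divergence `∑ i, ∂_{x_i} φ_i` of a test field on `(0, T) × Ω`. -/
def divX {d : ℕ} {Ω : Opens (Vec d)} {T : ℝ} (φ : 𝓓(spaceTime Ω T, Vec d)) :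
    𝓓(spaceTime Ω T, ℝ) where
  toFun z := ∑ i : Fin d, fderiv ℝ φ z (0, EuclideanSpace.single i 1) i
  contDiff' := by
    have h : ContDiff ℝ ((⊤ : ℕ∞) : WithTop ℕ∞) (fderiv ℝ φ) := φ.contDiff.fderiv_right (by simp)
    refine ContDiff.sum fun i _ => ?_
    exact (EuclideanSpace.proj i : Vec d →L[ℝ] ℝ).contDiff.comp
      (h.clm_apply contDiff_const)
  hasCompactSupport' := by
    refine φ.hasCompactSupport.mono' fun z hz => ?_
    by_contra h
    exact hz (by simp [fderiv_of_notMem_tsupport (𝕜 := ℝ) h])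
  tsupport_subset' := by
    refine subset_trans (closure_minimal (fun z hz => ?_) (isClosed_tsupport φ)) φ.tsupport_subset
    by_contra h
    exact hz (by simp [fderiv_of_notMem_tsupport (𝕜 := ℝ) h])

/-! ### Function spaces on the domain -/

/-- `Dg` is the weak gradient of `g` in `Ω`, `(Dg)_{ik} = ∂_i g_k` in the sense of distributions. -/
structure HasWeakGrad {d : ℕ} {ι : Type} [Fintype ι] (Ω : Opens (Vec d))
    (g : Vec d → EuclideanSpace ℝ ι) (Dg : Vec d → EuclideanSpace ℝ (Fin d × ι)) : Prop where
  locInt : LocallyIntegrableOn g Ω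
  locInt_grad : LocallyIntegrableOn Dg Ω
  integral_eq : ∀ (φ : 𝓓(Ω, ℝ)) (i : Fin d) (k : ι),
    ∫ x in Ω, g x k * fderiv ℝ φ x (EuclideanSpace.single i 1) = -∫ x in Ω, Dg x (i, k) * φ x

/-- The Hilbert space `L²(Ω; ℝ^d) × L²(Ω; ℝ^{d×d})`, in which `H¹(Ω)` embeds isometrically by
`v ↦ (v, ∇v)`. -/
abbrev L2Pair {d : ℕ} (Ω : Opens (Vec d)) :=
  WithLp 2 (Lp (Vec d) 2 (volume.restrict (Ω : Set (Vec d))) ×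
    Lp (Ten d) 2 (volume.restrict (Ω : Set (Vec d))))

lemma continuous_grad_test {d : ℕ} {Ω : Opens (Vec d)} (φ : 𝓓(Ω, Vec d)) :
    Continuous (grad φ) := by
  have h : Continuous (fderiv ℝ φ) := φ.contDiff.continuous_fderiv (by simp)
  unfold grad
  fun_prop

lemma hasCompactSupport_grad_test {d : ℕ} {Ω : Opens (Vec d)} (φ : 𝓓(Ω, Vec d)) :
    HasCompactSupport (grad φ) := by
  refine φ.hasCompactSupport.mono' fun z hz => ?_
  by_contra h
  refine hz ?_
  ext ik
  simp [grad, fderiv_of_notMem_tsupport (𝕜 := ℝ) h]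

/-- The pair `(φ, ∇φ)` of a test field `φ`. -/
def testPair {d : ℕ} {Ω : Opens (Vec d)} (φ : 𝓓(Ω, Vec d)) : L2Pair Ω :=
  WithLp.toLp 2
    ((φ.continuous.memLp_of_hasCompactSupport φ.hasCompactSupport).toLp φ,
      ((continuous_grad_test φ).memLp_of_hasCompactSupport
        (hasCompactSupport_grad_test φ)).toLp (grad φ))

/-- The space `H¹₀(Ω; ℝ^d)`, the closure of the test fields in `H¹`. An element is a pair
`(v, ∇v)`. -/
def H10 {d : ℕ} (Ω : Opens (Vec d)) : Submodule ℝ (L2Pair Ω) :=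
  (Submodule.span ℝ (range (testPair (Ω := Ω)))).topologicalClosure

/-- A test field as an element of `H¹₀(Ω; ℝ^d)`. -/
def testH10 {d : ℕ} {Ω : Opens (Vec d)} (φ : 𝓓(Ω, Vec d)) : H10 Ω :=
  ⟨testPair φ, Submodule.le_topologicalClosure _ (Submodule.subset_span ⟨φ, rfl⟩)⟩

/-- The field `v` itself, for `(v, ∇v)` in `H¹₀(Ω; ℝ^d)`. -/
def H10val {d : ℕ} {Ω : Opens (Vec d)} (v : H10 Ω) : Vec d → Vec d := v.1.fst

/-- The gradient `∇v`, for `(v, ∇v)` in `H¹₀(Ω; ℝ^d)`. -/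
def H10grad {d : ℕ} {Ω : Opens (Vec d)} (v : H10 Ω) : Vec d → Ten d := v.1.snd

/-- The space `V(Ω)` of the divergence free fields in `H¹₀(Ω; ℝ^d)`. -/
def V {d : ℕ} (Ω : Opens (Vec d)) : Submodule ℝ (H10 Ω) where
  carrier := {v | ∀ᵐ x ∂volume.restrict (Ω : Set (Vec d)), ∑ i, H10grad v x (i, i) = 0}
  zero_mem' := by
    filter_upwards [Lp.coeFn_zero (Ten d) 2 (volume.restrict (Ω : Set (Vec d)))] with x hx
    have h : H10grad (0 : H10 Ω) x = 0 := hx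
    simp [h]
  add_mem' := by
    intro a b ha hb
    filter_upwards [ha, hb, Lp.coeFn_add a.1.snd b.1.snd] with x hxa hxb hx
    simp only [H10grad, Submodule.coe_add, WithLp.add_snd, hx] at *
    simp [Finset.sum_add_distrib, hxa, hxb]
  smul_mem' := by
    intro c a ha
    filter_upwards [ha, Lp.coeFn_smul c a.1.snd] with x hxa hx
    simp only [H10grad, Submodule.coe_smul, WithLp.smul_snd, hx] at *
    simp [← Finset.mul_sum, hxa]

/-- `v` belongs to `H(Ω)`: it is in `L²(Ω)`, `div v = 0` in `Ω` and `v · n = 0` on `∂Ω`. The last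
two conditions are expressed together through Green's formula, that is by `∫_Ω v · ∇q = 0` for
every smooth function `q` up to the boundary. -/
def MemH {d : ℕ} (Ω : Opens (Vec d)) (v : Vec d → Vec d) : Prop :=
  MemLp v 2 (volume.restrict (Ω : Set (Vec d))) ∧
    ∀ q : 𝓓((⊤ : Opens (Vec d)), ℝ), ∫ x in Ω, fderiv ℝ q x (v x) = 0

/-! ### Classes of velocities and of deformation gradients -/

/-- `u ∈ L^∞(0,T; L²(Ω)) ∩ L²(0,T; H¹(Ω)) ∩ L¹(0,T; W^{1,∞}(Ω))`, with spatial weak gradient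
`Du`. -/
structure VelocityClass {d : ℕ} (Ω : Opens (Vec d)) (T : ℝ)
    (u : ℝ → Vec d → Vec d) (Du : ℝ → Vec d → Ten d) : Prop where
  meas : AEStronglyMeasurable (fun z : ℝ × Vec d => u z.1 z.2)
    (volume.restrict (spaceTime Ω T : Set (ℝ × Vec d)))
  meas_grad : AEStronglyMeasurable (fun z : ℝ × Vec d => Du z.1 z.2)
    (volume.restrict (spaceTime Ω T : Set (ℝ × Vec d)))
  weakGrad : ∀ᵐ t ∂volume.restrict (Ioo 0 T), HasWeakGrad Ω (u t) (Du t)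
  linf_l2 : ∃ M : ℝ≥0, ∀ᵐ t ∂volume.restrict (Ioo 0 T),
    eLpNorm (u t) 2 (volume.restrict (Ω : Set (Vec d))) ≤ M
  l2_h1 : ∫⁻ t in Ioo 0 T, (eLpNorm (u t) 2 (volume.restrict (Ω : Set (Vec d))) ^ 2 +
    eLpNorm (Du t) 2 (volume.restrict (Ω : Set (Vec d))) ^ 2) < ∞
  l1_w1inf : ∫⁻ t in Ioo 0 T, (eLpNorm (u t) ∞ (volume.restrict (Ω : Set (Vec d))) +
    eLpNorm (Du t) ∞ (volume.restrict (Ω : Set (Vec d)))) < ∞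

/-- `G ∈ L^∞(ℝ⁺ × (0,T); W^{1,d}(Ω))`, with spatial weak gradient `DG`. -/
structure DeformationClass {d : ℕ} (Ω : Opens (Vec d)) (T : ℝ)
    (G : ℝ → ℝ → Vec d → Ten d)
    (DG : ℝ → ℝ → Vec d → EuclideanSpace ℝ (Fin d × (Fin d × Fin d))) : Prop where
  meas : AEStronglyMeasurable (fun z : ℝ × ℝ × Vec d => G z.1 z.2.1 z.2.2)
    (volume.restrict (ageCylinder Ω T))
  meas_grad : AEStronglyMeasurable (fun z : ℝ × ℝ × Vec d => DG z.1 z.2.1 z.2.2)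
    (volume.restrict (ageCylinder Ω T))
  weakGrad : ∀ᵐ r ∂volume.restrict (Ioi (0 : ℝ) ×ˢ Ioo 0 T),
    HasWeakGrad Ω (G r.1 r.2) (DG r.1 r.2)
  linf_w1d : ∃ M : ℝ≥0, ∀ᵐ r ∂volume.restrict (Ioi (0 : ℝ) ×ˢ Ioo 0 T),
    eLpNorm (G r.1 r.2) d (volume.restrict (Ω : Set (Vec d))) +
      eLpNorm (DG r.1 r.2) d (volume.restrict (Ω : Set (Vec d))) ≤ M

/-- `G ∈ L^∞(ℝ⁺ × (0,T) × Ω)` (for a measurable `G`). -/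
def EssBounded {d : ℕ} (Ω : Opens (Vec d)) (T : ℝ) (G : ℝ → ℝ → Vec d → Ten d) : Prop :=
  ∃ M : ℝ, ∀ᵐ z ∂volume.restrict (ageCylinder Ω T), ‖G z.1 z.2.1 z.2.2‖ ≤ M

/-- `G_old ∈ L^∞(ℝ⁺; L²(Ω))`. -/
structure PastClass {d : ℕ} (Ω : Opens (Vec d)) (Gold : ℝ → Vec d → Ten d) : Prop where
  meas : AEStronglyMeasurable (fun z : ℝ × Vec d => Gold z.1 z.2)
    (volume.restrict (Ioi (0 : ℝ) ×ˢ (Ω : Set (Vec d))))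
  linf_l2 : ∃ M : ℝ≥0, ∀ᵐ s ∂volume.restrict (Ioi (0 : ℝ)),
    eLpNorm (Gold s) 2 (volume.restrict (Ω : Set (Vec d))) ≤ M

/-- The memory function: integrable on `ℝ⁺`, nonnegative, with integral `1`. -/
structure IsMemory (m : ℝ → ℝ) : Prop where
  nonneg : ∀ s, 0 < s → 0 ≤ m s
  integrable : IntegrableOn m (Ioi 0)
  integral_eq_one : ∫ s in Ioi 0, m s = 1

/-- `f ∈ L¹(0,T; V(Ω)')`: as `V(Ω)` is separable, the measurability of `f` means that of
`t ↦ ⟨f(t), v⟩` for all `v ∈ V(Ω)`. -/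
structure ForceClass {d : ℕ} (Ω : Opens (Vec d)) (T : ℝ) (f : ℝ → StrongDual ℝ (V Ω)) :
    Prop where
  meas : ∀ v : V Ω, AEStronglyMeasurable (fun t => f t v) (volume.restrict (Ioo 0 T))
  l1 : ∫⁻ t in Ioo 0 T, ENNReal.ofReal ‖f t‖ < ∞

/-- `F` represents the `V(Ω)'`-valued force `f` as a distribution on `(0,T) × Ω`: `F(t)` is a
continuous linear form on `H¹₀(Ω)` that extends the form `f(t)` on `V(Ω)`. -/
structure RepresentsForce {d : ℕ} (Ω : Opens (Vec d)) (T : ℝ)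
    (f : ℝ → StrongDual ℝ (V Ω)) (F : ℝ → StrongDual ℝ (H10 Ω)) : Prop where
  extends_force : ∀ᵐ t ∂volume.restrict (Ioo 0 T), ∀ v : V Ω, F t (v : H10 Ω) = f t v
  integrable : ∀ φ : 𝓓(spaceTime Ω T, Vec d),
    IntegrableOn (fun t => F t (testH10 (slice φ t))) (Ioo 0 T)

/-! ### Weak solutions -/

/-- Incompressibility and the no-slip condition: `u(t) ∈ V(Ω)` for almost every `t`. -/
def SolenoidalNoSlip {d : ℕ} (Ω : Opens (Vec d)) (T : ℝ)
    (u : ℝ → Vec d → Vec d) (Du : ℝ → Vec d → Ten d) : Prop :=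
  ∀ᵐ t ∂volume.restrict (Ioo 0 T), ∃ v ∈ V Ω,
    H10val v =ᵐ[volume.restrict (Ω : Set (Vec d))] u t ∧
      H10grad v =ᵐ[volume.restrict (Ω : Set (Vec d))] Du t

/-- The momentum equation with `u|_{t=0} = u₀`, tested by the fields of `V(Ω)`: for all `v ∈ V(Ω)`,
`d/dt Re (u, v) + Re (u·∇u, v) + (1-ω) (∇u, ∇v) + (τ, ∇v) = ⟨f, v⟩` in the weak sense on `[0,T)`. -/
def WeakMomentum {d : ℕ} (Ω : Opens (Vec d)) (T Re ω : ℝ) (u₀ : Vec d → Vec d)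
    (f : ℝ → StrongDual ℝ (V Ω)) (u : ℝ → Vec d → Vec d) (Du : ℝ → Vec d → Ten d)
    (τ : ℝ → Vec d → Ten d) : Prop :=
  ∀ (v : V Ω) (θ : 𝓓(timeBefore T, ℝ)),
    ∫ t in Ioo 0 T,
      (-(Re * deriv θ t * ∫ x in Ω, inner ℝ (u t x) (H10val v.1 x)) +
        θ t * ((Re * ∫ x in Ω, inner ℝ (advect (u t x) (Du t x)) (H10val v.1 x)) +
          ((1 - ω) * ∫ x in Ω, inner ℝ (Du t x) (H10grad v.1 x)) +
          ∫ x in Ω, inner ℝ (τ t x) (H10grad v.1 x))) =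
    (Re * θ 0 * ∫ x in Ω, inner ℝ (u₀ x) (H10val v.1 x)) + ∫ t in Ioo 0 T, θ t * f t v

/-- The momentum equation with pressure, in the sense of distributions on `(0,T) × Ω`:
`Re (∂_t u + u·∇u) + ∇p - (1-ω) Δu = div τ + F`, where `(div τ)_j = ∑ i, ∂_i τ_{ij}`. -/
def PressureEquation {d : ℕ} (Ω : Opens (Vec d)) (T Re ω : ℝ)
    (F : ℝ → StrongDual ℝ (H10 Ω)) (u : ℝ → Vec d → Vec d) (Du : ℝ → Vec d → Ten d)
    (p : 𝓓'(spaceTime Ω T, ℝ)) (τ : ℝ → Vec d → Ten d) : Prop :=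
  ∀ φ : 𝓓(spaceTime Ω T, Vec d),
    (∫ t in Ioo 0 T, ∫ x in Ω,
      (-(Re * inner ℝ (u t x) (deriv (fun r => φ (r, x)) t)) +
        Re * inner ℝ (advect (u t x) (Du t x)) (φ (t, x)) +
        (1 - ω) * inner ℝ (Du t x) (grad (fun y => φ (t, y)) x) +
        inner ℝ (τ t x) (grad (fun y => φ (t, y)) x))) - p (divX φ) =
    ∫ t in Ioo 0 T, F t (testH10 (slice φ t))

/-- The integral law `τ(t,x) = (ω / We) ∫_0^∞ m(s) 𝒮(G(s,t,x)) ds`. -/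
def IntegralLaw {d : ℕ} (Ω : Opens (Vec d)) (T We ω : ℝ) (m : ℝ → ℝ) (S : Ten d → Ten d)
    (τ : ℝ → Vec d → Ten d) (G : ℝ → ℝ → Vec d → Ten d) : Prop :=
  ∀ᵐ z ∂volume.restrict (spaceTime Ω T : Set (ℝ × Vec d)),
    IntegrableOn (fun s => m s • S (G s z.1 z.2)) (Ioi 0) ∧
      τ z.1 z.2 = (ω / We) • ∫ s in Ioi 0, m s • S (G s z.1 z.2)

/-- The equation `∂_t G + (1/We) ∂_s G + u·∇G = G·∇u` on `ℝ⁺ × (0,T) × Ω`, with `G|_{t=0} = G_old`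
and `G|_{s=0} = δ`, in the weak sense: the test tensors `ψ` need not vanish at `s = 0` or at
`t = 0`. -/
def WeakTransport {d : ℕ} (Ω : Opens (Vec d)) (T We : ℝ) (Gold : ℝ → Vec d → Ten d)
    (u : ℝ → Vec d → Vec d) (Du : ℝ → Vec d → Ten d) (G : ℝ → ℝ → Vec d → Ten d)
    (DG : ℝ → ℝ → Vec d → EuclideanSpace ℝ (Fin d × (Fin d × Fin d))) : Prop :=
  ∀ ψ : 𝓓(ageTestDomain Ω T, Ten d),
    ∫ z in ageCylinder Ω T,
      (-inner ℝ (G z.1 z.2.1 z.2.2)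
          (deriv (fun r => ψ (z.1, r, z.2.2)) z.2.1 +
            (1 / We) • deriv (fun r => ψ (r, z.2.1, z.2.2)) z.1) +
        inner ℝ (advect (u z.2.1 z.2.2) (DG z.1 z.2.1 z.2.2) -
          tenMul (G z.1 z.2.1 z.2.2) (Du z.2.1 z.2.2)) (ψ z)) =
    (∫ z in Ioi (0 : ℝ) ×ˢ (Ω : Set (Vec d)), inner ℝ (Gold z.1 z.2) (ψ (z.1, 0, z.2))) +
      (1 / We) * ∫ z in Ioo 0 T ×ˢ (Ω : Set (Vec d)), inner ℝ (idTen d) (ψ (0, z.1, z.2))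

/-- `(u, p, τ, G)` is a weak solution of the initial boundary value problem for
`Re (∂_t u + u·∇u) + ∇p - (1-ω) Δu = div τ + f`, `div u = 0`,
`τ = (ω/We) ∫_0^∞ m(s) 𝒮(G(s)) ds`, `∂_t G + (1/We) ∂_s G + u·∇G = G·∇u`,
`u|_{t=0} = u₀`, `u|_{∂Ω} = 0`, `G|_{t=0} = G_old`, `G|_{s=0} = δ`.
Here `Du` and `DG` are the spatial weak gradients of `u` and `G`, and `F` represents `f` as a
distribution. -/
structure IsWeakSolution {d : ℕ} (Ω : Opens (Vec d)) (T Re We ω : ℝ) (m : ℝ → ℝ)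
    (S : Ten d → Ten d) (u₀ : Vec d → Vec d) (Gold : ℝ → Vec d → Ten d)
    (f : ℝ → StrongDual ℝ (V Ω)) (F : ℝ → StrongDual ℝ (H10 Ω))
    (u : ℝ → Vec d → Vec d) (Du : ℝ → Vec d → Ten d) (p : 𝓓'(spaceTime Ω T, ℝ))
    (τ : ℝ → Vec d → Ten d) (G : ℝ → ℝ → Vec d → Ten d)
    (DG : ℝ → ℝ → Vec d → EuclideanSpace ℝ (Fin d × (Fin d × Fin d))) : Prop where
  solenoidal : SolenoidalNoSlip Ω T u Du
  momentum : WeakMomentum Ω T Re ω u₀ f u Du τ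
  pressure : PressureEquation Ω T Re ω F u Du p τ
  law : IntegralLaw Ω T We ω m S τ G
  transport : WeakTransport Ω T We Gold u Du G DG

/-! ### Pressures -/

/-- The distribution `q` on `(0,T) × Ω` depends on `t` only: there is a distribution `c` on `(0,T)`
such that `⟨q, χ⟩ = ⟨c, ∫_Ω χ(·, x) dx⟩`. -/
def DependsOnTimeOnly {d : ℕ} {Ω : Opens (Vec d)} {T : ℝ} (q : 𝓓'(spaceTime Ω T, ℝ)) : Prop :=
  ∃ c : 𝓓'(timeInterval T, ℝ), ∀ (χ : 𝓓(spaceTime Ω T, ℝ)) (ψ : 𝓓(timeInterval T, ℝ)),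
    (∀ t, ψ t = ∫ x in Ω, χ (t, x)) → q χ = c ψ

/-- The distribution `p` is the locally integrable function `P`. -/
def IsFunction {d : ℕ} {Ω : Opens (Vec d)} {T : ℝ} (p : 𝓓'(spaceTime Ω T, ℝ))
    (P : ℝ → Vec d → ℝ) : Prop :=
  LocallyIntegrableOn (fun z : ℝ × Vec d => P z.1 z.2) (spaceTime Ω T : Set (ℝ × Vec d)) ∧
    ∀ χ : 𝓓(spaceTime Ω T, ℝ),
      p χ = ∫ z in (spaceTime Ω T : Set (ℝ × Vec d)), P z.1 z.2 * χ z

end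

/-! All norms below are those of L²(Ω). Put U(t) = ‖u₁ - u₂‖², D(t) = ‖∇u₁ - ∇u₂‖², z(s,t) = ‖G₁ -
G₂‖², and let Z(t) be the essential supremum of z(s,t) over all ages s. Uniqueness of u, τ and G
follows from a closed system of integral inequalities for U and Z; the pressure is treated
afterwards.

Momentum. The difference of the velocities satisfies an energy identity (`energy_identity`).
Convection of the difference by u₁ drops out because u₁ is divergence free, and the remaining
convection term costs ‖∇u₂‖_∞ U, with a coefficient integrable in time. Young's inequality leaves
-(1-ω) D and a multiple of ‖τ₁ - τ₂‖² (`energy_difference`). As m is a probability density and 𝒮 is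
Lipschitz on bounded sets, ‖τ₁ - τ₂‖² ≤ A Z (`exists_stress_difference_bound`). The time derivative
of u is never used as an element of a dual space: the weak equation is tested with u(r) at another
time r, and the diagonal t = r is reached through a symmetric approximate identity
(`weak_deriv_diag`).

Transport. The equation for G is read as a derivative in the constant direction ∂_t + (1/We) ∂_s,
with u·∇G - G·∇u kept on the other side as a source. Hence |G₁ - G₂|² satisfies the expected
equation by plain mollification (`weak_deriv_sq`), its integral over Ω satisfies an equation in
(s,t) alone (`transport_reduction`), and this one is integrated along characteristics with zero data
on s = 0 and on t = 0 (`le_primitive_of_transport`). In the source, u₁·∇(G₁ - G₂) vanishes after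
integration against G₁ - G₂; the terms with G·∇u are handled by ‖∇u₁‖_∞ and by the bound of G₂.

The critical term is the integral of (u₁ - u₂)·∇G₂ against G₁ - G₂, where ∇G₂ is only in L^d. For d
≥ 3 it is estimated by Hölder and the Sobolev embedding of H¹₀ in L^{2d/(d-2)}. For d = 2 that
embedding fails at its endpoint. The pointwise bound of u₁ - u₂ by a Riesz potential of its
gradient, with the kernel split as |x|^{-(2-ε)/2} |x|^{-ε/2} and ε = 1/n, gives instead C √n
‖∇(u₁-u₂)‖ ‖G₁-G₂‖^{1-1/n} for every n ≥ 2 (`lintegral_trilinear_two`, `exists_trilinear_bound`).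
Young's inequality turns this into a part of D plus C n Z^{1-1/n}. For small y the infimum over n of
n y^{1-1/n} behaves like y log(1/y), so the Osgood condition holds.

Conclusion for u, τ, G. In Re U + (1-ω) Z the two contributions of D cancel, and the sum satisfies
Y(t) ≤ ∫₀ᵗ (c Y + C n Y^{1-1/n}) for all n with c integrable. It therefore vanishes
(`eq_zero_of_osgood`, `eq_zero_of_coupled_inequalities`).

Pressure. Once velocities, their gradients and stresses agree, q = p₁ - p₂ annihilates every spatial
divergence. If a test function is supported near a point, it differs from the product of its spatial
mean with a fixed bump by a divergence, which is written down explicitly by moving mass along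
segments (`exists_divX_eq_integral`). Connectedness of Ω and a partition of unity make this global:
q(χ) depends on the mean of χ only (`exists_apply_eq_testTensor`). -/

noncomputable section

/-! ### Primitives and a nonlinear Gronwall lemma -/

/-- The primitive `t ↦ ∫_t^T β`, cut off at `-∞`, as a test function on `(-∞, T)`. -/
lemma exists_test_primitive {T : ℝ} {β : ℝ → ℝ} (hβ : ContDiff ℝ ((⊤ : ℕ∞) : WithTop ℕ∞) β)
    (hβc : HasCompactSupport β) (hβT : tsupport β ⊆ Ioo 0 T) :
    ∃ θ : 𝓓(timeBefore T, ℝ), ∀ t ∈ Ioo 0 T,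
      θ t = ∫ r in Ioo t T, β r ∧ deriv θ t = -β t := by
  obtain ⟨b, hbT, hb⟩ : ∃ b < T, ∀ x ∈ tsupport β, x ≤ b := by
    rcases (tsupport β).eq_empty_or_nonempty with h | h
    · exact ⟨T - 1, by linarith, by simp [h]⟩
    · obtain ⟨b, hb, hmax⟩ := hβc.isCompact.exists_isMaxOn h continuousOn_id
      exact ⟨b, (hβT hb).2, fun x hx => hmax hx⟩
  set B : ℝ → ℝ := fun t => ∫ r in t..T, β r with hB
  have hBd : ∀ t, HasDerivAt B (-β t) t := fun t =>
    intervalIntegral.integral_hasDerivAt_left (hβ.continuous.intervalIntegrable _ _)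
      (hβ.continuous.stronglyMeasurableAtFilter _ _) hβ.continuous.continuousAt
  have hBs : ContDiff ℝ ((⊤ : ℕ∞) : WithTop ℕ∞) B := by
    rw [contDiff_infty_iff_deriv]
    refine ⟨fun t => (hBd t).differentiableAt, ?_⟩
    have : deriv B = fun t => -β t := funext fun t => (hBd t).deriv
    rw [this]
    exact hβ.neg
  have hB0 : ∀ t, b < t → B t = 0 := by
    intro t ht
    have : ∀ r ∈ uIcc t T, β r = 0 := by
      intro r hr
      refine image_eq_zero_of_notMem_tsupport fun h => ?_
      have h1 := hb r h
      rcases le_total t T with h2 | h2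
      · rw [uIcc_of_le h2] at hr; linarith [hr.1]
      · rw [uIcc_of_ge h2] at hr; linarith [hr.1]
    simp only [hB]
    rw [intervalIntegral.integral_congr (g := fun _ => 0) this]
    simp
  -- To the left of the support of β the primitive is constant and in general nonzero, so it has to
  -- be cut off. The factor vanishes for t ≤ -2 and equals 1 for t ≥ -1, hence it changes nothing on
  -- (0, T).
  set κ : ℝ → ℝ := fun t => Real.smoothTransition (t + 2) with hκ
  have hκs : ContDiff ℝ ((⊤ : ℕ∞) : WithTop ℕ∞) κ :=
    Real.smoothTransition.contDiff.comp (contDiff_id.add contDiff_const)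
  have hsub : Function.support (fun t => κ t * B t) ⊆ Icc (-2) b := by
    intro t ht
    rw [Function.mem_support] at ht
    constructor
    · by_contra h
      exact ht (by simp [hκ, Real.smoothTransition.zero_of_nonpos (by linarith : t + 2 ≤ 0)])
    · by_contra h
      exact ht (by simp [hB0 t (by linarith)])
  have hts : tsupport (fun t => κ t * B t) ⊆ Icc (-2) b := closure_minimal hsub isClosed_Icc
  refine ⟨⟨fun t => κ t * B t, hκs.mul hBs, HasCompactSupport.of_support_subset_isCompact
    isCompact_Icc hsub, fun t ht => lt_of_le_of_lt (hts ht).2 hbT⟩, fun t ht => ?_⟩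
  have hone : ∀ s : ℝ, 0 < s → κ s = 1 := fun s hs =>
    Real.smoothTransition.one_of_one_le (by linarith)
  constructor
  · change κ t * B t = _
    rw [hone t ht.1, one_mul, hB]
    simp only
    rw [intervalIntegral.integral_of_le ht.2.le, integral_Ioc_eq_integral_Ioo]
  · change deriv (fun t => κ t * B t) t = _
    have : (fun t => κ t * B t) =ᶠ[nhds t] B := by
      filter_upwards [lt_mem_nhds ht.1] with s hs
      rw [hone s hs, one_mul]
    rw [this.deriv_eq, (hBd t).deriv]

lemma integrable_primitive {T : ℝ} {g : ℝ → ℝ} (hg : IntegrableOn g (Ioo 0 T)) :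
    IntegrableOn (fun t => ∫ r in Ioo 0 t, g r) (Ioo 0 T) := by
  have hc : ContinuousOn (fun t => ∫ r in Ioc 0 t, g r) (Icc 0 T) :=
    intervalIntegral.continuousOn_primitive (by rwa [integrableOn_Icc_iff_integrableOn_Ioo])
  simp_rw [integral_Ioc_eq_integral_Ioo] at hc
  exact (hc.integrableOn_compact isCompact_Icc).mono_set Ioo_subset_Icc_self

/-- A function on `(0, T)` whose weak derivative on `[0, T)`, with zero initial value, is `g`, is
the primitive of `g`. -/
lemma eq_primitive_of_weak_deriv {T : ℝ} {f g : ℝ → ℝ} (hf : IntegrableOn f (Ioo 0 T))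
    (hg : IntegrableOn g (Ioo 0 T))
    (h : ∀ θ : 𝓓(timeBefore T, ℝ), ∫ t in Ioo 0 T, (f t * deriv θ t + g t * θ t) = 0) :
    ∀ᵐ t ∂volume.restrict (Ioo 0 T), f t = ∫ r in Ioo 0 t, g r := by
  have hGi := integrable_primitive hg
  have key := isOpen_Ioo.ae_eq_zero_of_integral_contDiff_smul_eq_zero
    (μ := volume) (U := Ioo 0 T) (f := fun t => f t - ∫ r in Ioo 0 t, g r)
    (hf.sub hGi).locallyIntegrableOn ?_
  · rw [ae_restrict_iff' measurableSet_Ioo]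
    filter_upwards [key] with t ht hmem
    exact sub_eq_zero.1 (ht hmem)
  intro β hβ hβc hβT
  -- Since θ' = -β, the hypothesis for θ pairs f with β. The term g θ is a double integral over t <
  -- r, and Fubini turns it into the pairing of β with the primitive of g. That θ need not vanish at
  -- 0 is what excludes an additive constant.
  obtain ⟨θ, hθ⟩ := exists_test_primitive hβ hβc hβT
  have h1 := h θ
  obtain ⟨M, hM⟩ := hβ.continuous.bounded_above_of_compact_support hβc
  have hβb : ∀ {φ : ℝ → ℝ}, IntegrableOn φ (Ioo 0 T) →
      IntegrableOn (fun t => β t * φ t) (Ioo 0 T) := fun hφ =>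
    Integrable.bdd_mul hφ hβ.continuous.aestronglyMeasurable
      (Filter.Eventually.of_forall hM)
  have hβi : IntegrableOn β (Ioo 0 T) := (hβ.continuous.integrable_of_hasCompactSupport hβc).integrableOn
  have hbig : Integrable (fun z : ℝ × ℝ => {p : ℝ × ℝ | p.1 < p.2}.indicator
      (fun p => g p.1 * β p.2) z)
      ((volume.restrict (Ioo 0 T)).prod (volume.restrict (Ioo 0 T))) :=
    (hg.mul_prod hβi).indicator (measurableSet_lt measurable_fst measurable_snd)
  have hA : ∀ t ∈ Ioo 0 T, ∫ r in Ioo 0 T, {p : ℝ × ℝ | p.1 < p.2}.indicator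
      (fun p => g p.1 * β p.2) (t, r) = g t * ∫ r in Ioo t T, β r := by
    intro t ht
    have : (fun r => {p : ℝ × ℝ | p.1 < p.2}.indicator (fun p => g p.1 * β p.2) (t, r)) =
        (Ioi t).indicator (fun r => g t * β r) := by
      ext r; simp [indicator]
    rw [this, setIntegral_indicator measurableSet_Ioi, ← integral_const_mul]
    congr 2
    ext r; simp only [mem_inter_iff, mem_Ioo, mem_Ioi]
    constructor
    · rintro ⟨⟨_, h2⟩, h3⟩; exact ⟨h3, h2⟩
    · rintro ⟨h2, h3⟩; exact ⟨⟨ht.1.trans h2, h3⟩, h2⟩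
  have hA' : ∀ r ∈ Ioo 0 T, ∫ t in Ioo 0 T, {p : ℝ × ℝ | p.1 < p.2}.indicator
      (fun p => g p.1 * β p.2) (t, r) = β r * ∫ t in Ioo 0 r, g t := by
    intro r hr
    have : (fun t => {p : ℝ × ℝ | p.1 < p.2}.indicator (fun p => g p.1 * β p.2) (t, r)) =
        (Iio r).indicator (fun t => β r * g t) := by
      ext t; simp [indicator, mul_comm]
    rw [this, setIntegral_indicator measurableSet_Iio, ← integral_const_mul]
    congr 2
    ext t; simp only [mem_inter_iff, mem_Ioo, mem_Iio]
    constructor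
    · rintro ⟨⟨h1, _⟩, h3⟩; exact ⟨h1, h3⟩
    · rintro ⟨h2, h3⟩; exact ⟨⟨h2, h3.trans hr.2⟩, h3⟩
  have hswap : ∫ t in Ioo 0 T, g t * ∫ r in Ioo t T, β r =
      ∫ r in Ioo 0 T, β r * ∫ t in Ioo 0 r, g t := by
    rw [← setIntegral_congr_fun measurableSet_Ioo hA, ← setIntegral_congr_fun measurableSet_Ioo hA']
    exact integral_integral_swap hbig
  have hgi : IntegrableOn (fun t => g t * ∫ r in Ioo t T, β r) (Ioo 0 T) :=
    (integrableOn_congr_fun hA measurableSet_Ioo).1 hbig.integral_prod_left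
  have h2 : ∫ t in Ioo 0 T, (f t * deriv θ t + g t * θ t) =
      -(∫ t in Ioo 0 T, β t * f t) + ∫ t in Ioo 0 T, g t * ∫ r in Ioo t T, β r := by
    have hn : IntegrableOn (fun t => -(β t * f t)) (Ioo 0 T) := (hβb hf).neg
    rw [← integral_neg, ← integral_add hn hgi]
    refine setIntegral_congr_fun measurableSet_Ioo fun t ht => ?_
    simp only [(hθ t ht).1, (hθ t ht).2]
    ring
  rw [h2, hswap] at h1
  have h3 : ∫ t, β t • (f t - ∫ r in Ioo 0 t, g r) =
      ∫ t in Ioo 0 T, (β t * f t - β t * ∫ r in Ioo 0 t, g r) := by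
    rw [← setIntegral_eq_integral_of_forall_compl_eq_zero (s := Ioo 0 T)]
    · simp [mul_sub]
    · intro t ht
      rw [image_eq_zero_of_notMem_tsupport fun h => ht (hβT h), zero_smul]
  rw [h3, integral_sub (hβb hf) (hβb hGi)]
  linarith

/-- One step of the Osgood argument: on an interval `[a, b]` on which `∫ c ≤ 1/2` and
`C (b - a) ≤ 1/8`, smallness of order `2⁻ⁿ`. -/
lemma osgood_step {a b C : ℝ} (hab : a ≤ b) (hC : 0 ≤ C) (hCb : C * (b - a) ≤ 1 / 8) {n : ℕ}
    (hn : 2 ≤ n) {Φ : ℝ → ℝ} (hΦ : Continuous Φ) (hΦ0 : ∀ t, 0 ≤ Φ t)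
    (h : ∀ t ∈ Icc a b, Φ t ≤ Φ t / 2 + ∫ r in a..t, C * n * Φ r ^ (1 - 1 / (n : ℝ))) :
    ∀ t ∈ Icc a b, Φ t ≤ (1 / 2) ^ n := by
  have hn0 : (0 : ℝ) < n := by positivity
  have hn1 : 1 / (n : ℝ) ≤ 1 := by
    rw [div_le_one hn0]; exact_mod_cast (by omega : 1 ≤ n)
  have hp : 0 ≤ 1 - 1 / (n : ℝ) := by linarith
  -- The factor 2 comes from absorbing Φ/2 into the left side.
  set k : ℝ → ℝ := fun r => 2 * (C * n * Φ r ^ (1 - 1 / (n : ℝ))) with hk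
  have hkc : Continuous k :=
    continuous_const.mul (continuous_const.mul (hΦ.rpow_const fun x => Or.inr hp))
  have hk0 : ∀ r, 0 ≤ k r := fun r => by
    have := Real.rpow_nonneg (hΦ0 r) (1 - 1 / (n : ℝ)); positivity
  set W : ℝ → ℝ := fun t => ∫ r in a..t, k r with hW
  have hΦW : ∀ t ∈ Icc a b, Φ t ≤ W t := by
    intro t ht
    have := h t ht
    simp only [hW, hk, intervalIntegral.integral_const_mul (2 : ℝ)]
    linarith
  have hW0 : ∀ t ∈ Icc a b, 0 ≤ W t := fun t ht => (hΦ0 t).trans (hΦW t ht)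
  have hWd : ∀ t, HasDerivAt W (k t) t := fun t =>
    intervalIntegral.integral_hasDerivAt_right (hkc.intervalIntegrable _ _)
      (hkc.stronglyMeasurableAtFilter _ _) hkc.continuousAt
  -- W vanishes at a, where the n-th root is not differentiable. With this shift (W + κ)^{1/n}
  -- starts at 1/4 and has slope at most 2C, so over a length b - a with C (b - a) ≤ 1/8 it stays
  -- below 1/2.
  set κ : ℝ := (1 / 4) ^ n with hκ
  have hκ0 : 0 < κ := by positivity
  have hd : ∀ t ∈ Icc a b, HasDerivAt (fun t => (W t + κ) ^ (1 / (n : ℝ)))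
      (k t * (1 / (n : ℝ)) * (W t + κ) ^ (1 / (n : ℝ) - 1)) t := by
    intro t ht
    exact ((hWd t).add_const κ).rpow_const (Or.inl (by have := hW0 t ht; positivity))
  intro t ht
  have hmv := (convex_Icc a b).image_sub_le_mul_sub_of_deriv_le (C := 2 * C)
    (f := fun t => (W t + κ) ^ (1 / (n : ℝ)))
    (fun s hs => (hd s hs).continuousAt.continuousWithinAt)
    (fun s hs => (hd s (interior_subset hs)).differentiableAt.differentiableWithinAt)
    (fun s hs => by
      have hs' := interior_subset hs
      rw [(hd s hs').deriv]
      have hpos : 0 < W s + κ := by have := hW0 s hs'; positivity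
      have h1 : Φ s ^ (1 - 1 / (n : ℝ)) ≤ (W s + κ) ^ (1 - 1 / (n : ℝ)) :=
        Real.rpow_le_rpow (hΦ0 s) (by linarith [hΦW s hs']) hp
      have h2 : (W s + κ) ^ (1 - 1 / (n : ℝ)) * (W s + κ) ^ (1 / (n : ℝ) - 1) = 1 := by
        rw [← Real.rpow_add hpos]; simp
      have h3 : 0 ≤ (W s + κ) ^ (1 / (n : ℝ) - 1) := Real.rpow_nonneg hpos.le _
      calc k s * (1 / (n : ℝ)) * (W s + κ) ^ (1 / (n : ℝ) - 1)
          = 2 * C * (Φ s ^ (1 - 1 / (n : ℝ)) * (W s + κ) ^ (1 / (n : ℝ) - 1)) := by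
            simp only [hk]; field_simp
        _ ≤ 2 * C * ((W s + κ) ^ (1 - 1 / (n : ℝ)) * (W s + κ) ^ (1 / (n : ℝ) - 1)) := by gcongr
        _ = 2 * C := by rw [h2, mul_one])
    a (left_mem_Icc.2 hab) t ht ht.1
  have hWa : (W a + κ) ^ (1 / (n : ℝ)) = 1 / 4 := by
    simp only [hW, intervalIntegral.integral_same, zero_add, hκ]
    rw [one_div (n : ℝ), Real.pow_rpow_inv_natCast (by norm_num) (by omega)]
  have h4 : (W t + κ) ^ (1 / (n : ℝ)) ≤ 1 / 2 := by
    have h5 : C * (t - a) ≤ C * (b - a) := by have := ht.2; gcongr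
    rw [hWa] at hmv
    linarith
  have hpos : 0 ≤ W t + κ := by have := hW0 t ht; positivity
  calc Φ t ≤ W t + κ := by linarith [hΦW t ht]
    _ = ((W t + κ) ^ (1 / (n : ℝ))) ^ n := by
        rw [one_div, Real.rpow_inv_natCast_pow hpos (by omega)]
    _ ≤ (1 / 2) ^ n := pow_le_pow_left₀ (Real.rpow_nonneg hpos _) h4 n

/-- Vanishing propagates over one short interval: on it Y is at most 2⁻ⁿ for every n. As Y is only
measurable, `osgood_step` is applied to the right-hand side Φ of the inequality, which is continuous
and nondecreasing, dominates Y almost everywhere and vanishes at a. -/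
lemma osgood_interval {T a b C M : ℝ} (ha : 0 ≤ a) (hab : a ≤ b) (hbT : b ≤ T) (hC : 0 ≤ C)
    (hCb : C * (b - a) ≤ 1 / 8) {Y c : ℝ → ℝ} (hY0 : ∀ t, 0 ≤ Y t) (hc0 : ∀ t, 0 ≤ c t)
    (hYm : AEStronglyMeasurable Y (volume.restrict (Ioo 0 T)))
    (hYM : ∀ᵐ t ∂volume.restrict (Ioo 0 T), Y t ≤ M) (hc : IntegrableOn c (Ioo 0 T))
    (hcb : ∫ t in Ioo a b, c t ≤ 1 / 2)
    (h : ∀ n : ℕ, 2 ≤ n → ∀ᵐ t ∂volume.restrict (Ioo 0 T),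
      Y t ≤ ∫ r in Ioo 0 t, (c r * Y r + C * n * Y r ^ (1 - 1 / (n : ℝ))))
    (hYa : ∀ᵐ t ∂volume.restrict (Ioo 0 a), Y t = 0) :
    ∀ᵐ t ∂volume.restrict (Ioo 0 b), Y t = 0 := by
  have hY' : ∀ n : ℕ, 2 ≤ n → ∀ᵐ t ∂volume.restrict (Ioo 0 b), Y t ≤ (1 / 2) ^ n := by
    intro n hn
    have hn0 : (0 : ℝ) < n := by positivity
    have hn1 : 1 / (n : ℝ) < 1 := by
      rw [div_lt_one hn0]; exact_mod_cast (by omega : 1 < n)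
    have hp : 0 < 1 - 1 / (n : ℝ) := by linarith
    set F : ℝ → ℝ := fun r => c r * Y r + C * n * Y r ^ (1 - 1 / (n : ℝ)) with hF
    have hF0 : ∀ r, 0 ≤ F r := fun r => by
      have := Real.rpow_nonneg (hY0 r) (1 - 1 / (n : ℝ))
      have := hY0 r; have := hc0 r; positivity
    have hFi : IntegrableOn F (Ioo 0 T) := by
      refine Integrable.add ?_ (Integrable.const_mul ?_ _)
      · refine Integrable.mul_bdd (c := M) hc hYm ?_
        filter_upwards [hYM] with t ht
        rwa [Real.norm_of_nonneg (hY0 t)]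
      · refine Integrable.mono' (g := fun _ => M ^ (1 - 1 / (n : ℝ))) (integrable_const _)
          (hYm.aemeasurable.pow_const _).aestronglyMeasurable ?_
        filter_upwards [hYM] with t ht
        rw [Real.norm_of_nonneg (Real.rpow_nonneg (hY0 t) _)]
        exact Real.rpow_le_rpow (hY0 t) ht hp.le
    set Ft := (Ioo 0 T).indicator F with hFt
    have hFti : Integrable Ft := hFi.integrable_indicator measurableSet_Ioo
    have hFt0 : ∀ r, 0 ≤ Ft r := fun r => indicator_nonneg (fun r _ => hF0 r) r
    set Φ : ℝ → ℝ := fun t => ∫ r in Iic t, Ft r with hΦd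
    have hΦmono : Monotone Φ := fun s t hst =>
      setIntegral_mono_set hFti.integrableOn (Filter.Eventually.of_forall hFt0)
        (Iic_subset_Iic.2 hst).eventuallyLE
    have hΦ0 : ∀ t, 0 ≤ Φ t := fun t => integral_nonneg hFt0
    have hΦsub : ∀ s t, Φ t - Φ s = ∫ r in s..t, Ft r := fun s t =>
      intervalIntegral.integral_Iic_sub_Iic hFti.integrableOn hFti.integrableOn
    have hΦc : Continuous Φ := by
      have : Φ = fun t => Φ 0 + ∫ r in (0 : ℝ)..t, Ft r := by
        ext t; rw [← hΦsub]; ring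
      rw [this]
      exact continuous_const.add
        (intervalIntegral.continuous_primitive (fun _ _ => hFti.intervalIntegrable) 0)
    have hΦeq : ∀ t ≤ T, Φ t = ∫ r in Ioo 0 t, F r := by
      intro t ht
      simp only [hΦd, hFt]
      rw [setIntegral_indicator measurableSet_Ioo]
      refine setIntegral_congr_set ?_
      have h2 : Iio t ∩ Ioo 0 T = Ioo 0 t := by
        ext x; simp only [mem_inter_iff, mem_Ioo, mem_Iio]
        exact ⟨fun h => ⟨h.2.1, h.1⟩, fun h => ⟨h.2, h.1, h.2.trans_le ht⟩⟩
      rw [← h2]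
      exact ae_eq_set_inter Iio_ae_eq_Iic.symm Filter.EventuallyEq.rfl
    have hYΦ : ∀ᵐ t ∂volume.restrict (Ioo 0 T), Y t ≤ Φ t := by
      filter_upwards [h n hn, ae_restrict_mem measurableSet_Ioo] with t ht hmem
      rw [hΦeq t hmem.2.le]
      exact ht
    have hΦa : Φ a = 0 := by
      rw [hΦeq a (hab.trans hbT)]
      refine integral_eq_zero_of_ae ?_
      filter_upwards [hYa] with t ht
      simp only [hF, ht, Real.zero_rpow hp.ne', Pi.zero_apply]
      ring
    have hstep := osgood_step hab hC hCb hn hΦc hΦ0 ?_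
    · have h1 : ∀ᵐ t ∂volume.restrict (Ioo 0 b), Y t ≤ Φ t :=
        ae_mono (Measure.restrict_mono (Ioo_subset_Ioo_right hbT) le_rfl) hYΦ
      filter_upwards [h1, ae_restrict_mem measurableSet_Ioo] with t ht hmem
      refine ht.trans ((hΦmono hmem.2.le).trans (hstep b (right_mem_Icc.2 hab)))
    intro t ht
    have hT : Ioo a t ⊆ Ioo 0 T := Ioo_subset_Ioo ha (ht.2.trans hbT)
    have hci : IntegrableOn (fun r => c r * Φ t) (Ioo a t) := (hc.mono_set hT).mul_const _
    have hpc : Continuous fun r => C * n * Φ r ^ (1 - 1 / (n : ℝ)) :=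
      continuous_const.mul (hΦc.rpow_const fun _ => Or.inr hp.le)
    have hpi : IntegrableOn (fun r => C * n * Φ r ^ (1 - 1 / (n : ℝ))) (Ioo a t) :=
      (hpc.integrableOn_Icc (a := a) (b := t)).mono_set Ioo_subset_Icc_self
    have h1 : Φ t = ∫ r in Ioo a t, F r := by
      rw [← sub_zero (Φ t), ← hΦa, hΦsub, intervalIntegral.integral_of_le ht.1,
        integral_Ioc_eq_integral_Ioo]
      exact setIntegral_congr_fun measurableSet_Ioo fun r hr => indicator_of_mem (hT hr) _
    -- By monotonicity Φ(t) can be taken out of the linear term, and ∫ c ≤ 1/2 then produces the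
    -- Φ(t)/2 of `osgood_step`.
    have h2 : ∫ r in Ioo a t, F r ≤
        ∫ r in Ioo a t, (c r * Φ t + C * n * Φ r ^ (1 - 1 / (n : ℝ))) := by
      refine integral_mono_ae (hFi.mono_set hT) (hci.add hpi) ?_
      filter_upwards [ae_mono (Measure.restrict_mono hT le_rfl) hYΦ,
        ae_restrict_mem measurableSet_Ioo] with r hr hmem
      have h3 := hc0 r
      have h4 : Y r ≤ Φ t := hr.trans (hΦmono hmem.2.le)
      have h5 : Y r ^ (1 - 1 / (n : ℝ)) ≤ Φ r ^ (1 - 1 / (n : ℝ)) :=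
        Real.rpow_le_rpow (hY0 r) hr hp.le
      simp only [hF]
      gcongr
    have h3 : ∫ r in Ioo a t, c r ≤ 1 / 2 := by
      refine (setIntegral_mono_set (hc.mono_set (Ioo_subset_Ioo ha hbT))
        (Filter.Eventually.of_forall hc0) (Ioo_subset_Ioo_right ht.2).eventuallyLE).trans hcb
    rw [integral_add hci hpi, integral_mul_const, ← h1] at h2
    rw [intervalIntegral.integral_of_le ht.1, integral_Ioc_eq_integral_Ioo]
    have := hΦ0 t
    nlinarith
  have hall : ∀ᵐ t ∂volume.restrict (Ioo 0 b), ∀ n : ℕ, 2 ≤ n → Y t ≤ (1 / 2) ^ n := by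
    rw [ae_all_iff]; intro n
    by_cases hn : 2 ≤ n
    · filter_upwards [hY' n hn] with t ht _ using ht
    · exact Filter.Eventually.of_forall fun t h => absurd h hn
  filter_upwards [hall] with t ht
  refine le_antisymm ?_ (hY0 t)
  refine ge_of_tendsto (tendsto_pow_atTop_nhds_zero_of_lt_one (by norm_num : (0:ℝ) ≤ 1 / 2)
    (by norm_num)) ?_
  filter_upwards [Filter.eventually_ge_atTop 2] with n hn using ht n hn

/-- The Osgood uniqueness lemma in integral form, with an integrable coefficient `c` and the
modulus of continuity `y log (1/y)` written as the infimum of `n y ^ (1 - 1/n)`. -/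
lemma eq_zero_of_osgood {T C M : ℝ} (hC : 0 ≤ C) {Y c : ℝ → ℝ} (hY0 : ∀ t, 0 ≤ Y t)
    (hc0 : ∀ t, 0 ≤ c t) (hYm : AEStronglyMeasurable Y (volume.restrict (Ioo 0 T)))
    (hYM : ∀ᵐ t ∂volume.restrict (Ioo 0 T), Y t ≤ M) (hc : IntegrableOn c (Ioo 0 T))
    (h : ∀ n : ℕ, 2 ≤ n → ∀ᵐ t ∂volume.restrict (Ioo 0 T),
      Y t ≤ ∫ r in Ioo 0 t, (c r * Y r + C * n * Y r ^ (1 - 1 / (n : ℝ)))) :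
    ∀ᵐ t ∂volume.restrict (Ioo 0 T), Y t = 0 := by
  rcases le_or_gt T 0 with hT | hT
  · simp [Ioo_eq_empty (not_lt.2 hT)]
  -- Absolute continuity of the integral of c gives one step length that works everywhere in [0, T].
  obtain ⟨δ, hδ, hδc⟩ : ∃ δ > (0 : ℝ), ∀ a b, 0 ≤ a → a ≤ b → b ≤ T → b - a ≤ δ →
      ∫ t in Ioo a b, c t ≤ 1 / 2 := by
    obtain ⟨δ, hδ, hs⟩ := exists_pos_setLIntegral_lt_of_measure_lt
      (μ := volume.restrict (Ioo 0 T)) (f := fun t => ENNReal.ofReal (c t))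
      (by
        have := hc.lintegral_lt_top
        exact this.ne) (ε := ENNReal.ofReal (1 / 2)) (by simp)
    obtain ⟨δ', hδ', hδδ⟩ : ∃ δ' : ℝ, 0 < δ' ∧ ENNReal.ofReal δ' < δ := by
      obtain ⟨r, hr0, hr⟩ := ENNReal.lt_iff_exists_nnreal_btwn.1 hδ
      exact ⟨r, by exact_mod_cast hr0, by simpa using hr⟩
    refine ⟨δ', hδ', fun a b ha hab hbT hba => ?_⟩
    have h1 := hs (Ioo a b) (by
      refine lt_of_le_of_lt (Measure.restrict_apply_le _ _) ?_
      rw [Real.volume_Ioo]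
      exact (ENNReal.ofReal_le_ofReal hba).trans_lt hδδ)
    rw [Measure.restrict_restrict measurableSet_Ioo,
      inter_eq_left.2 (Ioo_subset_Ioo ha hbT)] at h1
    rw [integral_eq_lintegral_of_nonneg_ae (Filter.Eventually.of_forall hc0)
      (hc.mono_set (Ioo_subset_Ioo ha hbT)).aestronglyMeasurable]
    refine (ENNReal.toReal_mono (by simp) h1.le).trans ?_
    rw [ENNReal.toReal_ofReal (by norm_num)]
  -- This length meets both smallness conditions of `osgood_interval`; C + 1 replaces C because C
  -- may be zero.
  set η : ℝ := min δ (1 / (8 * (C + 1))) with hη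
  have hη0 : 0 < η := lt_min hδ (by positivity)
  have hηC : C * η ≤ 1 / 8 := by
    have h1 : η ≤ 1 / (8 * (C + 1)) := min_le_right _ _
    calc C * η ≤ C * (1 / (8 * (C + 1))) := by gcongr
      _ = (C / (C + 1)) / 8 := by field_simp
      _ ≤ 1 / 8 := by
        have : C / (C + 1) ≤ 1 := by rw [div_le_one (by positivity)]; linarith
        linarith
  have hk : ∀ k : ℕ, ∀ᵐ t ∂volume.restrict (Ioo 0 (min (k * η) T)), Y t = 0 := by
    intro k
    induction k with
    | zero => simp [hT.le]
    | succ k ih =>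
      have h1 : min (k * η) T ≤ min ((k + 1 : ℕ) * η) T := by
        push_cast; gcongr; linarith
      have h2 : min ((k + 1 : ℕ) * η) T - min (k * η) T ≤ η := by
        push_cast
        rcases le_total (k * η) T with h | h
        · rw [min_eq_left h]; linarith [min_le_left ((k + 1) * η) T]
        · rw [min_eq_right h]; linarith [min_le_right ((k + 1) * η) T]
      refine osgood_interval (le_min (by positivity) hT.le) h1 (min_le_right _ _) hC
        ((mul_le_mul_of_nonneg_left h2 hC).trans hηC) hY0 hc0 hYm hYM hc
        (hδc _ _ (le_min (by positivity) hT.le) h1 (min_le_right _ _)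
          (h2.trans (min_le_left _ _))) h ih
  obtain ⟨k, hkT⟩ := exists_nat_ge (T / η)
  have := hk k
  rwa [min_eq_right ((div_le_iff₀ hη0).1 hkT)] at this

end

noncomputable section

/-! ### The chain rule for the square of a weakly differentiable function -/

section ChainRule

open scoped Convolution Topology
open ContinuousLinearMap Filter

variable {E : Type*} [NormedAddCommGroup E] [NormedSpace ℝ E] [FiniteDimensional ℝ E]
  [MeasurableSpace E] [BorelSpace E] {μ : Measure E} [μ.IsAddHaarMeasure]

lemma convolution_normed_eq (ρ : ContDiffBump (0 : E)) (f : E → ℝ) (x : E) :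
    (ρ.normed μ ⋆[lsmul ℝ ℝ, μ] f) x = ∫ t, ρ.normed μ (x - t) * f t ∂μ := by
  rw [convolution_eq_swap]; rfl

lemma norm_convolution_normed_le (ρ : ContDiffBump (0 : E)) {f : E → ℝ} {M : ℝ}
    (hM : ∀ᵐ x ∂μ, ‖f x‖ ≤ M) (x : E) : ‖(ρ.normed μ ⋆[lsmul ℝ ℝ, μ] f) x‖ ≤ M := by
  rw [convolution_normed_eq]
  have hi : Integrable (fun t => ρ.normed μ (x - t)) μ := ρ.integrable_normed.comp_sub_left x
  calc ‖∫ t, ρ.normed μ (x - t) * f t ∂μ‖ ≤ ∫ t, ρ.normed μ (x - t) * M ∂μ := by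
        refine norm_integral_le_of_norm_le (hi.mul_const M) ?_
        filter_upwards [hM] with t ht
        rw [norm_mul, Real.norm_of_nonneg (ρ.nonneg_normed _)]
        exact mul_le_mul_of_nonneg_left ht (ρ.nonneg_normed _)
    _ = M := by
        rw [integral_mul_const, integral_sub_left_eq_self (fun t => ρ.normed μ t), 
          ρ.integral_normed, one_mul]

/-- A bump function of outer radius `r`. -/
def bumpOfRadius {r : ℝ} (hr : 0 < r) : ContDiffBump (0 : E) := ⟨r / 2, r, by linarith, by linarith⟩

/-- Fubini together with the evenness of the bump: mollification is a symmetric operator. -/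
lemma integral_mul_convolution_normed (ρ : ContDiffBump (0 : E)) {f k : E → ℝ}
    (hf : Integrable f μ) (hk : Integrable k μ) :
    ∫ x, k x * (ρ.normed μ ⋆[lsmul ℝ ℝ, μ] f) x ∂μ =
      ∫ t, f t * (ρ.normed μ ⋆[lsmul ℝ ℝ, μ] k) t ∂μ := by
  obtain ⟨C, hC⟩ := ρ.continuous_normed (μ := μ) |>.bounded_above_of_compact_support
    ρ.hasCompactSupport_normed
  simp_rw [convolution_normed_eq, ← integral_const_mul]
  have hi : Integrable (fun p : E × E => ρ.normed μ (p.1 - p.2) * (k p.1 * f p.2)) (μ.prod μ) :=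
    Integrable.bdd_mul (hk.mul_prod hf)
      (ρ.continuous_normed.comp (continuous_fst.sub continuous_snd)).aestronglyMeasurable
      (Eventually.of_forall fun p => hC _)
  have hi' : Integrable (Function.uncurry fun x t => k x * (ρ.normed μ (x - t) * f t))
      (μ.prod μ) := by
    refine hi.congr (Eventually.of_forall fun p => ?_)
    simp only [Function.uncurry]; ring
  rw [integral_integral_swap hi']
  refine integral_congr_ae (Eventually.of_forall fun t => ?_)
  refine integral_congr_ae (Eventually.of_forall fun x => ?_)
  simp only
  rw [← ρ.normed_neg (t - x), neg_sub]; ring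

/-- The translated bump t ↦ ρ(x - t) is itself a test function as long as its ball lies in N, and
testing with it gives the derivative of the mollification at x. The truncation of g and R to N is
not felt there. -/
lemma weak_deriv_convolution {O : Opens E} {e : E} {g R : E → ℝ} {N : Set E}
    (hN : IsCompact N) (hNO : N ⊆ O) (hg : IntegrableOn g N μ) 
    (h : ∀ φ : 𝓓(O, ℝ), ∫ x in O, (g x * fderiv ℝ φ x e + R x * φ x) ∂μ = 0)
    (hRi : IntegrableOn R N μ)
    (ρ : ContDiffBump (0 : E)) (x : E) (hx : Metric.closedBall x ρ.rOut ⊆ N) :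
    fderiv ℝ (ρ.normed μ ⋆[lsmul ℝ ℝ, μ] N.indicator g) x e =
      (ρ.normed μ ⋆[lsmul ℝ ℝ, μ] N.indicator R) x := by
  have hgi : Integrable (N.indicator g) μ := hg.integrable_indicator hN.measurableSet
  have hρs : ContDiff ℝ ((⊤ : ℕ∞) : WithTop ℕ∞) (ρ.normed μ) := ρ.contDiff_normed
  have hρd : ∀ y, DifferentiableAt ℝ (ρ.normed μ) y := fun y =>
    (hρs.differentiable (by simp)).differentiableAt
  have h1 := (ρ.hasCompactSupport_normed (μ := μ)).hasFDerivAt_convolution_left (lsmul ℝ ℝ)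
    ρ.contDiff_normed (μ := μ) hgi.locallyIntegrable x
  rw [h1.fderiv, convolution_normed_eq]
  have hce : ConvolutionExistsAt (fderiv ℝ (ρ.normed μ)) (N.indicator g) x
      ((lsmul ℝ ℝ : ℝ →L[ℝ] ℝ →L[ℝ] ℝ).precompL E) μ :=
    (ρ.hasCompactSupport_normed.fderiv ℝ).convolutionExists_left _
      (hρs.continuous_fderiv (by simp)) hgi.locallyIntegrable x
  have hc : (fderiv ℝ (ρ.normed μ) ⋆[(lsmul ℝ ℝ).precompL E, μ] N.indicator g) x e =
      ∫ t, (lsmul ℝ ℝ) (fderiv ℝ (ρ.normed μ) (x - t) e) (N.indicator g t) ∂μ := by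
    rw [convolution_def, ContinuousLinearMap.integral_apply hce,
      ← integral_sub_left_eq_self _ μ x]
    simp
  rw [hc]
  have hsupp : Function.support (fun t => ρ.normed μ (x - t)) ⊆ Metric.closedBall x ρ.rOut := by
    intro t ht
    have h2 : x - t ∈ Function.support (ρ.normed μ) := ht
    rw [ρ.support_normed_eq, mem_ball_zero_iff] at h2
    rw [Metric.mem_closedBall, dist_eq_norm, ← norm_neg, neg_sub]
    exact h2.le
  have hts : tsupport (fun t => ρ.normed μ (x - t)) ⊆ N :=
    (closure_minimal hsupp Metric.isClosed_closedBall).trans hx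
  let ψ : 𝓓(O, ℝ) := ⟨fun t => ρ.normed μ (x - t), hρs.comp (contDiff_const.sub contDiff_id),
    HasCompactSupport.of_support_subset_isCompact hN (subset_closure.trans hts), hts.trans hNO⟩
  have hψ : ∀ t, ψ t = ρ.normed μ (x - t) := fun _ => rfl
  have hψd : ∀ t, fderiv ℝ ψ t e = -(fderiv ℝ (ρ.normed μ) (x - t) e) := by
    intro t
    have h3 : HasFDerivAt ψ ((fderiv ℝ (ρ.normed μ) (x - t)).comp (-ContinuousLinearMap.id ℝ E)) t :=
      (hρd (x - t)).hasFDerivAt.comp t ((hasFDerivAt_id t).const_sub x)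
    rw [h3.fderiv]; simp
  have hz : ∀ t ∉ N, ψ t = 0 ∧ fderiv ℝ ψ t e = 0 := by
    intro t ht
    have h4 : t ∉ tsupport ψ := fun h => ht (hts h)
    exact ⟨image_eq_zero_of_notMem_tsupport h4, by simp [fderiv_of_notMem_tsupport (𝕜 := ℝ) h4]⟩
  have h5 := h ψ
  rw [setIntegral_eq_of_subset_of_forall_sdiff_eq_zero O.isOpen.measurableSet hNO
    (fun t ht => by simp [hz t ht.2])] at h5
  have hbd : Continuous fun t => fderiv ℝ ψ t e :=
    (ψ.contDiff.continuous_fderiv (by simp)).clm_apply continuous_const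
  obtain ⟨C₁, hC₁⟩ := hbd.bounded_above_of_compact_support
    ((ψ.hasCompactSupport.fderiv ℝ).comp_left (g := fun L : E →L[ℝ] ℝ => L e) (by simp))
  obtain ⟨C₂, hC₂⟩ := ψ.continuous.bounded_above_of_compact_support ψ.hasCompactSupport
  rw [integral_add (Integrable.mul_bdd hg hbd.aestronglyMeasurable (Eventually.of_forall hC₁))
    (Integrable.mul_bdd hRi ψ.continuous.aestronglyMeasurable (Eventually.of_forall hC₂))] at h5
  have h6 : ∀ t, N.indicator g t * fderiv ℝ ψ t e =
      -((lsmul ℝ ℝ) ((fderiv ℝ (ρ.normed μ) (x - t)) e) (N.indicator g t)) := by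
    intro t; rw [hψd]; simp [mul_comm]
  have e1 : ∫ t in N, g t * fderiv ℝ ψ t e ∂μ = ∫ t, N.indicator g t * fderiv ℝ ψ t e ∂μ := by
    rw [← integral_indicator hN.measurableSet]
    congr 1; ext t; by_cases ht : t ∈ N <;> simp [ht]
  have e2 : ∫ t in N, R t * ψ t ∂μ = ∫ t, ρ.normed μ (x - t) * N.indicator R t ∂μ := by
    rw [← integral_indicator hN.measurableSet]
    congr 1; ext t; by_cases ht : t ∈ N <;> simp [ht, hψ, mul_comm]
  rw [e1, e2] at h5
  simp_rw [h6, integral_neg] at h5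
  linarith

/-- If `∂_e g = R` weakly in `O`, with `g` bounded and `R` locally integrable, then
`∂_e (g²) = 2 g R` weakly in `O`. -/
lemma weak_deriv_sq {O : Opens E} {e : E} {g R : E → ℝ} {M : ℝ}
    (hgm : AEStronglyMeasurable g (μ.restrict (O : Set E)))
    (hgM : ∀ᵐ x ∂μ.restrict (O : Set E), ‖g x‖ ≤ M)
    (hR : LocallyIntegrableOn R (O : Set E) μ)
    (h : ∀ φ : 𝓓(O, ℝ), ∫ x in O, (g x * fderiv ℝ φ x e + R x * φ x) ∂μ = 0) (φ : 𝓓(O, ℝ)) :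
    ∫ x in O, (g x ^ 2 * fderiv ℝ φ x e + 2 * (R x * g x * φ x)) ∂μ = 0 := by
  have hprop : ProperSpace E := FiniteDimensional.proper ℝ E
  set K := tsupport φ with hKdef
  have hK : IsCompact K := φ.hasCompactSupport
  -- A compact neighbourhood of the support of φ: mollification with radius at most δ at a point of
  -- the support uses only values in N, where g and R are integrable.
  obtain ⟨δ, hδ, hδO⟩ := hK.exists_cthickening_subset_open O.isOpen φ.tsupport_subset
  set N := Metric.cthickening δ K with hNdef
  have hN : IsCompact N := hK.cthickening
  have hKN : K ⊆ N := Metric.self_subset_cthickening K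
  set G := N.indicator g with hGdef
  set Q := N.indicator R with hQdef
  have hM0 : ∀ᵐ x ∂μ, ‖G x‖ ≤ |M| := by
    have := (ae_restrict_iff' O.isOpen.measurableSet).1 hgM
    filter_upwards [this] with x hx
    by_cases hxN : x ∈ N
    · simp only [hGdef, indicator_of_mem hxN]; exact (hx (hδO hxN)).trans (le_abs_self M)
    · simp [hGdef, hxN]
  have hgN : IntegrableOn g N μ := by
    have : IsFiniteMeasure (μ.restrict N) := ⟨by simpa using hN.measure_lt_top⟩
    refine Integrable.of_bound (hgm.mono_set hδO) M ?_
    exact ae_mono (Measure.restrict_mono hδO le_rfl) hgM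
  have hRN : IntegrableOn R N μ := hR.integrableOn_compact_subset hδO hN
  have hGi : Integrable G μ := hgN.integrable_indicator hN.measurableSet
  have hQi : Integrable Q μ := hRN.integrable_indicator hN.measurableSet
  set r : ℕ → ℝ := fun n => δ / (n + 1) with hr
  have hr0 : ∀ n, 0 < r n := fun n => by positivity
  have hrδ : ∀ n, r n ≤ δ := fun n => div_le_self hδ.le (by simp)
  have hrt : Tendsto r atTop (𝓝 0) := by
    have := (tendsto_one_div_add_atTop_nhds_zero_nat (𝕜 := ℝ)).const_mul δ
    simpa [hr, div_eq_mul_inv] using this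
  set ρ : ℕ → ContDiffBump (0 : E) := fun n => bumpOfRadius (hr0 n) with hρ
  have hball : ∀ n, ∀ x ∈ K, Metric.closedBall x (ρ n).rOut ⊆ N := fun n x hx =>
    (Metric.closedBall_subset_closedBall (hrδ n)).trans (Metric.closedBall_subset_cthickening hx δ)
  have hzero : ∀ x ∉ K, φ x = 0 ∧ fderiv ℝ φ x = 0 := fun x hx =>
    ⟨image_eq_zero_of_notMem_tsupport hx, fderiv_of_notMem_tsupport (𝕜 := ℝ) hx⟩
  have hφc := φ.continuous
  have hφd : Continuous fun x => fderiv ℝ φ x e :=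
    (φ.contDiff.continuous_fderiv (by simp)).clm_apply continuous_const
  obtain ⟨C₁, hC₁⟩ := hφd.bounded_above_of_compact_support
    ((φ.hasCompactSupport.fderiv ℝ).comp_left (g := fun L : E →L[ℝ] ℝ => L e) (by simp))
  obtain ⟨C₂, hC₂⟩ := hφc.bounded_above_of_compact_support φ.hasCompactSupport
  have hGφ : Integrable (fun x => G x * φ x) μ :=
    hGi.mul_bdd hφc.aestronglyMeasurable (Eventually.of_forall hC₂)
  set Gn : ℕ → E → ℝ := fun n => (ρ n).normed μ ⋆[lsmul ℝ ℝ, μ] G with hGn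
  set Fn : ℕ → E → ℝ := fun n => (ρ n).normed μ ⋆[lsmul ℝ ℝ, μ] (fun x => G x * φ x) with hFn
  have hGns : ∀ n, ContDiff ℝ ((⊤ : ℕ∞) : WithTop ℕ∞) (Gn n) := fun n =>
    (ρ n).hasCompactSupport_normed.contDiff_convolution_left _ (ρ n).contDiff_normed
      hGi.locallyIntegrable
  have hFns : ∀ n, ContDiff ℝ ((⊤ : ℕ∞) : WithTop ℕ∞) (Fn n) := fun n =>
    (ρ n).hasCompactSupport_normed.contDiff_convolution_left _ (ρ n).contDiff_normed
      hGφ.locallyIntegrable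
  have hGφb : ∀ᵐ x ∂μ, ‖G x * φ x‖ ≤ |M| * C₂ := by
    filter_upwards [hM0] with x hx
    rw [norm_mul]; exact mul_le_mul hx (hC₂ x) (norm_nonneg _) (abs_nonneg _)
  have hGnb : ∀ n x, ‖Gn n x‖ ≤ |M| := fun n x => norm_convolution_normed_le _ hM0 x
  have hFnb : ∀ n x, ‖Fn n x‖ ≤ |M| * C₂ := fun n x => norm_convolution_normed_le _ hGφb x
  -- the identity at the level of the mollified functions
  have hid : ∀ n, ∫ x, (G x * fderiv ℝ φ x e * Gn n x + Q x * (Fn n x + φ x * Gn n x)) ∂μ = 0 := by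
    intro n
    -- Only one factor of the square is mollified. The derivative falls on φ or on the mollified G;
    -- in the second case it produces the mollified Q, and the symmetry of the mollifier moves it
    -- onto G φ, which is `Fn`. No commutator arises, since the direction e is constant, and the
    -- boundedness of g makes all terms dominated uniformly in n.
    let ψ : 𝓓(O, ℝ) := ⟨fun x => φ x * Gn n x, φ.contDiff.mul (hGns n),
      φ.hasCompactSupport.mul_right, (tsupport_mul_subset_left).trans φ.tsupport_subset⟩
    have hψ : ∀ x, ψ x = φ x * Gn n x := fun _ => rfl
    have hψd : ∀ x, fderiv ℝ ψ x e = fderiv ℝ φ x e * Gn n x +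
        φ x * ((ρ n).normed μ ⋆[lsmul ℝ ℝ, μ] Q) x := by
      intro x
      have h1 : fderiv ℝ ψ x = φ x • fderiv ℝ (Gn n) x + Gn n x • fderiv ℝ φ x :=
        fderiv_fun_mul (φ.contDiff.differentiable (by simp)).differentiableAt
          ((hGns n).differentiable (by simp)).differentiableAt
      rw [h1]
      by_cases hx : x ∈ K
      · rw [← weak_deriv_convolution hN hδO hgN h hRN (ρ n) x (hball n x hx)]
        simp [mul_comm, hGn, hGdef]; ring
      · simp [hzero x hx]
    have h1 := h ψ
    have h2 : ∫ x in O, (g x * fderiv ℝ ψ x e + R x * ψ x) ∂μ =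
        ∫ x, (G x * fderiv ℝ φ x e * Gn n x + Q x * (φ x * Gn n x) +
          (G x * φ x) * ((ρ n).normed μ ⋆[lsmul ℝ ℝ, μ] Q) x) ∂μ := by
      have h3 : ∀ x ∉ K, g x * fderiv ℝ ψ x e + R x * ψ x = 0 := fun x hx => by
        simp [hψd, hψ, hzero x hx]
      rw [setIntegral_eq_integral_of_forall_compl_eq_zero
        (fun x hx => h3 x fun hK => hx (φ.tsupport_subset hK))]
      refine integral_congr_ae (Eventually.of_forall fun x => ?_)
      by_cases hx : x ∈ K
      · simp only [hψd, hψ, hGdef, hQdef, indicator_of_mem (hKN hx)]; ring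
      · simp only [h3 x hx, hzero x hx]; simp
    rw [h2] at h1
    have hQn : Integrable ((ρ n).normed μ ⋆[lsmul ℝ ℝ, μ] Q) μ :=
      (ρ n).integrable_normed.integrable_convolution _ hQi
    have i1 : Integrable (fun x => G x * fderiv ℝ φ x e * Gn n x) μ :=
      (hGi.mul_bdd hφd.aestronglyMeasurable (Eventually.of_forall hC₁)).mul_bdd
        (hGns n).continuous.aestronglyMeasurable (Eventually.of_forall (hGnb n))
    have i2 : Integrable (fun x => Q x * (φ x * Gn n x)) μ :=
      hQi.mul_bdd (hφc.mul (hGns n).continuous).aestronglyMeasurable (c := C₂ * |M|)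
        (Eventually.of_forall fun x => by
          rw [norm_mul]
          exact mul_le_mul (hC₂ x) (hGnb n x) (norm_nonneg _) ((norm_nonneg _).trans (hC₂ x)))
    have i3 : Integrable (fun x => (G x * φ x) * ((ρ n).normed μ ⋆[lsmul ℝ ℝ, μ] Q) x) μ :=
      hQn.bdd_mul hGφ.aestronglyMeasurable hGφb
    have i4 : Integrable (fun x => Q x * Fn n x) μ :=
      hQi.mul_bdd (hFns n).continuous.aestronglyMeasurable (Eventually.of_forall (hFnb n))
    have i12 : Integrable (fun x => G x * fderiv ℝ φ x e * Gn n x + Q x * (φ x * Gn n x)) μ :=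
      i1.add i2
    have i42 : Integrable (fun x => Q x * Fn n x + Q x * (φ x * Gn n x)) μ := i4.add i2
    rw [integral_add i12 i3, integral_mul_convolution_normed _ hQi hGφ,
      integral_add i1 i2] at h1
    simp_rw [mul_add]
    rw [integral_add i1 i42, integral_add i4 i2]
    linarith
  -- passage to the limit
  have hlim := tendsto_integral_of_dominated_convergence (μ := μ)
    (F := fun n x => G x * fderiv ℝ φ x e * Gn n x + Q x * (Fn n x + φ x * Gn n x))
    (f := fun x => G x * fderiv ℝ φ x e * G x + Q x * (G x * φ x + φ x * G x))
    (fun x => ‖G x * fderiv ℝ φ x e‖ * |M| + ‖Q x‖ * (|M| * C₂ + C₂ * |M|))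
    (fun n => ((hGi.aestronglyMeasurable.mul hφd.aestronglyMeasurable).mul
      (hGns n).continuous.aestronglyMeasurable).add (hQi.aestronglyMeasurable.mul
        ((hFns n).continuous.add (hφc.mul (hGns n).continuous)).aestronglyMeasurable))
    (((hGi.mul_bdd hφd.aestronglyMeasurable (Eventually.of_forall hC₁)).norm.mul_const _).add
      (hQi.norm.mul_const _))
    (fun n => Eventually.of_forall fun x => by
      refine (norm_add_le _ _).trans ?_
      rw [norm_mul, norm_mul (Q x)]
      gcongr
      · exact hGnb n x
      · refine (norm_add_le _ _).trans (add_le_add (hFnb n x) ?_)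
        rw [norm_mul]
        exact mul_le_mul (hC₂ x) (hGnb n x) (norm_nonneg _) ((norm_nonneg _).trans (hC₂ x)))
    (by
      have hrK : ∀ᶠ n in atTop, (ρ n).rOut ≤ 2 * (ρ n).rIn :=
        Eventually.of_forall fun n => by simp [hρ, bumpOfRadius]; linarith
      have hrO : Tendsto (fun n => (ρ n).rOut) atTop (𝓝 0) := hrt
      filter_upwards [ContDiffBump.ae_convolution_tendsto_right_of_locallyIntegrable hrO hrK
          hGi.locallyIntegrable,
        ContDiffBump.ae_convolution_tendsto_right_of_locallyIntegrable hrO hrK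
          hGφ.locallyIntegrable] with x hx1 hx2
      exact (hx1.const_mul _).add ((hx2.add (hx1.const_mul _)).const_mul _))
  simp_rw [hid] at hlim
  have h0 := tendsto_nhds_unique hlim tendsto_const_nhds
  rw [setIntegral_eq_integral_of_forall_compl_eq_zero, ← h0]
  · refine integral_congr_ae (Eventually.of_forall fun x => ?_)
    by_cases hx : x ∈ K
    · simp only [hGdef, hQdef, indicator_of_mem (hKN hx)]; ring
    · simp [hzero x hx]
  · intro x hx
    have : x ∉ K := fun hK => hx (φ.tsupport_subset hK)
    simp [hzero x this]

end ChainRule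

end

noncomputable section

/-! ### Riesz potentials in the plane -/

/-- The fundamental theorem of calculus on the half line x + ρ z, ρ ≤ 0, far out on which φ
vanishes. -/
lemma enorm_le_lintegral_ray {E F : Type*} [NormedAddCommGroup E] [NormedSpace ℝ E]
    [NormedAddCommGroup F] [NormedSpace ℝ F] {φ : E → F} (hφ : ContDiff ℝ 1 φ)
    (hφc : HasCompactSupport φ) (x : E) {z : E} (hz : z ≠ 0) :
    ‖φ x‖ₑ ≤ ∫⁻ ρ in Iic (0 : ℝ), ‖fderiv ℝ φ (x + ρ • z)‖ₑ * ‖z‖ₑ := by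
  have hl : ContDiff ℝ 1 fun ρ : ℝ => x + ρ • z := by fun_prop
  have hcl : Topology.IsClosedEmbedding fun ρ : ℝ => x + ρ • z := by
    have h1 : Topology.IsClosedEmbedding fun ρ : ℝ => ρ • z := isClosedEmbedding_smul_left hz
    exact (Homeomorph.addLeft x).isClosedEmbedding.comp h1
  have h := HasCompactSupport.enorm_le_lintegral_Ici_deriv (hφ.comp hl)
    (hφc.comp_isClosedEmbedding hcl) 0
  simp only [Function.comp, zero_smul, add_zero] at h
  refine h.trans (lintegral_mono fun ρ => ?_)
  have hd : HasDerivAt (fun ρ : ℝ => φ (x + ρ • z)) (fderiv ℝ φ (x + ρ • z) z) ρ := by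
    have h2 : HasDerivAt (fun ρ : ℝ => x + ρ • z) z ρ := by
      simpa using ((hasDerivAt_id ρ).smul_const z).const_add x
    exact ((hφ.differentiable one_ne_zero) _).hasFDerivAt.comp_hasDerivAt ρ h2
  change ‖deriv (fun ρ : ℝ => φ (x + ρ • z)) ρ‖ₑ ≤ _
  rw [hd.deriv]
  exact (fderiv ℝ φ (x + ρ • z)).le_opENorm z

lemma two_mul_ofReal (x : ℝ) : 2 * ENNReal.ofReal x = ENNReal.ofReal (2 * x) := by
  rw [ENNReal.ofReal_mul (by norm_num), ENNReal.ofReal_ofNat]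

/-- The kernel `‖y‖^{-a}` (with value `0` at the origin, when `a ≠ 0`). -/
def rieszKernel (a : ℝ) (y : Vec 2) : ℝ≥0∞ := ENNReal.ofReal (‖y‖ ^ (-a))

lemma measurable_rieszKernel (a : ℝ) : Measurable (rieszKernel a) :=
  (measurable_norm.pow_const _).ennreal_ofReal

lemma lintegral_comp_smul_vec2 {ρ : ℝ} (hρ : ρ ≠ 0) {H : Vec 2 → ℝ≥0∞} (hH : Measurable H) :
    ∫⁻ z, H (ρ • z) = ENNReal.ofReal (1 / ρ ^ 2) * ∫⁻ y, H y := by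
  have h := Measure.map_addHaar_smul (volume : Measure (Vec 2)) hρ
  rw [← lintegral_map (μ := volume) hH (measurable_const_smul ρ), h, lintegral_smul_measure]
  simp

/-- The admissible ρ fill an interval of length ‖y‖/2, on which 1/ρ² is at most 4/‖y‖². This is the
radial integral left over after the change of variables in `enorm_le_rieszPotential`. -/
lemma lintegral_annulus_inv_sq (y : Vec 2) :
    ∫⁻ ρ in Iio (0 : ℝ), {ρ : ℝ | |ρ| ≤ ‖y‖ ∧ ‖y‖ ≤ 2 * |ρ|}.indicator
      (fun ρ => ENNReal.ofReal (1 / ρ ^ 2)) ρ ≤ 2 * rieszKernel 1 y := by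
  rcases eq_or_ne y 0 with rfl | hy
  · have h0 : ∀ ρ ∈ Iio (0 : ℝ), {ρ : ℝ | |ρ| ≤ ‖(0 : Vec 2)‖ ∧ ‖(0 : Vec 2)‖ ≤ 2 * |ρ|}.indicator
        (fun ρ => ENNReal.ofReal (1 / ρ ^ 2)) ρ = 0 := by
      intro ρ hρ
      refine indicator_of_notMem (fun h => ?_) _
      have h1 : |ρ| ≤ 0 := by simpa using h.1
      exact absurd (abs_nonpos_iff.1 h1) (ne_of_lt hρ)
    rw [setLIntegral_congr_fun measurableSet_Iio h0]
    simp
  have hy0 : 0 < ‖y‖ := norm_pos_iff.2 hy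
  calc _ ≤ ∫⁻ ρ, (Icc (-‖y‖) (-(‖y‖ / 2))).indicator
        (fun _ => ENNReal.ofReal (4 / ‖y‖ ^ 2)) ρ := by
        rw [← lintegral_indicator measurableSet_Iio]
        refine lintegral_mono fun ρ => ?_
        by_cases hρ : ρ ∈ Iio (0 : ℝ)
        · rw [indicator_of_mem hρ]
          have ha : |ρ| = -ρ := abs_of_neg hρ
          by_cases hρ' : ρ ∈ {ρ : ℝ | |ρ| ≤ ‖y‖ ∧ ‖y‖ ≤ 2 * |ρ|}
          · rw [indicator_of_mem hρ', indicator_of_mem]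
            · apply ENNReal.ofReal_le_ofReal
              obtain ⟨_, h2⟩ := hρ'
              have h3 : ‖y‖ ^ 2 ≤ 4 * ρ ^ 2 := by
                have := pow_le_pow_left₀ hy0.le h2 2
                rw [mul_pow, sq_abs] at this; linarith
              have h4 : 0 < ρ ^ 2 := sq_pos_of_neg hρ
              rw [div_le_div_iff₀ h4 (by positivity)]
              linarith
            · obtain ⟨h1, h2⟩ := hρ'
              rw [ha] at h1 h2
              exact ⟨by linarith, by linarith⟩
          · rw [indicator_of_notMem hρ']; exact zero_le
        · rw [indicator_of_notMem hρ]; exact zero_le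
    _ = 2 * rieszKernel 1 y := by
        rw [lintegral_indicator measurableSet_Icc, setLIntegral_const, Real.volume_Icc, rieszKernel,
          ← ENNReal.ofReal_mul (by positivity)]
        rw [two_mul_ofReal, Real.rpow_neg hy0.le, Real.rpow_one]
        congr 1
        field_simp
        ring

/-- The ray estimate is averaged over directions z in the annulus 1 ≤ ‖z‖ ≤ 2 instead of the unit
circle, so that no surface measure is needed. The substitution y = ρ z has Jacobian ρ⁻² in the
plane, and integrating it over the ρ for which y/ρ lies in the annulus leaves a multiple of 1/‖y‖.
One factor 2 of the constant is the bound of ‖z‖, the other comes from `lintegral_annulus_inv_sq`.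
-/
lemma enorm_le_rieszPotential : ∃ C : ℝ≥0, ∀ {F : Type} [NormedAddCommGroup F] [NormedSpace ℝ F]
    {φ : Vec 2 → F}, ContDiff ℝ 1 φ → HasCompactSupport φ → ∀ x,
    ‖φ x‖ₑ ≤ C * ∫⁻ y, ‖fderiv ℝ φ y‖ₑ * rieszKernel 1 (y - x) := by
  set A : Set (Vec 2) := {z | 1 ≤ ‖z‖ ∧ ‖z‖ ≤ 2} with hA
  have hAm : MeasurableSet A :=
    (measurableSet_le measurable_const measurable_norm).inter
      (measurableSet_le measurable_norm measurable_const)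
  have hA0 : volume A ≠ 0 := by
    have ho : IsOpen {z : Vec 2 | 1 < ‖z‖ ∧ ‖z‖ < 2} :=
      (isOpen_lt continuous_const continuous_norm).inter
        (isOpen_lt continuous_norm continuous_const)
    have hne : {z : Vec 2 | 1 < ‖z‖ ∧ ‖z‖ < 2}.Nonempty := by
      refine ⟨EuclideanSpace.single 0 (3 / 2), ?_⟩
      rw [mem_ofPred_eq, PiLp.norm_single]
      norm_num
    have hsub : {z : Vec 2 | 1 < ‖z‖ ∧ ‖z‖ < 2} ⊆ A := fun z hz => ⟨hz.1.le, hz.2.le⟩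
    exact ((ho.measure_pos volume hne).trans_le (measure_mono hsub)).ne'
  have hAt : volume A ≠ ∞ := by
    refine ((measure_mono fun z hz => ?_).trans_lt
      (measure_closedBall_lt_top (x := (0 : Vec 2)) (r := 2))).ne
    simpa using hz.2
  refine ⟨((volume A)⁻¹ * 4).toNNReal, fun {F} _ _ {φ} hφ hφc x => ?_⟩
  rw [ENNReal.coe_toNNReal (ENNReal.mul_ne_top (ENNReal.inv_ne_top.2 hA0) (by simp))]
  set k : Vec 2 → ℝ≥0∞ := fun z => ‖fderiv ℝ φ (x + z)‖ₑ with hk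
  have hkm : Measurable k := by
    have : Continuous fun z => fderiv ℝ φ (x + z) :=
      (hφ.continuous_fderiv one_ne_zero).comp (continuous_const.add continuous_id)
    exact this.enorm.measurable
  have hmain : volume A * ‖φ x‖ₑ ≤ 4 * ∫⁻ z, k z * rieszKernel 1 z := by
    -- For ρ ≠ 0 the pair (ρ, ρ z) lies in S exactly when z lies in the annulus, so S carries the
    -- domain of integration through the substitution.
    set S : Set (ℝ × Vec 2) := {p | |p.1| ≤ ‖p.2‖ ∧ ‖p.2‖ ≤ 2 * |p.1|} with hS
    have hm1 : Measurable fun p : ℝ × Vec 2 => |p.1| := measurable_fst.abs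
    have hm2 : Measurable fun p : ℝ × Vec 2 => ‖p.2‖ := measurable_snd.norm
    have hSm : MeasurableSet S :=
      (measurableSet_le hm1 hm2).inter (measurableSet_le hm2 (hm1.const_mul 2))
    calc volume A * ‖φ x‖ₑ = ∫⁻ z in A, ‖φ x‖ₑ := by rw [setLIntegral_const, mul_comm]
      _ ≤ ∫⁻ z in A, ∫⁻ ρ in Iio (0 : ℝ), 2 * k (ρ • z) := by
          refine setLIntegral_mono' hAm fun z hz => ?_
          have hz0 : z ≠ 0 := by
            rintro rfl
            have := hz.1; simp at this; linarith
          refine (enorm_le_lintegral_ray hφ hφc x hz0).trans ?_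
          rw [setLIntegral_congr Iio_ae_eq_Iic.symm]
          refine lintegral_mono fun ρ => ?_
          rw [mul_comm]
          refine mul_le_mul' ?_ le_rfl
          rw [← ofReal_norm]
          exact (ENNReal.ofReal_le_ofReal hz.2).trans_eq (ENNReal.ofReal_ofNat 2)
      _ = ∫⁻ ρ in Iio (0 : ℝ), ∫⁻ z in A, 2 * k (ρ • z) := by
          rw [lintegral_lintegral_swap]
          refine Measurable.aemeasurable ?_
          exact (hkm.comp (measurable_snd.smul measurable_fst)).const_mul 2
      _ = ∫⁻ ρ in Iio (0 : ℝ), ENNReal.ofReal (1 / ρ ^ 2) *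
            ∫⁻ y, S.indicator (fun p => 2 * k p.2) (ρ, y) := by
          refine setLIntegral_congr_fun measurableSet_Iio fun ρ hρ => ?_
          have hρ0 : ρ ≠ 0 := ne_of_lt hρ
          have hH : Measurable fun y => S.indicator (fun p => 2 * k p.2) (ρ, y) :=
            (((hkm.comp measurable_snd).const_mul 2).indicator hSm).comp measurable_prodMk_left
          rw [← lintegral_comp_smul_vec2 hρ0 hH, ← lintegral_indicator hAm]
          refine lintegral_congr fun z => ?_
          have h1 : (ρ, ρ • z) ∈ S ↔ z ∈ A := by
            have hp : 0 < |ρ| := abs_pos.2 hρ0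
            simp only [hS, hA, mem_ofPred_eq, norm_smul, Real.norm_eq_abs]
            constructor
            · rintro ⟨h1, h2⟩
              exact ⟨by nlinarith, by nlinarith⟩
            · rintro ⟨h1, h2⟩
              exact ⟨by nlinarith, by nlinarith⟩
          by_cases hz : z ∈ A
          · rw [indicator_of_mem hz, indicator_of_mem (h1.2 hz)]
          · rw [indicator_of_notMem hz, indicator_of_notMem (mt h1.1 hz)]
      _ = ∫⁻ y, ∫⁻ ρ in Iio (0 : ℝ), ENNReal.ofReal (1 / ρ ^ 2) *
            S.indicator (fun p => 2 * k p.2) (ρ, y) := by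
          rw [← lintegral_lintegral_swap]
          · refine lintegral_congr fun ρ => ?_
            rw [lintegral_const_mul]
            exact (((hkm.comp measurable_snd).const_mul 2).indicator hSm).comp
              measurable_prodMk_left
          · refine Measurable.aemeasurable ?_
            refine Measurable.mul ?_ (((hkm.comp measurable_snd).const_mul 2).indicator hSm)
            exact ((measurable_const.div (measurable_fst.pow_const 2))).ennreal_ofReal
      _ ≤ ∫⁻ y, 2 * k y * (2 * rieszKernel 1 y) := by
          refine lintegral_mono fun y => ?_
          refine le_trans (le_of_eq ?_) (mul_le_mul' le_rfl (lintegral_annulus_inv_sq y))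
          rw [← lintegral_const_mul]
          · refine lintegral_congr fun ρ => ?_
            by_cases h : (ρ, y) ∈ S
            · rw [indicator_of_mem h, indicator_of_mem (by exact h), mul_comm]
            · rw [indicator_of_notMem h, indicator_of_notMem (by exact h), mul_zero, mul_zero]
          · refine Measurable.indicator ?_ ?_
            · exact ((measurable_const.div (measurable_id.pow_const 2))).ennreal_ofReal
            · exact hSm.preimage measurable_prodMk_right
      _ = 4 * ∫⁻ z, k z * rieszKernel 1 z := by
          have hm : Measurable fun z => k z * rieszKernel 1 z := hkm.mul (measurable_rieszKernel 1)
          rw [← lintegral_const_mul _ hm]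
          refine lintegral_congr fun y => ?_
          rw [show (4 : ℝ≥0∞) = 2 * 2 by norm_num]
          ring
  have hshift : ∫⁻ y, ‖fderiv ℝ φ y‖ₑ * rieszKernel 1 (y - x) = ∫⁻ z, k z * rieszKernel 1 z := by
    rw [← lintegral_add_left_eq_self _ x]
    simp [hk]
  rw [hshift]
  calc ‖φ x‖ₑ = (volume A)⁻¹ * (volume A * ‖φ x‖ₑ) := by
        rw [← mul_assoc, ENNReal.inv_mul_cancel hA0 hAt, one_mul]
    _ ≤ (volume A)⁻¹ * (4 * ∫⁻ z, k z * rieszKernel 1 z) := by gcongr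
    _ = _ := by rw [mul_assoc]

/-- Polar coordinates give a multiple of D^{2-a}/(2-a). The blow-up 1/(2-a) must be kept explicit:
with a = 2 - 1/n it becomes the factor n of the trilinear estimate. -/
lemma lintegral_rieszKernel_le : ∃ C : ℝ≥0, ∀ (D a : ℝ), 1 ≤ D → 1 ≤ a → a < 2 →
    ∫⁻ y in Metric.ball (0 : Vec 2) D, rieszKernel a y ≤ C * ENNReal.ofReal (D / (2 - a)) := by
  refine ⟨2 * (volume (Metric.ball (0 : Vec 2) 1)).toNNReal, fun D a hD ha1 ha => ?_⟩
  have hD0 : (0 : ℝ) ≤ D := by linarith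
  have hfr : Module.finrank ℝ (Vec 2) = 2 := by simp
  have hnt : Nontrivial (Vec 2) := Module.nontrivial_of_finrank_pos (R := ℝ) (by simp)
  have hpow : ∀ r ∈ Ioo 0 D, r ^ (2 - 1) • r ^ (-a) = r ^ (1 - a) := by
    intro r hr
    rw [smul_eq_mul, show (2 - 1 : ℕ) = 1 from rfl, pow_one, Real.rpow_sub hr.1, Real.rpow_one,
      Real.rpow_neg hr.1.le, div_eq_mul_inv]
  have hii : IntervalIntegrable (fun r : ℝ => r ^ (1 - a)) volume 0 D :=
    intervalIntegral.intervalIntegrable_rpow' (by linarith)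
  have hi : IntegrableOn (fun y : Vec 2 => ‖y‖ ^ (-a)) (Metric.ball 0 D) := by
    rw [integrableOn_fun_norm_addHaar (volume : Measure (Vec 2)) (f := fun r => r ^ (-a)), hfr,
      integrableOn_congr_fun hpow measurableSet_Ioo]
    rw [intervalIntegrable_iff_integrableOn_Ioo_of_le hD0] at hii
    exact hii
  have h1 : ∫⁻ y in Metric.ball (0 : Vec 2) D, rieszKernel a y =
      ENNReal.ofReal (∫ y in Metric.ball (0 : Vec 2) D, ‖y‖ ^ (-a)) :=
    (ofReal_integral_eq_lintegral_ofReal hi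
      (Filter.Eventually.of_forall fun y => Real.rpow_nonneg (norm_nonneg _) _)).symm
  have h2 : ∫ y in Metric.ball (0 : Vec 2) D, ‖y‖ ^ (-a) =
      2 * (volume.real (Metric.ball (0 : Vec 2) 1) * (D ^ (2 - a) / (2 - a))) := by
    have h3 : ∫ y in Metric.ball (0 : Vec 2) D, ‖y‖ ^ (-a) =
        ∫ y : Vec 2, (Iio D).indicator (fun r : ℝ => r ^ (-a)) ‖y‖ := by
      rw [← integral_indicator measurableSet_ball]
      congr 1; ext y
      simp [indicator]
    rw [h3, integral_fun_norm_addHaar, hfr]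
    have h4 : ∫ r in Ioi (0 : ℝ), r ^ (2 - 1) • (Iio D).indicator (fun r : ℝ => r ^ (-a)) r =
        D ^ (2 - a) / (2 - a) := by
      have h5 : (fun r : ℝ => r ^ (2 - 1) • (Iio D).indicator (fun r : ℝ => r ^ (-a)) r) =
          (Iio D).indicator fun r => r ^ (2 - 1) • r ^ (-a) := by
        ext r; by_cases hr : r ∈ Iio D <;> simp [hr]
      rw [h5, setIntegral_indicator measurableSet_Iio, Ioi_inter_Iio,
        setIntegral_congr_fun measurableSet_Ioo hpow, ← integral_Ioc_eq_integral_Ioo,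
        ← intervalIntegral.integral_of_le hD0, integral_rpow (Or.inl (by linarith)),
        Real.zero_rpow (by linarith)]
      rw [sub_zero, show 1 - a + 1 = 2 - a by ring]
    rw [h4]; simp
  rw [h1, h2]
  have h6 : D ^ (2 - a) ≤ D := by
    calc D ^ (2 - a) ≤ D ^ (1 : ℝ) := Real.rpow_le_rpow_of_exponent_le hD (by linarith)
      _ = D := Real.rpow_one D
  have h7 : (0 : ℝ) < 2 - a := by linarith
  rw [← mul_assoc, ENNReal.ofReal_mul (by positivity)]
  refine mul_le_mul' (le_of_eq ?_) (ENNReal.ofReal_le_ofReal (by gcongr))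
  rw [ENNReal.ofReal_mul (by norm_num), Measure.real, ENNReal.ofReal_toReal measure_ball_lt_top.ne]
  rw [ENNReal.coe_mul, ENNReal.coe_toNNReal measure_ball_lt_top.ne]
  simp

end

noncomputable section

/-! ### Trilinear estimates -/

/-- The case a + b = 0 is excluded because of y = 0, where the real power gives 0⁰ = 1. -/
lemma rieszKernel_mul {a b : ℝ} (hab : a + b ≠ 0) (y : Vec 2) :
    rieszKernel a y * rieszKernel b y = rieszKernel (a + b) y := by
  rw [rieszKernel, rieszKernel, rieszKernel,
    ← ENNReal.ofReal_mul (Real.rpow_nonneg (norm_nonneg _) _),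
    ← Real.rpow_add' (norm_nonneg _) (by intro h; apply hab; linarith)]
  congr 2; ring

lemma rieszKernel_rpow {a c : ℝ} (hc : 0 ≤ c) (y : Vec 2) :
    rieszKernel a y ^ c = rieszKernel (a * c) y := by
  rw [rieszKernel, rieszKernel, ENNReal.ofReal_rpow_of_nonneg
    (Real.rpow_nonneg (norm_nonneg _) _) hc, ← Real.rpow_mul (norm_nonneg _)]
  congr 2; ring

lemma rieszKernel_neg (a : ℝ) (y : Vec 2) : rieszKernel a (-y) = rieszKernel a y := by
  rw [rieszKernel, norm_neg]; rfl

lemma lintegral_rieszKernel_sub_le {C : ℝ≥0} {R : ℝ} (hR : 1 ≤ R)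
    (hC : ∀ (D a : ℝ), 1 ≤ D → 1 ≤ a → a < 2 →
      ∫⁻ y in Metric.ball (0 : Vec 2) D, rieszKernel a y ≤ C * ENNReal.ofReal (D / (2 - a)))
    {Ω : Set (Vec 2)} (hΩm : MeasurableSet Ω) (hΩ : Ω ⊆ Metric.ball 0 R) {x : Vec 2}
    (hx : x ∈ Ω) {a : ℝ} (ha : 1 ≤ a)
    (ha2 : a < 2) :
    ∫⁻ y in Ω, rieszKernel a (y - x) ≤ C * ENNReal.ofReal (2 * R / (2 - a)) := by
  refine le_trans ?_ (hC (2 * R) a (by linarith) ha ha2)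
  have hm : ∀ y ∈ Ω, y - x ∈ Metric.ball (0 : Vec 2) (2 * R) := by
    intro y hy
    have h1 := mem_ball_zero_iff.1 (hΩ hy)
    have h2 := mem_ball_zero_iff.1 (hΩ hx)
    rw [mem_ball_zero_iff]
    linarith [norm_sub_le y x]
  calc ∫⁻ y in Ω, rieszKernel a (y - x)
      ≤ ∫⁻ y, (Metric.ball (0 : Vec 2) (2 * R)).indicator (rieszKernel a) (y - x) := by
        refine le_trans ?_ (setLIntegral_le_lintegral Ω _)
        refine setLIntegral_mono' hΩm fun y hy => ?_
        rw [indicator_of_mem (hm y hy)]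
    _ = ∫⁻ y in Metric.ball (0 : Vec 2) (2 * R), rieszKernel a y := by
        rw [lintegral_sub_right_eq_self (fun y => (Metric.ball (0 : Vec 2) (2 * R)).indicator
          (rieszKernel a) y) x, lintegral_indicator measurableSet_ball]

/-- The planar trilinear estimate, with the sharp growth in `n`, for smooth fields. -/
lemma lintegral_trilinear_two {Ω : Set (Vec 2)} (hΩm : MeasurableSet Ω)
    (hΩ : Bornology.IsBounded Ω) (M : ℝ≥0) :
    ∃ C : ℝ≥0, ∀ {F : Type} [NormedAddCommGroup F] [NormedSpace ℝ F] {φ : Vec 2 → F},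
      ContDiff ℝ 1 φ → HasCompactSupport φ → tsupport φ ⊆ Ω → ∀ {h g : Vec 2 → ℝ≥0∞},
      AEMeasurable h (volume.restrict Ω) → AEMeasurable g (volume.restrict Ω) →
      ∫⁻ x in Ω, h x ^ 2 ≤ M → (∀ᵐ x ∂volume.restrict Ω, g x ≤ M) → ∀ n : ℕ, 2 ≤ n →
      ∫⁻ x in Ω, ‖φ x‖ₑ * (h x * g x) ≤ C * (n : ℝ≥0∞) ^ (1 / 2 : ℝ) *
        (∫⁻ x in Ω, ‖fderiv ℝ φ x‖ₑ ^ 2) ^ (1 / 2 : ℝ) *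
        (∫⁻ x in Ω, g x ^ 2) ^ ((1 - 1 / (n : ℝ)) / 2) := by
  obtain ⟨C₁, hC₁⟩ := enorm_le_rieszPotential
  obtain ⟨C₂, hC₂⟩ := lintegral_rieszKernel_le
  obtain ⟨R, hR1, hΩR⟩ : ∃ R : ℝ, 1 ≤ R ∧ Ω ⊆ Metric.ball 0 R := by
    obtain ⟨R, hR⟩ := hΩ.subset_ball 0
    exact ⟨max 1 R, le_max_left _ _, hR.trans (Metric.ball_subset_ball (le_max_right _ _))⟩
  set k : ℝ≥0 := C₂ * (2 * R).toNNReal with hk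
  -- The summand 1 ensures L ≥ 1, hence L^ε ≤ L with a bound that does not depend on n.
  set L : ℝ≥0 := 1 + M ^ 2 * k with hL
  refine ⟨C₁ * (M * k * L) ^ (1 / 2 : ℝ), fun {F} _ _ {φ} hφ hφc hφΩ {h g} hh hg hhM hgM n hn => ?_⟩
  have hn0 : (0 : ℝ) < n := by positivity
  have hn1 : 1 / (n : ℝ) ≤ 1 / 2 := by
    apply one_div_le_one_div_of_le (by norm_num); exact_mod_cast hn
  set ε : ℝ := 1 / n with hε
  have hε0 : 0 < ε := by positivity
  set p : Vec 2 → ℝ≥0∞ := fun y => ‖fderiv ℝ φ y‖ₑ with hp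
  have hpm : Measurable p := (hφ.continuous_fderiv one_ne_zero).enorm.measurable
  have hp0 : ∀ y ∉ Ω, p y = 0 := fun y hy => by
    simp only [hp, fderiv_of_notMem_tsupport (𝕜 := ℝ) (fun h => hy (hφΩ h))]
    rw [← ofReal_norm, norm_zero, ENNReal.ofReal_zero]
  set J : Vec 2 → ℝ≥0∞ := fun y => ∫⁻ x in Ω, rieszKernel 1 (y - x) * (h x * g x) with hJ
  have hker : ∀ a : ℝ, Measurable fun q : Vec 2 × Vec 2 => rieszKernel a (q.1 - q.2) := fun a =>
    (measurable_rieszKernel a).comp (measurable_fst.sub measurable_snd)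
  have hh2 : AEMeasurable (fun q : Vec 2 × Vec 2 => h q.2)
      ((volume.restrict Ω).prod (volume.restrict Ω)) := hh.comp_snd
  have hg2 : AEMeasurable (fun q : Vec 2 × Vec 2 => g q.2)
      ((volume.restrict Ω).prod (volume.restrict Ω)) := hg.comp_snd
  have hJm : AEMeasurable J (volume.restrict Ω) :=
    ((hker 1).aemeasurable.mul (hh2.mul hg2)).lintegral_prod_right'
  -- Riesz potential
  have h1 : ∫⁻ x in Ω, ‖φ x‖ₑ * (h x * g x) ≤ C₁ * ∫⁻ y in Ω, p y * J y := by
    calc ∫⁻ x in Ω, ‖φ x‖ₑ * (h x * g x)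
        ≤ ∫⁻ x in Ω, C₁ * ∫⁻ y in Ω, p y * (rieszKernel 1 (y - x) * (h x * g x)) := by
          refine lintegral_mono fun x => ?_
          have e1 : ∫⁻ y, p y * rieszKernel 1 (y - x) = ∫⁻ y in Ω, p y * rieszKernel 1 (y - x) := by
            rw [← lintegral_indicator hΩm]
            refine lintegral_congr fun y => ?_
            by_cases hy : y ∈ Ω
            · rw [indicator_of_mem hy]
            · rw [indicator_of_notMem hy, hp0 y hy, zero_mul]
          refine (mul_le_mul' (hC₁ hφ hφc x) le_rfl).trans ?_
          rw [e1, mul_assoc, ← lintegral_mul_const]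
          · exact mul_le_mul' le_rfl (le_of_eq (lintegral_congr fun y => mul_assoc _ _ _))
          · exact hpm.mul ((measurable_rieszKernel 1).comp (measurable_id.sub_const x))
      _ = C₁ * ∫⁻ x in Ω, ∫⁻ y in Ω, p y * (rieszKernel 1 (y - x) * (h x * g x)) := by
          rw [lintegral_const_mul' _ _ ENNReal.coe_ne_top]
      _ = C₁ * ∫⁻ y in Ω, p y * J y := by
          rw [lintegral_lintegral_swap]
          · congr 1
            refine lintegral_congr fun y => ?_
            rw [hJ, ← lintegral_const_mul' _ _ enorm_ne_top]
          · have h3 : AEMeasurable (fun q : Vec 2 × Vec 2 => h q.1 * g q.1)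
                ((volume.restrict Ω).prod (volume.restrict Ω)) := hh.comp_fst.mul hg.comp_fst
            refine AEMeasurable.mul (hpm.comp measurable_snd).aemeasurable (AEMeasurable.mul ?_ h3)
            exact ((measurable_rieszKernel 1).comp (measurable_snd.sub measurable_fst)).aemeasurable
  -- Cauchy-Schwarz in `y`
  have h2 : ∫⁻ y in Ω, p y * J y ≤
      (∫⁻ y in Ω, p y ^ 2) ^ (1 / 2 : ℝ) * (∫⁻ y in Ω, J y ^ 2) ^ (1 / 2 : ℝ) := by
    have := ENNReal.lintegral_mul_le_Lp_mul_Lq (volume.restrict Ω) Real.HolderConjugate.two_two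
      hpm.aemeasurable hJm
    simpa only [ENNReal.rpow_two, Pi.mul_apply] using this
  -- Cauchy-Schwarz in `x`
  set A : Vec 2 → ℝ≥0∞ := fun y => ∫⁻ x in Ω, h x ^ 2 * rieszKernel (2 - ε) (y - x) with hA
  set B : Vec 2 → ℝ≥0∞ := fun y => ∫⁻ x in Ω, g x ^ 2 * rieszKernel ε (y - x) with hB
  have hk1 : ∀ a y, AEMeasurable (fun x => rieszKernel a (y - x)) (volume.restrict Ω) := fun a y =>
    ((measurable_rieszKernel a).comp (measurable_const.sub measurable_id)).aemeasurable
  -- The kernel ‖y-x‖⁻¹ is split into the powers (2-ε)/2 and ε/2. The nearly critical power goes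
  -- with h, and its integral in y costs 1/ε = n; the weak power stays with g, where it costs only a
  -- small part of the exponent.
  have h3 : ∀ y, J y ^ 2 ≤ A y * B y := by
    intro y
    have h4 : J y ≤ A y ^ (1 / 2 : ℝ) * B y ^ (1 / 2 : ℝ) := by
      refine le_trans (le_of_eq ?_) (ENNReal.lintegral_mul_norm_pow_le
        ((hh.pow_const 2).mul (hk1 (2 - ε) y)) ((hg.pow_const 2).mul (hk1 ε y))
        (by norm_num : (0 : ℝ) ≤ 1 / 2) (by norm_num : (0 : ℝ) ≤ 1 / 2) (by norm_num))
      refine lintegral_congr fun x => ?_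
      have e1 : ∀ z : ℝ≥0∞, (z ^ 2) ^ (1 / 2 : ℝ) = z := fun z => by
        rw [← ENNReal.rpow_natCast, ← ENNReal.rpow_mul]; norm_num
      rw [Pi.mul_apply, Pi.mul_apply, ENNReal.mul_rpow_of_nonneg _ _ (by norm_num),
        ENNReal.mul_rpow_of_nonneg _ _ (by norm_num), e1, e1, rieszKernel_rpow (by norm_num),
        rieszKernel_rpow (by norm_num)]
      have e2 := rieszKernel_mul (a := (2 - ε) * (1 / 2)) (b := ε * (1 / 2))
        (by ring_nf; norm_num) (y - x)
      rw [show (2 - ε) * (1 / 2) + ε * (1 / 2) = 1 by ring] at e2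
      rw [← e2]; ring
    calc J y ^ 2 ≤ (A y ^ (1 / 2 : ℝ) * B y ^ (1 / 2 : ℝ)) ^ 2 := by gcongr
      _ = A y * B y := by
        rw [mul_pow, ← ENNReal.rpow_natCast, ← ENNReal.rpow_mul, ← ENNReal.rpow_natCast,
          ← ENNReal.rpow_mul]
        norm_num
  have hkint : ∀ x ∈ Ω, ∀ a, 1 ≤ a → a < 2 → ∫⁻ y in Ω, rieszKernel a (y - x) ≤
      k * ENNReal.ofReal (1 / (2 - a)) := by
    intro x hx a ha ha2
    refine (lintegral_rieszKernel_sub_le hR1 hC₂ hΩm hΩR hx ha ha2).trans (le_of_eq ?_)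
    rw [hk, ENNReal.coe_mul, mul_assoc]
    congr 1
    rw [show (((2 * R).toNNReal : ℝ≥0) : ℝ≥0∞) = ENNReal.ofReal (2 * R) from rfl,
      ← ENNReal.ofReal_mul (by linarith)]
    congr 1; ring
  -- the second factor
  have h4 : ∀ y ∈ Ω, B y ≤ (∫⁻ x in Ω, g x ^ 2) ^ (1 - ε) * L := by
    intro y hy
    -- A small power (g²)^ε is estimated by M^{2ε} and grouped with the kernel. Hölder with
    -- exponents 1/(1-ε) and 1/ε then leaves the kernel to the first power, which is integrable
    -- uniformly in y.
    have e1 : ∀ᵐ x ∂volume.restrict Ω, g x ^ 2 * rieszKernel ε (y - x) ≤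
        (g x ^ 2) ^ (1 - ε) * (M ^ 2 * rieszKernel 1 (y - x)) ^ ε := by
      filter_upwards [hgM] with x hx
      have e2 : g x ^ 2 = (g x ^ 2) ^ (1 - ε) * (g x ^ 2) ^ ε := by
        rw [← ENNReal.rpow_add_of_nonneg _ _ (by linarith) hε0.le]; simp
      rw [ENNReal.mul_rpow_of_nonneg _ _ hε0.le, rieszKernel_rpow hε0.le, one_mul, ← mul_assoc]
      refine mul_le_mul' ?_ le_rfl
      calc g x ^ 2 = (g x ^ 2) ^ (1 - ε) * (g x ^ 2) ^ ε := e2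
        _ ≤ (g x ^ 2) ^ (1 - ε) * ((M : ℝ≥0∞) ^ 2) ^ ε := by gcongr
    refine (lintegral_mono_ae e1).trans ((ENNReal.lintegral_mul_norm_pow_le (hg.pow_const 2)
      ((hk1 1 y).const_mul _) (by linarith) hε0.le (by ring)).trans ?_)
    refine mul_le_mul' le_rfl ?_
    rw [lintegral_const_mul'' _ (hk1 1 y)]
    have e3 : ∫⁻ x in Ω, rieszKernel 1 (y - x) ≤ k := by
      have := hkint y hy 1 le_rfl (by norm_num)
      norm_num at this
      refine le_trans (le_of_eq (lintegral_congr fun x => ?_)) this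
      rw [← rieszKernel_neg, neg_sub]
    calc ((M : ℝ≥0∞) ^ 2 * ∫⁻ x in Ω, rieszKernel 1 (y - x)) ^ ε
        ≤ ((L : ℝ≥0∞)) ^ ε := by
          gcongr
          calc (M : ℝ≥0∞) ^ 2 * ∫⁻ x in Ω, rieszKernel 1 (y - x) ≤ (M : ℝ≥0∞) ^ 2 * (k : ℝ≥0∞) := by
                gcongr
            _ ≤ (L : ℝ≥0∞) := by rw [hL]; push_cast; exact le_add_self
      _ ≤ (L : ℝ≥0∞) ^ (1 : ℝ) := by
          refine ENNReal.rpow_le_rpow_of_exponent_le ?_ (by linarith)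
          rw [hL]; push_cast; exact le_self_add
      _ = L := ENNReal.rpow_one _
  -- the first factor
  have h5 : ∫⁻ y in Ω, A y ≤ M * (k * n) := by
    rw [hA, lintegral_lintegral_swap]
    · calc ∫⁻ x in Ω, ∫⁻ y in Ω, h x ^ 2 * rieszKernel (2 - ε) (y - x)
          ≤ ∫⁻ x in Ω, h x ^ 2 * (k * n) := by
            refine setLIntegral_mono_ae' hΩm (Filter.Eventually.of_forall fun x hx => ?_)
            have hkm : Measurable fun y => rieszKernel (2 - ε) (y - x) :=
              (measurable_rieszKernel _).comp (measurable_id.sub_const x)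
            rw [lintegral_const_mul _ hkm]
            refine mul_le_mul' le_rfl ((hkint x hx (2 - ε) (by linarith) (by linarith)).trans
              (le_of_eq ?_))
            rw [sub_sub_cancel, hε, one_div_one_div, ENNReal.ofReal_natCast]
        _ = (∫⁻ x in Ω, h x ^ 2) * (k * n) := lintegral_mul_const'' _ (hh.pow_const 2)
        _ ≤ M * (k * n) := by gcongr
    · exact (hh2.pow_const 2).mul (hker _).aemeasurable
  have h6 : ∫⁻ y in Ω, J y ^ 2 ≤ (M * k * L) * n * (∫⁻ x in Ω, g x ^ 2) ^ (1 - ε) := by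
    calc ∫⁻ y in Ω, J y ^ 2 ≤ ∫⁻ y in Ω, A y * ((∫⁻ x in Ω, g x ^ 2) ^ (1 - ε) * L) := by
          refine setLIntegral_mono_ae' hΩm (Filter.Eventually.of_forall fun y hy => ?_)
          exact (h3 y).trans (mul_le_mul' le_rfl (h4 y hy))
      _ = (∫⁻ y in Ω, A y) * ((∫⁻ x in Ω, g x ^ 2) ^ (1 - ε) * L) := by
          refine lintegral_mul_const'' _ ?_
          exact ((hh2.pow_const 2).mul (hker _).aemeasurable).lintegral_prod_right'
      _ ≤ (M * (k * n)) * ((∫⁻ x in Ω, g x ^ 2) ^ (1 - ε) * L) := by gcongr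
      _ = _ := by ring
  have h7 : (∫⁻ y in Ω, J y ^ 2) ^ (1 / 2 : ℝ) ≤ (M * k * L : ℝ≥0∞) ^ (1 / 2 : ℝ) *
      (n : ℝ≥0∞) ^ (1 / 2 : ℝ) * (∫⁻ x in Ω, g x ^ 2) ^ ((1 - ε) / 2) := by
    refine (ENNReal.rpow_le_rpow h6 (by norm_num)).trans (le_of_eq ?_)
    rw [ENNReal.mul_rpow_of_nonneg _ _ (by norm_num), ENNReal.mul_rpow_of_nonneg _ _ (by norm_num),
      ← ENNReal.rpow_mul]
    congr 2; ring
  calc _ ≤ C₁ * ((∫⁻ y in Ω, p y ^ 2) ^ (1 / 2 : ℝ) * ((M * k * L : ℝ≥0∞) ^ (1 / 2 : ℝ) *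
      (n : ℝ≥0∞) ^ (1 / 2 : ℝ) * (∫⁻ x in Ω, g x ^ 2) ^ ((1 - ε) / 2))) :=
        h1.trans (mul_le_mul' le_rfl (h2.trans (mul_le_mul' le_rfl h7)))
    _ = _ := by
      push_cast [ENNReal.coe_rpow_of_nonneg _ (by norm_num : (0 : ℝ) ≤ 1 / 2)]
      ring

/-- The exponent is lowered at the price of the bound L, so that the estimate for d ≥ 3 takes the
same form as the planar one. -/
lemma rpow_half_le_of_le {a L : ℝ≥0∞} {ε : ℝ} (hε : 0 ≤ ε) (hε1 : ε ≤ 1) (haL : a ≤ L)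
    (hL : 1 ≤ L) : a ^ (1 / 2 : ℝ) ≤ L * a ^ ((1 - ε) / 2) := by
  calc a ^ (1 / 2 : ℝ) = a ^ (ε / 2) * a ^ ((1 - ε) / 2) := by
        rw [← ENNReal.rpow_add_of_nonneg _ _ (by linarith) (by linarith)]; congr 1; ring
    _ ≤ L ^ (ε / 2) * a ^ ((1 - ε) / 2) := by gcongr
    _ ≤ L ^ (1 : ℝ) * a ^ ((1 - ε) / 2) := by
        gcongr
        linarith
    _ = _ := by rw [ENNReal.rpow_one]

/-- The trilinear estimate in dimension `d ≥ 3`, for smooth fields. -/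
lemma lintegral_trilinear_three {d : ℕ} (hd : 3 ≤ d) {Ω : Set (Vec d)} (hΩm : MeasurableSet Ω)
    (hΩ : Bornology.IsBounded Ω) (M : ℝ≥0) :
    ∃ C : ℝ≥0, ∀ {φ : Vec d → Vec d},
      ContDiff ℝ 1 φ → HasCompactSupport φ → tsupport φ ⊆ Ω → ∀ {h g : Vec d → ℝ≥0∞},
      AEMeasurable h (volume.restrict Ω) → AEMeasurable g (volume.restrict Ω) →
      ∫⁻ x in Ω, h x ^ d ≤ M → (∀ᵐ x ∂volume.restrict Ω, g x ≤ M) → ∀ n : ℕ, 2 ≤ n →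
      ∫⁻ x in Ω, ‖φ x‖ₑ * (h x * g x) ≤ C * (n : ℝ≥0∞) ^ (1 / 2 : ℝ) *
        (∫⁻ x in Ω, ‖fderiv ℝ φ x‖ₑ ^ 2) ^ (1 / 2 : ℝ) *
        (∫⁻ x in Ω, g x ^ 2) ^ ((1 - 1 / (n : ℝ)) / 2) := by
  have hd3 : (3 : ℝ) ≤ d := by exact_mod_cast hd
  have hd0 : (0 : ℝ) < d := by linarith
  set C₁ : ℝ≥0 := eLpNormLESNormFDerivOfEqInnerConst (volume : Measure (Vec d)) 2
  have hvol : volume Ω ≠ ∞ := hΩ.measure_lt_top.ne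
  set L : ℝ≥0 := 1 + M ^ 2 * (volume Ω).toNNReal with hL
  refine ⟨C₁ * M ^ (1 / d : ℝ) * L, fun {φ} hφ hφc hφΩ {h g} hh hg hhM hgM n hn => ?_⟩
  have hn0 : (0 : ℝ) < n := by positivity
  have hn1 : 1 / (n : ℝ) ≤ 1 := by
    rw [div_le_one hn0]; exact_mod_cast (by omega : 1 ≤ n)
  -- The Sobolev exponent, for which 1/q + 1/d + 1/2 = 1; this makes Hölder with three factors
  -- applicable to φ, h and g.
  set q : ℝ≥0 := (2 * d / (d - 2) : ℝ).toNNReal with hq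
  have hqv : (q : ℝ) = 2 * d / (d - 2) := Real.coe_toNNReal _ (by
    apply div_nonneg <;> linarith)
  have hq0 : (0 : ℝ) < q := by rw [hqv]; apply div_pos <;> linarith
  have hS := eLpNorm_le_eLpNorm_fderiv_of_eq_inner (volume : Measure (Vec d)) hφ hφc
    (p := 2) (p' := q) (by norm_num) (by simp; omega) (by
      rw [hqv]; simp
      have : (d : ℝ) - 2 ≠ 0 := by linarith
      field_simp)
  have hS2 : eLpNorm (fderiv ℝ φ) (2 : ℝ≥0) volume =
      (∫⁻ x in Ω, ‖fderiv ℝ φ x‖ₑ ^ 2) ^ (1 / 2 : ℝ) := by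
    rw [eLpNorm_nnreal_eq_lintegral (by norm_num)]
    simp only [NNReal.coe_ofNat, ENNReal.rpow_two]
    congr 1
    rw [← lintegral_indicator hΩm]
    refine lintegral_congr fun x => ?_
    by_cases hx : x ∈ Ω
    · rw [indicator_of_mem hx]
    · rw [indicator_of_notMem hx, fderiv_of_notMem_tsupport (𝕜 := ℝ) (fun h => hx (hφΩ h)),
        ← ofReal_norm, norm_zero, ENNReal.ofReal_zero, zero_pow two_ne_zero]
  have hS1 : (∫⁻ x in Ω, ‖φ x‖ₑ ^ (q : ℝ)) ^ (1 / (q : ℝ)) ≤ eLpNorm φ q volume := by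
    rw [eLpNorm_nnreal_eq_lintegral (by exact_mod_cast hq0.ne')]
    gcongr
    exact Measure.restrict_le_self
  rw [hS2] at hS
  have hφm : AEMeasurable (fun x => ‖φ x‖ₑ) (volume.restrict Ω) :=
    hφ.continuous.enorm.measurable.aemeasurable
  have hH := ENNReal.lintegral_prod_norm_pow_le (μ := volume.restrict Ω) (Finset.univ : Finset (Fin 3))
    (f := ![fun x => ‖φ x‖ₑ ^ (q : ℝ), fun x => h x ^ d, fun x => g x ^ 2])
    (p := ![1 / q, 1 / d, 1 / 2])
    (by
      intro i _; fin_cases i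
      · exact hφm.pow_const _
      · exact hh.pow_const _
      · exact hg.pow_const _)
    (by
      simp [Fin.sum_univ_three, hqv]
      have : (d : ℝ) - 2 ≠ 0 := by linarith
      field_simp; ring)
    (by intro i _; fin_cases i <;> simp)
  simp only [Fin.prod_univ_three, Matrix.cons_val_zero, Matrix.cons_val_one, Matrix.cons_val] at hH
  have hHl : ∫⁻ x in Ω, ‖φ x‖ₑ * (h x * g x) = ∫⁻ x in Ω, (‖φ x‖ₑ ^ (q : ℝ)) ^ (1 / (q : ℝ)) *
      (h x ^ d) ^ (1 / (d : ℝ)) * (g x ^ 2) ^ (1 / 2 : ℝ) := by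
    refine lintegral_congr fun x => ?_
    rw [← ENNReal.rpow_mul, ← ENNReal.rpow_natCast, ← ENNReal.rpow_mul, ← ENNReal.rpow_natCast,
      ← ENNReal.rpow_mul, mul_one_div_cancel hq0.ne', mul_one_div_cancel hd0.ne']
    norm_num [mul_assoc]
  rw [hHl]
  refine hH.trans ?_
  have hg2 : ∫⁻ x in Ω, g x ^ 2 ≤ L := by
    calc ∫⁻ x in Ω, g x ^ 2 ≤ ∫⁻ x in Ω, (M : ℝ≥0∞) ^ 2 := by
          refine lintegral_mono_ae ?_
          filter_upwards [hgM] with x hx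
          gcongr
      _ = (M : ℝ≥0∞) ^ 2 * volume Ω := by rw [setLIntegral_const]
      _ ≤ L := by
          rw [hL]; push_cast; rw [ENNReal.coe_toNNReal hvol]; exact le_add_self
  -- Here no growth in n is needed. The factor is inserted so that both dimensions share one
  -- statement.
  have hn12 : (1 : ℝ≥0∞) ≤ (n : ℝ≥0∞) ^ (1 / 2 : ℝ) := by
    refine ENNReal.one_le_rpow ?_ (by norm_num)
    exact_mod_cast (by omega : 1 ≤ n)
  set D := (∫⁻ x in Ω, ‖fderiv ℝ φ x‖ₑ ^ 2) ^ (1 / 2 : ℝ)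
  set g2 := ∫⁻ x in Ω, g x ^ 2
  calc _ ≤ (C₁ * D) * (M : ℝ≥0∞) ^ (1 / (d : ℝ)) * (L * g2 ^ ((1 - 1 / (n : ℝ)) / 2)) := by
        gcongr
        · exact hS1.trans hS
        · exact rpow_half_le_of_le (by positivity) hn1 hg2 (by
            rw [hL]; push_cast; exact le_self_add)
    _ ≤ ((C₁ * D) * (M : ℝ≥0∞) ^ (1 / (d : ℝ)) * (L * g2 ^ ((1 - 1 / (n : ℝ)) / 2))) *
        (n : ℝ≥0∞) ^ (1 / 2 : ℝ) := le_mul_of_one_le_right' hn12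
    _ = _ := by
      rw [ENNReal.coe_mul, ENNReal.coe_mul, ENNReal.coe_rpow_of_nonneg _ (by positivity)]
      ring

end

noncomputable section

/-! ### Algebra of the contractions -/

lemma norm_advect_le {d : ℕ} {ι : Type} [Fintype ι] (a : Vec d)
    (B : EuclideanSpace ℝ (Fin d × ι)) : ‖advect a B‖ ≤ ‖a‖ * ‖B‖ := by
  refine abs_le_of_sq_le_sq' ?_ (by positivity) |>.2
  rw [mul_pow, EuclideanSpace.real_norm_sq_eq, EuclideanSpace.real_norm_sq_eq,
    EuclideanSpace.real_norm_sq_eq, Fintype.sum_prod_type_right, Finset.mul_sum]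
  refine Finset.sum_le_sum fun k _ => ?_
  exact Finset.sum_mul_sq_le_sq_mul_sq Finset.univ (fun i => a i) (fun i => B (i, k))

lemma norm_tenMul_le {d : ℕ} (A B : Ten d) : ‖tenMul A B‖ ≤ ‖A‖ * ‖B‖ := by
  refine abs_le_of_sq_le_sq' ?_ (by positivity) |>.2
  rw [mul_pow, EuclideanSpace.real_norm_sq_eq, EuclideanSpace.real_norm_sq_eq,
    EuclideanSpace.real_norm_sq_eq, Fintype.sum_prod_type, Fintype.sum_prod_type,
    Fintype.sum_prod_type_right (f := fun x => B x ^ 2), Finset.sum_mul_sum]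
  refine Finset.sum_le_sum fun i _ => Finset.sum_le_sum fun j _ => ?_
  exact Finset.sum_mul_sq_le_sq_mul_sq Finset.univ (fun k => A (i, k)) (fun k => B (k, j))

lemma advect_sub_left {d : ℕ} {ι : Type} [Fintype ι] (a b : Vec d)
    (B : EuclideanSpace ℝ (Fin d × ι)) : advect (a - b) B = advect a B - advect b B := by
  ext k; simp [advect, sub_mul]

lemma advect_sub_right {d : ℕ} {ι : Type} [Fintype ι] (a : Vec d)
    (A B : EuclideanSpace ℝ (Fin d × ι)) : advect a (A - B) = advect a A - advect a B := by
  ext k; simp [advect, mul_sub]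

lemma tenMul_sub_left {d : ℕ} (A B C : Ten d) : tenMul (A - B) C = tenMul A C - tenMul B C := by
  ext k; simp [tenMul, sub_mul]

lemma tenMul_sub_right {d : ℕ} (A B C : Ten d) : tenMul A (B - C) = tenMul A B - tenMul A C := by
  ext k; simp [tenMul, mul_sub]

lemma continuous_advect {d : ℕ} {ι : Type} [Fintype ι] :
    Continuous fun p : Vec d × EuclideanSpace ℝ (Fin d × ι) => advect p.1 p.2 := by
  unfold advect; fun_prop

lemma continuous_tenMul {d : ℕ} : Continuous fun p : Ten d × Ten d => tenMul p.1 p.2 := by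
  unfold tenMul; fun_prop

lemma fderiv_apply_eq_advect {d : ℕ} {ι : Type} [Fintype ι] (g : Vec d → EuclideanSpace ℝ ι)
    (x z : Vec d) : fderiv ℝ g x z = advect z (grad g x) := by
  have hz : z = ∑ i, z i • EuclideanSpace.single i (1 : ℝ) := by
    ext k; simp [Pi.single_apply]
  conv_lhs => rw [hz]
  rw [map_sum]
  ext k
  simp [advect, grad]

lemma norm_fderiv_le_norm_grad {d : ℕ} {ι : Type} [Fintype ι] (g : Vec d → EuclideanSpace ℝ ι)
    (x : Vec d) : ‖fderiv ℝ g x‖ ≤ ‖grad g x‖ := by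
  refine ContinuousLinearMap.opNorm_le_bound _ (norm_nonneg _) fun z => ?_
  rw [fderiv_apply_eq_advect, mul_comm]
  exact norm_advect_le _ _

/-! ### Density of the test fields -/

lemma memLp_test {d : ℕ} {Ω : Opens (Vec d)} (φ : 𝓓(Ω, Vec d)) :
    MemLp φ 2 (volume.restrict (Ω : Set (Vec d))) :=
  φ.continuous.memLp_of_hasCompactSupport φ.hasCompactSupport

lemma memLp_grad_test {d : ℕ} {Ω : Opens (Vec d)} (φ : 𝓓(Ω, Vec d)) :
    MemLp (grad φ) 2 (volume.restrict (Ω : Set (Vec d))) :=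
  (continuous_grad_test φ).memLp_of_hasCompactSupport (hasCompactSupport_grad_test φ)

lemma testPair_add {d : ℕ} {Ω : Opens (Vec d)} (φ ψ : 𝓓(Ω, Vec d)) :
    testPair (φ + ψ) = testPair φ + testPair ψ := by
  have hg : grad (φ + ψ : 𝓓(Ω, Vec d)) = grad φ + grad ψ := by
    ext x ik
    have := fderiv_add (𝕜 := ℝ) (φ.contDiff.differentiable (by simp)).differentiableAt
      (ψ.contDiff.differentiable (by simp)).differentiableAt (x := x)
    simp only [grad, Pi.add_apply, PiLp.add_apply]
    change fderiv ℝ (⇑φ + ⇑ψ) x _ _ = _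
    rw [this]; simp
  apply (WithLp.equiv 2 _).injective
  refine Prod.ext ?_ ?_
  · rfl
  · change (memLp_grad_test (φ + ψ)).toLp _ = (memLp_grad_test φ).toLp _ + (memLp_grad_test ψ).toLp _
    rw [← MemLp.toLp_add]
    congr 1

lemma testPair_smul {d : ℕ} {Ω : Opens (Vec d)} (c : ℝ) (φ : 𝓓(Ω, Vec d)) :
    testPair (c • φ) = c • testPair φ := by
  have hg : grad (c • φ : 𝓓(Ω, Vec d)) = c • grad φ := by
    ext x ik
    have := fderiv_const_smul (𝕜 := ℝ) (φ.contDiff.differentiable (by simp)).differentiableAt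
      (x := x) c
    simp only [grad, Pi.smul_apply, PiLp.smul_apply]
    change fderiv ℝ (c • ⇑φ) x _ _ = _
    rw [this]; simp
  apply (WithLp.equiv 2 _).injective
  refine Prod.ext ?_ ?_
  · rfl
  · change (memLp_grad_test (c • φ)).toLp _ = c • (memLp_grad_test φ).toLp _
    rw [← MemLp.toLp_const_smul]
    congr 1

/-- The pairs (φ, ∇φ) already form a subspace, so their span contains nothing else, and an element
of its closure is a limit of single test fields. -/
lemma exists_test_seq {d : ℕ} {Ω : Opens (Vec d)} (v : H10 Ω) :
    ∃ φ : ℕ → 𝓓(Ω, Vec d),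
      Filter.Tendsto (fun n => eLpNorm (fun x => H10val v x - φ n x) 2
        (volume.restrict (Ω : Set (Vec d)))) Filter.atTop (nhds 0) ∧
      Filter.Tendsto (fun n => eLpNorm (fun x => H10grad v x - grad (φ n) x) 2
        (volume.restrict (Ω : Set (Vec d)))) Filter.atTop (nhds 0) := by
  have hspan : ∀ w ∈ Submodule.span ℝ (range (testPair (Ω := Ω))), ∃ φ, testPair φ = w := by
    intro w hw
    induction hw using Submodule.span_induction with
    | mem x hx => exact hx
    | zero => exact ⟨(0 : ℝ) • 0, by rw [testPair_smul, zero_smul]⟩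
    | add x y _ _ hx hy =>
      obtain ⟨φ, rfl⟩ := hx
      obtain ⟨ψ, rfl⟩ := hy
      exact ⟨φ + ψ, testPair_add _ _⟩
    | smul a x _ hx =>
      obtain ⟨φ, rfl⟩ := hx
      exact ⟨a • φ, testPair_smul _ _⟩
  have hv : (v : L2Pair Ω) ∈ closure (Submodule.span ℝ (range (testPair (Ω := Ω))) : Set (L2Pair Ω)) :=
    v.2
  obtain ⟨w, hw, hlim⟩ := mem_closure_iff_seq_limit.1 hv
  choose φ hφ using fun n => hspan (w n) (hw n)
  refine ⟨φ, ?_, ?_⟩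
  · have h1 : Filter.Tendsto (fun n => (w n).fst) Filter.atTop (nhds (v : L2Pair Ω).fst) :=
      ((WithLp.prod_continuous_ofLp 2 _ _).fst.tendsto _).comp hlim
    rw [Lp.tendsto_Lp_iff_tendsto_eLpNorm'] at h1
    refine h1.congr fun n => ?_
    rw [← eLpNorm_neg]
    refine eLpNorm_congr_ae ?_
    have h2 : (w n).fst =ᵐ[volume.restrict (Ω : Set (Vec d))] φ n := by
      rw [← hφ n]; exact (memLp_test (φ n)).coeFn_toLp
    filter_upwards [h2] with x hx
    simp [hx, H10val]
  · have h1 : Filter.Tendsto (fun n => (w n).snd) Filter.atTop (nhds (v : L2Pair Ω).snd) :=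
      ((WithLp.prod_continuous_ofLp 2 _ _).snd.tendsto _).comp hlim
    rw [Lp.tendsto_Lp_iff_tendsto_eLpNorm'] at h1
    refine h1.congr fun n => ?_
    rw [← eLpNorm_neg]
    refine eLpNorm_congr_ae ?_
    have h2 : (w n).snd =ᵐ[volume.restrict (Ω : Set (Vec d))] grad (φ n) := by
      rw [← hφ n]; exact (memLp_grad_test (φ n)).coeFn_toLp
    filter_upwards [h2] with x hx
    simp [hx, H10grad]

lemma eLpNorm_two_eq {α E : Type*} [MeasurableSpace α] [NormedAddCommGroup E] (f : α → E)
    (μ : Measure α) : eLpNorm f 2 μ = (∫⁻ x, ‖f x‖ₑ ^ 2 ∂μ) ^ (1 / 2 : ℝ) := by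
  rw [eLpNorm_eq_lintegral_rpow_enorm_toReal (by norm_num) (by norm_num)]
  simp

lemma memLp_H10val {d : ℕ} {Ω : Opens (Vec d)} (v : H10 Ω) :
    MemLp (H10val v) 2 (volume.restrict (Ω : Set (Vec d))) := Lp.memLp _

lemma memLp_H10grad {d : ℕ} {Ω : Opens (Vec d)} (v : H10 Ω) :
    MemLp (H10grad v) 2 (volume.restrict (Ω : Set (Vec d))) := Lp.memLp _

/-- The trilinear estimate `∫ |v| h g ≤ C √n ‖∇v‖ ‖g‖^(1 - 1/n)` for `v ∈ H¹₀(Ω)`, `h` bounded in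
`L^d` and `g` bounded. -/
lemma exists_trilinear_bound {d : ℕ} (hd : 2 ≤ d) {Ω : Opens (Vec d)}
    (hΩ : Bornology.IsBounded (Ω : Set (Vec d))) (M : ℝ≥0) :
    ∃ C : ℝ≥0, ∀ (v : H10 Ω) {h g : Vec d → ℝ≥0∞},
      AEMeasurable h (volume.restrict (Ω : Set (Vec d))) →
      AEMeasurable g (volume.restrict (Ω : Set (Vec d))) →
      ∫⁻ x in Ω, h x ^ d ≤ M → (∀ᵐ x ∂volume.restrict (Ω : Set (Vec d)), g x ≤ M) →
      ∀ n : ℕ, 2 ≤ n → ∫⁻ x in Ω, ‖H10val v x‖ₑ * (h x * g x) ≤ C * (n : ℝ≥0∞) ^ (1 / 2 : ℝ) *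
        eLpNorm (H10grad v) 2 (volume.restrict (Ω : Set (Vec d))) *
        (∫⁻ x in Ω, g x ^ 2) ^ ((1 - 1 / (n : ℝ)) / 2) := by
  obtain ⟨C, hC⟩ : ∃ C : ℝ≥0, ∀ (φ : 𝓓(Ω, Vec d)) {h g : Vec d → ℝ≥0∞},
      AEMeasurable h (volume.restrict (Ω : Set (Vec d))) →
      AEMeasurable g (volume.restrict (Ω : Set (Vec d))) →
      ∫⁻ x in Ω, h x ^ d ≤ M → (∀ᵐ x ∂volume.restrict (Ω : Set (Vec d)), g x ≤ M) →
      ∀ n : ℕ, 2 ≤ n → ∫⁻ x in Ω, ‖φ x‖ₑ * (h x * g x) ≤ C * (n : ℝ≥0∞) ^ (1 / 2 : ℝ) *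
        (∫⁻ x in Ω, ‖fderiv ℝ φ x‖ₑ ^ 2) ^ (1 / 2 : ℝ) *
        (∫⁻ x in Ω, g x ^ 2) ^ ((1 - 1 / (n : ℝ)) / 2) := by
    rcases hd.eq_or_lt with rfl | hd3
    · obtain ⟨C, hC⟩ := lintegral_trilinear_two Ω.isOpen.measurableSet hΩ M
      exact ⟨C, fun φ {h g} hh hg h1 h2 => hC (φ.contDiff.of_le (by simp)) φ.hasCompactSupport
        φ.tsupport_subset hh hg h1 h2⟩
    · obtain ⟨C, hC⟩ := lintegral_trilinear_three hd3 Ω.isOpen.measurableSet hΩ M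
      exact ⟨C, fun φ {h g} hh hg h1 h2 => hC (φ.contDiff.of_le (by simp)) φ.hasCompactSupport
        φ.tsupport_subset hh hg h1 h2⟩
  refine ⟨C, fun v {h g} hh hg hhM hgM n hn => ?_⟩
  set μ := volume.restrict (Ω : Set (Vec d)) with hμ
  obtain ⟨φ, hφ1, hφ2⟩ := exists_test_seq v
  have hvol : volume (Ω : Set (Vec d)) ≠ ∞ := hΩ.measure_lt_top.ne
  -- Square integrability of h g, from h² ≤ 1 + h^d and the bound of g. It is used only
  -- qualitatively: the L² error in approximating v by test fields, paired with h g, tends to zero.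
  have hhg : ∫⁻ x, (h x * g x) ^ 2 ∂μ ≤ (volume (Ω : Set (Vec d)) + M) * (M : ℝ≥0∞) ^ 2 := by
    calc ∫⁻ x, (h x * g x) ^ 2 ∂μ ≤ ∫⁻ x, (1 + h x ^ d) * (M : ℝ≥0∞) ^ 2 ∂μ := by
          refine lintegral_mono_ae ?_
          filter_upwards [hgM] with x hx
          rw [mul_pow]
          gcongr
          rcases le_total (h x) 1 with h1 | h1
          · exact (pow_le_one₀ zero_le h1).trans le_self_add
          · exact (pow_le_pow_right₀ h1 hd).trans le_add_self
      _ = (∫⁻ x, (1 + h x ^ d) ∂μ) * (M : ℝ≥0∞) ^ 2 :=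
          lintegral_mul_const'' _ ((hh.pow_const d).const_add 1)
      _ ≤ _ := by
          rw [lintegral_add_left measurable_const]
          gcongr
          simp [hμ]
  set Q := (∫⁻ x, (h x * g x) ^ 2 ∂μ) ^ (1 / 2 : ℝ) with hQ
  have hQt : Q ≠ ∞ := by
    refine ENNReal.rpow_ne_top_of_nonneg (by norm_num) (ne_top_of_le_ne_top ?_ hhg)
    exact ENNReal.mul_ne_top (by simp [hvol]) (by simp)
  set P := (∫⁻ x, g x ^ 2 ∂μ) ^ ((1 - 1 / (n : ℝ)) / 2) with hP
  have hn1 : 1 / (n : ℝ) ≤ 1 := by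
    rw [div_le_one (by positivity)]; exact_mod_cast (by omega : 1 ≤ n)
  have hPt : P ≠ ∞ := by
    refine ENNReal.rpow_ne_top_of_nonneg (by linarith) (ne_top_of_le_ne_top
      (b := (M : ℝ≥0∞) ^ 2 * volume (Ω : Set (Vec d))) (ENNReal.mul_ne_top (by simp) hvol) ?_)
    calc ∫⁻ x, g x ^ 2 ∂μ ≤ ∫⁻ x, (M : ℝ≥0∞) ^ 2 ∂μ := by
          refine lintegral_mono_ae ?_
          filter_upwards [hgM] with x hx
          gcongr
      _ = _ := by rw [lintegral_const]; simp [hμ]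
  have hnt : (C : ℝ≥0∞) * (n : ℝ≥0∞) ^ (1 / 2 : ℝ) ≠ ∞ :=
    ENNReal.mul_ne_top (by simp) (ENNReal.rpow_ne_top_of_nonneg (by norm_num) (by simp))
  have hbound : ∀ k, ∫⁻ x, ‖H10val v x‖ₑ * (h x * g x) ∂μ ≤
      (C : ℝ≥0∞) * (n : ℝ≥0∞) ^ (1 / 2 : ℝ) * (eLpNorm (H10grad v) 2 μ +
        eLpNorm (fun x => H10grad v x - grad (φ k) x) 2 μ) * P +
      eLpNorm (fun x => H10val v x - φ k x) 2 μ * Q := by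
    intro k
    have hdm : AEStronglyMeasurable (fun x => H10val v x - φ k x) μ :=
      (memLp_H10val v).1.sub (φ k).continuous.aestronglyMeasurable
    have hgm : AEStronglyMeasurable (fun x => H10grad v x - grad (φ k) x) μ :=
      (memLp_H10grad v).1.sub (continuous_grad_test (φ k)).aestronglyMeasurable
    have hgrad : (∫⁻ x, ‖fderiv ℝ (φ k) x‖ₑ ^ 2 ∂μ) ^ (1 / 2 : ℝ) ≤ eLpNorm (H10grad v) 2 μ +
        eLpNorm (fun x => H10grad v x - grad (φ k) x) 2 μ := by
      calc (∫⁻ x, ‖fderiv ℝ (φ k) x‖ₑ ^ 2 ∂μ) ^ (1 / 2 : ℝ) ≤ eLpNorm (grad (φ k)) 2 μ := by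
            rw [eLpNorm_two_eq]
            gcongr with x
            rw [← ofReal_norm, ← ofReal_norm]
            exact ENNReal.ofReal_le_ofReal (norm_fderiv_le_norm_grad _ _)
        _ = eLpNorm (fun x => H10grad v x - (H10grad v x - grad (φ k) x)) 2 μ := by
            congr 1; ext x; simp
        _ ≤ _ := eLpNorm_sub_le (memLp_H10grad v).1 hgm (by norm_num)
    calc ∫⁻ x, ‖H10val v x‖ₑ * (h x * g x) ∂μ
        ≤ ∫⁻ x, (‖φ k x‖ₑ * (h x * g x) + ‖H10val v x - φ k x‖ₑ * (h x * g x)) ∂μ := by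
          refine lintegral_mono fun x => ?_
          rw [← add_mul]
          gcongr
          calc ‖H10val v x‖ₑ = ‖φ k x + (H10val v x - φ k x)‖ₑ := by rw [add_sub_cancel]
            _ ≤ _ := enorm_add_le _ _
      _ = ∫⁻ x, ‖φ k x‖ₑ * (h x * g x) ∂μ + ∫⁻ x, ‖H10val v x - φ k x‖ₑ * (h x * g x) ∂μ :=
          lintegral_add_left' ((φ k).continuous.enorm.measurable.aemeasurable.mul (hh.mul hg)) _
      _ ≤ _ := by
          refine add_le_add ((hC (φ k) hh hg hhM hgM n hn).trans (by gcongr)) ?_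
          rw [eLpNorm_two_eq]
          have := ENNReal.lintegral_mul_le_Lp_mul_Lq μ Real.HolderConjugate.two_two
            hdm.enorm (hh.mul hg)
          simpa only [ENNReal.rpow_two, Pi.mul_apply] using this
  have e1 : Filter.Tendsto (fun k => (C : ℝ≥0∞) * (n : ℝ≥0∞) ^ (1 / 2 : ℝ) *
      (eLpNorm (H10grad v) 2 μ + eLpNorm (fun x => H10grad v x - grad (φ k) x) 2 μ) * P +
      eLpNorm (fun x => H10val v x - φ k x) 2 μ * Q) Filter.atTop
      (nhds ((C : ℝ≥0∞) * (n : ℝ≥0∞) ^ (1 / 2 : ℝ) * (eLpNorm (H10grad v) 2 μ + 0) * P + 0 * Q)) :=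
    (ENNReal.Tendsto.mul_const (ENNReal.Tendsto.const_mul (hφ2.const_add _) (Or.inr hnt))
      (Or.inr hPt)).add (ENNReal.Tendsto.mul_const hφ1 (Or.inr hQt))
  rw [add_zero, zero_mul, add_zero] at e1
  exact ge_of_tendsto' e1 hbound

end

noncomputable section

/-! ### Integrals of products -/

lemma integrableOn_mul_of_hasCompactSupport {E : Type*} [NormedAddCommGroup E] [MeasurableSpace E]
    [BorelSpace E] {μ : Measure E} {O : Opens E} {g k : E → ℝ} (hg : LocallyIntegrableOn g O μ)
    (hk : Continuous k) (hc : HasCompactSupport k) (hs : tsupport k ⊆ O) :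
    IntegrableOn (fun x => g x * k x) O μ := by
  obtain ⟨C, hC⟩ := hk.bounded_above_of_compact_support hc
  have h1 : IntegrableOn g (tsupport k) μ := hg.integrableOn_compact_subset hs hc
  have h2 : IntegrableOn (fun x => g x * k x) (tsupport k) μ :=
    Integrable.mul_bdd h1 hk.aestronglyMeasurable (Filter.Eventually.of_forall hC)
  refine h2.of_forall_sdiff_eq_zero O.isOpen.measurableSet fun x hx => ?_
  rw [image_eq_zero_of_notMem_tsupport hx.2, mul_zero]

lemma locallyIntegrableOn_apply {X : Type*} [TopologicalSpace X] [MeasurableSpace X]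
    {μ : Measure X} {ι : Type*} [Fintype ι] {s : Set X} {g : X → EuclideanSpace ℝ ι}
    (hg : LocallyIntegrableOn g s μ) (k : ι) : LocallyIntegrableOn (fun x => g x k) s μ := by
  intro x hx
  obtain ⟨t, ht, hi⟩ := hg x hx
  exact ⟨t, ht, (EuclideanSpace.proj k : EuclideanSpace ℝ ι →L[ℝ] ℝ).integrable_comp hi⟩

lemma lintegral_enorm_mul_enorm_le {α E F : Type*} [MeasurableSpace α] [NormedAddCommGroup E]
    [NormedAddCommGroup F] {μ : Measure α} {a : α → E} {b : α → F}
    (ha : AEStronglyMeasurable a μ) (hb : AEStronglyMeasurable b μ) :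
    ∫⁻ x, ‖a x‖ₑ * ‖b x‖ₑ ∂μ ≤ eLpNorm a 2 μ * eLpNorm b 2 μ := by
  rw [eLpNorm_two_eq, eLpNorm_two_eq]
  have := ENNReal.lintegral_mul_le_Lp_mul_Lq μ Real.HolderConjugate.two_two ha.enorm hb.enorm
  simpa only [ENNReal.rpow_two, Pi.mul_apply] using this

/-- Convergence of the integrals of a bilinear expression in two `L²` functions. -/
lemma tendsto_integral_of_bilinear_bound {α E F : Type*} [MeasurableSpace α]
    [NormedAddCommGroup E] [NormedAddCommGroup F] {μ : Measure α} {a : α → E} {b : α → F}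
    {a' : ℕ → α → E} {b' : ℕ → α → F} (ha : MemLp a 2 μ) (hb : MemLp b 2 μ)
    (ha' : ∀ n, AEStronglyMeasurable (a' n) μ) (hb' : ∀ n, AEStronglyMeasurable (b' n) μ)
    (hal : Filter.Tendsto (fun n => eLpNorm (fun x => a x - a' n x) 2 μ) Filter.atTop (nhds 0))
    (hbl : Filter.Tendsto (fun n => eLpNorm (fun x => b x - b' n x) 2 μ) Filter.atTop (nhds 0))
    {Φ : α → ℝ} {Φ' : ℕ → α → ℝ} (hΦ : Integrable Φ μ) (hΦ' : ∀ n, AEStronglyMeasurable (Φ' n) μ)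
    (K : ℝ≥0) (h : ∀ n, ∀ᵐ x ∂μ, ‖Φ' n x - Φ x‖ₑ ≤ K * (‖a x - a' n x‖ₑ * ‖b x - b' n x‖ₑ +
      ‖a x - a' n x‖ₑ * ‖b x‖ₑ + ‖a x‖ₑ * ‖b x - b' n x‖ₑ)) :
    Filter.Tendsto (fun n => ∫ x, Φ' n x ∂μ) Filter.atTop (nhds (∫ x, Φ x ∂μ)) := by
  have hlim : Filter.Tendsto (fun n => (K : ℝ≥0∞) *
      (eLpNorm (fun x => a x - a' n x) 2 μ * eLpNorm (fun x => b x - b' n x) 2 μ +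
      eLpNorm (fun x => a x - a' n x) 2 μ * eLpNorm b 2 μ +
      eLpNorm a 2 μ * eLpNorm (fun x => b x - b' n x) 2 μ)) Filter.atTop
      (nhds ((K : ℝ≥0∞) * (0 * 0 + 0 * eLpNorm b 2 μ + eLpNorm a 2 μ * 0))) :=
    ENNReal.Tendsto.const_mul (((ENNReal.Tendsto.mul hal (Or.inr (by simp)) hbl
      (Or.inr (by simp))).add (ENNReal.Tendsto.mul_const hal (Or.inr hb.2.ne))).add
      (ENNReal.Tendsto.const_mul hbl (Or.inr ha.2.ne))) (Or.inr (by simp))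
  simp only [mul_zero, zero_mul, add_zero] at hlim
  have hlim' : Filter.Tendsto (fun n => ∫⁻ x, ‖Φ' n x - Φ x‖ₑ ∂μ) Filter.atTop (nhds 0) := by
    refine tendsto_of_tendsto_of_tendsto_of_le_of_le tendsto_const_nhds hlim (fun _ => zero_le)
      fun n => ?_
    have m1 : AEMeasurable (fun x => ‖a x - a' n x‖ₑ) μ := (ha.1.sub (ha' n)).enorm
    have m2 : AEMeasurable (fun x => ‖b x - b' n x‖ₑ) μ := (hb.1.sub (hb' n)).enorm
    calc ∫⁻ x, ‖Φ' n x - Φ x‖ₑ ∂μ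
        ≤ ∫⁻ x, K * (‖a x - a' n x‖ₑ * ‖b x - b' n x‖ₑ +
          ‖a x - a' n x‖ₑ * ‖b x‖ₑ + ‖a x‖ₑ * ‖b x - b' n x‖ₑ) ∂μ := lintegral_mono_ae (h n)
      _ = K * (∫⁻ x, ‖a x - a' n x‖ₑ * ‖b x - b' n x‖ₑ ∂μ +
          ∫⁻ x, ‖a x - a' n x‖ₑ * ‖b x‖ₑ ∂μ + ∫⁻ x, ‖a x‖ₑ * ‖b x - b' n x‖ₑ ∂μ) := by
          rw [lintegral_const_mul' _ _ (by simp),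
            lintegral_add_right' (g := fun x => ‖a x‖ₑ * ‖b x - b' n x‖ₑ) _ (ha.1.enorm.mul m2),
            lintegral_add_right' (g := fun x => ‖a x - a' n x‖ₑ * ‖b x‖ₑ) _ (m1.mul hb.1.enorm)]
      _ ≤ _ := by
          gcongr
          · exact lintegral_enorm_mul_enorm_le (ha.1.sub (ha' n)) (hb.1.sub (hb' n))
          · exact lintegral_enorm_mul_enorm_le (ha.1.sub (ha' n)) hb.1
          · exact lintegral_enorm_mul_enorm_le ha.1 (hb.1.sub (hb' n))
  refine tendsto_integral_of_L1 Φ hΦ.1 ?_ hlim'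
  filter_upwards [hlim'.eventually_lt_const ENNReal.zero_lt_top] with n hn
  have h1 : Integrable (fun x => Φ' n x - Φ x) μ := ⟨(hΦ' n).sub hΦ.1, hn⟩
  exact (h1.add hΦ).congr (Filter.Eventually.of_forall fun x => by simp)

/-! ### Cancellations in the convection terms -/

lemma AEStronglyMeasurable.advect {α : Type*} [MeasurableSpace α] {μ : Measure α} {d : ℕ}
    {ι : Type} [Fintype ι] {a : α → Vec d} {B : α → EuclideanSpace ℝ (Fin d × ι)}
    (ha : AEStronglyMeasurable a μ) (hB : AEStronglyMeasurable B μ) :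
    AEStronglyMeasurable (fun x => advect (a x) (B x)) μ :=
  continuous_advect.comp_aestronglyMeasurable (ha.prodMk hB)

lemma AEStronglyMeasurable.tenMul {α : Type*} [MeasurableSpace α] {μ : Measure α} {d : ℕ}
    {A B : α → Ten d} (hA : AEStronglyMeasurable A μ) (hB : AEStronglyMeasurable B μ) :
    AEStronglyMeasurable (fun x => tenMul (A x) (B x)) μ :=
  continuous_tenMul.comp_aestronglyMeasurable (hA.prodMk hB)

lemma enorm_inner_advect_le {d : ℕ} {ι : Type} [Fintype ι] (a : Vec d)
    (B : EuclideanSpace ℝ (Fin d × ι)) (c : EuclideanSpace ℝ ι) :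
    ‖(inner ℝ (advect a B) c : ℝ)‖ₑ ≤ ‖a‖ₑ * ‖B‖ₑ * ‖c‖ₑ := by
  simp only [← ofReal_norm, ← ENNReal.ofReal_mul (norm_nonneg _),
    ← ENNReal.ofReal_mul (mul_nonneg (norm_nonneg _) (norm_nonneg _))]
  refine ENNReal.ofReal_le_ofReal ((norm_inner_le_norm _ _).trans ?_)
  gcongr
  exact norm_advect_le _ _

/-- A component of a test field. -/
def testApply {E : Type*} [NormedAddCommGroup E] [NormedSpace ℝ E] {O : Opens E} {ι : Type*}
    [Fintype ι] (φ : 𝓓(O, EuclideanSpace ℝ ι)) (k : ι) : 𝓓(O, ℝ) where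
  toFun x := φ x k
  contDiff' := (EuclideanSpace.proj k : EuclideanSpace ℝ ι →L[ℝ] ℝ).contDiff.comp φ.contDiff
  hasCompactSupport' := φ.hasCompactSupport.comp_left (g := fun v : EuclideanSpace ℝ ι => v k) rfl
  tsupport_subset' := (tsupport_comp_subset (g := fun v : EuclideanSpace ℝ ι => v k) rfl _).trans
    φ.tsupport_subset

lemma testApply_apply {E : Type*} [NormedAddCommGroup E] [NormedSpace ℝ E] {O : Opens E}
    {ι : Type*} [Fintype ι] (φ : 𝓓(O, EuclideanSpace ℝ ι)) (k : ι) (x : E) :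
    testApply φ k x = φ x k := rfl

lemma fderiv_testApply {E : Type*} [NormedAddCommGroup E] [NormedSpace ℝ E] {O : Opens E}
    {ι : Type*} [Fintype ι] (φ : 𝓓(O, EuclideanSpace ℝ ι)) (k : ι) (x e : E) :
    fderiv ℝ (testApply φ k) x e = fderiv ℝ φ x e k := by
  have h : HasFDerivAt (testApply φ k)
      ((EuclideanSpace.proj k : EuclideanSpace ℝ ι →L[ℝ] ℝ).comp (fderiv ℝ φ x)) x :=
    (EuclideanSpace.proj k : EuclideanSpace ℝ ι →L[ℝ] ℝ).hasFDerivAt.comp x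
      (φ.contDiff.differentiable (by simp)).differentiableAt.hasFDerivAt
  rw [h.fderiv]; rfl

/-- The square of the norm of a test field. -/
def testNormSq {d : ℕ} {Ω : Opens (Vec d)} (φ : 𝓓(Ω, Vec d)) : 𝓓(Ω, ℝ) where
  toFun x := ‖φ x‖ ^ 2
  contDiff' := φ.contDiff.norm_sq ℝ
  hasCompactSupport' := φ.hasCompactSupport.comp_left (g := fun v : Vec d => ‖v‖ ^ 2) (by simp)
  tsupport_subset' := (tsupport_comp_subset (g := fun v : Vec d => ‖v‖ ^ 2) (by simp) _).trans
    φ.tsupport_subset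

lemma inner_advect_grad_test {d : ℕ} {Ω : Opens (Vec d)} (φ : 𝓓(Ω, Vec d)) (w x : Vec d) :
    inner ℝ (advect w (grad φ x)) (φ x) =
      (1 / 2) * ∑ i, w i * fderiv ℝ (testNormSq φ) x (EuclideanSpace.single i 1) := by
  have h : HasFDerivAt (testNormSq φ) (2 • (innerSL ℝ (φ x)).comp (fderiv ℝ φ x)) x :=
    (φ.contDiff.differentiable (by simp)).differentiableAt.hasFDerivAt.norm_sq
  have hw : w = ∑ i, w i • EuclideanSpace.single i (1 : ℝ) := by
    ext k; simp [Pi.single_apply]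
  rw [← fderiv_apply_eq_advect]
  have h2 : ∑ i, w i * fderiv ℝ (testNormSq φ) x (EuclideanSpace.single i 1) =
      fderiv ℝ (testNormSq φ) x w := by
    conv_rhs => rw [hw]
    simp
  rw [h2, h.fderiv, real_inner_comm]
  simp

/-- The integrand is half of w·∇|φ|², and |φ|² is a scalar test function; the definition of the weak
gradient moves the derivatives to w, where they form its divergence. -/
lemma integral_inner_advect_grad_test_eq_zero {d : ℕ} {Ω : Opens (Vec d)} {w : Vec d → Vec d}
    {Dw : Vec d → Ten d} (hw : HasWeakGrad Ω w Dw)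
    (hdiv : ∀ᵐ x ∂volume.restrict (Ω : Set (Vec d)), ∑ i, Dw x (i, i) = 0) (φ : 𝓓(Ω, Vec d)) :
    ∫ x in Ω, inner ℝ (advect (w x) (grad φ x)) (φ x) = 0 := by
  simp_rw [inner_advect_grad_test]
  have hcd : ∀ i : Fin d, Continuous fun x =>
      fderiv ℝ (testNormSq φ) x (EuclideanSpace.single i 1) := fun i =>
    ((testNormSq φ).contDiff.continuous_fderiv (by simp)).clm_apply continuous_const
  have hsd : ∀ i : Fin d, tsupport (fun x =>
      fderiv ℝ (testNormSq φ) x (EuclideanSpace.single i 1)) ⊆ tsupport (testNormSq φ) := by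
    intro i
    refine closure_minimal (fun x hx => ?_) (isClosed_tsupport _)
    by_contra h
    exact hx (by simp [fderiv_of_notMem_tsupport (𝕜 := ℝ) h])
  rw [integral_const_mul, integral_finsetSum]
  · simp_rw [hw.integral_eq]
    rw [Finset.sum_neg_distrib, ← integral_finsetSum]
    · simp_rw [← Finset.sum_mul]
      rw [integral_eq_zero_of_ae]
      · simp
      · filter_upwards [hdiv] with x hx
        simp [hx]
    · exact fun i _ => integrableOn_mul_of_hasCompactSupport
        (locallyIntegrableOn_apply hw.locInt_grad (i, i)) (testNormSq φ).continuous
        (testNormSq φ).hasCompactSupport (testNormSq φ).tsupport_subset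
  · exact fun i _ => integrableOn_mul_of_hasCompactSupport (locallyIntegrableOn_apply hw.locInt i)
      (hcd i) ((testNormSq φ).hasCompactSupport.mono' (subset_closure.trans (hsd i)))
      ((hsd i).trans (testNormSq φ).tsupport_subset)

/-- `(w·∇v, v) = 0` for a bounded divergence free `w` and `v ∈ H¹₀(Ω)`. -/
lemma integral_inner_advect_H10grad_eq_zero {d : ℕ} {Ω : Opens (Vec d)} {w : Vec d → Vec d}
    {Dw : Vec d → Ten d} (hw : HasWeakGrad Ω w Dw)
    (hdiv : ∀ᵐ x ∂volume.restrict (Ω : Set (Vec d)), ∑ i, Dw x (i, i) = 0)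
    (hwm : AEStronglyMeasurable w (volume.restrict (Ω : Set (Vec d)))) {K : ℝ≥0}
    (hwK : ∀ᵐ x ∂volume.restrict (Ω : Set (Vec d)), ‖w x‖ₑ ≤ K) (v : H10 Ω) :
    ∫ x in Ω, inner ℝ (advect (w x) (H10grad v x)) (H10val v x) = 0 := by
  -- For bounded w the form (w·∇v, v) is continuous with respect to convergence of v and ∇v in L²,
  -- so the identity for test fields passes to the limit.
  obtain ⟨φ, h1, h2⟩ := exists_test_seq v
  have hv := memLp_H10val v
  have hDv := memLp_H10grad v
  have hlim := tendsto_integral_of_bilinear_bound hv hDv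
    (fun n => (φ n).continuous.aestronglyMeasurable)
    (fun n => (continuous_grad_test (φ n)).aestronglyMeasurable) h1 h2
    (Φ := fun x => inner ℝ (advect (w x) (H10grad v x)) (H10val v x))
    (Φ' := fun n x => inner ℝ (advect (w x) (grad (φ n) x)) (φ n x)) ?_ ?_ K ?_
  · simp_rw [integral_inner_advect_grad_test_eq_zero hw hdiv] at hlim
    exact (tendsto_nhds_unique hlim tendsto_const_nhds)
  · refine ⟨(AEStronglyMeasurable.advect hwm hDv.1).inner hv.1, ?_⟩
    calc ∫⁻ x in Ω, ‖(inner ℝ (advect (w x) (H10grad v x)) (H10val v x) : ℝ)‖ₑ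
        ≤ ∫⁻ x in Ω, K * (‖H10grad v x‖ₑ * ‖H10val v x‖ₑ) := by
          refine lintegral_mono_ae ?_
          filter_upwards [hwK] with x hx
          refine (enorm_inner_advect_le _ _ _).trans ?_
          rw [mul_assoc]; gcongr
      _ = K * ∫⁻ x in Ω, ‖H10grad v x‖ₑ * ‖H10val v x‖ₑ := lintegral_const_mul' _ _ (by simp)
      _ ≤ K * (eLpNorm (H10grad v) 2 _ * eLpNorm (H10val v) 2 _) := by
          gcongr; exact lintegral_enorm_mul_enorm_le hDv.1 hv.1
      _ < ∞ := ENNReal.mul_lt_top (by simp) (ENNReal.mul_lt_top hDv.2 hv.2)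
  · exact fun n => (AEStronglyMeasurable.advect hwm
      (continuous_grad_test (φ n)).aestronglyMeasurable).inner
      (φ n).continuous.aestronglyMeasurable
  · intro n
    filter_upwards [hwK] with x hx
    have e : inner ℝ (advect (w x) (grad (φ n) x)) (φ n x) -
        inner ℝ (advect (w x) (H10grad v x)) (H10val v x) =
        inner ℝ (advect (w x) (H10grad v x - grad (φ n) x)) (H10val v x - φ n x) -
        inner ℝ (advect (w x) (H10grad v x)) (H10val v x - φ n x) -
        inner ℝ (advect (w x) (H10grad v x - grad (φ n) x)) (H10val v x) := by
      rw [advect_sub_right]; simp only [inner_sub_left, inner_sub_right]; ring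
    rw [e]
    calc _ ≤ ‖w x‖ₑ * ‖H10grad v x - grad (φ n) x‖ₑ * ‖H10val v x - φ n x‖ₑ +
          ‖w x‖ₑ * ‖H10grad v x‖ₑ * ‖H10val v x - φ n x‖ₑ +
          ‖w x‖ₑ * ‖H10grad v x - grad (φ n) x‖ₑ * ‖H10val v x‖ₑ := by
          refine (enorm_sub_le).trans (add_le_add (enorm_sub_le.trans (add_le_add ?_ ?_)) ?_) <;>
          exact enorm_inner_advect_le _ _ _
      _ = ‖w x‖ₑ * (‖H10val v x - φ n x‖ₑ * ‖H10grad v x - grad (φ n) x‖ₑ +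
          ‖H10val v x - φ n x‖ₑ * ‖H10grad v x‖ₑ +
          ‖H10val v x‖ₑ * ‖H10grad v x - grad (φ n) x‖ₑ) := by ring
      _ ≤ _ := by gcongr

/-- `weak_deriv_sq` gives ∂_i(g_k²) = 2 g_k ∂_i g_k weakly for each component. Testing it with φ_i
and summing over i and k yields the identity; boundedness of g replaces any relation between the
exponent of its gradient and the dimension. -/
lemma integral_inner_advect_test_eq {d : ℕ} {ι : Type} [Fintype ι] {Ω : Opens (Vec d)}
    {g : Vec d → EuclideanSpace ℝ ι} {Dg : Vec d → EuclideanSpace ℝ (Fin d × ι)}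
    (hg : HasWeakGrad Ω g Dg) (hgm : AEStronglyMeasurable g (volume.restrict (Ω : Set (Vec d))))
    {M : ℝ≥0} (hgM : ∀ᵐ x ∂volume.restrict (Ω : Set (Vec d)), ‖g x‖ₑ ≤ M) (φ : 𝓓(Ω, Vec d)) :
    ∫ x in Ω, (2 * inner ℝ (advect (φ x) (Dg x)) (g x) +
      (∑ i, grad φ x (i, i)) * ‖g x‖ ^ 2) = 0 := by
  have hgk : ∀ k, AEStronglyMeasurable (fun x => g x k) (volume.restrict (Ω : Set (Vec d))) :=
    fun k => (EuclideanSpace.proj k : EuclideanSpace ℝ ι →L[ℝ] ℝ).continuous.comp_aestronglyMeasurable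
      hgm
  have hgkM : ∀ k, ∀ᵐ x ∂volume.restrict (Ω : Set (Vec d)), ‖g x k‖ ≤ M := by
    intro k
    filter_upwards [hgM] with x hx
    refine (PiLp.norm_apply_le (g x) k).trans ?_
    rw [← ENNReal.ofReal_le_ofReal_iff (by positivity), ofReal_norm]
    simpa using hx
  have hcd : ∀ (i : Fin d) (ψ : 𝓓(Ω, ℝ)), Continuous fun x =>
      fderiv ℝ ψ x (EuclideanSpace.single i 1) := fun i ψ =>
    (ψ.contDiff.continuous_fderiv (by simp)).clm_apply continuous_const
  have hsd : ∀ (i : Fin d) (ψ : 𝓓(Ω, ℝ)), tsupport (fun x =>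
      fderiv ℝ ψ x (EuclideanSpace.single i 1)) ⊆ tsupport ψ := by
    intro i ψ
    refine closure_minimal (fun x hx => ?_) (isClosed_tsupport _)
    by_contra h
    exact hx (by simp [fderiv_of_notMem_tsupport (𝕜 := ℝ) h])
  have i1 : ∀ (i : Fin d) (k : ι) (ψ : 𝓓(Ω, ℝ)), IntegrableOn (fun x => g x k *
      fderiv ℝ ψ x (EuclideanSpace.single i 1)) Ω := fun i k ψ =>
    integrableOn_mul_of_hasCompactSupport (locallyIntegrableOn_apply hg.locInt k)
      (hcd i ψ) (ψ.hasCompactSupport.mono' (subset_closure.trans (hsd i ψ)))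
      ((hsd i ψ).trans ψ.tsupport_subset)
  have i2 : ∀ (i : Fin d) (k : ι) (ψ : 𝓓(Ω, ℝ)), IntegrableOn (fun x => Dg x (i, k) * ψ x) Ω :=
    fun i k ψ => integrableOn_mul_of_hasCompactSupport
      (locallyIntegrableOn_apply hg.locInt_grad (i, k)) ψ.continuous ψ.hasCompactSupport
      ψ.tsupport_subset
  have key : ∀ (i : Fin d) (k : ι), ∫ x in Ω, (g x k ^ 2 *
      fderiv ℝ (testApply φ i) x (EuclideanSpace.single i 1) +
      2 * (Dg x (i, k) * g x k * testApply φ i x)) = 0 := by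
    intro i k
    refine weak_deriv_sq (hgk k) (hgkM k) (locallyIntegrableOn_apply hg.locInt_grad (i, k))
      (fun ψ => ?_) _
    rw [integral_add (i1 i k ψ) (i2 i k ψ), hg.integral_eq, neg_add_cancel]
  have hi : ∀ (i : Fin d) (k : ι), Integrable (fun x => g x k ^ 2 *
      fderiv ℝ (testApply φ i) x (EuclideanSpace.single i 1) +
      2 * (Dg x (i, k) * g x k * testApply φ i x)) (volume.restrict (Ω : Set (Vec d))) := by
    intro i k
    have j1 := (i1 i k (testApply φ i)).mul_bdd (hgk k) (hgkM k)
    have j2 := ((i2 i k (testApply φ i)).mul_bdd (hgk k) (hgkM k)).const_mul 2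
    refine (j1.add j2).congr (Filter.Eventually.of_forall fun x => ?_)
    simp only [Pi.add_apply]; ring
  have hsum : ∫ x in Ω, ∑ i : Fin d, ∑ k : ι, (g x k ^ 2 *
      fderiv ℝ (testApply φ i) x (EuclideanSpace.single i 1) +
      2 * (Dg x (i, k) * g x k * testApply φ i x)) = 0 := by
    rw [integral_finsetSum _ fun i _ => integrable_finsetSum _ fun k _ => hi i k]
    refine Finset.sum_eq_zero fun i _ => ?_
    rw [integral_finsetSum _ fun k _ => hi i k]
    exact Finset.sum_eq_zero fun k _ => key i k
  rw [← hsum]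
  refine integral_congr_ae (Filter.Eventually.of_forall fun x => ?_)
  simp only [fderiv_testApply, testApply_apply, Finset.sum_add_distrib, advect, grad,
    EuclideanSpace.real_norm_sq_eq, PiLp.inner_apply, RCLike.inner_apply, conj_trivial,
    Finset.sum_mul, Finset.mul_sum]
  rw [add_comm]
  congr 1
  · rw [Finset.sum_comm]
    refine Finset.sum_congr rfl fun i _ => Finset.sum_congr rfl fun k _ => by ring
  · rw [Finset.sum_comm]
    refine Finset.sum_congr rfl fun i _ => Finset.sum_congr rfl fun k _ => by ring

/-- `(v·∇g, g) = 0` for `v ∈ V(Ω)` and a bounded `g` with square integrable weak gradient. -/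
lemma integral_inner_advect_weakGrad_eq_zero {d : ℕ} {ι : Type} [Fintype ι] {Ω : Opens (Vec d)}
    (hΩ : Bornology.IsBounded (Ω : Set (Vec d)))
    {g : Vec d → EuclideanSpace ℝ ι} {Dg : Vec d → EuclideanSpace ℝ (Fin d × ι)}
    (hg : HasWeakGrad Ω g Dg) (hgm : AEStronglyMeasurable g (volume.restrict (Ω : Set (Vec d))))
    {M : ℝ≥0} (hgM : ∀ᵐ x ∂volume.restrict (Ω : Set (Vec d)), ‖g x‖ₑ ≤ M)
    (hDg : MemLp Dg 2 (volume.restrict (Ω : Set (Vec d)))) {v : H10 Ω} (hv : v ∈ V Ω) :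
    ∫ x in Ω, inner ℝ (advect (H10val v x) (Dg x)) (g x) = 0 := by
  have hvol : volume (Ω : Set (Vec d)) ≠ ∞ := hΩ.measure_lt_top.ne
  obtain ⟨φ, h1, h2⟩ := exists_test_seq v
  have hvL := memLp_H10val v
  have hDv := memLp_H10grad v
  set μ := volume.restrict (Ω : Set (Vec d)) with hμ
  have : IsFiniteMeasure μ := ⟨by simp [hμ, hvol.lt_top]⟩
  have hgR : ∀ᵐ x ∂μ, ‖g x‖ ≤ M := by
    filter_upwards [hgM] with x hx
    rw [← ENNReal.ofReal_le_ofReal_iff (by positivity), ofReal_norm]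
    simpa using hx
  have htr : ∀ B : Ten d, ‖∑ i, B (i, i)‖ₑ ≤ d * ‖B‖ₑ := by
    intro B
    refine (enorm_sum_le _ _).trans ((Finset.sum_le_card_nsmul _ _ ‖B‖ₑ fun i _ => ?_).trans_eq
      (by simp))
    rw [← ofReal_norm, ← ofReal_norm]
    exact ENNReal.ofReal_le_ofReal (PiLp.norm_apply_le B (i, i))
  have htrm : ∀ {B : Vec d → Ten d}, AEStronglyMeasurable B μ →
      AEStronglyMeasurable (fun x => ∑ i, B x (i, i)) μ := fun hB =>
    (by fun_prop : Continuous fun A : Ten d => ∑ i, A (i, i)).comp_aestronglyMeasurable hB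
  have ia : ∀ {a : Vec d → Vec d}, MemLp a 2 μ →
      Integrable (fun x => inner ℝ (advect (a x) (Dg x)) (g x)) μ := by
    intro a ha
    refine ⟨(AEStronglyMeasurable.advect ha.1 hDg.1).inner hgm, ?_⟩
    calc ∫⁻ x, ‖(inner ℝ (advect (a x) (Dg x)) (g x) : ℝ)‖ₑ ∂μ
        ≤ ∫⁻ x, M * (‖a x‖ₑ * ‖Dg x‖ₑ) ∂μ := by
          refine lintegral_mono_ae ?_
          filter_upwards [hgM] with x hx
          refine (enorm_inner_advect_le _ _ _).trans ?_
          rw [mul_comm (M : ℝ≥0∞)]; gcongr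
      _ = M * ∫⁻ x, ‖a x‖ₑ * ‖Dg x‖ₑ ∂μ := lintegral_const_mul' _ _ (by simp)
      _ ≤ M * (eLpNorm a 2 _ * eLpNorm Dg 2 _) := by
          gcongr; exact lintegral_enorm_mul_enorm_le ha.1 hDg.1
      _ < ∞ := ENNReal.mul_lt_top (by simp) (ENNReal.mul_lt_top ha.2 hDg.2)
  have ib : ∀ {B : Vec d → Ten d}, MemLp B 2 μ →
      Integrable (fun x => (∑ i, B x (i, i)) * ‖g x‖ ^ 2) μ := by
    intro B hB
    refine Integrable.mul_bdd (c := (M : ℝ) ^ 2) ⟨htrm hB.1, ?_⟩ (hgm.norm.pow 2) ?_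
    · calc ∫⁻ x, ‖∑ i, B x (i, i)‖ₑ ∂μ ≤ ∫⁻ x, d * ‖B x‖ₑ ∂μ := lintegral_mono fun x => htr _
        _ = d * ∫⁻ x, ‖B x‖ₑ ∂μ := lintegral_const_mul' _ _ (by simp)
        _ < ∞ := ENNReal.mul_lt_top (by simp) (hB.integrable (by norm_num)).2
    · filter_upwards [hgR] with x hx
      rw [norm_pow, norm_norm]; gcongr
  -- The approximation is made in the velocity and not in g: both terms of
  -- `integral_inner_advect_test_eq` are continuous in (v, ∇v), because g is bounded and its
  -- gradient is square integrable. In the limit the second term contains div v.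
  have l1 := tendsto_integral_of_bilinear_bound hvL hDg
    (fun n => (φ n).continuous.aestronglyMeasurable) (fun n => hDg.1) h1 (by simp) (ia hvL)
    (Φ' := fun n x => inner ℝ (advect (φ n x) (Dg x)) (g x))
    (fun n => (ia (memLp_test (φ n))).1) M ?_
  · have l2 := tendsto_integral_of_bilinear_bound hDv (memLp_const (1 : ℝ))
      (fun n => (continuous_grad_test (φ n)).aestronglyMeasurable)
      (fun n => aestronglyMeasurable_const (b := (1 : ℝ))) h2 (by simp) (ib hDv)
      (Φ' := fun n x => (∑ i, grad (φ n) x (i, i)) * ‖g x‖ ^ 2)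
      (fun n => (ib (memLp_grad_test (φ n))).1) (d * M ^ 2) ?_
    · have hz : ∫ x, (∑ i, H10grad v x (i, i)) * ‖g x‖ ^ 2 ∂μ = 0 := by
        refine integral_eq_zero_of_ae ?_
        have hv' : ∀ᵐ x ∂μ, ∑ i, H10grad v x (i, i) = 0 := hv
        filter_upwards [hv'] with x hx
        simp [hx]
      have l3 := (l1.const_mul 2).add l2
      rw [hz, add_zero] at l3
      have hn : ∀ n, 2 * ∫ x, inner ℝ (advect (φ n x) (Dg x)) (g x) ∂μ +
          ∫ x, (∑ i, grad (φ n) x (i, i)) * ‖g x‖ ^ 2 ∂μ = 0 := by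
        intro n
        rw [← integral_inner_advect_test_eq hg hgm hgM (φ n), integral_add
          ((ia (memLp_test (φ n))).const_mul 2) (ib (memLp_grad_test (φ n))), integral_const_mul]
      simp_rw [hn] at l3
      have := tendsto_nhds_unique l3 tendsto_const_nhds
      linarith
    · intro n
      filter_upwards [hgR] with x hx
      have e : (∑ i, grad (φ n) x (i, i)) * ‖g x‖ ^ 2 - (∑ i, H10grad v x (i, i)) * ‖g x‖ ^ 2 =
          -((∑ i, (H10grad v x - grad (φ n) x) (i, i)) * ‖g x‖ ^ 2) := by
        simp [Finset.sum_sub_distrib]; ring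
      rw [e, enorm_neg, enorm_mul]
      have hx2 : ‖‖g x‖ ^ 2‖ₑ ≤ (M : ℝ≥0∞) ^ 2 := by
        rw [enorm_pow, enorm_norm]
        gcongr
        rw [← ofReal_norm]
        exact (ENNReal.ofReal_le_ofReal hx).trans_eq (by simp)
      calc _ ≤ d * ‖H10grad v x - grad (φ n) x‖ₑ * (M : ℝ≥0∞) ^ 2 := mul_le_mul' (htr _) hx2
        _ = _ := by push_cast; simp; ring
  · intro n
    filter_upwards [hgM] with x hx
    rw [← inner_sub_left, ← advect_sub_left]
    refine (enorm_inner_advect_le _ _ _).trans ?_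
    simp only [sub_self, enorm_zero, mul_zero, add_zero, zero_add]
    rw [enorm_sub_rev, mul_comm]
    gcongr

end

noncomputable section

/-! ### Kernels `∫ ⟨a(t,x), b(r,x)⟩ dx` on the diagonal -/

section Kernel

set_option linter.unusedSectionVars false

open Filter Topology

variable {X E : Type*} [MeasurableSpace X] [NormedAddCommGroup E] [InnerProductSpace ℝ E]
  {ν : Measure X} [SFinite ν]

lemma enorm_integral_inner_le {f g : X → E} (hf : AEStronglyMeasurable f ν)
    (hg : AEStronglyMeasurable g ν) :
    ‖∫ x, (inner ℝ (f x) (g x) : ℝ) ∂ν‖ₑ ≤ eLpNorm f 2 ν * eLpNorm g 2 ν := by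
  refine (enorm_integral_le_lintegral_enorm _).trans
    ((lintegral_mono fun x => ?_).trans (lintegral_enorm_mul_enorm_le hf hg))
  simp only [← ofReal_norm, ← ENNReal.ofReal_mul (norm_nonneg _)]
  exact ENNReal.ofReal_le_ofReal (norm_inner_le_norm _ _)

lemma integrable_inner_of_memLp_two {f g : X → E} (hf : MemLp f 2 ν) (hg : MemLp g 2 ν) :
    Integrable (fun x => (inner ℝ (f x) (g x) : ℝ)) ν := by
  refine ⟨hf.1.inner hg.1, lt_of_le_of_lt ((lintegral_mono fun x => ?_).trans
    (lintegral_enorm_mul_enorm_le hf.1 hg.1)) (ENNReal.mul_lt_top hf.2 hg.2)⟩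
  simp only [← ofReal_norm, ← ENNReal.ofReal_mul (norm_nonneg _)]
  exact ENNReal.ofReal_le_ofReal (norm_inner_le_norm _ _)

variable {μ μ' : Measure ℝ} [SFinite μ] [SFinite μ']

lemma aestronglyMeasurable_inner_kernel {a b : ℝ × X → E} (ha : AEStronglyMeasurable a (μ.prod ν))
    (hb : AEStronglyMeasurable b (μ'.prod ν)) :
    AEStronglyMeasurable (fun p : (ℝ × ℝ) × X => (inner ℝ (a (p.1.1, p.2)) (b (p.1.2, p.2)) : ℝ))
      ((μ.prod μ').prod ν) := by
  have q1 : Measure.QuasiMeasurePreserving (fun p : (ℝ × ℝ) × X => (p.1.1, p.2))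
      ((μ.prod μ').prod ν) (μ.prod ν) :=
    QuasiMeasurePreserving.prodMap Measure.quasiMeasurePreserving_fst (.id _)
  have q2 : Measure.QuasiMeasurePreserving (fun p : (ℝ × ℝ) × X => (p.1.2, p.2))
      ((μ.prod μ').prod ν) (μ'.prod ν) :=
    QuasiMeasurePreserving.prodMap Measure.quasiMeasurePreserving_snd (.id _)
  exact (ha.comp_quasiMeasurePreserving q1).inner (hb.comp_quasiMeasurePreserving q2)

lemma aestronglyMeasurable_kernel {a b : ℝ × X → E} (ha : AEStronglyMeasurable a (μ.prod ν))
    (hb : AEStronglyMeasurable b (μ'.prod ν)) :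
    AEStronglyMeasurable (fun p : ℝ × ℝ => ∫ x, (inner ℝ (a (p.1, x)) (b (p.2, x)) : ℝ) ∂ν)
      (μ.prod μ') :=
  (aestronglyMeasurable_inner_kernel ha hb).integral_prod_right'

lemma aemeasurable_eLpNorm_two {a : ℝ × X → E} (ha : AEStronglyMeasurable a (μ.prod ν)) :
    AEMeasurable (fun t => eLpNorm (fun x => a (t, x)) 2 ν) μ := by
  simp_rw [eLpNorm_two_eq]
  exact (AEMeasurable.lintegral_prod_right' (ha.enorm.pow_const 2)).pow_const _

lemma lintegral_eLpNorm_two_sq {a : ℝ × X → E} (ha : AEStronglyMeasurable a (μ.prod ν)) :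
    ∫⁻ t, eLpNorm (fun x => a (t, x)) 2 ν ^ 2 ∂μ = eLpNorm a 2 (μ.prod ν) ^ 2 := by
  have h : ∀ y : ℝ≥0∞, (y ^ (1 / 2 : ℝ)) ^ 2 = y := fun y => by
    rw [← ENNReal.rpow_natCast, ← ENNReal.rpow_mul]; simp
  simp_rw [eLpNorm_two_eq, h]
  rw [lintegral_prod _ (ha.enorm.pow_const 2)]

lemma integrable_kernel {a b : ℝ × X → E} (ha : AEStronglyMeasurable a (μ.prod ν))
    (hb : AEStronglyMeasurable b (μ'.prod ν))
    (ha1 : ∫⁻ t, eLpNorm (fun x => a (t, x)) 2 ν ∂μ < ∞)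
    (hb1 : ∫⁻ t, eLpNorm (fun x => b (t, x)) 2 ν ∂μ' < ∞) :
    Integrable (fun p : ℝ × ℝ => ∫ x, (inner ℝ (a (p.1, x)) (b (p.2, x)) : ℝ) ∂ν)
      (μ.prod μ') := by
  refine ⟨aestronglyMeasurable_kernel ha hb, ?_⟩
  have h1 : ∀ᵐ p ∂μ.prod μ', AEStronglyMeasurable (fun x => a (p.1, x)) ν :=
    Measure.quasiMeasurePreserving_fst.ae ha.prodMk_left
  have h2 : ∀ᵐ p ∂μ.prod μ', AEStronglyMeasurable (fun x => b (p.2, x)) ν :=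
    Measure.quasiMeasurePreserving_snd.ae hb.prodMk_left
  calc ∫⁻ p : ℝ × ℝ, ‖∫ x, (inner ℝ (a (p.1, x)) (b (p.2, x)) : ℝ) ∂ν‖ₑ ∂μ.prod μ'
      ≤ ∫⁻ p : ℝ × ℝ, eLpNorm (fun x => a (p.1, x)) 2 ν * eLpNorm (fun x => b (p.2, x)) 2 ν
          ∂μ.prod μ' := by
        refine lintegral_mono_ae ?_
        filter_upwards [h1, h2] with p hp1 hp2
        exact enorm_integral_inner_le hp1 hp2
    _ = _ := lintegral_prod_mul (aemeasurable_eLpNorm_two ha) (aemeasurable_eLpNorm_two hb)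
    _ < ∞ := ENNReal.mul_lt_top ha1 hb1

/-- A kernel that is continuous across the diagonal in the mean, tested with an approximate
identity. -/
lemma tendsto_integral_bump_kernel {K : ℝ → ℝ → ℝ}
    (hK : Integrable (fun p : ℝ × ℝ => K p.1 p.2) (volume.prod volume))
    (hc : Tendsto (fun h => ∫ t, K t (t - h)) (𝓝 0) (𝓝 (∫ t, K t t)))
    {ρ : ℕ → ContDiffBump (0 : ℝ)} (hρ : Tendsto (fun n => (ρ n).rOut) atTop (𝓝 0)) :
    Tendsto (fun n => ∫ t, ∫ r, (ρ n).normed volume (t - r) * K t r) atTop (𝓝 (∫ t, K t t)) := by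
  -- In the variables t and h = t - r the double integral is the mollification at 0 of h ↦ ∫ K(t,
  -- t-h) dt, whose continuity at 0 is the hypothesis.
  have hmp : MeasurePreserving (fun p : ℝ × ℝ => (p.1, p.1 - p.2)) (volume.prod volume)
      (volume.prod volume) := by
    have h1 := measurePreserving_prod_sub (volume : Measure ℝ) (volume : Measure ℝ)
    have h2 : MeasurePreserving (fun p : ℝ × ℝ => (p.1, -p.2)) (volume.prod volume)
      (volume.prod volume) := (MeasurePreserving.id _).prod (Measure.measurePreserving_neg volume)
    convert! h2.comp h1 using 2 with p
    simp
  have hK' : Integrable (fun p : ℝ × ℝ => K p.1 (p.1 - p.2)) (volume.prod volume) :=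
    hmp.integrable_comp_of_integrable hK
  have hcm : AEStronglyMeasurable (fun h => ∫ t, K t (t - h)) volume :=
    (hK'.swap.integral_prod_left).1
  have heq : ∀ n, ∫ t, ∫ r, (ρ n).normed volume (t - r) * K t r =
      ∫ h, (ρ n).normed volume h * ∫ t, K t (t - h) := by
    intro n
    obtain ⟨C, hC⟩ := (ρ n).continuous_normed (μ := volume) |>.bounded_above_of_compact_support
      (ρ n).hasCompactSupport_normed
    have e1 : ∀ t, ∫ r, (ρ n).normed volume (t - r) * K t r =
        ∫ h, (ρ n).normed volume h * K t (t - h) := fun t => by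
      rw [← integral_sub_left_eq_self _ volume t]
      simp
    simp_rw [e1]
    rw [integral_integral_swap]
    · simp_rw [integral_const_mul]
    · exact hK'.bdd_mul ((ρ n).continuous_normed.comp continuous_snd).aestronglyMeasurable
        (Eventually.of_forall fun p => hC _)
  simp_rw [heq]
  rw [Metric.tendsto_atTop]
  intro ε hε
  obtain ⟨δ, hδ, h⟩ := Metric.tendsto_nhds_nhds.1 hc (ε / 2) (by positivity)
  obtain ⟨N, hN⟩ := Metric.tendsto_atTop.1 hρ δ hδ
  refine ⟨N, fun n hn => ?_⟩
  have hr : (ρ n).rOut < δ := by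
    have := hN n hn
    rw [Real.dist_eq, sub_zero] at this
    exact (le_abs_self _).trans_lt this
  have h0 : ∫ t, K t (t - 0) = ∫ t, K t t := by simp
  have h1 := (ρ n).dist_normed_convolution_le (μ := volume) (x₀ := 0) (ε := ε / 2) hcm (by
    intro x hx
    rw [h0]
    exact (h ((Metric.mem_ball.1 hx).trans hr)).le)
  have h2 : (convolution ((ρ n).normed volume) (fun h => ∫ t, K t (t - h))
      (ContinuousLinearMap.lsmul ℝ ℝ) volume) 0 =
      ∫ h, (ρ n).normed volume h * ∫ t, K t (t - h) := by
    rw [convolution_def, ← integral_neg_eq_self]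
    refine integral_congr_ae (Eventually.of_forall fun x => ?_)
    simp [(ρ n).normed_neg]
  rw [h2] at h1
  simp only [sub_zero] at h1
  exact lt_of_le_of_lt h1 (half_lt_self hε)

end Kernel

/-! ### Continuity of the pairing of two space-time functions under time shifts -/

section Translation

set_option linter.unusedSectionVars false

open Filter Topology

variable {X E : Type*} [TopologicalSpace X] [MeasurableSpace X] [BorelSpace X] [R1Space X]
  [SecondCountableTopology X] [NormedAddCommGroup E] [InnerProductSpace ℝ E]
  {ν : Measure X} [SFinite ν] [((volume : Measure ℝ).prod ν).InnerRegularCompactLTTop]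
  [IsLocallyFiniteMeasure ((volume : Measure ℝ).prod ν)]

lemma measurePreserving_time_shift (h : ℝ) : MeasurePreserving
    (fun z : ℝ × X => (z.1 - h, z.2)) ((volume : Measure ℝ).prod ν) (volume.prod ν) :=
  (measurePreserving_sub_right volume h).prod (MeasurePreserving.id ν)

/-- Time translations act strongly continuously on L² of space-time. -/
lemma tendsto_integral_inner_time_shift {a b : ℝ × X → E}
    (ha : MemLp a 2 ((volume : Measure ℝ).prod ν)) (hb : MemLp b 2 ((volume : Measure ℝ).prod ν)) :
    Tendsto (fun h => ∫ z, (inner ℝ (a z) (b (z.1 - h, z.2)) : ℝ) ∂(volume.prod ν)) (𝓝 0)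
      (𝓝 (∫ z, (inner ℝ (a z) (b z) : ℝ) ∂(volume.prod ν))) := by
  let S : C(ℝ, C(ℝ × X, ℝ × X)) :=
    ContinuousMap.curry ⟨fun p : ℝ × (ℝ × X) => (p.2.1 - p.1, p.2.2), by fun_prop⟩
  have hS : ∀ h, MeasurePreserving (S h) ((volume : Measure ℝ).prod ν) (volume.prod ν) :=
    measurePreserving_time_shift
  have h1 := Filter.Tendsto.compMeasurePreservingLp (E := E) (p := 2)
    (tendsto_const_nhds (x := hb.toLp) (f := 𝓝 (0 : ℝ))) (S.continuous.tendsto 0) hS (hS 0)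
    (by norm_num)
  have h2 : Tendsto (fun h => (inner ℝ (ha.toLp) (Lp.compMeasurePreserving (S h) (hS h) hb.toLp) : ℝ))
      (𝓝 0) (𝓝 (inner ℝ (ha.toLp) (Lp.compMeasurePreserving (S 0) (hS 0) hb.toLp))) :=
    tendsto_const_nhds.inner h1
  have h3 : ∀ h, (inner ℝ (ha.toLp) (Lp.compMeasurePreserving (S h) (hS h) hb.toLp) : ℝ) =
      ∫ z, (inner ℝ (a z) (b (z.1 - h, z.2)) : ℝ) ∂(volume.prod ν) := by
    intro h
    rw [L2.inner_def]
    refine integral_congr_ae ?_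
    filter_upwards [ha.coeFn_toLp, Lp.coeFn_compMeasurePreserving hb.toLp (hS h),
      (hS h).quasiMeasurePreserving.ae hb.coeFn_toLp] with z hz1 hz2 hz3
    rw [hz1, hz2, Function.comp_apply, hz3]
    rfl
  simp_rw [h3] at h2
  simpa using h2

lemma tendsto_integral_integral_inner_time_shift {a b : ℝ × X → E}
    (ha : MemLp a 2 ((volume : Measure ℝ).prod ν)) (hb : MemLp b 2 ((volume : Measure ℝ).prod ν)) :
    Tendsto (fun h => ∫ t, ∫ x, (inner ℝ (a (t, x)) (b (t - h, x)) : ℝ) ∂ν) (𝓝 0)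
      (𝓝 (∫ t, ∫ x, (inner ℝ (a (t, x)) (b (t, x)) : ℝ) ∂ν)) := by
  have h1 := tendsto_integral_inner_time_shift ha hb
  rw [integral_prod _ (integrable_inner_of_memLp_two ha hb)] at h1
  refine h1.congr fun h => ?_
  rw [integral_prod]
  exact integrable_inner_of_memLp_two ha (hb.comp_measurePreserving (measurePreserving_time_shift h))

/-- This version pairs L¹ in time with L^∞ in time, as the convection term requires. Where ‖a(t)‖ ≤
k the function a is square integrable and the previous lemma applies; the remaining times contribute
at most M times the integral of ‖a(t)‖ over {‖a(t)‖ > k}, which is small uniformly in the shift h.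
-/
lemma tendsto_integral_integral_inner_time_shift_of_bound {a b : ℝ × X → E}
    (ha : AEStronglyMeasurable a ((volume : Measure ℝ).prod ν))
    (ha1 : ∫⁻ t, eLpNorm (fun x => a (t, x)) 2 ν < ∞)
    (hb : MemLp b 2 ((volume : Measure ℝ).prod ν)) {M : ℝ≥0}
    (hbM : ∀ᵐ t, eLpNorm (fun x => b (t, x)) 2 ν ≤ M) :
    Tendsto (fun h => ∫ t, ∫ x, (inner ℝ (a (t, x)) (b (t - h, x)) : ℝ) ∂ν) (𝓝 0)
      (𝓝 (∫ t, ∫ x, (inner ℝ (a (t, x)) (b (t, x)) : ℝ) ∂ν)) := by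
  set α : ℝ → ℝ≥0∞ := fun t => eLpNorm (fun x => a (t, x)) 2 ν with hα
  have hαm : AEMeasurable α volume := aemeasurable_eLpNorm_two ha
  set J : ℝ → ℝ → ℝ := fun h t => ∫ x, (inner ℝ (a (t, x)) (b (t - h, x)) : ℝ) ∂ν with hJ
  have hJ0 : ∫ t, ∫ x, (inner ℝ (a (t, x)) (b (t, x)) : ℝ) ∂ν = ∫ t, J 0 t := by simp [hJ]
  have hbh : ∀ h, AEStronglyMeasurable (fun z : ℝ × X => b (z.1 - h, z.2)) (volume.prod ν) :=
    fun h => hb.1.comp_measurePreserving (measurePreserving_time_shift h)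
  have hJb : ∀ h, ∀ᵐ t, ‖J h t‖ₑ ≤ α t * M := by
    intro h
    filter_upwards [ha.prodMk_left, (hbh h).prodMk_left,
      (measurePreserving_sub_right volume h).quasiMeasurePreserving.ae hbM] with t h1 h2 h3
    refine (enorm_integral_inner_le h1 h2).trans ?_
    gcongr
  have hJi : ∀ h, Integrable (J h) := by
    intro h
    have hm : AEStronglyMeasurable (fun z : ℝ × X => (inner ℝ (a z) (b (z.1 - h, z.2)) : ℝ))
      (volume.prod ν) := ha.inner (hbh h)
    refine ⟨hm.integral_prod_right', ?_⟩
    refine (lintegral_mono_ae (hJb h)).trans_lt ?_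
    rw [lintegral_mul_const' _ _ (by simp)]
    exact ENNReal.mul_lt_top ha1 (by simp)
  set S : ℕ → Set ℝ := fun k => {t | α t ≤ k} with hS
  have hSm : ∀ k, NullMeasurableSet (S k) volume := fun k =>
    nullMeasurableSet_le hαm aemeasurable_const
  have hδ : Tendsto (fun k => ∫⁻ t in (S k)ᶜ, α t * M) atTop (𝓝 0) := by
    have h1 : ∀ k, ∫⁻ t in (S k)ᶜ, α t * M = ∫⁻ t, (S k)ᶜ.indicator (fun t => α t * M) t :=
      fun k => (lintegral_indicator₀ (hSm k).compl _).symm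
    simp_rw [h1]
    have h2 := tendsto_lintegral_of_dominated_convergence' (μ := volume)
      (F := fun k => (S k)ᶜ.indicator (fun t => α t * M)) (f := fun _ => 0)
      (fun t => α t * M) (fun k => (hαm.mul_const _).indicator₀ (hSm k).compl)
      (fun k => Eventually.of_forall fun t => indicator_le_self _ _ t)
      (by rw [lintegral_mul_const' _ _ (by simp)]
          exact (ENNReal.mul_lt_top ha1 (by simp)).ne) (by
        filter_upwards [ae_lt_top' hαm ha1.ne] with t ht
        obtain ⟨N, hN⟩ := ENNReal.exists_nat_gt ht.ne
        refine tendsto_const_nhds.congr' ?_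
        filter_upwards [eventually_ge_atTop N] with k hk
        rw [indicator_of_notMem]
        simp only [mem_compl_iff, not_not, hS, mem_ofPred_eq]
        exact hN.le.trans (by exact_mod_cast hk))
    simpa using h2
  have hdist : ∀ k h, ‖(∫ t, J h t) - ∫ t in S k, J h t‖ₑ ≤ ∫⁻ t in (S k)ᶜ, α t * M := by
    intro k h
    rw [← integral_add_compl₀ (hSm k) (hJi h), add_sub_cancel_left]
    exact (enorm_integral_le_lintegral_enorm _).trans
      (lintegral_mono_ae (ae_restrict_of_ae (hJb h)))
  have htr : ∀ k, Tendsto (fun h => ∫ t in S k, J h t) (𝓝 0) (𝓝 (∫ t in S k, J 0 t)) := by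
    intro k
    have hSp : NullMeasurableSet (Prod.fst ⁻¹' S k : Set (ℝ × X)) (volume.prod ν) :=
      (hSm k).preimage Measure.quasiMeasurePreserving_fst
    have ham : AEStronglyMeasurable ((Prod.fst ⁻¹' S k).indicator a) (volume.prod ν) :=
      ha.indicator₀ hSp
    have hak : MemLp ((Prod.fst ⁻¹' S k).indicator a) 2 (volume.prod ν) := by
      refine ⟨ham, ?_⟩
      have h1 : ∫⁻ t, eLpNorm (fun x => (Prod.fst ⁻¹' S k).indicator a (t, x)) 2 ν ^ 2 ≤
          ∫⁻ t, k * α t := by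
        refine lintegral_mono fun t => ?_
        by_cases ht : t ∈ S k
        · have e : (fun x => (Prod.fst ⁻¹' S k).indicator a (t, x)) = fun x => a (t, x) := by
            ext x; simp [indicator, ht]
          rw [e, sq]
          exact mul_le_mul_left ht _
        · have e : (fun x => (Prod.fst ⁻¹' S k).indicator a (t, x)) = fun x => 0 := by
            ext x; simp [indicator, ht]
          rw [e]; simp
      rw [lintegral_eLpNorm_two_sq ham, lintegral_const_mul' _ _ (by simp)] at h1
      have h2 := h1.trans_lt (ENNReal.mul_lt_top (by simp) ha1)
      simpa using h2
    have h2 := tendsto_integral_integral_inner_time_shift hak hb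
    have h3 : ∀ h, ∫ t, ∫ x, (inner ℝ ((Prod.fst ⁻¹' S k).indicator a (t, x)) (b (t - h, x)) : ℝ) ∂ν =
        ∫ t in S k, J h t := by
      intro h
      rw [← integral_indicator₀ (hSm k)]
      refine integral_congr_ae (Eventually.of_forall fun t => ?_)
      by_cases ht : t ∈ S k <;> simp [indicator, ht, hJ]
    simp_rw [h3] at h2
    have h4 := h3 0
    simp only [sub_zero] at h4
    rwa [h4] at h2
  rw [hJ0, Metric.tendsto_nhds]
  intro ε hε
  obtain ⟨k, hk⟩ := (hδ.eventually_lt_const (ENNReal.ofReal_pos.2 (by positivity : 0 < ε / 3))).exists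
  have hd : ∀ h, dist (∫ t, J h t) (∫ t in S k, J h t) < ε / 3 := by
    intro h
    have h1 := (hdist k h).trans_lt hk
    rw [← ofReal_norm, ENNReal.ofReal_lt_ofReal_iff (by positivity)] at h1
    rwa [dist_eq_norm]
  filter_upwards [Metric.tendsto_nhds.1 (htr k) (ε / 3) (by positivity)] with h hh
  have h1 := dist_triangle4 (∫ t, J h t) (∫ t in S k, J h t) (∫ t in S k, J 0 t) (∫ t, J 0 t)
  have h2 := hd 0
  rw [dist_comm] at h2
  linarith [hd h]

end Translation

end

noncomputable section

/-! ### The energy identity -/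

section Energy

open Filter Topology

variable {d : ℕ} {E : Type*} [NormedAddCommGroup E] [InnerProductSpace ℝ E]

lemma lintegral_eLpNorm_two_lt_top {X : Type*} [MeasurableSpace X] {ν : Measure X} [SFinite ν]
    {μ : Measure ℝ} [IsFiniteMeasure μ] {a : ℝ × X → E} (ha : MemLp a 2 (μ.prod ν)) :
    ∫⁻ t, eLpNorm (fun x => a (t, x)) 2 ν ∂μ < ∞ := by
  calc ∫⁻ t, eLpNorm (fun x => a (t, x)) 2 ν ∂μ
      ≤ ∫⁻ t, (1 + eLpNorm (fun x => a (t, x)) 2 ν ^ 2) ∂μ := by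
        refine lintegral_mono fun t => ?_
        rcases le_total (eLpNorm (fun x => a (t, x)) 2 ν) 1 with h | h
        · exact h.trans le_self_add
        · exact (le_self_pow₀ h (by norm_num)).trans le_add_self
    _ = μ univ + eLpNorm a 2 (μ.prod ν) ^ 2 := by
        rw [lintegral_add_left measurable_const, lintegral_eLpNorm_two_sq ha.1]; simp
    _ < ∞ := by
        have := ha.2
        simp [ENNReal.add_lt_top, this]

lemma memLp_two_of_eLpNorm_le {X : Type*} [MeasurableSpace X] {ν : Measure X} [SFinite ν]
    {μ : Measure ℝ} [IsFiniteMeasure μ] {a : ℝ × X → E} (ha : AEStronglyMeasurable a (μ.prod ν))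
    {M : ℝ≥0} (hM : ∀ᵐ t ∂μ, eLpNorm (fun x => a (t, x)) 2 ν ≤ M) : MemLp a 2 (μ.prod ν) := by
  refine ⟨ha, ?_⟩
  have h1 : ∫⁻ t, eLpNorm (fun x => a (t, x)) 2 ν ^ 2 ∂μ ≤ ∫⁻ t, (M : ℝ≥0∞) ^ 2 ∂μ := by
    refine lintegral_mono_ae ?_
    filter_upwards [hM] with t ht
    gcongr
  rw [lintegral_eLpNorm_two_sq ha, lintegral_const] at h1
  have h2 := h1.trans_lt (ENNReal.mul_lt_top (by simp) (measure_lt_top μ univ))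
  simpa using h2

variable {Ω : Opens (Vec d)} {T : ℝ}

/-- The kernel `∫ ⟨a(t,x), b(r,x)⟩ dx` tested with an approximate identity on the diagonal. -/
lemma tendsto_setIntegral_bump_kernel {a b : ℝ × Vec d → E}
    (ha : AEStronglyMeasurable a ((volume.restrict (Ioo 0 T)).prod
      (volume.restrict (Ω : Set (Vec d)))))
    (ha1 : ∫⁻ t in Ioo 0 T, eLpNorm (fun x => a (t, x)) 2
      (volume.restrict (Ω : Set (Vec d))) < ∞)
    (hb : MemLp b 2 ((volume.restrict (Ioo 0 T)).prod (volume.restrict (Ω : Set (Vec d)))))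
    (hab : MemLp a 2 ((volume.restrict (Ioo 0 T)).prod (volume.restrict (Ω : Set (Vec d)))) ∨
      ∃ M : ℝ≥0, ∀ᵐ t ∂volume.restrict (Ioo 0 T), eLpNorm (fun x => b (t, x)) 2
        (volume.restrict (Ω : Set (Vec d))) ≤ M)
    {θ₁ θ₂ : ℝ → ℝ} (hθ₁ : Continuous θ₁) (hθ₂ : Continuous θ₂) {C : ℝ≥0}
    (hC₁ : ∀ t, ‖θ₁ t‖ ≤ C) (hC₂ : ∀ t, ‖θ₂ t‖ ≤ C)
    {ρ : ℕ → ContDiffBump (0 : ℝ)} (hρ : Tendsto (fun n => (ρ n).rOut) atTop (𝓝 0)) :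
    Tendsto (fun n => ∫ t in Ioo 0 T, ∫ r in Ioo 0 T, (ρ n).normed volume (t - r) *
      (θ₁ t * θ₂ r * ∫ x in Ω, (inner ℝ (a (t, x)) (b (r, x)) : ℝ))) atTop
      (𝓝 (∫ t in Ioo 0 T, θ₁ t * θ₂ t * ∫ x in Ω, (inner ℝ (a (t, x)) (b (t, x)) : ℝ))) := by
  set ν := volume.restrict (Ω : Set (Vec d)) with hν
  set I := Ioo 0 T with hI
  have hIm : MeasurableSet I := measurableSet_Ioo
  have hIp : MeasurableSet (I ×ˢ (univ : Set (Vec d))) := hIm.prod .univ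
  have hres : (volume.restrict I).prod ν = ((volume : Measure ℝ).prod ν).restrict (I ×ˢ univ) := by
    rw [← Measure.prod_restrict, Measure.restrict_univ]
  have ext_meas : ∀ {f : ℝ × Vec d → E} {θ : ℝ → ℝ}, Continuous θ →
      AEStronglyMeasurable f ((volume.restrict I).prod ν) →
      AEStronglyMeasurable ((I ×ˢ univ).indicator fun z => θ z.1 • f z) (volume.prod ν) := by
    intro f θ hθ hf
    rw [aestronglyMeasurable_indicator_iff hIp, ← hres]
    exact (hθ.comp continuous_fst).aestronglyMeasurable.smul hf
  have ext_le : ∀ {f : ℝ × Vec d → E} {θ : ℝ → ℝ}, (∀ t, ‖θ t‖ ≤ C) → ∀ t,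
      eLpNorm (fun x => (I ×ˢ univ).indicator (fun z => θ z.1 • f z) (t, x)) 2 ν ≤
        I.indicator (fun t => C * eLpNorm (fun x => f (t, x)) 2 ν) t := by
    intro f θ hθ t
    by_cases ht : t ∈ I
    · have e : (fun x => (I ×ˢ univ).indicator (fun z : ℝ × Vec d => θ z.1 • f z) (t, x)) =
          θ t • fun x => f (t, x) := by
        ext x; simp [indicator, ht]
      rw [e, indicator_of_mem ht, eLpNorm_const_smul]
      gcongr
      rw [← ofReal_norm]
      exact (ENNReal.ofReal_le_ofReal (hθ t)).trans_eq (by simp)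
    · have e : (fun x => (I ×ˢ univ).indicator (fun z : ℝ × Vec d => θ z.1 • f z) (t, x)) =
          fun x => 0 := by
        ext x; simp [indicator, ht]
      rw [e]; simp
  have ext_L1 : ∀ {f : ℝ × Vec d → E} {θ : ℝ → ℝ}, (∀ t, ‖θ t‖ ≤ C) →
      ∫⁻ t in I, eLpNorm (fun x => f (t, x)) 2 ν < ∞ →
      ∫⁻ t, eLpNorm (fun x => (I ×ˢ univ).indicator (fun z => θ z.1 • f z) (t, x)) 2 ν < ∞ := by
    intro f θ hθ hf
    refine (lintegral_mono (ext_le hθ)).trans_lt ?_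
    rw [lintegral_indicator hIm, lintegral_const_mul' _ _ (by simp)]
    exact ENNReal.mul_lt_top (by simp) hf
  have ext_L2 : ∀ {f : ℝ × Vec d → E} {θ : ℝ → ℝ}, Continuous θ → (∀ t, ‖θ t‖ ≤ C) →
      MemLp f 2 ((volume.restrict I).prod ν) →
      MemLp ((I ×ˢ univ).indicator fun z => θ z.1 • f z) 2 (volume.prod ν) := by
    intro f θ hθ hθC hf
    rw [memLp_indicator_iff_restrict hIp, ← hres]
    refine hf.of_le_mul (c := C) ((hθ.comp continuous_fst).aestronglyMeasurable.smul hf.1)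
      (Eventually.of_forall fun z => ?_)
    simp only [norm_smul]
    gcongr
    exact hθC _
  -- The functions, with the weights θ₁ and θ₂ included, are extended by zero to all times, so that
  -- shifts act on the whole line.
  set A : ℝ × Vec d → E := (I ×ˢ univ).indicator fun z => θ₁ z.1 • a z with hA
  set B : ℝ × Vec d → E := (I ×ˢ univ).indicator fun z => θ₂ z.1 • b z with hB
  set K : ℝ → ℝ → ℝ := fun t r => ∫ x, (inner ℝ (A (t, x)) (B (r, x)) : ℝ) ∂ν with hK
  have hKin : ∀ t ∈ I, ∀ r ∈ I, K t r = θ₁ t * θ₂ r * ∫ x in Ω, (inner ℝ (a (t, x)) (b (r, x)) : ℝ) := by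
    intro t ht r hr
    simp only [hK, hA, hB, indicator, mem_prod, ht, hr, mem_univ, and_self, if_true]
    rw [← integral_const_mul]
    refine integral_congr_ae (Eventually.of_forall fun x => ?_)
    simp only [inner_smul_left, inner_smul_right, conj_trivial]; ring
  have hKl : ∀ t ∉ I, ∀ r, K t r = 0 := by
    intro t ht r
    simp [hK, hA, indicator, ht]
  have hKr : ∀ r ∉ I, ∀ t, K t r = 0 := by
    intro r hr t
    simp [hK, hB, indicator, hr]
  have hKi : Integrable (fun p : ℝ × ℝ => K p.1 p.2) (volume.prod volume) :=
    integrable_kernel (ext_meas hθ₁ ha) (ext_meas hθ₂ hb.1) (ext_L1 hC₁ ha1)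
      (ext_L1 hC₂ (lintegral_eLpNorm_two_lt_top hb))
  have hc : Tendsto (fun h => ∫ t, K t (t - h)) (𝓝 0) (𝓝 (∫ t, K t t)) := by
    rcases hab with ha2 | ⟨M, hM⟩
    · exact tendsto_integral_integral_inner_time_shift (ext_L2 hθ₁ hC₁ ha2) (ext_L2 hθ₂ hC₂ hb)
    · refine tendsto_integral_integral_inner_time_shift_of_bound (M := C * M) (ext_meas hθ₁ ha)
        (ext_L1 hC₁ ha1) (ext_L2 hθ₂ hC₂ hb) ?_
      rw [ae_restrict_iff' hIm] at hM
      filter_upwards [hM] with t ht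
      refine (ext_le hC₂ t).trans ?_
      by_cases htI : t ∈ I
      · rw [indicator_of_mem htI]
        push_cast
        gcongr
        exact ht htI
      · rw [indicator_of_notMem htI]; exact zero_le
  have hlim := tendsto_integral_bump_kernel hKi hc hρ
  have e1 : ∫ t, K t t = ∫ t in I, θ₁ t * θ₂ t * ∫ x in Ω, (inner ℝ (a (t, x)) (b (t, x)) : ℝ) := by
    rw [← setIntegral_eq_integral_of_forall_compl_eq_zero (s := I) fun t ht => hKl t ht t]
    exact setIntegral_congr_fun hIm fun t ht => hKin t ht t ht
  rw [← e1]
  refine hlim.congr fun n => ?_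
  rw [← setIntegral_eq_integral_of_forall_compl_eq_zero (s := I) fun t ht => by simp [hKl t ht]]
  refine setIntegral_congr_fun hIm fun t ht => ?_
  rw [← setIntegral_eq_integral_of_forall_compl_eq_zero (s := I) fun r hr => by simp [hKr r hr]]
  refine setIntegral_congr_fun hIm fun r hr => ?_
  rw [hKin t ht r hr]

/-- A family of weak equations `κ ∂ₜ K(·, r) + L(·, r) = 0` with a symmetric kernel `K`, on the
diagonal. -/
lemma weak_deriv_diag {κ : ℝ} {K L : ℝ → ℝ → ℝ} (hKs : ∀ t r, K t r = K r t)
    (hKi : Integrable (fun p : ℝ × ℝ => K p.1 p.2)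
      ((volume.restrict (Ioo 0 T)).prod (volume.restrict (Ioo 0 T))))
    (hLi : Integrable (fun p : ℝ × ℝ => L p.1 p.2)
      ((volume.restrict (Ioo 0 T)).prod (volume.restrict (Ioo 0 T))))
    (hw : ∀ᵐ r ∂volume.restrict (Ioo 0 T), ∀ ϑ : 𝓓(timeBefore T, ℝ),
      ∫ t in Ioo 0 T, (-(κ * deriv ϑ t * K t r) + ϑ t * L t r) = 0)
    {ρ : ℕ → ContDiffBump (0 : ℝ)} (hρ : Tendsto (fun n => (ρ n).rOut) atTop (𝓝 0))
    (hlim : ∀ N : ℝ → ℝ → ℝ, N = K ∨ N = L → ∀ {θ₁ θ₂ : ℝ → ℝ}, Continuous θ₁ → Continuous θ₂ →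
      ∀ C : ℝ≥0, (∀ t, ‖θ₁ t‖ ≤ C) → (∀ t, ‖θ₂ t‖ ≤ C) →
      Tendsto (fun n => ∫ t in Ioo 0 T, ∫ r in Ioo 0 T, (ρ n).normed volume (t - r) *
        (θ₁ t * θ₂ r * N t r)) atTop (𝓝 (∫ t in Ioo 0 T, θ₁ t * θ₂ t * N t t)))
    (θ : 𝓓(timeBefore T, ℝ)) :
    -(κ * ∫ t in Ioo 0 T, deriv θ t * K t t) + 2 * ∫ t in Ioo 0 T, θ t * L t t = 0 := by
  have hθc : Continuous θ := θ.continuous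
  have hθ'c : Continuous (deriv θ) := θ.contDiff.continuous_deriv (by simp)
  obtain ⟨C₁, hC₁⟩ := hθc.bounded_above_of_compact_support θ.hasCompactSupport
  obtain ⟨C₂, hC₂⟩ := hθ'c.bounded_above_of_compact_support θ.hasCompactSupport.deriv
  -- This leaves room before T: when the bump has radius less than δ, the function t ↦ (θ(t) + θ(r))
  -- χ(t - r) is still a test function on (-∞, T), for every r.
  obtain ⟨δ, hδ, hδT⟩ := θ.hasCompactSupport.isCompact.exists_cthickening_subset_open
    (isOpen_Iio (a := T)) θ.tsupport_subset
  let C : ℝ≥0 := ⟨max 1 (max C₁ C₂), by positivity⟩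
  have hC1 : ∀ t : ℝ, ‖(1 : ℝ)‖ ≤ C := fun _ => by
    change _ ≤ max 1 (max C₁ C₂); simp
  have hCθ : ∀ t, ‖θ t‖ ≤ C := fun t =>
    (hC₁ t).trans ((le_max_left C₁ C₂).trans (le_max_right 1 _))
  have hCθ' : ∀ t, ‖deriv θ t‖ ≤ C := fun t =>
    (hC₂ t).trans ((le_max_right C₁ C₂).trans (le_max_right 1 _))
  have t1 := hlim K (Or.inl rfl) hθ'c (continuous_const (y := (1 : ℝ))) C hCθ' hC1
  have t2 := hlim L (Or.inr rfl) hθc (continuous_const (y := (1 : ℝ))) C hCθ hC1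
  have t3 := hlim L (Or.inr rfl) (continuous_const (y := (1 : ℝ))) hθc C hC1 hCθ
  -- The weights θ(t) and θ(r) have the same limit on the diagonal; their sum accounts for the
  -- factor 2 in front of L.
  have t4 := ((t1.const_mul κ).neg.add (t2.add t3))
  have e : -(κ * ∫ t in Ioo 0 T, deriv θ t * 1 * K t t) + ((∫ t in Ioo 0 T, θ t * 1 * L t t) +
      ∫ t in Ioo 0 T, 1 * θ t * L t t) =
      -(κ * ∫ t in Ioo 0 T, deriv θ t * K t t) + 2 * ∫ t in Ioo 0 T, θ t * L t t := by
    simp only [mul_one, one_mul]; ring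
  rw [e] at t4
  refine tendsto_nhds_unique (t4.congr' ?_) tendsto_const_nhds
  have hev : ∀ᶠ n in atTop, (ρ n).rOut < δ := hρ.eventually_lt_const hδ
  filter_upwards [hev] with n hn
  set χ := (ρ n).normed volume with hχ
  have hχc : Continuous χ := (ρ n).continuous_normed
  have hχs : ContDiff ℝ ((⊤ : ℕ∞) : WithTop ℕ∞) χ := (ρ n).contDiff_normed
  have hχ'c : Continuous (deriv χ) := hχs.continuous_deriv (by simp)
  obtain ⟨D₁, hD₁⟩ := hχc.bounded_above_of_compact_support (ρ n).hasCompactSupport_normed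
  obtain ⟨D₂, hD₂⟩ := hχ'c.bounded_above_of_compact_support (ρ n).hasCompactSupport_normed.deriv
  have hχ'odd : ∀ s, deriv χ (-s) = -deriv χ s := by
    intro s
    have h1 : (fun s => χ (-s)) = χ := funext fun s => (ρ n).normed_neg s
    have h2 := deriv_comp_neg χ s
    rw [h1] at h2
    linarith
  -- the test functions
  have htest : ∀ r, ∃ ϑ : 𝓓(timeBefore T, ℝ), (∀ t, ϑ t = (θ t + θ r) * χ (t - r)) ∧
      ∀ t, deriv ϑ t = deriv θ t * χ (t - r) + (θ t + θ r) * deriv χ (t - r) := by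
    intro r
    have hs : Function.support (fun t => (θ t + θ r) * χ (t - r)) ⊆
        Metric.cthickening δ (tsupport θ) := by
      intro t ht
      rw [Function.mem_support] at ht
      have h1 : χ (t - r) ≠ 0 := right_ne_zero_of_mul ht
      have h2 : θ t + θ r ≠ 0 := left_ne_zero_of_mul ht
      by_cases h3 : θ t = 0
      · have h4 : r ∈ tsupport θ := subset_tsupport _ (by simpa [h3] using h2)
        have h5 : t - r ∈ Function.support χ := h1
        rw [hχ, (ρ n).support_normed_eq, mem_ball_zero_iff] at h5
        refine Metric.mem_cthickening_of_dist_le t r δ _ h4 ?_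
        rw [dist_eq_norm]; linarith
      · exact Metric.self_subset_cthickening _ (subset_tsupport _ h3)
    have hts : tsupport (fun t => (θ t + θ r) * χ (t - r)) ⊆ Metric.cthickening δ (tsupport θ) :=
      closure_minimal hs Metric.isClosed_cthickening
    refine ⟨⟨fun t => (θ t + θ r) * χ (t - r), (θ.contDiff.add contDiff_const).mul
      (hχs.comp (contDiff_id.sub contDiff_const)), ?_, hts.trans hδT⟩, fun _ => rfl, fun t => ?_⟩
    · exact HasCompactSupport.of_support_subset_isCompact
        θ.hasCompactSupport.isCompact.cthickening hs
    · have h1 : HasDerivAt θ (deriv θ t) t :=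
        (θ.contDiff.differentiable (by simp)).differentiableAt.hasDerivAt
      have h2 : HasDerivAt (fun t => χ (t - r)) (deriv χ (t - r)) t :=
        ((hχs.differentiable (by simp)).differentiableAt.hasDerivAt).comp_sub_const t r
      exact ((h1.add_const (θ r)).mul h2).deriv
  have hm : ∀ {N : ℝ → ℝ → ℝ} {w : ℝ × ℝ → ℝ} {D : ℝ}, Integrable (fun p : ℝ × ℝ => N p.1 p.2)
      ((volume.restrict (Ioo 0 T)).prod (volume.restrict (Ioo 0 T))) → Continuous w →
      (∀ p, ‖w p‖ ≤ D) → Integrable (fun p : ℝ × ℝ => w p * N p.1 p.2)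
      ((volume.restrict (Ioo 0 T)).prod (volume.restrict (Ioo 0 T))) := fun hN hw hD =>
    hN.bdd_mul hw.aestronglyMeasurable (Eventually.of_forall hD)
  have b2 : ∀ {x y : ℝ} {X Y : ℝ}, ‖x‖ ≤ X → ‖y‖ ≤ Y → ‖x * y‖ ≤ X * Y := fun {x y X Y} hx hy => by
    rw [norm_mul]; exact mul_le_mul hx hy (norm_nonneg _) ((norm_nonneg _).trans hx)
  have i1 := hm (w := fun p => χ (p.1 - p.2) * (deriv θ p.1 * 1)) (D := D₁ * (C * C)) hKi
    (by fun_prop) fun p => b2 (hD₁ _) (b2 (hCθ' _) (hC1 0))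
  have i2 := hm (w := fun p => χ (p.1 - p.2) * (θ p.1 * 1)) (D := D₁ * (C * C)) hLi
    (by fun_prop) fun p => b2 (hD₁ _) (b2 (hCθ _) (hC1 0))
  have i3 := hm (w := fun p => χ (p.1 - p.2) * (1 * θ p.2)) (D := D₁ * (C * C)) hLi
    (by fun_prop) fun p => b2 (hD₁ _) (b2 (hC1 0) (hCθ _))
  have i4 := hm (w := fun p => (θ p.1 + θ p.2) * deriv χ (p.1 - p.2)) (D := (C + C) * D₂) hKi
    (by fun_prop) fun p => b2 ((norm_add_le _ _).trans (add_le_add (hCθ _) (hCθ _))) (hD₂ _)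
  -- The singular term with χ' cancels exactly before the limit: its weight is antisymmetric in (t,
  -- r), because χ is even, and K is symmetric. The symmetric choice θ(t) + θ(r) is made for this
  -- reason.
  have hanti : ∫ p, (θ p.1 + θ p.2) * deriv χ (p.1 - p.2) * K p.1 p.2
      ∂((volume.restrict (Ioo 0 T)).prod (volume.restrict (Ioo 0 T))) = 0 := by
    have h1 := integral_prod_swap (μ := volume.restrict (Ioo 0 T)) (ν := volume.restrict (Ioo 0 T))
      (fun p : ℝ × ℝ => (θ p.1 + θ p.2) * deriv χ (p.1 - p.2) * K p.1 p.2)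
    have h2 : ∀ p : ℝ × ℝ, (θ p.swap.1 + θ p.swap.2) * deriv χ (p.swap.1 - p.swap.2) *
        K p.swap.1 p.swap.2 = -((θ p.1 + θ p.2) * deriv χ (p.1 - p.2) * K p.1 p.2) := by
      intro p
      rw [Prod.fst_swap, Prod.snd_swap, hKs, ← neg_sub, hχ'odd]; ring
    simp_rw [h2] at h1
    rw [integral_neg] at h1
    linarith
  have i14 : Integrable (fun p : ℝ × ℝ => -(κ * ((χ (p.1 - p.2) * (deriv θ p.1 * 1)) * K p.1 p.2 +
      (θ p.1 + θ p.2) * deriv χ (p.1 - p.2) * K p.1 p.2)))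
      ((volume.restrict (Ioo 0 T)).prod (volume.restrict (Ioo 0 T))) :=
    ((i1.add i4).const_mul κ).neg
  have i23 : Integrable (fun p : ℝ × ℝ => (χ (p.1 - p.2) * (θ p.1 * 1)) * L p.1 p.2 +
      (χ (p.1 - p.2) * (1 * θ p.2)) * L p.1 p.2)
      ((volume.restrict (Ioo 0 T)).prod (volume.restrict (Ioo 0 T))) := i2.add i3
  have hzero : ∫ p, (-(κ * ((χ (p.1 - p.2) * (deriv θ p.1 * 1)) * K p.1 p.2 +
      (θ p.1 + θ p.2) * deriv χ (p.1 - p.2) * K p.1 p.2)) +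
      ((χ (p.1 - p.2) * (θ p.1 * 1)) * L p.1 p.2 + (χ (p.1 - p.2) * (1 * θ p.2)) * L p.1 p.2))
      ∂((volume.restrict (Ioo 0 T)).prod (volume.restrict (Ioo 0 T))) = 0 := by
    have hsymm := integral_prod_symm _ (i14.add i23)
    simp only [Pi.add_apply] at hsymm
    rw [hsymm]
    refine integral_eq_zero_of_ae ?_
    filter_upwards [hw] with r hr
    obtain ⟨ϑ, h1, h2⟩ := htest r
    refine Eq.trans ?_ (hr ϑ)
    refine integral_congr_ae (Eventually.of_forall fun t => ?_)
    simp only [h1, h2]; ring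
  rw [integral_add i14 i23, integral_neg, integral_const_mul,
    integral_add i1 i4, hanti, integral_add i2 i3, add_zero, integral_prod _ i1, integral_prod _ i2,
    integral_prod _ i3] at hzero
  refine Eq.trans ?_ hzero
  simp only [mul_assoc]

set_option maxHeartbeats 1000000 in
/-- The energy identity: the equation `d/dt κ (u, v) + (n, v) + (B, ∇v) = 0` for all `v ∈ V(Ω)`, with
`u(t) ∈ V(Ω)` and zero initial value, implies `κ ‖u(t)‖² = -2 ∫₀ᵗ ((n, u) + (B, ∇u))`. -/
lemma energy_identity {κ : ℝ} {u n : ℝ → Vec d → Vec d} {Du B : ℝ → Vec d → Ten d}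
    (hu : AEStronglyMeasurable (fun z : ℝ × Vec d => u z.1 z.2)
      ((volume.restrict (Ioo 0 T)).prod (volume.restrict (Ω : Set (Vec d))))) {M : ℝ≥0}
    (huM : ∀ᵐ t ∂volume.restrict (Ioo 0 T), eLpNorm (u t) 2 (volume.restrict (Ω : Set (Vec d))) ≤ M)
    (hDu : MemLp (fun z : ℝ × Vec d => Du z.1 z.2) 2
      ((volume.restrict (Ioo 0 T)).prod (volume.restrict (Ω : Set (Vec d)))))
    (hB : MemLp (fun z : ℝ × Vec d => B z.1 z.2) 2
      ((volume.restrict (Ioo 0 T)).prod (volume.restrict (Ω : Set (Vec d)))))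
    (hn : AEStronglyMeasurable (fun z : ℝ × Vec d => n z.1 z.2)
      ((volume.restrict (Ioo 0 T)).prod (volume.restrict (Ω : Set (Vec d)))))
    (hn1 : ∫⁻ t in Ioo 0 T, eLpNorm (n t) 2 (volume.restrict (Ω : Set (Vec d))) < ∞)
    (hsol : SolenoidalNoSlip Ω T u Du)
    (hweak : ∀ (v : V Ω) (θ : 𝓓(timeBefore T, ℝ)), ∫ t in Ioo 0 T,
      (-(κ * deriv θ t * ∫ x in Ω, inner ℝ (u t x) (H10val v.1 x)) +
        θ t * ((∫ x in Ω, inner ℝ (n t x) (H10val v.1 x)) +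
          ∫ x in Ω, inner ℝ (B t x) (H10grad v.1 x))) = 0) :
    ∀ᵐ t ∂volume.restrict (Ioo 0 T), κ * ∫ x in Ω, (inner ℝ (u t x) (u t x) : ℝ) =
      ∫ r in Ioo 0 t, -2 * ((∫ x in Ω, (inner ℝ (n r x) (u r x) : ℝ)) +
        ∫ x in Ω, (inner ℝ (B r x) (Du r x) : ℝ)) := by
  let ν := volume.restrict (Ω : Set (Vec d))
  let I := Ioo 0 T
  have hIm : MeasurableSet I := measurableSet_Ioo
  have hIfin : IsFiniteMeasure (volume.restrict I) := ⟨by simp [I]⟩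
  have hu2 : MemLp (fun z : ℝ × Vec d => u z.1 z.2) 2 ((volume.restrict I).prod ν) :=
    memLp_two_of_eLpNorm_le hu huM
  have hu1 := lintegral_eLpNorm_two_lt_top hu2
  have hB1 := lintegral_eLpNorm_two_lt_top hB
  have hDu1 := lintegral_eLpNorm_two_lt_top hDu
  let K : ℝ → ℝ → ℝ := fun t r => ∫ x in Ω, (inner ℝ (u t x) (u r x) : ℝ)
  let L₁ : ℝ → ℝ → ℝ := fun t r => ∫ x in Ω, (inner ℝ (n t x) (u r x) : ℝ)
  let L₂ : ℝ → ℝ → ℝ := fun t r => ∫ x in Ω, (inner ℝ (B t x) (Du r x) : ℝ)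
  have hKi : Integrable (fun p : ℝ × ℝ => K p.1 p.2) ((volume.restrict I).prod (volume.restrict I)) :=
    integrable_kernel hu hu hu1 hu1
  have hL₁i : Integrable (fun p : ℝ × ℝ => L₁ p.1 p.2)
      ((volume.restrict I).prod (volume.restrict I)) := integrable_kernel hn hu hn1 hu1
  have hL₂i : Integrable (fun p : ℝ × ℝ => L₂ p.1 p.2)
      ((volume.restrict I).prod (volume.restrict I)) := integrable_kernel hB.1 hDu.1 hB1 hDu1
  have hKd : IntegrableOn (fun t => K t t) I :=
    (integrable_inner_of_memLp_two hu2 hu2).integral_prod_left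
  have hL₂d : IntegrableOn (fun t => L₂ t t) I :=
    (integrable_inner_of_memLp_two hB hDu).integral_prod_left
  have hL₁d : IntegrableOn (fun t => L₁ t t) I := by
    have hm : AEStronglyMeasurable (fun z : ℝ × Vec d => (inner ℝ (n z.1 z.2) (u z.1 z.2) : ℝ))
      ((volume.restrict I).prod ν) := hn.inner hu
    refine ⟨hm.integral_prod_right', ?_⟩
    calc ∫⁻ t in I, ‖L₁ t t‖ₑ ≤ ∫⁻ t in I, eLpNorm (n t) 2 ν * M := by
          refine lintegral_mono_ae ?_
          filter_upwards [hn.prodMk_left, hu.prodMk_left, huM] with t h1 h2 h3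
          refine (enorm_integral_inner_le h1 h2).trans ?_
          gcongr
      _ = (∫⁻ t in I, eLpNorm (n t) 2 ν) * M := lintegral_mul_const' _ _ (by simp)
      _ < ∞ := ENNReal.mul_lt_top hn1 (by simp)
  refine eq_primitive_of_weak_deriv (hKd.const_mul κ) ((hL₁d.add hL₂d).const_mul (-2)) fun θ => ?_
  have hρ : Tendsto (fun n : ℕ => (bumpOfRadius (E := ℝ)
      (Nat.one_div_pos_of_nat (α := ℝ) (n := n))).rOut) atTop (𝓝 0) :=
    tendsto_one_div_add_atTop_nhds_zero_nat
  have hlimK : ∀ {θ₁ θ₂ : ℝ → ℝ}, Continuous θ₁ → Continuous θ₂ →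
      ∀ C : ℝ≥0, (∀ t, ‖θ₁ t‖ ≤ C) → (∀ t, ‖θ₂ t‖ ≤ C) → _ := fun h1 h2 C h3 h4 =>
    tendsto_setIntegral_bump_kernel hu hu1 hu2 (Or.inl hu2) h1 h2 h3 h4 hρ
  have hlimL₁ : ∀ {θ₁ θ₂ : ℝ → ℝ}, Continuous θ₁ → Continuous θ₂ →
      ∀ C : ℝ≥0, (∀ t, ‖θ₁ t‖ ≤ C) → (∀ t, ‖θ₂ t‖ ≤ C) → _ := fun h1 h2 C h3 h4 =>
    tendsto_setIntegral_bump_kernel hn hn1 hu2 (Or.inr ⟨M, huM⟩) h1 h2 h3 h4 hρ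
  have hlimL₂ : ∀ {θ₁ θ₂ : ℝ → ℝ}, Continuous θ₁ → Continuous θ₂ →
      ∀ C : ℝ≥0, (∀ t, ‖θ₁ t‖ ≤ C) → (∀ t, ‖θ₂ t‖ ≤ C) → _ := fun h1 h2 C h3 h4 =>
    tendsto_setIntegral_bump_kernel hB.1 hB1 hDu (Or.inl hB) h1 h2 h3 h4 hρ
  have hkey := weak_deriv_diag (T := T) (κ := κ) (K := K) (L := fun t r => L₁ t r + L₂ t r)
    (fun t r => integral_congr_ae (Eventually.of_forall fun x => real_inner_comm _ _))
    hKi (hL₁i.add hL₂i) ?_ hρ ?_ θ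
  · have hθm : ∀ {N : ℝ → ℝ} {w : ℝ → ℝ}, IntegrableOn N (Ioo 0 T) → Continuous w →
        HasCompactSupport w → IntegrableOn (fun t => w t * N t) (Ioo 0 T) := fun hN hw hc => by
      obtain ⟨C, hC⟩ := hw.bounded_above_of_compact_support hc
      exact Integrable.bdd_mul hN hw.aestronglyMeasurable (Eventually.of_forall hC)
    have j1 : IntegrableOn (fun t => deriv θ t * K t t) (Ioo 0 T) :=
      hθm hKd (θ.contDiff.continuous_deriv (by simp)) θ.hasCompactSupport.deriv
    have j2 : IntegrableOn (fun t => θ t * (L₁ t t + L₂ t t)) (Ioo 0 T) :=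
      hθm (hL₁d.add hL₂d) θ.continuous θ.hasCompactSupport
    have e1 : ∫ t in Ioo 0 T, (κ * K t t * deriv θ t + -2 * (L₁ t t + L₂ t t) * θ t) =
        ∫ t in Ioo 0 T, (κ * (deriv θ t * K t t) + (-2) * (θ t * (L₁ t t + L₂ t t))) :=
      integral_congr_ae (Eventually.of_forall fun t => by simp only; ring)
    refine e1.trans ?_
    rw [integral_add (j1.const_mul κ) (j2.const_mul (-2)), integral_const_mul, integral_const_mul]
    linarith
  -- For almost every r the field u(r) is represented by an element of V(Ω), hence it is an
  -- admissible test field in the equation at time t.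
  · filter_upwards [hsol] with r ⟨v, hv, h1, h2⟩ ϑ
    refine Eq.trans ?_ (hweak ⟨v, hv⟩ ϑ)
    have e1 : ∀ {w : Vec d → Vec d}, ∫ x in Ω, (inner ℝ (w x) (H10val v x) : ℝ) =
        ∫ x in Ω, (inner ℝ (w x) (u r x) : ℝ) := fun {w} =>
      integral_congr_ae (h1.mono fun x hx => by simp only [hx])
    have e2 : ∀ {w : Vec d → Ten d}, ∫ x in Ω, (inner ℝ (w x) (H10grad v x) : ℝ) =
        ∫ x in Ω, (inner ℝ (w x) (Du r x) : ℝ) := fun {w} =>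
      integral_congr_ae (h2.mono fun x hx => by simp only [hx])
    simp only [e1, e2]
    rfl
  · rintro N (rfl | rfl) θ₁ θ₂ h1 h2 C h3 h4
    · exact hlimK h1 h2 C h3 h4
    · have hk : ∀ {N : ℝ → ℝ → ℝ} (n : ℕ), Integrable (fun p : ℝ × ℝ => N p.1 p.2)
          ((volume.restrict (Ioo 0 T)).prod (volume.restrict (Ioo 0 T))) →
          Integrable (fun p : ℝ × ℝ => (bumpOfRadius (E := ℝ)
            (Nat.one_div_pos_of_nat (α := ℝ) (n := n))).normed volume (p.1 - p.2) *
            (θ₁ p.1 * θ₂ p.2 * N p.1 p.2))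
          ((volume.restrict (Ioo 0 T)).prod (volume.restrict (Ioo 0 T))) := by
        intro N n hN
        obtain ⟨D, hD⟩ := (bumpOfRadius (E := ℝ) (Nat.one_div_pos_of_nat (α := ℝ) (n := n))
          ).continuous_normed (μ := volume) |>.bounded_above_of_compact_support
          (ContDiffBump.hasCompactSupport_normed _)
        refine Integrable.bdd_mul (Integrable.bdd_mul (c := C * C) hN (by fun_prop) ?_)
          ((ContDiffBump.continuous_normed _).comp (by fun_prop)).aestronglyMeasurable
          (Eventually.of_forall fun p => hD _)
        refine Eventually.of_forall fun p => ?_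
        rw [norm_mul]
        exact mul_le_mul (h3 _) (h4 _) (norm_nonneg _) C.2
      have hd : ∀ {N : ℝ → ℝ}, IntegrableOn N (Ioo 0 T) →
          IntegrableOn (fun t => θ₁ t * θ₂ t * N t) (Ioo 0 T) := fun {N} hN => by
        refine Integrable.bdd_mul (c := C * C) hN (by fun_prop) (Eventually.of_forall fun p => ?_)
        rw [norm_mul]
        exact mul_le_mul (h3 _) (h4 _) (norm_nonneg _) C.2
      have h5 := (hlimL₁ h1 h2 C h3 h4).add (hlimL₂ h1 h2 C h3 h4)
      have e1 : (∫ t in Ioo 0 T, θ₁ t * θ₂ t * L₁ t t) + ∫ t in Ioo 0 T, θ₁ t * θ₂ t * L₂ t t =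
          ∫ t in Ioo 0 T, θ₁ t * θ₂ t * (L₁ t t + L₂ t t) := by
        rw [← integral_add (hd hL₁d) (hd hL₂d)]
        exact integral_congr_ae (Eventually.of_forall fun t => by simp only; ring)
      rw [← e1]
      refine h5.congr fun n => ?_
      have e2 := integral_integral_add (hk n hL₁i) (hk n hL₂i)
      refine e2.symm.trans ?_
      refine integral_congr_ae (Eventually.of_forall fun t => ?_)
      refine integral_congr_ae (Eventually.of_forall fun r => ?_)
      simp only; ring

end Energy

end

noncomputable section

/-! ### The transport equation -/

section Transport

open Filter Topology

variable {d : ℕ} {Ω : Opens (Vec d)} {T : ℝ}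

/-- `weak_deriv_sq` is applied in the space of the variables (s, t, x), where Lebesgue measure has
to be recognised as a Haar measure. -/
instance isAddHaarMeasure_volume_prod (d : ℕ) :
    (volume : Measure (ℝ × Vec d)).IsAddHaarMeasure :=
  inferInstanceAs ((volume : Measure ℝ).prod (volume : Measure (Vec d))).IsAddHaarMeasure

instance isAddHaarMeasure_volume_prod_prod (d : ℕ) :
    (volume : Measure (ℝ × ℝ × Vec d)).IsAddHaarMeasure :=
  inferInstanceAs ((volume : Measure ℝ).prod (volume : Measure (ℝ × Vec d))).IsAddHaarMeasure

/-- The characteristic direction `∂_t + (1/We) ∂_s` in the variables `(s, t, x)`. -/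
def charDir (d : ℕ) (We : ℝ) : ℝ × ℝ × Vec d := (1 / We, 1, 0)

lemma measurableSet_ageCylinder (Ω : Opens (Vec d)) (T : ℝ) : MeasurableSet (ageCylinder Ω T) :=
  measurableSet_Ioi.prod (measurableSet_Ioo.prod Ω.isOpen.measurableSet)

lemma ageCylinder_subset (Ω : Opens (Vec d)) (T : ℝ) :
    ageCylinder Ω T ⊆ (ageTestDomain Ω T : Set (ℝ × ℝ × Vec d)) := fun _ hz =>
  ⟨mem_univ _, hz.2.1.2, hz.2.2⟩

lemma deriv_time_add_deriv_age {F : Type*} [NormedAddCommGroup F] [NormedSpace ℝ F] {We : ℝ}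
    {ψ : ℝ × ℝ × Vec d → F} (hψ : Differentiable ℝ ψ) (z : ℝ × ℝ × Vec d) :
    deriv (fun r => ψ (z.1, r, z.2.2)) z.2.1 + (1 / We) • deriv (fun r => ψ (r, z.2.1, z.2.2)) z.1 =
      fderiv ℝ ψ z (charDir d We) := by
  have h1 : HasDerivAt (fun r => ψ (z.1, r, z.2.2)) (fderiv ℝ ψ z (0, 1, 0)) z.2.1 :=
    (hψ z).hasFDerivAt.comp_hasDerivAt z.2.1 ((hasDerivAt_const _ _).prodMk
      ((hasDerivAt_id _).prodMk (hasDerivAt_const _ _)))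
  have h2 : HasDerivAt (fun r => ψ (r, z.2.1, z.2.2)) (fderiv ℝ ψ z (1, 0, 0)) z.1 :=
    (hψ z).hasFDerivAt.comp_hasDerivAt z.1 ((hasDerivAt_id _).prodMk (hasDerivAt_const _ _))
  rw [h1.deriv, h2.deriv, ← map_smul, ← map_add]
  simp [charDir]

/-- A scalar test function times a fixed vector. -/
def testSMul {E F : Type*} [NormedAddCommGroup E] [NormedSpace ℝ E] [NormedAddCommGroup F]
    [NormedSpace ℝ F] {O : Opens E} (φ : 𝓓(O, ℝ)) (v : F) : 𝓓(O, F) where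
  toFun x := φ x • v
  contDiff' := φ.contDiff.smul contDiff_const
  hasCompactSupport' := φ.hasCompactSupport.comp_left (g := fun c : ℝ => c • v) (zero_smul ℝ v)
  tsupport_subset' := (tsupport_comp_subset (g := fun c : ℝ => c • v) (zero_smul ℝ v) _).trans
    φ.tsupport_subset

/-- Zero data on s = 0 and t = 0 are encoded by extension by zero to negative ages and times. Local
integrability in the larger domain requires integrability up to these faces, but only for bounded
ages. -/
lemma locallyIntegrableOn_indicator_ageCylinder {N : ℝ × ℝ × Vec d → ℝ}
    (hN : ∀ S, IntegrableOn N (Ioo 0 S ×ˢ (Ioo 0 T ×ˢ (Ω : Set (Vec d))))) :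
    LocallyIntegrableOn ((ageCylinder Ω T).indicator N) (ageTestDomain Ω T) := by
  intro z _
  refine ⟨Iio (z.1 + 1) ×ˢ univ, mem_nhdsWithin_of_mem_nhds
    (prod_mem_nhds (Iio_mem_nhds (by linarith)) univ_mem), ?_⟩
  rw [IntegrableOn, integrable_indicator_iff (measurableSet_ageCylinder Ω T), IntegrableOn,
    Measure.restrict_restrict (measurableSet_ageCylinder Ω T)]
  refine (hN (z.1 + 1)).mono_set ?_
  rintro ⟨s, t, x⟩ ⟨h1, h2⟩
  exact ⟨⟨h1.1, h2.1⟩, h1.2⟩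

/-- The square of the norm of a bounded weak solution of a transport equation along the
characteristic direction. -/
lemma weak_transport_norm_sq {We M : ℝ} {G N : ℝ × ℝ × Vec d → Ten d}
    (hG : AEStronglyMeasurable G (volume.restrict (ageCylinder Ω T)))
    (hGM : ∀ᵐ z ∂volume.restrict (ageCylinder Ω T), ‖G z‖ ≤ M)
    (hGi : ∀ S, IntegrableOn G (Ioo 0 S ×ˢ (Ioo 0 T ×ˢ (Ω : Set (Vec d)))))
    (hN : ∀ S, IntegrableOn N (Ioo 0 S ×ˢ (Ioo 0 T ×ˢ (Ω : Set (Vec d)))))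
    (h : ∀ ψ : 𝓓(ageTestDomain Ω T, Ten d), ∫ z in ageCylinder Ω T,
      (-inner ℝ (G z) (deriv (fun r => ψ (z.1, r, z.2.2)) z.2.1 +
        (1 / We) • deriv (fun r => ψ (r, z.2.1, z.2.2)) z.1) + inner ℝ (N z) (ψ z)) = 0)
    (φ : 𝓓(ageTestDomain Ω T, ℝ)) :
    ∫ z in ageCylinder Ω T, (‖G z‖ ^ 2 * fderiv ℝ φ z (charDir d We) -
      2 * (inner ℝ (N z) (G z) * φ z)) = 0 := by
  set Q := ageCylinder Ω T with hQ
  let O := ageTestDomain Ω T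
  have hQm : MeasurableSet Q := measurableSet_ageCylinder Ω T
  have hQO : Q ⊆ O := ageCylinder_subset Ω T
  have hrr : (volume.restrict (O : Set (ℝ × ℝ × Vec d))).restrict Q = volume.restrict Q := by
    rw [Measure.restrict_restrict hQm, inter_eq_left.2 hQO]
  have hOQ : ∀ f : ℝ × ℝ × Vec d → ℝ, ∫ z in O, Q.indicator f z = ∫ z in Q, f z := fun f => by
    rw [integral_indicator hQm, hrr]
  have hcomp : ∀ k, ∀ᵐ z ∂volume.restrict Q, ‖G z k‖ ≤ M := fun k =>
    hGM.mono fun z hz => (PiLp.norm_apply_le (G z) k).trans hz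
  have hGk : ∀ k, AEStronglyMeasurable (fun z => G z k) (volume.restrict Q) := fun k =>
    (EuclideanSpace.proj k : Ten d →L[ℝ] ℝ).continuous.comp_aestronglyMeasurable hG
  have hNk : ∀ k S, IntegrableOn (fun z => N z k) (Ioo 0 S ×ˢ (Ioo 0 T ×ˢ (Ω : Set (Vec d)))) :=
    fun k S => (EuclideanSpace.proj k : Ten d →L[ℝ] ℝ).integrable_comp (hN S)
  have hNl : ∀ k, LocallyIntegrableOn (Q.indicator fun z => -N z k) O := fun k =>
    locallyIntegrableOn_indicator_ageCylinder fun S => (hNk k S).neg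
  have hsq : ∀ k, ∫ z in Q, ((G z k) ^ 2 * fderiv ℝ φ z (charDir d We) +
      2 * (-N z k * G z k * φ z)) = 0 := by
    intro k
    -- The hypothesis has no boundary terms although ψ need not vanish on s = 0 and t = 0. Hence
    -- each component, extended by zero, solves the equation across these faces, and the squared
    -- equation inherits the zero data.
    have h1 := weak_deriv_sq (O := O) (e := charDir d We) (g := Q.indicator fun z => G z k)
      (R := Q.indicator fun z => -N z k) (M := |M|) (μ := volume) ?_ ?_ (hNl k) ?_ φ
    · rw [← h1, ← hOQ]
      refine integral_congr_ae (Eventually.of_forall fun z => ?_)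
      by_cases hz : z ∈ Q <;> simp [hz]
    · rw [aestronglyMeasurable_indicator_iff hQm, hrr]; exact hGk k
    · have h2 : ∀ᵐ z ∂volume.restrict (O : Set (ℝ × ℝ × Vec d)), z ∈ Q → ‖G z k‖ ≤ M := by
        rw [← ae_restrict_iff' hQm, hrr]; exact hcomp k
      filter_upwards [h2] with z hz
      by_cases hzQ : z ∈ Q
      · simpa [hzQ] using (hz hzQ).trans (le_abs_self M)
      · simp [hzQ]
    · intro η
      have h3 := h (testSMul η (EuclideanSpace.single k (1 : ℝ)))
      refine Eq.trans ?_ (neg_eq_zero.2 h3)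
      rw [← integral_neg, ← hOQ]
      refine integral_congr_ae (Eventually.of_forall fun z => ?_)
      by_cases hz : z ∈ Q
      · have e1 : HasFDerivAt (testSMul η (EuclideanSpace.single k (1 : ℝ)))
            ((fderiv ℝ η z).smulRight (EuclideanSpace.single k (1 : ℝ))) z :=
          (η.contDiff.differentiable (by simp)).differentiableAt.hasFDerivAt.smul_const _
        simp only [hz, indicator_of_mem]
        rw [deriv_time_add_deriv_age ((testSMul η _).contDiff.differentiable (by simp)), e1.fderiv]
        have e2 : testSMul η (EuclideanSpace.single k (1 : ℝ)) z =
          η z • EuclideanSpace.single k (1 : ℝ) := rfl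
        rw [e2, ContinuousLinearMap.smulRight_apply, inner_smul_right, inner_smul_right,
          EuclideanSpace.inner_single_right, EuclideanSpace.inner_single_right]
        simp only [conj_trivial, one_mul]
        ring
      · simp [hz]
  have hcd : Continuous fun z => fderiv ℝ φ z (charDir d We) :=
    (φ.contDiff.continuous_fderiv (by simp)).clm_apply continuous_const
  have hsd : tsupport (fun z => fderiv ℝ φ z (charDir d We)) ⊆ tsupport φ := by
    refine closure_minimal (fun x hx => ?_) (isClosed_tsupport _)
    by_contra h
    exact hx (by simp [fderiv_of_notMem_tsupport (𝕜 := ℝ) h])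
  have hcut : ∀ {f k : ℝ × ℝ × Vec d → ℝ}, (∀ S, IntegrableOn f (Ioo 0 S ×ˢ (Ioo 0 T ×ˢ
      (Ω : Set (Vec d))))) → Continuous k → tsupport k ⊆ tsupport φ →
      IntegrableOn (fun z => f z * k z) Q := by
    intro f k hf hk hs
    have h1 := integrableOn_mul_of_hasCompactSupport
      (locallyIntegrableOn_indicator_ageCylinder hf) hk
      (φ.hasCompactSupport.mono' (subset_closure.trans hs)) (hs.trans φ.tsupport_subset)
    refine (h1.mono_set hQO).congr_fun (fun z hz => ?_) hQm
    simp only [hQ] at hz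
    simp [hz]
  have hi : ∀ k, IntegrableOn (fun z => (G z k) ^ 2 * fderiv ℝ φ z (charDir d We) +
      2 * (-N z k * G z k * φ z)) Q := by
    intro k
    have j1 := (hcut (f := fun z => G z k) (fun S => (EuclideanSpace.proj k :
      Ten d →L[ℝ] ℝ).integrable_comp (hGi S)) hcd hsd).mul_bdd (hGk k) (hcomp k)
    have j2 := ((hcut (hNk k) φ.continuous subset_rfl).mul_bdd (hGk k) (hcomp k)).const_mul (-2)
    refine (j1.add j2).congr (Eventually.of_forall fun z => ?_)
    simp only [Pi.add_apply]; ring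
  have hsum : ∫ z in Q, ∑ k, ((G z k) ^ 2 * fderiv ℝ φ z (charDir d We) +
      2 * (-N z k * G z k * φ z)) = 0 := by
    rw [integral_finsetSum _ fun k _ => hi k]
    exact Finset.sum_eq_zero fun k _ => hsq k
  rw [← hsum]
  refine integral_congr_ae (Eventually.of_forall fun z => ?_)
  simp only [Finset.sum_add_distrib, EuclideanSpace.real_norm_sq_eq, PiLp.inner_apply,
    RCLike.inner_apply, conj_trivial, Finset.sum_mul, Finset.mul_sum, sub_eq_add_neg,
    ← Finset.sum_neg_distrib]
  congr 1
  exact Finset.sum_congr rfl fun k _ => by ring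

end Transport

end

noncomputable section

/-! ### Cut-off functions -/

section CutOff

open Filter Topology
open scoped Manifold

variable {E : Type*} [NormedAddCommGroup E] [NormedSpace ℝ E] [FiniteDimensional ℝ E]

lemma exists_test_eq_one {O : Opens E} {K : Set E} (hK : IsCompact K) (hKO : K ⊆ O) :
    ∃ ξ : 𝓓(O, ℝ), (∀ x ∈ K, ξ x = 1) ∧ ∀ x, 0 ≤ ξ x ∧ ξ x ≤ 1 := by
  obtain ⟨δ, hδ, hδO⟩ := hK.exists_cthickening_subset_open O.isOpen hKO
  obtain ⟨f, hf, hfr, hfs, hf1⟩ := exists_contMDiff_support_eq_eq_one_iff (n := (⊤ : ℕ∞))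
    𝓘(ℝ, E) (Metric.isOpen_thickening (δ := δ) (E := K)) hK.isClosed
    (Metric.self_subset_thickening hδ K)
  have hs : Function.support f ⊆ Metric.cthickening δ K :=
    hfs.subset.trans (Metric.thickening_subset_cthickening δ K)
  refine ⟨⟨f, hf.contDiff, HasCompactSupport.of_support_subset_isCompact hK.cthickening hs,
    (closure_minimal hs Metric.isClosed_cthickening).trans hδO⟩, fun x hx => (hf1 x).1 hx, fun x => ?_⟩
  exact hfr ⟨x, rfl⟩

/-- An open set is an increasing union of closed sets, which become compact after intersection with
balls. Nothing is claimed about the gradients of the cut-offs; they will not be differentiated. -/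
lemma exists_test_seq_tendsto_one (O : Opens E) : ∃ ξ : ℕ → 𝓓(O, ℝ),
    (∀ n x, 0 ≤ ξ n x ∧ ξ n x ≤ 1) ∧ ∀ x ∈ O, Tendsto (fun n => ξ n x) atTop (𝓝 1) := by
  obtain ⟨F, hFc, hFO, hFU, hFm⟩ := O.isOpen.exists_iUnion_isClosed
  have hK : ∀ n : ℕ, IsCompact (F n ∩ Metric.closedBall 0 n) := fun n =>
    (isCompact_closedBall (0 : E) n).inter_left (hFc n)
  choose ξ h1 h2 using fun n : ℕ => exists_test_eq_one (hK n) (inter_subset_left.trans (hFO n))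
  refine ⟨ξ, h2, fun x hx => ?_⟩
  have hx' : x ∈ ⋃ n, F n := hFU ▸ hx
  obtain ⟨k, hk⟩ := mem_iUnion.1 hx'
  obtain ⟨l, hl⟩ := exists_nat_ge ‖x‖
  refine tendsto_const_nhds.congr' ?_
  filter_upwards [eventually_ge_atTop k, eventually_ge_atTop l] with n hn1 hn2
  refine (h1 n x ⟨hFm hn1 hk, ?_⟩).symm
  rw [mem_closedBall_zero_iff]
  exact hl.trans (by exact_mod_cast hn2)

end CutOff

section Reduction

open Filter Topology

variable {d : ℕ} {Ω : Opens (Vec d)} {T : ℝ}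

/-! ### Reduction to the variables age and time -/

lemma measurePreserving_assoc_restrict (J : Set ℝ) (Ω : Opens (Vec d)) (T : ℝ) :
    MeasurePreserving (MeasurableEquiv.prodAssoc : (ℝ × ℝ) × Vec d ≃ᵐ ℝ × ℝ × Vec d)
      ((volume.restrict (J ×ˢ Ioo 0 T)).prod (volume.restrict (Ω : Set (Vec d))))
      (volume.restrict (J ×ˢ (Ioo 0 T ×ˢ (Ω : Set (Vec d))))) := by
  have h1 : (volume.restrict (J ×ˢ Ioo 0 T) : Measure (ℝ × ℝ)) =
      (volume.restrict J).prod (volume.restrict (Ioo 0 T)) := by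
    rw [Measure.prod_restrict, Measure.volume_eq_prod]
  have h2 : (volume.restrict (J ×ˢ (Ioo 0 T ×ˢ (Ω : Set (Vec d)))) : Measure (ℝ × ℝ × Vec d)) =
      (volume.restrict J).prod ((volume.restrict (Ioo 0 T)).prod
        (volume.restrict (Ω : Set (Vec d)))) := by
    rw [Measure.prod_restrict, Measure.prod_restrict, Measure.volume_eq_prod,
      Measure.volume_eq_prod]
  rw [h1, h2]
  exact measurePreserving_prodAssoc _ _ _

lemma measurePreserving_ageCylinder (Ω : Opens (Vec d)) (T : ℝ) :
    MeasurePreserving (MeasurableEquiv.prodAssoc : (ℝ × ℝ) × Vec d ≃ᵐ ℝ × ℝ × Vec d)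
      ((volume.restrict (Ioi (0 : ℝ) ×ˢ Ioo 0 T)).prod (volume.restrict (Ω : Set (Vec d))))
      (volume.restrict (ageCylinder Ω T)) := measurePreserving_assoc_restrict _ Ω T

lemma integrable_assoc {J : Set ℝ} {f : ℝ × ℝ × Vec d → ℝ}
    (hf : IntegrableOn f (J ×ˢ (Ioo 0 T ×ˢ (Ω : Set (Vec d))))) :
    Integrable (fun p : (ℝ × ℝ) × Vec d => f (p.1.1, p.1.2, p.2))
      ((volume.restrict (J ×ˢ Ioo 0 T)).prod (volume.restrict (Ω : Set (Vec d)))) :=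
  ((measurePreserving_assoc_restrict J Ω T).integrable_comp_emb
    MeasurableEquiv.prodAssoc.measurableEmbedding).2 hf

lemma ae_ae_of_ae_ageCylinder {p : ℝ × ℝ × Vec d → Prop}
    (h : ∀ᵐ z ∂volume.restrict (ageCylinder Ω T), p z) :
    ∀ᵐ r ∂volume.restrict (Ioi (0 : ℝ) ×ˢ Ioo 0 T), ∀ᵐ x ∂volume.restrict (Ω : Set (Vec d)),
      p (r.1, r.2, x) :=
  Measure.ae_ae_of_ae_prod ((measurePreserving_ageCylinder Ω T).quasiMeasurePreserving.ae h)

lemma aestronglyMeasurable_comp_assoc {F : Type*} [TopologicalSpace F]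
    {f : ℝ × ℝ × Vec d → F} (hf : AEStronglyMeasurable f (volume.restrict (ageCylinder Ω T))) :
    AEStronglyMeasurable (fun p : (ℝ × ℝ) × Vec d => f (p.1.1, p.1.2, p.2))
      ((volume.restrict (Ioi (0 : ℝ) ×ˢ Ioo 0 T)).prod (volume.restrict (Ω : Set (Vec d)))) :=
  hf.comp_measurePreserving (measurePreserving_ageCylinder Ω T)

lemma setIntegral_ageCylinder {f : ℝ × ℝ × Vec d → ℝ} (hf : IntegrableOn f (ageCylinder Ω T)) :
    ∫ z in ageCylinder Ω T, f z =
      ∫ r in Ioi (0 : ℝ) ×ˢ Ioo 0 T, ∫ x in Ω, f (r.1, r.2, x) := by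
  rw [← (measurePreserving_ageCylinder Ω T).integral_comp
    MeasurableEquiv.prodAssoc.measurableEmbedding]
  exact integral_prod _ (integrable_assoc hf)

lemma integrableOn_ageCylinder_of_age_le {f : ℝ × ℝ × Vec d → ℝ} {S : ℝ}
    (hf : IntegrableOn f (Ioo 0 S ×ˢ (Ioo 0 T ×ˢ (Ω : Set (Vec d)))))
    (h : ∀ z, S ≤ z.1 → f z = 0) : IntegrableOn f (ageCylinder Ω T) := by
  refine hf.of_forall_sdiff_eq_zero (measurableSet_ageCylinder Ω T) fun z hz => ?_
  refine h z (not_lt.1 fun hlt => hz.2 ⟨⟨hz.1.1, hlt⟩, hz.1.2⟩)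

/-- The test functions are α(s,t) ξ_n(x) with ξ_n → 1. The characteristic direction has no component
in x, so ξ_n is never differentiated and dominated convergence suffices, without any control near
∂Ω. The convection is hidden in P. -/
lemma transport_reduction {We : ℝ} {A P : ℝ × ℝ × Vec d → ℝ}
    (hA : ∀ S, IntegrableOn A (Ioo 0 S ×ˢ (Ioo 0 T ×ˢ (Ω : Set (Vec d)))))
    (hP : ∀ S, IntegrableOn P (Ioo 0 S ×ˢ (Ioo 0 T ×ˢ (Ω : Set (Vec d)))))
    (h : ∀ φ : 𝓓(ageTestDomain Ω T, ℝ), ∫ z in ageCylinder Ω T,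
      (A z * fderiv ℝ φ z (charDir d We) - 2 * (P z * φ z)) = 0)
    {α : ℝ × ℝ → ℝ} (hα : ContDiff ℝ ((⊤ : ℕ∞) : WithTop ℕ∞) α) (hαc : HasCompactSupport α)
    (hαT : tsupport α ⊆ univ ×ˢ Iio T) :
    ∫ r in Ioi (0 : ℝ) ×ˢ Ioo 0 T, ((∫ x in Ω, A (r.1, r.2, x)) * fderiv ℝ α r (1 / We, 1) -
      2 * ((∫ x in Ω, P (r.1, r.2, x)) * α r)) = 0 := by
  obtain ⟨S, hS⟩ := hαc.isCompact.isBounded.subset_ball 0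
  have hα0 : ∀ r : ℝ × ℝ, S ≤ r.1 → r ∉ tsupport α := fun r hr hrα => by
    have h1 := mem_ball_zero_iff.1 (hS hrα)
    have h2 := (norm_fst_le r).trans_lt h1
    rw [Real.norm_eq_abs] at h2
    linarith [le_abs_self r.1]
  have hα1 : ∀ r : ℝ × ℝ, S ≤ r.1 → α r = 0 ∧ fderiv ℝ α r (1 / We, 1) = 0 := fun r hr =>
    ⟨image_eq_zero_of_notMem_tsupport (hα0 r hr),
      by simp [fderiv_of_notMem_tsupport (𝕜 := ℝ) (hα0 r hr)]⟩
  have hd : Continuous fun r => fderiv ℝ α r (1 / We, 1) :=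
    (hα.continuous_fderiv (by simp)).clm_apply continuous_const
  obtain ⟨C₁, hC₁⟩ := hα.continuous.bounded_above_of_compact_support hαc
  obtain ⟨C₂, hC₂⟩ := hd.bounded_above_of_compact_support
    ((hαc.fderiv ℝ).comp_left (g := fun L : ℝ × ℝ →L[ℝ] ℝ => L (1 / We, 1)) (by simp))
  have hFi : ∀ S, IntegrableOn (fun z : ℝ × ℝ × Vec d => A z * fderiv ℝ α (z.1, z.2.1) (1 / We, 1) -
      2 * (P z * α (z.1, z.2.1))) (Ioo 0 S ×ˢ (Ioo 0 T ×ˢ (Ω : Set (Vec d)))) := fun S =>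
    (Integrable.mul_bdd (hA S) (by fun_prop) (Eventually.of_forall fun z => hC₂ _)).sub
      ((Integrable.mul_bdd (hP S) (hα.continuous.comp (by fun_prop)).aestronglyMeasurable
        (Eventually.of_forall fun z => hC₁ _)).const_mul 2)
  have hF : IntegrableOn (fun z : ℝ × ℝ × Vec d => A z * fderiv ℝ α (z.1, z.2.1) (1 / We, 1) -
      2 * (P z * α (z.1, z.2.1))) (ageCylinder Ω T) :=
    integrableOn_ageCylinder_of_age_le (hFi S) fun z hz => by
      rw [(hα1 (z.1, z.2.1) hz).1, (hα1 (z.1, z.2.1) hz).2]; simp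
  obtain ⟨ξ, hξ, hξ1⟩ := exists_test_seq_tendsto_one Ω
  have hφ : ∀ n, ∃ φ : 𝓓(ageTestDomain Ω T, ℝ), (∀ z, φ z = α (z.1, z.2.1) * ξ n z.2.2) ∧
      ∀ z, fderiv ℝ φ z (charDir d We) = fderiv ℝ α (z.1, z.2.1) (1 / We, 1) * ξ n z.2.2 := by
    intro n
    have hs : tsupport (fun z : ℝ × ℝ × Vec d => α (z.1, z.2.1) * ξ n z.2.2) ⊆
        (fun q : (ℝ × ℝ) × Vec d => (q.1.1, q.1.2, q.2)) '' (tsupport α ×ˢ tsupport (ξ n)) := by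
      refine closure_minimal (fun z hz => ?_) ((hαc.isCompact.prod
        (ξ n).hasCompactSupport.isCompact).image (by fun_prop)).isClosed
      exact ⟨((z.1, z.2.1), z.2.2), ⟨subset_tsupport _ (left_ne_zero_of_mul hz),
        subset_tsupport _ (right_ne_zero_of_mul hz)⟩, rfl⟩
    refine ⟨⟨fun z => α (z.1, z.2.1) * ξ n z.2.2, ?_, ?_, ?_⟩, fun _ => rfl, fun z => ?_⟩
    · exact (hα.comp (contDiff_fst.prodMk (contDiff_fst.comp contDiff_snd))).mul
        ((ξ n).contDiff.comp (contDiff_snd.comp contDiff_snd))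
    · exact HasCompactSupport.of_support_subset_isCompact ((hαc.isCompact.prod
        (ξ n).hasCompactSupport.isCompact).image (by fun_prop)) (subset_closure.trans hs)
    · rintro z hz
      obtain ⟨⟨⟨s, t⟩, x⟩, ⟨h1, h2⟩, rfl⟩ := hs hz
      exact ⟨mem_univ _, (hαT h1).2, (ξ n).tsupport_subset h2⟩
    · have h1 : HasFDerivAt (fun z : ℝ × ℝ × Vec d => α (z.1, z.2.1))
          ((fderiv ℝ α (z.1, z.2.1)).comp ((ContinuousLinearMap.fst ℝ ℝ (ℝ × Vec d)).prod
            ((ContinuousLinearMap.fst ℝ ℝ (Vec d)).comp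
              (ContinuousLinearMap.snd ℝ ℝ (ℝ × Vec d))))) z :=
        HasFDerivAt.comp z (f := fun z : ℝ × ℝ × Vec d => (z.1, z.2.1))
          (hα.differentiable (by simp)).differentiableAt.hasFDerivAt
          (hasFDerivAt_fst.prodMk (hasFDerivAt_fst.comp z hasFDerivAt_snd))
      have h2 : HasFDerivAt (fun z : ℝ × ℝ × Vec d => ξ n z.2.2)
          ((fderiv ℝ (ξ n) z.2.2).comp ((ContinuousLinearMap.snd ℝ ℝ (Vec d)).comp
              (ContinuousLinearMap.snd ℝ ℝ (ℝ × Vec d)))) z :=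
        HasFDerivAt.comp z (f := fun z : ℝ × ℝ × Vec d => z.2.2)
          ((ξ n).contDiff.differentiable (by simp)).differentiableAt.hasFDerivAt
          (hasFDerivAt_snd.comp z hasFDerivAt_snd)
      have h3 := (h1.mul h2).fderiv
      change (fderiv ℝ (fun z : ℝ × ℝ × Vec d => α (z.1, z.2.1) * ξ n z.2.2) z) _ = _
      have h4 : (fun z : ℝ × ℝ × Vec d => α (z.1, z.2.1) * ξ n z.2.2) =
        (fun z : ℝ × ℝ × Vec d => α (z.1, z.2.1)) * fun z => ξ n z.2.2 := rfl
      rw [h4, h3]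
      simp [charDir, mul_comm]
  have hlim : Tendsto (fun n => ∫ z in ageCylinder Ω T, (A z * fderiv ℝ α (z.1, z.2.1) (1 / We, 1) -
      2 * (P z * α (z.1, z.2.1))) * ξ n z.2.2) atTop (𝓝 (∫ z in ageCylinder Ω T,
        (A z * fderiv ℝ α (z.1, z.2.1) (1 / We, 1) - 2 * (P z * α (z.1, z.2.1))))) := by
    refine tendsto_integral_of_dominated_convergence (fun z => ‖A z * fderiv ℝ α (z.1, z.2.1)
      (1 / We, 1) - 2 * (P z * α (z.1, z.2.1))‖) (fun n => hF.1.mul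
      ((ξ n).continuous.comp (by fun_prop)).aestronglyMeasurable) hF.norm
      (fun n => Eventually.of_forall fun z => ?_) ?_
    · rw [norm_mul]
      refine mul_le_of_le_one_right (norm_nonneg _) ?_
      rw [Real.norm_of_nonneg (hξ n _).1]; exact (hξ n _).2
    · rw [ae_restrict_iff' (measurableSet_ageCylinder Ω T)]
      refine Eventually.of_forall fun z hz => ?_
      simpa using (hξ1 z.2.2 hz.2.2).const_mul (A z * fderiv ℝ α (z.1, z.2.1) (1 / We, 1) -
        2 * (P z * α (z.1, z.2.1)))
  have hz : ∀ n, ∫ z in ageCylinder Ω T, (A z * fderiv ℝ α (z.1, z.2.1) (1 / We, 1) -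
      2 * (P z * α (z.1, z.2.1))) * ξ n z.2.2 = 0 := by
    intro n
    obtain ⟨φ, h1, h2⟩ := hφ n
    refine Eq.trans ?_ (h φ)
    refine integral_congr_ae (Eventually.of_forall fun z => ?_)
    simp only [h1, h2]; ring
  simp_rw [hz] at hlim
  have h0 := tendsto_nhds_unique hlim tendsto_const_nhds
  rw [setIntegral_ageCylinder hF] at h0
  refine Eq.trans ?_ h0
  have iA : ∀ᵐ r ∂volume.restrict (Ioi (0 : ℝ) ×ˢ Ioo 0 T), r.1 < S →
      IntegrableOn (fun x => A (r.1, r.2, x)) Ω ∧ IntegrableOn (fun x => P (r.1, r.2, x)) Ω := by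
    have j1 := (integrable_assoc (hA S)).prod_right_ae
    have j2 := (integrable_assoc (hP S)).prod_right_ae
    rw [ae_restrict_iff' (measurableSet_Ioo.prod measurableSet_Ioo)] at j1 j2
    rw [ae_restrict_iff' (measurableSet_Ioi.prod measurableSet_Ioo)]
    filter_upwards [j1, j2] with r h1 h2 hr hrS
    exact ⟨h1 ⟨⟨hr.1, hrS⟩, hr.2⟩, h2 ⟨⟨hr.1, hrS⟩, hr.2⟩⟩
  refine integral_congr_ae ?_
  filter_upwards [iA] with r hr
  rcases lt_or_ge r.1 S with hrS | hrS
  · obtain ⟨j1, j2⟩ := hr hrS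
    rw [integral_sub (j1.mul_const _) ((j2.mul_const _).const_mul 2), integral_mul_const,
      integral_const_mul, integral_mul_const]
  · obtain ⟨j1, j2⟩ := hα1 r hrS
    simp only [j1, j2]; simp

end Reduction

end

noncomputable section

/-! ### Integration along the characteristics -/

section Characteristics

open Filter Topology

/-- Passing from almost every slice to almost every point needs a measurable exceptional set, hence
the measurable representatives. -/
lemma ae_prod_le_of_ae_ae_le {α β : Type*} [MeasurableSpace α] [MeasurableSpace β]
    {μ : Measure α} {ν : Measure β} [SFinite μ] [SFinite ν] {f g : α × β → ℝ}
    (hf : AEMeasurable f (μ.prod ν)) (hg : AEMeasurable g (μ.prod ν))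
    (h : ∀ᵐ x ∂μ, ∀ᵐ y ∂ν, f (x, y) ≤ g (x, y)) : ∀ᵐ z ∂μ.prod ν, f z ≤ g z := by
  have h1 : ∀ᵐ z ∂μ.prod ν, hf.mk f z ≤ hg.mk g z := by
    rw [Measure.ae_prod_iff_ae_ae (measurableSet_le hf.measurable_mk hg.measurable_mk)]
    filter_upwards [h, Measure.ae_ae_of_ae_prod hf.ae_eq_mk, Measure.ae_ae_of_ae_prod hg.ae_eq_mk]
      with x h1 h2 h3
    filter_upwards [h1, h2, h3] with y e1 e2 e3
    rwa [← e2, ← e3]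
  filter_upwards [h1, hf.ae_eq_mk, hg.ae_eq_mk] with z e1 e2 e3
  rwa [e2, e3]

lemma ae_setProd_iff_swap {p : ℝ × ℝ → Prop} {J I : Set ℝ} :
    (∀ᵐ r ∂volume.restrict (J ×ˢ I), p r) ↔
      ∀ᵐ r ∂(volume.restrict I).prod (volume.restrict J), p r.swap := by
  rw [Measure.volume_eq_prod, ← Measure.prod_restrict]
  refine ⟨fun h => ?_, fun h => ?_⟩
  · exact (Measure.measurePreserving_swap (μ := volume.restrict I)
      (ν := volume.restrict J)).quasiMeasurePreserving.ae h
  · exact (Measure.measurePreserving_swap (μ := volume.restrict J)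
      (ν := volume.restrict I)).quasiMeasurePreserving.ae h

variable {T : ℝ}

/-- The mean of z over a thin strip around the characteristic s = σ + c t has weak derivative -2
times the mean of ρ and zero initial value. This includes characteristics that enter through s = 0,
because the test functions do not vanish there. The bump has mass at most 1 on s > 0, so the
derivative is at most ψ, and the bound for the mean is the primitive of ψ, which does not depend on
σ. Letting the strip shrink gives the bound for z itself at almost every point. -/
lemma le_primitive_of_transport {We : ℝ} {z ρ : ℝ × ℝ → ℝ} {ψ : ℝ → ℝ}
    (hzm : AEMeasurable z (volume.restrict (Ioi (0 : ℝ) ×ˢ Ioo 0 T)))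
    (hz : ∀ S, IntegrableOn z (Ioo 0 S ×ˢ Ioo 0 T))
    (hρ : ∀ S, IntegrableOn ρ (Ioo 0 S ×ˢ Ioo 0 T))
    (hψ : IntegrableOn ψ (Ioo 0 T)) (hψ0 : ∀ t, 0 ≤ ψ t)
    (hle : ∀ᵐ r ∂volume.restrict (Ioi (0 : ℝ) ×ˢ Ioo 0 T), -(2 * ρ r) ≤ ψ r.2)
    (h : ∀ α : ℝ × ℝ → ℝ, ContDiff ℝ ((⊤ : ℕ∞) : WithTop ℕ∞) α → HasCompactSupport α →
      tsupport α ⊆ univ ×ˢ Iio T → ∫ r in Ioi (0 : ℝ) ×ˢ Ioo 0 T,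
        (z r * fderiv ℝ α r (1 / We, 1) - 2 * (ρ r * α r)) = 0) :
    ∀ᵐ r ∂volume.restrict (Ioi (0 : ℝ) ×ˢ Ioo 0 T), z r ≤ ∫ t in Ioo 0 r.2, ψ t := by
  set c : ℝ := 1 / We with hc
  have hvol : ∀ J : Set ℝ, (volume.restrict (J ×ˢ Ioo 0 T) : Measure (ℝ × ℝ)) =
      (volume.restrict J).prod (volume.restrict (Ioo 0 T)) := fun J => by
    rw [Measure.prod_restrict, Measure.volume_eq_prod]
  let b : ℕ → ContDiffBump (0 : ℝ) := fun n =>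
    bumpOfRadius (E := ℝ) (Nat.one_div_pos_of_nat (α := ℝ) (n := n))
  have hb1 : ∀ n, (b n).rOut ≤ 1 := fun n => by
    change 1 / ((n : ℝ) + 1) ≤ 1
    rw [div_le_one (by positivity)]; linarith [n.cast_nonneg (α := ℝ)]
  have hb0 : Tendsto (fun n => (b n).rOut) atTop (𝓝 0) := tendsto_one_div_add_atTop_nhds_zero_nat
  -- the mean over a strip around a characteristic
  have key : ∀ (σ : ℝ) (n : ℕ), ∀ᵐ t ∂volume.restrict (Ioo 0 T),
      ∫ s in Ioi 0, (b n).normed volume (s - σ - c * t) * z (s, t) ≤ ∫ r in Ioo 0 t, ψ r := by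
    intro σ n
    set χ := (b n).normed volume with hχ
    have hχc : Continuous χ := (b n).continuous_normed
    have hχs : ContDiff ℝ ((⊤ : ℕ∞) : WithTop ℕ∞) χ := (b n).contDiff_normed
    obtain ⟨D, hD⟩ := hχc.bounded_above_of_compact_support (b n).hasCompactSupport_normed
    have hχ0 : ∀ y, 1 < y → χ y = 0 := by
      intro y hy
      by_contra hne
      have h5 : y ∈ Function.support χ := hne
      rw [hχ, (b n).support_normed_eq, mem_ball_zero_iff, Real.norm_eq_abs] at h5
      linarith [le_abs_self y, hb1 n]
    -- Beyond this age the strip of half-width at most 1 is not met at any time in (0, T), so only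
    -- integrability for bounded ages is used.
    set S : ℝ := σ + |c| * |T| + 2 with hS
    have hS0 : ∀ t ∈ Ioo 0 T, ∀ s, S ≤ s → χ (s - σ - c * t) = 0 := by
      intro t ht s hs
      refine hχ0 _ ?_
      have h1 : c * t ≤ |c| * |T| := by
        calc c * t ≤ |c| * |t| := by rw [← abs_mul]; exact le_abs_self _
          _ ≤ |c| * |T| := mul_le_mul_of_nonneg_left (by
              rw [abs_of_pos ht.1, abs_of_pos (ht.1.trans ht.2)]; exact ht.2.le) (abs_nonneg c)
      linarith
    have hcut : ∀ {f : ℝ × ℝ → ℝ}, (∀ S, IntegrableOn f (Ioo 0 S ×ˢ Ioo 0 T)) →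
        Integrable (fun r : ℝ × ℝ => χ (r.1 - σ - c * r.2) * f r)
          ((volume.restrict (Ioi 0)).prod (volume.restrict (Ioo 0 T))) := by
      intro f hf
      rw [← hvol]
      have h1 : IntegrableOn (fun r : ℝ × ℝ => χ (r.1 - σ - c * r.2) * f r)
          (Ioo 0 S ×ˢ Ioo 0 T) :=
        Integrable.bdd_mul (hf S) (hχc.comp (by fun_prop)).aestronglyMeasurable
          (Eventually.of_forall fun r => hD _)
      refine h1.of_forall_sdiff_eq_zero (measurableSet_Ioi.prod measurableSet_Ioo) fun r hr => ?_
      rw [hS0 r.2 hr.1.2 r.1 (not_lt.1 fun hlt => hr.2 ⟨⟨hr.1.1, hlt⟩, hr.1.2⟩), zero_mul]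
    have iz := hcut hz
    have iρ := hcut hρ
    have hprim := eq_primitive_of_weak_deriv (T := T)
      (f := fun t => ∫ s in Ioi 0, χ (s - σ - c * t) * z (s, t))
      (g := fun t => -2 * ∫ s in Ioi 0, χ (s - σ - c * t) * ρ (s, t))
      iz.integral_prod_right (iρ.integral_prod_right.const_mul (-2)) ?_
    · have hle' : ∀ᵐ t ∂volume.restrict (Ioo 0 T),
          -2 * ∫ s in Ioi 0, χ (s - σ - c * t) * ρ (s, t) ≤ ψ t := by
        have h1 := ae_setProd_iff_swap.1 hle
        filter_upwards [Measure.ae_ae_of_ae_prod h1, iρ.prod_left_ae] with t h2 h3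
        have hi : Integrable (fun s => χ (s - σ - c * t)) := by
          have := (b n).integrable_normed (μ := volume) |>.comp_sub_right (σ + c * t)
          exact this.congr (Eventually.of_forall fun s => by simp only [hχ, sub_sub])
        calc -2 * ∫ s in Ioi 0, χ (s - σ - c * t) * ρ (s, t)
            = ∫ s in Ioi 0, -2 * (χ (s - σ - c * t) * ρ (s, t)) := (integral_const_mul _ _).symm
          _ ≤ ∫ s in Ioi 0, χ (s - σ - c * t) * ψ t := by
              refine integral_mono_ae (h3.const_mul _) (hi.integrableOn.mul_const _) ?_
              filter_upwards [h2] with s hs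
              have h4 := mul_le_mul_of_nonneg_left hs ((b n).nonneg_normed (μ := volume)
                (s - σ - c * t))
              simp only [Prod.swap_prod_mk] at h4
              linarith
          _ = (∫ s in Ioi 0, χ (s - σ - c * t)) * ψ t := integral_mul_const _ _
          _ ≤ 1 * ψ t := by
              gcongr
              · exact hψ0 t
              · refine (setIntegral_le_integral hi (Eventually.of_forall fun s =>
                  (b n).nonneg_normed _)).trans_eq ?_
                have e : (fun s => χ (s - σ - c * t)) = fun s => χ (s - (σ + c * t)) := by
                  ext s; rw [sub_sub]
                rw [e, integral_sub_right_eq_self (fun s => χ s)]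
                exact (b n).integral_normed
          _ = ψ t := one_mul _
      filter_upwards [hprim, ae_restrict_mem measurableSet_Ioo] with t h1 h2
      rw [h1]
      have hsub : Ioo 0 t ⊆ Ioo 0 T := Ioo_subset_Ioo_right h2.2.le
      exact integral_mono_ae ((iρ.integral_prod_right.const_mul (-2)).mono_measure
        (Measure.restrict_mono hsub le_rfl)) (hψ.mono_set hsub) (ae_restrict_of_ae_restrict_of_subset hsub hle')
    · intro θ
      set α : ℝ × ℝ → ℝ := fun r => χ (r.1 - σ - c * r.2) * θ r.2 with hα
      have hαd : ∀ r, fderiv ℝ α r (c, 1) = χ (r.1 - σ - c * r.2) * deriv θ r.2 := by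
        intro r
        have h1 : HasFDerivAt (fun r : ℝ × ℝ => r.1 - σ - c * r.2)
            (ContinuousLinearMap.fst ℝ ℝ ℝ - c • ContinuousLinearMap.snd ℝ ℝ ℝ) r :=
          ((hasFDerivAt_fst.sub_const σ).sub (hasFDerivAt_snd.const_smul c))
        have h2 : HasFDerivAt (fun r : ℝ × ℝ => χ (r.1 - σ - c * r.2))
            (deriv χ (r.1 - σ - c * r.2) •
              (ContinuousLinearMap.fst ℝ ℝ ℝ - c • ContinuousLinearMap.snd ℝ ℝ ℝ)) r :=
          (hχs.differentiable (by simp)).differentiableAt.hasDerivAt.comp_hasFDerivAt r h1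
        have h3 : HasFDerivAt (fun r : ℝ × ℝ => θ r.2)
            (deriv θ r.2 • ContinuousLinearMap.snd ℝ ℝ ℝ) r :=
          (θ.contDiff.differentiable (by simp)).differentiableAt.hasDerivAt.comp_hasFDerivAt r
            hasFDerivAt_snd
        have h4 := (h2.mul h3).fderiv
        have h5 : α = (fun r : ℝ × ℝ => χ (r.1 - σ - c * r.2)) * fun r => θ r.2 := rfl
        rw [h5, h4]
        simp
      have hK : IsCompact ((fun q : ℝ × ℝ => (q.1 + σ + c * q.2, q.2)) ''
          (Metric.closedBall 0 1 ×ˢ tsupport θ)) :=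
        ((isCompact_closedBall (0 : ℝ) 1).prod θ.hasCompactSupport.isCompact).image (by fun_prop)
      have hs : Function.support α ⊆ (fun q : ℝ × ℝ => (q.1 + σ + c * q.2, q.2)) ''
          (Metric.closedBall 0 1 ×ˢ tsupport θ) := by
        intro r hr
        refine ⟨(r.1 - σ - c * r.2, r.2), ⟨?_, subset_tsupport _ (right_ne_zero_of_mul hr)⟩, ?_⟩
        · have h5 : r.1 - σ - c * r.2 ∈ Function.support χ := left_ne_zero_of_mul hr
          rw [hχ, (b n).support_normed_eq] at h5
          exact Metric.ball_subset_closedBall (Metric.ball_subset_ball (hb1 n) h5)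
        · exact Prod.ext (by simp only; ring) rfl
      have h1 := h α ((hχs.comp (by fun_prop)).mul (θ.contDiff.comp contDiff_snd))
        (HasCompactSupport.of_support_subset_isCompact hK hs) (by
          refine (closure_minimal hs hK.isClosed).trans ?_
          rintro _ ⟨q, hq, rfl⟩
          exact ⟨mem_univ _, θ.tsupport_subset hq.2⟩)
      obtain ⟨C₁, hC₁⟩ := θ.continuous.bounded_above_of_compact_support θ.hasCompactSupport
      obtain ⟨C₂, hC₂⟩ := (θ.contDiff.continuous_deriv (by simp)).bounded_above_of_compact_support
        θ.hasCompactSupport.deriv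
      have hθ'c : Continuous (deriv θ) := θ.contDiff.continuous_deriv (by simp)
      have j1 : Integrable (fun r : ℝ × ℝ => χ (r.1 - σ - c * r.2) * z r * deriv θ r.2)
          ((volume.restrict (Ioi 0)).prod (volume.restrict (Ioo 0 T))) :=
        iz.mul_bdd (hθ'c.comp continuous_snd).aestronglyMeasurable
          (Eventually.of_forall fun r => hC₂ _)
      have j2 : Integrable (fun r : ℝ × ℝ => -2 * (χ (r.1 - σ - c * r.2) * ρ r * θ r.2))
          ((volume.restrict (Ioi 0)).prod (volume.restrict (Ioo 0 T))) :=
        (iρ.mul_bdd (θ.continuous.comp continuous_snd).aestronglyMeasurable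
          (Eventually.of_forall fun r => hC₁ _)).const_mul (-2)
      have h2 := integral_prod_symm _ (j1.add j2)
      rw [← hvol] at h2
      have h3 : ∫ r in Ioi (0 : ℝ) ×ˢ Ioo 0 T, ((fun r : ℝ × ℝ => χ (r.1 - σ - c * r.2) * z r *
          deriv θ r.2) + fun r : ℝ × ℝ => -2 * (χ (r.1 - σ - c * r.2) * ρ r * θ r.2)) r = 0 := by
        refine Eq.trans ?_ h1
        refine integral_congr_ae (Eventually.of_forall fun r => ?_)
        simp only [Pi.add_apply]
        rw [hαd r]
        simp only [hα]
        ring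
      rw [h3] at h2
      refine Eq.trans ?_ h2.symm
      refine integral_congr_ae ?_
      filter_upwards [iz.prod_left_ae, iρ.prod_left_ae] with t h4 h5
      simp only [Pi.add_apply]
      rw [integral_add (h4.mul_const _) ((h5.mul_const _).const_mul _), integral_mul_const,
        integral_const_mul, integral_mul_const]
      ring
  -- Rational σ make the exceptional set of times common to all strips; continuity of the
  -- mollification then gives all real positions.
  have hall : ∀ᵐ t ∂volume.restrict (Ioo 0 T), ∀ (q : ℚ) (n : ℕ),
      ∫ s in Ioi 0, (b n).normed volume (s - q - c * t) * z (s, t) ≤ ∫ r in Ioo 0 t, ψ r :=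
    ae_all_iff.2 fun q => ae_all_iff.2 fun n => key q n
  have hloc : ∀ᵐ t ∂volume.restrict (Ioo 0 T),
      LocallyIntegrable ((Ioi (0 : ℝ)).indicator fun s => z (s, t)) := by
    have h1 : ∀ᵐ t ∂volume.restrict (Ioo 0 T), ∀ N : ℕ, IntegrableOn (fun s => z (s, t))
        (Ioo 0 (N : ℝ)) := by
      rw [ae_all_iff]
      intro N
      have h2 := hz N
      rw [IntegrableOn, hvol] at h2
      exact h2.prod_left_ae
    filter_upwards [h1] with t ht x
    obtain ⟨N, hN⟩ := exists_nat_gt (x + 1)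
    refine ⟨Iio (x + 1), Iio_mem_nhds (by linarith), ?_⟩
    rw [IntegrableOn, integrable_indicator_iff measurableSet_Ioi, IntegrableOn,
      Measure.restrict_restrict measurableSet_Ioi]
    exact (ht N).mono_set fun s hs => ⟨hs.1, lt_trans hs.2 hN⟩
  have hslice : ∀ᵐ t ∂volume.restrict (Ioo 0 T), ∀ᵐ s ∂volume.restrict (Ioi (0 : ℝ)),
      z (s, t) ≤ ∫ r in Ioo 0 t, ψ r := by
    filter_upwards [hall, hloc] with t h1 h2
    have hconv : ∀ n y, (convolution ((b n).normed volume) ((Ioi (0 : ℝ)).indicator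
        fun s => z (s, t)) (ContinuousLinearMap.lsmul ℝ ℝ) volume) y =
        ∫ s in Ioi 0, (b n).normed volume (s - y) * z (s, t) := by
      intro n y
      rw [convolution_normed_eq, ← integral_indicator measurableSet_Ioi]
      refine integral_congr_ae (Eventually.of_forall fun s => ?_)
      have e : (b n).normed volume (y - s) = (b n).normed volume (s - y) := by
        rw [← (b n).normed_neg, neg_sub]
      by_cases hs : s ∈ Ioi (0 : ℝ)
      · simp only [indicator_of_mem hs, e]
      · simp [indicator_of_notMem hs]
    have hle1 : ∀ n y, (convolution ((b n).normed volume) ((Ioi (0 : ℝ)).indicator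
        fun s => z (s, t)) (ContinuousLinearMap.lsmul ℝ ℝ) volume) y ≤ ∫ r in Ioo 0 t, ψ r := by
      intro n y
      have hcont := (b n).hasCompactSupport_normed.continuous_convolution_left
        (ContinuousLinearMap.lsmul ℝ ℝ) ((b n).continuous_normed (μ := volume)) h2 (μ := volume)
      have hcl : IsClosed {y | (convolution ((b n).normed volume) ((Ioi (0 : ℝ)).indicator
        fun s => z (s, t)) (ContinuousLinearMap.lsmul ℝ ℝ) volume) y ≤ ∫ r in Ioo 0 t, ψ r} :=
        isClosed_le hcont continuous_const
      have hdense : DenseRange fun q : ℚ => (q : ℝ) + c * t :=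
        (Homeomorph.addRight (c * t)).surjective.denseRange.comp Rat.denseRange_cast
          (Homeomorph.addRight (c * t)).continuous
      refine hdense.induction_on (p := fun y => (convolution ((b n).normed volume)
        ((Ioi (0 : ℝ)).indicator fun s => z (s, t)) (ContinuousLinearMap.lsmul ℝ ℝ) volume) y ≤
        ∫ r in Ioo 0 t, ψ r) y hcl fun q => ?_
      rw [hconv]
      refine le_trans (le_of_eq ?_) (h1 q n)
      simp only [sub_sub]
    have hlim := ContDiffBump.ae_convolution_tendsto_right_of_locallyIntegrable (K := 2) hb0
      (Eventually.of_forall fun n => by simp [b, bumpOfRadius]; linarith) h2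
    rw [ae_restrict_iff' measurableSet_Ioi]
    filter_upwards [hlim] with s hs hs0
    rw [indicator_of_mem hs0] at hs
    exact le_of_tendsto' hs fun n => hle1 n s
  rw [ae_setProd_iff_swap]
  have hzs : AEMeasurable (fun r : ℝ × ℝ => z r.swap)
      ((volume.restrict (Ioo 0 T)).prod (volume.restrict (Ioi (0 : ℝ)))) := by
    rw [hvol] at hzm
    exact hzm.prod_swap
  refine ae_prod_le_of_ae_ae_le hzs ?_ hslice
  exact (integrable_primitive hψ).1.aemeasurable.comp_fst

end Characteristics

end

noncomputable section

/-! ### Integrability of the terms of the equations -/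

section Integrability

open Filter Topology

section Mixed

variable {α X E : Type*} [MeasurableSpace α] [MeasurableSpace X] [NormedAddCommGroup E]
  {μ : Measure α} {ν : Measure X} [SFinite ν]

/-- The supremum over a slice exceeds c exactly when the slice of {f > c} has nonzero measure, and
that measure depends measurably on the parameter. -/
lemma measurable_essSup_slice {f : α × X → ℝ≥0∞} (hf : Measurable f) :
    Measurable fun t => essSup (fun x => f (t, x)) ν := by
  refine measurable_of_Ioi fun c => ?_
  have h : (fun t => essSup (fun x => f (t, x)) ν) ⁻¹' Ioi c =
      {t | ν (Prod.mk t ⁻¹' (f ⁻¹' Ioi c)) = 0}ᶜ := by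
    ext t
    rw [mem_preimage, mem_Ioi, ← not_le, mem_compl_iff, not_iff_not]
    have h1 : {x | ¬ f (t, x) ≤ c} = Prod.mk t ⁻¹' (f ⁻¹' Ioi c) := by ext x; simp
    constructor
    · intro h2
      have h3 : ∀ᵐ x ∂ν, f (t, x) ≤ c :=
        (ENNReal.ae_le_essSup fun x => f (t, x)).mono fun x hx => hx.trans h2
      rwa [ae_iff, h1] at h3
    · intro h2
      refine essSup_le_of_ae_le c ?_
      change ∀ᵐ x ∂ν, f (t, x) ≤ c
      rwa [ae_iff, h1]
  rw [h]
  exact (measurable_measure_prodMk_left (hf measurableSet_Ioi) (measurableSet_singleton 0)).compl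

lemma aemeasurable_eLpNorm_top {a : α × X → E} (ha : AEStronglyMeasurable a (μ.prod ν)) :
    AEMeasurable (fun t => eLpNorm (fun x => a (t, x)) ∞ ν) μ := by
  have hm : Measurable fun z => ‖ha.mk a z‖ₑ := ha.stronglyMeasurable_mk.enorm
  refine ⟨fun t => essSup (fun x => ‖ha.mk a (t, x)‖ₑ) ν,
    measurable_essSup_slice (f := fun z => ‖ha.mk a z‖ₑ) hm, ?_⟩
  filter_upwards [Measure.ae_ae_of_ae_prod ha.ae_eq_mk] with t ht
  have h : (fun x => ‖a (t, x)‖ₑ) =ᵐ[ν] fun x => ‖ha.mk a (t, x)‖ₑ := by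
    filter_upwards [ht] with x hx
    rw [hx]
  rw [eLpNorm_exponent_top]
  exact essSup_congr_ae h

end Mixed

variable {d : ℕ} {Ω : Opens (Vec d)} {T : ℝ}

lemma volume_restrict_spaceTime (Ω : Opens (Vec d)) (T : ℝ) :
    (volume.restrict (spaceTime Ω T : Set (ℝ × Vec d)) : Measure (ℝ × Vec d)) =
      (volume.restrict (Ioo 0 T)).prod (volume.restrict (Ω : Set (Vec d))) := by
  rw [Measure.prod_restrict, Measure.volume_eq_prod]; rfl

lemma integrable_integral_inner {E : Type*} [NormedAddCommGroup E] [InnerProductSpace ℝ E]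
    {a : ℝ → Vec d → E} {v : Vec d → E}
    (ha : AEStronglyMeasurable (fun z : ℝ × Vec d => a z.1 z.2)
      ((volume.restrict (Ioo 0 T)).prod (volume.restrict (Ω : Set (Vec d)))))
    (ha1 : ∫⁻ t in Ioo 0 T, eLpNorm (a t) 2 (volume.restrict (Ω : Set (Vec d))) < ∞)
    (hv : MemLp v 2 (volume.restrict (Ω : Set (Vec d)))) :
    IntegrableOn (fun t => ∫ x in Ω, (inner ℝ (a t x) (v x) : ℝ)) (Ioo 0 T) := by
  have hm : AEStronglyMeasurable (fun z : ℝ × Vec d => (inner ℝ (a z.1 z.2) (v z.2) : ℝ))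
      ((volume.restrict (Ioo 0 T)).prod (volume.restrict (Ω : Set (Vec d)))) :=
    ha.inner hv.1.comp_snd
  refine ⟨hm.integral_prod_right', ?_⟩
  calc ∫⁻ t in Ioo 0 T, ‖∫ x in Ω, (inner ℝ (a t x) (v x) : ℝ)‖ₑ
      ≤ ∫⁻ t in Ioo 0 T, eLpNorm (a t) 2 (volume.restrict (Ω : Set (Vec d))) *
          eLpNorm v 2 (volume.restrict (Ω : Set (Vec d))) := by
        refine lintegral_mono_ae ?_
        filter_upwards [ha.prodMk_left] with t ht
        exact enorm_integral_inner_le ht hv.1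
    _ = (∫⁻ t in Ioo 0 T, eLpNorm (a t) 2 (volume.restrict (Ω : Set (Vec d)))) *
          eLpNorm v 2 (volume.restrict (Ω : Set (Vec d))) :=
        lintegral_mul_const' _ _ hv.2.ne
    _ < ∞ := ENNReal.mul_lt_top ha1 hv.2

namespace VelocityClass

variable {u : ℝ → Vec d → Vec d} {Du : ℝ → Vec d → Ten d}

lemma aestronglyMeasurable (hu : VelocityClass Ω T u Du) :
    AEStronglyMeasurable (fun z : ℝ × Vec d => u z.1 z.2)
      ((volume.restrict (Ioo 0 T)).prod (volume.restrict (Ω : Set (Vec d)))) :=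
  volume_restrict_spaceTime Ω T ▸ hu.meas

lemma aestronglyMeasurable_grad (hu : VelocityClass Ω T u Du) :
    AEStronglyMeasurable (fun z : ℝ × Vec d => Du z.1 z.2)
      ((volume.restrict (Ioo 0 T)).prod (volume.restrict (Ω : Set (Vec d)))) :=
  volume_restrict_spaceTime Ω T ▸ hu.meas_grad

lemma memLp (hu : VelocityClass Ω T u Du) : MemLp (fun z : ℝ × Vec d => u z.1 z.2) 2
    ((volume.restrict (Ioo 0 T)).prod (volume.restrict (Ω : Set (Vec d)))) :=
  memLp_two_of_eLpNorm_le hu.aestronglyMeasurable hu.linf_l2.choose_spec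

lemma memLp_grad (hu : VelocityClass Ω T u Du) : MemLp (fun z : ℝ × Vec d => Du z.1 z.2) 2
    ((volume.restrict (Ioo 0 T)).prod (volume.restrict (Ω : Set (Vec d)))) := by
  refine ⟨hu.aestronglyMeasurable_grad, ?_⟩
  have h := lintegral_eLpNorm_two_sq hu.aestronglyMeasurable_grad
  have h2 : ∫⁻ t in Ioo 0 T, eLpNorm (fun x => Du t x) 2
      (volume.restrict (Ω : Set (Vec d))) ^ 2 < ∞ :=
    (lintegral_mono fun _ => le_add_self).trans_lt hu.l2_h1
  rw [h] at h2
  exact (ENNReal.pow_lt_top_iff).1 h2 |>.resolve_right two_ne_zero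

lemma lintegral_eLpNorm_top_lt_top (hu : VelocityClass Ω T u Du) :
    ∫⁻ t in Ioo 0 T, eLpNorm (Du t) ∞ (volume.restrict (Ω : Set (Vec d))) < ∞ :=
  (lintegral_mono fun _ => le_add_self).trans_lt hu.l1_w1inf

lemma aemeasurable_eLpNorm_top_grad (hu : VelocityClass Ω T u Du) :
    AEMeasurable (fun t => eLpNorm (Du t) ∞ (volume.restrict (Ω : Set (Vec d))))
      (volume.restrict (Ioo 0 T)) :=
  aemeasurable_eLpNorm_top (a := fun z : ℝ × Vec d => Du z.1 z.2) hu.aestronglyMeasurable_grad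

lemma eLpNorm_top_grad_lt_top (hu : VelocityClass Ω T u Du) :
    ∀ᵐ t ∂volume.restrict (Ioo 0 T),
      eLpNorm (Du t) ∞ (volume.restrict (Ω : Set (Vec d))) < ∞ :=
  ae_lt_top' hu.aemeasurable_eLpNorm_top_grad hu.lintegral_eLpNorm_top_lt_top.ne

lemma eLpNorm_top_lt_top (hu : VelocityClass Ω T u Du) :
    ∀ᵐ t ∂volume.restrict (Ioo 0 T), eLpNorm (u t) ∞ (volume.restrict (Ω : Set (Vec d))) < ∞ :=
  ae_lt_top' (aemeasurable_eLpNorm_top (a := fun z : ℝ × Vec d => u z.1 z.2)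
    hu.aestronglyMeasurable)
    ((lintegral_mono fun _ => le_self_add).trans_lt hu.l1_w1inf).ne

/-- The product of L^∞(0,T; L²) for u and L¹(0,T; L^∞) for its gradient. The convection term is thus
obtained only as an L¹ function of time with values in L², so the energy identity pairs it with the
bound of u in L^∞(0,T; L²). -/
lemma lintegral_eLpNorm_advect_lt_top (hu : VelocityClass Ω T u Du) :
    ∫⁻ t in Ioo 0 T, eLpNorm (fun x => advect (u t x) (Du t x)) 2
      (volume.restrict (Ω : Set (Vec d))) < ∞ := by
  obtain ⟨M, hM⟩ := hu.linf_l2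
  calc ∫⁻ t in Ioo 0 T, eLpNorm (fun x => advect (u t x) (Du t x)) 2
        (volume.restrict (Ω : Set (Vec d)))
      ≤ ∫⁻ t in Ioo 0 T, eLpNorm (Du t) ∞ (volume.restrict (Ω : Set (Vec d))) * M := by
        refine lintegral_mono_ae ?_
        filter_upwards [hM, hu.aestronglyMeasurable.prodMk_left] with t h1 h2
        refine (eLpNorm_le_eLpNorm_top_mul_eLpNorm 2 (Du t) h2 (fun B a => advect a B) 1
          (Eventually.of_forall fun x => ?_)).trans ?_
        · simpa [← NNReal.coe_le_coe, mul_comm] using norm_advect_le (u t x) (Du t x)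
        · simp only [ENNReal.coe_one, one_mul]
          gcongr
    _ = (∫⁻ t in Ioo 0 T, eLpNorm (Du t) ∞ (volume.restrict (Ω : Set (Vec d)))) * M :=
        lintegral_mul_const' _ _ ENNReal.coe_ne_top
    _ < ∞ := ENNReal.mul_lt_top hu.lintegral_eLpNorm_top_lt_top ENNReal.coe_lt_top

end VelocityClass

namespace DeformationClass

variable {G : ℝ → ℝ → Vec d → Ten d}
  {DG : ℝ → ℝ → Vec d → EuclideanSpace ℝ (Fin d × (Fin d × Fin d))}

lemma lintegral_grad_rpow_le (hG : DeformationClass Ω T G DG) (hd : 2 ≤ d) :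
    ∃ M : ℝ≥0, ∀ᵐ r ∂volume.restrict (Ioi (0 : ℝ) ×ˢ Ioo 0 T),
      ∫⁻ x in Ω, ‖DG r.1 r.2 x‖ₑ ^ d ≤ M := by
  obtain ⟨M, hM⟩ := hG.linf_w1d
  refine ⟨M ^ d, hM.mono fun r hr => ?_⟩
  have h1 := le_add_self.trans hr
  have hd0 : (d : ℝ≥0∞) ≠ 0 := by simp; omega
  rw [eLpNorm_eq_lintegral_rpow_enorm_toReal hd0 (ENNReal.natCast_ne_top d), ENNReal.toReal_natCast,
    one_div, ENNReal.rpow_inv_le_iff (by positivity)] at h1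
  simpa using h1

/-- On a bounded domain L^d embeds in L² since d ≥ 2, and the constant is the same for all ages and
times. -/
lemma eLpNorm_two_grad_le (hG : DeformationClass Ω T G DG) (hd : 2 ≤ d)
    (hΩ : Bornology.IsBounded (Ω : Set (Vec d))) :
    ∃ M : ℝ≥0, ∀ᵐ r ∂volume.restrict (Ioi (0 : ℝ) ×ˢ Ioo 0 T),
      eLpNorm (DG r.1 r.2) 2 (volume.restrict (Ω : Set (Vec d))) ≤ M := by
  obtain ⟨M, hM⟩ := hG.linf_w1d
  have : IsFiniteMeasure (volume.restrict (Ω : Set (Vec d))) := ⟨by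
    rw [Measure.restrict_apply_univ]; exact hΩ.measure_lt_top⟩
  have hd' : (2 : ℝ≥0∞) ≤ d := by exact_mod_cast hd
  set c : ℝ≥0∞ := volume.restrict (Ω : Set (Vec d)) univ ^
    (1 / (2 : ℝ≥0∞).toReal - 1 / (d : ℝ≥0∞).toReal) with hc
  have hcf : c ≠ ∞ := by
    refine ENNReal.rpow_ne_top_of_nonneg ?_ (measure_ne_top _ _)
    simp only [ENNReal.toReal_ofNat, ENNReal.toReal_natCast, sub_nonneg]
    gcongr
    exact_mod_cast hd
  refine ⟨M * c.toNNReal, ?_⟩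
  have hm := (aestronglyMeasurable_comp_assoc hG.meas_grad).prodMk_left
  filter_upwards [hM, hm] with r hr h2
  rw [ENNReal.coe_mul, ENNReal.coe_toNNReal hcf]
  exact (eLpNorm_le_eLpNorm_mul_rpow_measure_univ hd' h2).trans
    (mul_le_mul_left (le_add_self.trans hr) c)

lemma memLp_two_grad (hG : DeformationClass Ω T G DG) (hd : 2 ≤ d)
    (hΩ : Bornology.IsBounded (Ω : Set (Vec d))) (S : ℝ) :
    MemLp (fun z : ℝ × ℝ × Vec d => DG z.1 z.2.1 z.2.2) 2
      (volume.restrict (Ioo 0 S ×ˢ (Ioo 0 T ×ˢ (Ω : Set (Vec d))))) := by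
  obtain ⟨M, hM⟩ := hG.eLpNorm_two_grad_le hd hΩ
  have hsub : Ioo 0 S ×ˢ (Ioo 0 T ×ˢ (Ω : Set (Vec d))) ⊆ ageCylinder Ω T :=
    prod_mono Ioo_subset_Ioi_self subset_rfl
  have hm := hG.meas_grad.mono_measure (Measure.restrict_mono hsub le_rfl)
  refine ⟨hm, ?_⟩
  have hmp := measurePreserving_assoc_restrict (Ioo 0 S) Ω T
  rw [← eLpNorm_comp_measurePreserving hm hmp, eLpNorm_two_eq]
  refine ENNReal.rpow_lt_top_of_nonneg (by positivity) (ne_of_lt ?_)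
  rw [lintegral_prod _ ((hm.comp_measurePreserving hmp).enorm.pow_const 2)]
  calc ∫⁻ r in Ioo 0 S ×ˢ Ioo 0 T, ∫⁻ x in Ω, ‖DG r.1 r.2 x‖ₑ ^ 2
      ≤ ∫⁻ r in Ioo 0 S ×ˢ Ioo 0 T, (M : ℝ≥0∞) ^ 2 := by
        refine lintegral_mono_ae ?_
        filter_upwards [ae_restrict_of_ae_restrict_of_subset
          (prod_mono Ioo_subset_Ioi_self subset_rfl) hM] with r hr
        rw [eLpNorm_two_eq] at hr
        have := pow_le_pow_left' hr 2
        rwa [← ENNReal.rpow_natCast, ← ENNReal.rpow_mul, show (1 / 2 : ℝ) * (2 : ℕ) = 1 by norm_num,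
          ENNReal.rpow_one] at this
    _ < ∞ := by
        rw [setLIntegral_const, Measure.volume_eq_prod, Measure.prod_prod]
        simp only [Real.volume_Ioo]
        finiteness

/-- The right-hand side `u · ∇G - G · ∇u` is integrable for bounded ages. -/
lemma integrableOn_transport {u : ℝ → Vec d → Vec d} {Du : ℝ → Vec d → Ten d}
    (hG : DeformationClass Ω T G DG) (hGb : EssBounded Ω T G) (hu : VelocityClass Ω T u Du)
    (hd : 2 ≤ d) (hΩ : Bornology.IsBounded (Ω : Set (Vec d))) (S : ℝ) :
    IntegrableOn (fun z : ℝ × ℝ × Vec d => advect (u z.2.1 z.2.2) (DG z.1 z.2.1 z.2.2) -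
      tenMul (G z.1 z.2.1 z.2.2) (Du z.2.1 z.2.2)) (Ioo 0 S ×ˢ (Ioo 0 T ×ˢ (Ω : Set (Vec d)))) := by
  obtain ⟨M, hM⟩ := hGb
  have : IsFiniteMeasure (volume.restrict (Ω : Set (Vec d))) := ⟨by
    rw [Measure.restrict_apply_univ]; exact hΩ.measure_lt_top⟩
  have hsub : Ioo 0 S ×ˢ (Ioo 0 T ×ˢ (Ω : Set (Vec d))) ⊆ ageCylinder Ω T :=
    prod_mono Ioo_subset_Ioi_self subset_rfl
  have hvol : (volume.restrict (Ioo 0 S ×ˢ (Ioo 0 T ×ˢ (Ω : Set (Vec d)))) :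
      Measure (ℝ × ℝ × Vec d)) = (volume.restrict (Ioo 0 S)).prod
        ((volume.restrict (Ioo 0 T)).prod (volume.restrict (Ω : Set (Vec d)))) := by
    rw [Measure.prod_restrict, Measure.prod_restrict]; rfl
  have h1 : MemLp (fun z : ℝ × ℝ × Vec d => u z.2.1 z.2.2) 2
      (volume.restrict (Ioo 0 S ×ˢ (Ioo 0 T ×ˢ (Ω : Set (Vec d))))) := by
    rw [hvol]; exact hu.memLp.comp_snd _
  have h2 : MemLp (fun z : ℝ × ℝ × Vec d => Du z.2.1 z.2.2) 2
      (volume.restrict (Ioo 0 S ×ˢ (Ioo 0 T ×ˢ (Ω : Set (Vec d))))) := by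
    rw [hvol]; exact hu.memLp_grad.comp_snd _
  have : IsFiniteMeasure (volume.restrict (Ioo 0 S ×ˢ (Ioo 0 T ×ˢ (Ω : Set (Vec d)))) :
      Measure (ℝ × ℝ × Vec d)) := by rw [hvol]; infer_instance
  have hDG := hG.memLp_two_grad hd hΩ S
  have hGm := hG.meas.mono_measure (Measure.restrict_mono hsub le_rfl)
  have hM' := ae_restrict_of_ae_restrict_of_subset hsub hM
  refine Integrable.sub ?_ ?_
  · refine (h1.norm.integrable_mul hDG.norm).mono' (AEStronglyMeasurable.advect h1.1 hDG.1)
      (Eventually.of_forall fun z => norm_advect_le _ _)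
  · refine ((h2.integrable (by norm_num)).norm.const_mul M).mono' (AEStronglyMeasurable.tenMul hGm h2.1) ?_
    filter_upwards [hM'] with z hz
    exact (norm_tenMul_le _ _).trans (mul_le_mul_of_nonneg_right hz (norm_nonneg _))

lemma integrableOn (hG : DeformationClass Ω T G DG) (hGb : EssBounded Ω T G)
    (hΩ : Bornology.IsBounded (Ω : Set (Vec d))) (S : ℝ) :
    IntegrableOn (fun z : ℝ × ℝ × Vec d => G z.1 z.2.1 z.2.2)
      (Ioo 0 S ×ˢ (Ioo 0 T ×ˢ (Ω : Set (Vec d)))) := by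
  obtain ⟨M, hM⟩ := hGb
  have hsub : Ioo 0 S ×ˢ (Ioo 0 T ×ˢ (Ω : Set (Vec d))) ⊆ ageCylinder Ω T :=
    prod_mono Ioo_subset_Ioi_self subset_rfl
  refine IntegrableOn.of_bound ?_ (hG.meas.mono_measure (Measure.restrict_mono hsub le_rfl)) M
    (ae_restrict_of_ae_restrict_of_subset hsub hM)
  exact (((Metric.isBounded_Ioo 0 S).prod ((Metric.isBounded_Ioo 0 T).prod hΩ))).measure_lt_top

end DeformationClass

end Integrability

end

noncomputable section

/-! ### The difference of two deformation gradients at fixed age and time -/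

section Slices

open Filter Topology

variable {d : ℕ} {Ω : Opens (Vec d)}

lemma HasWeakGrad.sub {ι : Type} [Fintype ι] {g₁ g₂ : Vec d → EuclideanSpace ℝ ι}
    {Dg₁ Dg₂ : Vec d → EuclideanSpace ℝ (Fin d × ι)} (h₁ : HasWeakGrad Ω g₁ Dg₁)
    (h₂ : HasWeakGrad Ω g₂ Dg₂) :
    HasWeakGrad Ω (fun x => g₁ x - g₂ x) (fun x => Dg₁ x - Dg₂ x) where
  locInt := h₁.locInt.sub h₂.locInt
  locInt_grad := h₁.locInt_grad.sub h₂.locInt_grad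
  integral_eq φ i k := by
    have hφ : Continuous fun x => fderiv ℝ φ x (EuclideanSpace.single i 1) :=
      (φ.contDiff.continuous_fderiv (by simp)).clm_apply continuous_const
    have hs : tsupport (fun x => fderiv ℝ φ x (EuclideanSpace.single i 1)) ⊆ tsupport φ :=
      tsupport_fderiv_apply_subset ℝ _
    have i1 : ∀ {g : Vec d → EuclideanSpace ℝ ι}, LocallyIntegrableOn g Ω →
        IntegrableOn (fun x => g x k * fderiv ℝ φ x (EuclideanSpace.single i 1)) Ω :=
      fun hg => integrableOn_mul_of_hasCompactSupport (locallyIntegrableOn_apply hg k) hφ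
        (φ.hasCompactSupport.mono' ((subset_tsupport _).trans hs)) (hs.trans φ.tsupport_subset)
    have i2 : ∀ {g : Vec d → EuclideanSpace ℝ (Fin d × ι)}, LocallyIntegrableOn g Ω →
        IntegrableOn (fun x => g x (i, k) * φ x) Ω :=
      fun hg => integrableOn_mul_of_hasCompactSupport (locallyIntegrableOn_apply hg (i, k))
        φ.continuous φ.hasCompactSupport φ.tsupport_subset
    simp only [PiLp.sub_apply, sub_mul]
    rw [integral_sub (i1 h₁.locInt) (i1 h₂.locInt), integral_sub (i2 h₁.locInt_grad)
      (i2 h₂.locInt_grad), h₁.integral_eq, h₂.integral_eq]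
    ring

lemma toReal_lintegral_enorm_sq {α E : Type*} [MeasurableSpace α] [NormedAddCommGroup E]
    {μ : Measure α} {f : α → E} (hf : AEStronglyMeasurable f μ) :
    (∫⁻ x, ‖f x‖ₑ ^ 2 ∂μ).toReal = ∫ x, ‖f x‖ ^ 2 ∂μ := by
  rw [integral_eq_lintegral_of_nonneg_ae (Eventually.of_forall fun x => by positivity)
    (hf.norm.aemeasurable.pow_const 2).aestronglyMeasurable]
  congr 1
  refine lintegral_congr fun x => ?_
  rw [ENNReal.ofReal_pow (norm_nonneg _), ofReal_norm]

/-- The trilinear estimate in the form that is absorbed by the dissipation. -/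
lemma exists_trilinear_young (hd : 2 ≤ d) (hΩ : Bornology.IsBounded (Ω : Set (Vec d))) (M : ℝ≥0) :
    ∃ C : ℝ, 0 ≤ C ∧ ∀ (v : H10 Ω) {E F : Type} [NormedAddCommGroup E] [NormedAddCommGroup F]
      {h : Vec d → E} {g : Vec d → F},
      AEStronglyMeasurable h (volume.restrict (Ω : Set (Vec d))) →
      AEStronglyMeasurable g (volume.restrict (Ω : Set (Vec d))) →
      ∫⁻ x in Ω, ‖h x‖ₑ ^ d ≤ M → (∀ᵐ x ∂volume.restrict (Ω : Set (Vec d)), ‖g x‖ₑ ≤ M) →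
      ∀ n : ℕ, 2 ≤ n → IntegrableOn (fun x => ‖H10val v x‖ * (‖h x‖ * ‖g x‖)) Ω ∧
        2 * ∫ x in Ω, ‖H10val v x‖ * (‖h x‖ * ‖g x‖) ≤
        (1 / 2) * (∫ x in Ω, ‖H10grad v x‖ ^ 2) +
          C * n * (∫ x in Ω, ‖g x‖ ^ 2) ^ (1 - 1 / (n : ℝ)) := by
  obtain ⟨C, hC⟩ := exists_trilinear_bound hd hΩ M
  -- With e = ‖∇v‖ and X = C √n ‖g‖^{1-1/n}, Young's inequality 2 e X ≤ e²/2 + 2 X² gives this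
  -- constant and turns √n into n.
  refine ⟨2 * C ^ 2, by positivity, ?_⟩
  intro v E F _ _ h g hh hg hhM hgM n hn
  have hfin : IsFiniteMeasure (volume.restrict (Ω : Set (Vec d))) := ⟨by
    rw [Measure.restrict_apply_univ]; exact hΩ.measure_lt_top⟩
  have h1 := hC v hh.enorm hg.enorm hhM hgM n hn
  have hn1 : 0 ≤ 1 - 1 / (n : ℝ) := by
    rw [sub_nonneg, div_le_one (by positivity)]; exact_mod_cast (by omega : 1 ≤ n)
  have hg2 : ∫⁻ x in Ω, ‖g x‖ₑ ^ 2 < ∞ := by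
    calc ∫⁻ x in Ω, ‖g x‖ₑ ^ 2 ≤ ∫⁻ _ in (Ω : Set (Vec d)), (M : ℝ≥0∞) ^ 2 :=
          lintegral_mono_ae (hgM.mono fun x hx => pow_le_pow_left' hx 2)
      _ < ∞ := by
          rw [lintegral_const]
          exact ENNReal.mul_lt_top (by finiteness)
            (measure_lt_top (volume.restrict (Ω : Set (Vec d))) _)
  have hvf := (memLp_H10grad v).2
  have hRf : (C : ℝ≥0∞) * (n : ℝ≥0∞) ^ (1 / 2 : ℝ) *
        eLpNorm (H10grad v) 2 (volume.restrict (Ω : Set (Vec d))) *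
        (∫⁻ x in Ω, ‖g x‖ₑ ^ 2) ^ ((1 - 1 / (n : ℝ)) / 2) ≠ ∞ := by
    have : (∫⁻ x in Ω, ‖g x‖ₑ ^ 2) ^ ((1 - 1 / (n : ℝ)) / 2) ≠ ∞ :=
      ENNReal.rpow_ne_top_of_nonneg (by positivity) hg2.ne
    have h3 : (n : ℝ≥0∞) ^ (1 / 2 : ℝ) ≠ ∞ :=
      ENNReal.rpow_ne_top_of_nonneg (by positivity) (ENNReal.natCast_ne_top n)
    have h4 := hvf.ne
    finiteness
  have hm : AEStronglyMeasurable (fun x => ‖H10val v x‖ * (‖h x‖ * ‖g x‖))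
      (volume.restrict (Ω : Set (Vec d))) :=
    (memLp_H10val v).1.norm.mul (hh.norm.mul hg.norm)
  have he : ∀ x, ‖‖H10val v x‖ * (‖h x‖ * ‖g x‖)‖ₑ = ‖H10val v x‖ₑ * (‖h x‖ₑ * ‖g x‖ₑ) :=
    fun x => by simp only [enorm_mul, enorm_norm]
  have hi : IntegrableOn (fun x => ‖H10val v x‖ * (‖h x‖ * ‖g x‖)) Ω := by
    refine ⟨hm, ?_⟩
    rw [HasFiniteIntegral]
    simp only [he]
    exact h1.trans_lt hRf.lt_top
  refine ⟨hi, ?_⟩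
  have hlhs : ∫ x in Ω, ‖H10val v x‖ * (‖h x‖ * ‖g x‖) =
      (∫⁻ x in Ω, ‖H10val v x‖ₑ * (‖h x‖ₑ * ‖g x‖ₑ)).toReal := by
    rw [integral_eq_lintegral_of_nonneg_ae (Eventually.of_forall fun x => by positivity) hm]
    congr 1
    refine lintegral_congr fun x => ?_
    rw [← he, Real.enorm_of_nonneg (by positivity)]
  have h2 := ENNReal.toReal_mono hRf h1
  rw [← hlhs, ENNReal.toReal_mul, ENNReal.toReal_mul, ENNReal.toReal_mul, ENNReal.coe_toReal,
    ← ENNReal.toReal_rpow, ← ENNReal.toReal_rpow, toReal_lintegral_enorm_sq hg,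
    ENNReal.toReal_natCast] at h2
  set e := (eLpNorm (H10grad v) 2 (volume.restrict (Ω : Set (Vec d)))).toReal with he'
  have hD : ∫ x in Ω, ‖H10grad v x‖ ^ 2 = e ^ 2 := by
    rw [← toReal_lintegral_enorm_sq (memLp_H10grad v).1, he', eLpNorm_two_eq, ← ENNReal.toReal_pow,
      ← ENNReal.rpow_natCast, ← ENNReal.rpow_mul]
    norm_num
  set y := ∫ x in Ω, ‖g x‖ ^ 2 with hy
  have hy0 : 0 ≤ y := integral_nonneg fun x => by positivity
  have hw : (y ^ ((1 - 1 / (n : ℝ)) / 2)) ^ 2 = y ^ (1 - 1 / (n : ℝ)) := by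
    rw [← Real.rpow_natCast, ← Real.rpow_mul hy0]; norm_num
  have hnn : ((n : ℝ) ^ (1 / 2 : ℝ)) ^ 2 = n := by
    rw [← Real.rpow_natCast, ← Real.rpow_mul (by positivity)]; norm_num
  have hCn : 2 * (C : ℝ) ^ 2 * n * y ^ (1 - 1 / (n : ℝ)) =
      2 * (C * (n : ℝ) ^ (1 / 2 : ℝ) * y ^ ((1 - 1 / (n : ℝ)) / 2)) ^ 2 := by
    rw [mul_pow, mul_pow, hw, hnn]; ring
  rw [hD, hCn]
  nlinarith [sq_nonneg (e - 2 * (C * (n : ℝ) ^ (1 / 2 : ℝ) * y ^ ((1 - 1 / (n : ℝ)) / 2)))]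

lemma integrable_inner_advect {ι : Type} [Fintype ι] {α : Type*} [MeasurableSpace α]
    {μ : Measure α} {a : α → Vec d} {B : α → EuclideanSpace ℝ (Fin d × ι)}
    {c : α → EuclideanSpace ℝ ι} {M : ℝ} (ha : MemLp a 2 μ) (hB : MemLp B 2 μ)
    (hc : AEStronglyMeasurable c μ) (hM : ∀ᵐ x ∂μ, ‖c x‖ ≤ M) :
    Integrable (fun x => (inner ℝ (advect (a x) (B x)) (c x) : ℝ)) μ := by
  refine ((ha.norm.integrable_mul hB.norm).mul_const M).mono'
    ((AEStronglyMeasurable.advect ha.1 hB.1).inner hc) ?_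
  filter_upwards [hM] with x hx
  exact (norm_inner_le_norm _ _).trans (mul_le_mul (norm_advect_le _ _) hx (norm_nonneg _)
    (mul_nonneg (norm_nonneg _) (norm_nonneg _)))

lemma integrable_inner_tenMul {α : Type*} [MeasurableSpace α] {μ : Measure α} [IsFiniteMeasure μ]
    {A B c : α → Ten d} {K M : ℝ} (hB : MemLp B 2 μ) (hA : AEStronglyMeasurable A μ)
    (hK : ∀ᵐ x ∂μ, ‖A x‖ ≤ K) (hc : AEStronglyMeasurable c μ) (hM : ∀ᵐ x ∂μ, ‖c x‖ ≤ M) :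
    Integrable (fun x => (inner ℝ (tenMul (A x) (B x)) (c x) : ℝ)) μ := by
  refine (((hB.integrable (by norm_num)).norm.const_mul K).mul_const M).mono'
    ((AEStronglyMeasurable.tenMul hA hB.1).inner hc) ?_
  filter_upwards [hK, hM] with x h1 h2
  have h3 : ‖tenMul (A x) (B x)‖ ≤ K * ‖B x‖ :=
    (norm_tenMul_le _ _).trans (mul_le_mul_of_nonneg_right h1 (norm_nonneg _))
  exact (norm_inner_le_norm _ _).trans (mul_le_mul h3 h2 (norm_nonneg _)
    ((norm_nonneg _).trans h3))

/-- The growth of `∫ |g₁ - g₂|²` at fixed age and time. -/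
lemma exists_transport_slice_bound (hd : 2 ≤ d) (hΩ : Bornology.IsBounded (Ω : Set (Vec d)))
    (M : ℝ≥0) : ∃ C : ℝ, 0 ≤ C ∧ ∀ {u₁ u₂ : Vec d → Vec d} {Du₁ Du₂ : Vec d → Ten d}
      {g₁ g₂ : Vec d → Ten d} {Dg₁ Dg₂ : Vec d → EuclideanSpace ℝ (Fin d × (Fin d × Fin d))},
      (∃ v ∈ V Ω, H10val v =ᵐ[volume.restrict (Ω : Set (Vec d))] u₁ ∧
        H10grad v =ᵐ[volume.restrict (Ω : Set (Vec d))] Du₁) →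
      (∃ v ∈ V Ω, H10val v =ᵐ[volume.restrict (Ω : Set (Vec d))] u₂ ∧
        H10grad v =ᵐ[volume.restrict (Ω : Set (Vec d))] Du₂) →
      HasWeakGrad Ω g₁ Dg₁ → HasWeakGrad Ω g₂ Dg₂ →
      AEStronglyMeasurable g₁ (volume.restrict (Ω : Set (Vec d))) →
      AEStronglyMeasurable g₂ (volume.restrict (Ω : Set (Vec d))) →
      (∀ᵐ x ∂volume.restrict (Ω : Set (Vec d)), ‖g₁ x‖ ≤ M) →
      (∀ᵐ x ∂volume.restrict (Ω : Set (Vec d)), ‖g₂ x‖ ≤ M) →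
      MemLp Dg₁ 2 (volume.restrict (Ω : Set (Vec d))) →
      MemLp Dg₂ 2 (volume.restrict (Ω : Set (Vec d))) →
      ∫⁻ x in Ω, ‖Dg₂ x‖ₑ ^ d ≤ M →
      eLpNorm Du₁ ∞ (volume.restrict (Ω : Set (Vec d))) < ∞ → ∀ n : ℕ, 2 ≤ n →
      -(2 * ∫ x in Ω, (inner ℝ ((advect (u₁ x) (Dg₁ x) - tenMul (g₁ x) (Du₁ x)) -
        (advect (u₂ x) (Dg₂ x) - tenMul (g₂ x) (Du₂ x))) (g₁ x - g₂ x) : ℝ)) ≤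
      (∫ x in Ω, ‖Du₁ x - Du₂ x‖ ^ 2) + C * n * (∫ x in Ω, ‖g₁ x - g₂ x‖ ^ 2) ^ (1 - 1 / (n : ℝ)) +
        (2 * (eLpNorm Du₁ ∞ (volume.restrict (Ω : Set (Vec d)))).toReal + 2 * M ^ 2) *
          ∫ x in Ω, ‖g₁ x - g₂ x‖ ^ 2 := by
  obtain ⟨C, hC0, hC⟩ := exists_trilinear_young hd hΩ (2 * M)
  refine ⟨C, hC0, ?_⟩
  rintro u₁ u₂ Du₁ Du₂ g₁ g₂ Dg₁ Dg₂ ⟨v₁, hv₁, e₁, f₁⟩ ⟨v₂, hv₂, e₂, f₂⟩ hg₁ hg₂ hm₁ hm₂ hM₁ hM₂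
    hD₁ hD₂ hDM hA n hn
  have hfin : IsFiniteMeasure (volume.restrict (Ω : Set (Vec d))) := ⟨by
    rw [Measure.restrict_apply_univ]; exact hΩ.measure_lt_top⟩
  set A := (eLpNorm Du₁ ∞ (volume.restrict (Ω : Set (Vec d)))).toReal with hAdef
  have hA' : ∀ᵐ x ∂volume.restrict (Ω : Set (Vec d)), ‖Du₁ x‖ ≤ A := by
    have h := ae_le_eLpNormEssSup (f := Du₁) (μ := volume.restrict (Ω : Set (Vec d)))
    filter_upwards [h] with x hx
    rw [← eLpNorm_exponent_top, ← ofReal_norm] at hx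
    exact (ENNReal.ofReal_le_iff_le_toReal hA.ne).1 hx
  have hgM : ∀ᵐ x ∂volume.restrict (Ω : Set (Vec d)), ‖g₁ x - g₂ x‖ ≤ 2 * M := by
    filter_upwards [hM₁, hM₂] with x h1 h2
    exact (norm_sub_le _ _).trans (by linarith)
  have hgMe : ∀ᵐ x ∂volume.restrict (Ω : Set (Vec d)), ‖g₁ x - g₂ x‖ₑ ≤ ((2 * M : ℝ≥0) : ℝ≥0∞) := by
    filter_upwards [hgM] with x hx
    rw [enorm_le_coe, ← NNReal.coe_le_coe]
    simpa using hx
  have hgm : AEStronglyMeasurable (fun x => g₁ x - g₂ x) (volume.restrict (Ω : Set (Vec d))) :=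
    hm₁.sub hm₂
  have hDg : MemLp (fun x => Dg₁ x - Dg₂ x) 2 (volume.restrict (Ω : Set (Vec d))) := hD₁.sub hD₂
  have hval : H10val (v₁ - v₂) =ᵐ[volume.restrict (Ω : Set (Vec d))] fun x => u₁ x - u₂ x := by
    have h := Lp.coeFn_sub v₁.1.fst v₂.1.fst
    filter_upwards [h, e₁, e₂] with x h1 h2 h3
    rw [← h2, ← h3]; exact h1
  have hgrad : H10grad (v₁ - v₂) =ᵐ[volume.restrict (Ω : Set (Vec d))] fun x => Du₁ x - Du₂ x := by
    have h := Lp.coeFn_sub v₁.1.snd v₂.1.snd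
    filter_upwards [h, f₁, f₂] with x h1 h2 h3
    rw [← h2, ← h3]; exact h1
  have hzero := integral_inner_advect_weakGrad_eq_zero hΩ (hg₁.sub hg₂) hgm hgMe hDg hv₁
  obtain ⟨hi, htri⟩ := hC (v₁ - v₂) hD₂.1 hgm (hDM.trans (by
    norm_cast; exact le_mul_of_one_le_left (by positivity) (by norm_num))) hgMe n hn
  have hdiss : ∫ x in Ω, ‖H10grad (v₁ - v₂) x‖ ^ 2 = ∫ x in Ω, ‖Du₁ x - Du₂ x‖ ^ 2 :=
    integral_congr_ae (hgrad.mono fun x hx => by simp only [hx])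
  rw [hdiss] at htri
  have i0 := integrable_inner_advect (memLp_H10val v₁) hDg hgm hgM
  have i1 : IntegrableOn (fun x => ‖g₁ x - g₂ x‖ ^ 2) Ω :=
    (MemLp.of_bound hgm _ hgM : MemLp _ 2 _).integrable_norm_pow (by norm_num)
  have i2 : IntegrableOn (fun x => ‖Du₁ x - Du₂ x‖ ^ 2) Ω :=
    ((memLp_H10grad (v₁ - v₂)).ae_eq hgrad).integrable_norm_pow (by norm_num)
  have hle : ∀ᵐ x ∂volume.restrict (Ω : Set (Vec d)),
      -(2 * (inner ℝ ((advect (u₁ x) (Dg₁ x) - tenMul (g₁ x) (Du₁ x)) -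
        (advect (u₂ x) (Dg₂ x) - tenMul (g₂ x) (Du₂ x))) (g₁ x - g₂ x) : ℝ)) ≤
      -2 * inner ℝ (advect (H10val v₁ x) (Dg₁ x - Dg₂ x)) (g₁ x - g₂ x) +
        (2 * (‖H10val (v₁ - v₂) x‖ * (‖Dg₂ x‖ * ‖g₁ x - g₂ x‖)) +
        ((1 / 2) * ‖Du₁ x - Du₂ x‖ ^ 2 + (2 * A + 2 * M ^ 2) * ‖g₁ x - g₂ x‖ ^ 2)) := by
    filter_upwards [hA', hM₂, hval, e₁] with x h1 h2 h3 h4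
    -- The splitting lets u₁ carry the gradient of the difference, so that this term integrates to
    -- zero, while u₁ - u₂ meets the gradient of g₂ and is left to the trilinear estimate. In the
    -- product terms g₁ - g₂ meets the bounded ∇u₁, and ∇u₁ - ∇u₂ meets the bounded g₂.
    have hN : (advect (u₁ x) (Dg₁ x) - tenMul (g₁ x) (Du₁ x)) -
        (advect (u₂ x) (Dg₂ x) - tenMul (g₂ x) (Du₂ x)) =
        advect (u₁ x) (Dg₁ x - Dg₂ x) + (advect (u₁ x - u₂ x) (Dg₂ x) -
          tenMul (g₁ x - g₂ x) (Du₁ x) - tenMul (g₂ x) (Du₁ x - Du₂ x)) := by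
      rw [advect_sub_right, advect_sub_left, tenMul_sub_left, tenMul_sub_right]; abel
    rw [hN, inner_add_left, h4, h3]
    have hb : |(inner ℝ (advect (u₁ x - u₂ x) (Dg₂ x) - tenMul (g₁ x - g₂ x) (Du₁ x) -
        tenMul (g₂ x) (Du₁ x - Du₂ x)) (g₁ x - g₂ x) : ℝ)| ≤
        (‖u₁ x - u₂ x‖ * ‖Dg₂ x‖ + ‖g₁ x - g₂ x‖ * A + M * ‖Du₁ x - Du₂ x‖) * ‖g₁ x - g₂ x‖ := by
      refine (abs_real_inner_le_norm _ _).trans (mul_le_mul_of_nonneg_right ?_ (norm_nonneg _))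
      refine (norm_sub_le _ _).trans (add_le_add ((norm_sub_le _ _).trans
        (add_le_add (norm_advect_le _ _) ?_)) ?_)
      · exact (norm_tenMul_le _ _).trans (mul_le_mul_of_nonneg_left h1 (norm_nonneg _))
      · exact (norm_tenMul_le _ _).trans (mul_le_mul_of_nonneg_right h2 (norm_nonneg _))
    have hb' := (abs_le.1 hb).1
    -- The product 2 M |∇u₁-∇u₂| |g₁-g₂| is at most half of |∇u₁-∇u₂|² plus 2 M² |g₁-g₂|². The other
    -- half of the dissipation is spent by the trilinear estimate, so its total coefficient is 1.
    nlinarith [sq_nonneg (‖Du₁ x - Du₂ x‖ - 2 * (M * ‖g₁ x - g₂ x‖))]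
  have i3 : IntegrableOn (fun x => (1 / 2) * ‖Du₁ x - Du₂ x‖ ^ 2 +
      (2 * A + 2 * M ^ 2) * ‖g₁ x - g₂ x‖ ^ 2) Ω := (i2.const_mul _).add (i1.const_mul _)
  have i4 : IntegrableOn (fun x => 2 * (‖H10val (v₁ - v₂) x‖ * (‖Dg₂ x‖ * ‖g₁ x - g₂ x‖)) +
        ((1 / 2) * ‖Du₁ x - Du₂ x‖ ^ 2 + (2 * A + 2 * M ^ 2) * ‖g₁ x - g₂ x‖ ^ 2)) Ω :=
    (hi.const_mul 2).add i3
  have i5 : IntegrableOn (fun x => -2 * (inner ℝ (advect (H10val v₁ x) (Dg₁ x - Dg₂ x))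
      (g₁ x - g₂ x) : ℝ)) Ω := i0.const_mul (-2)
  have j1 : IntegrableOn (fun x => (inner ℝ ((advect (u₁ x) (Dg₁ x) - tenMul (g₁ x) (Du₁ x)) -
        (advect (u₂ x) (Dg₂ x) - tenMul (g₂ x) (Du₂ x))) (g₁ x - g₂ x) : ℝ)) Ω := by
    simp only [inner_sub_left]
    refine Integrable.sub (Integrable.sub ?_ ?_) (Integrable.sub ?_ ?_)
    · exact integrable_inner_advect ((memLp_H10val v₁).ae_eq e₁) hD₁ hgm hgM
    · exact integrable_inner_tenMul ((memLp_H10grad v₁).ae_eq f₁) hm₁ hM₁ hgm hgM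
    · exact integrable_inner_advect ((memLp_H10val v₂).ae_eq e₂) hD₂ hgm hgM
    · exact integrable_inner_tenMul ((memLp_H10grad v₂).ae_eq f₂) hm₂ hM₂ hgm hgM
  have hmono := integral_mono_ae (j1.const_mul 2).neg (i5.add i4) hle
  simp only [Pi.neg_apply, Pi.add_apply] at hmono
  rw [integral_neg, integral_const_mul, integral_add i5 i4, integral_const_mul, hzero,
    integral_add (hi.const_mul 2) i3, integral_const_mul, integral_add (i2.const_mul _)
    (i1.const_mul _), integral_const_mul, integral_const_mul] at hmono
  linarith

end Slices

end

noncomputable section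

/-! ### The difference of two deformation gradients -/

section TransportDifference

open Filter Topology

variable {d : ℕ} {Ω : Opens (Vec d)} {T : ℝ}

lemma integrableOn_inner_ageCylinder {H k : ℝ × ℝ × Vec d → Ten d}
    (hH : ∀ S, IntegrableOn H (Ioo 0 S ×ˢ (Ioo 0 T ×ˢ (Ω : Set (Vec d)))))
    (hk : Continuous k) (hc : HasCompactSupport k) :
    IntegrableOn (fun z => (inner ℝ (H z) (k z) : ℝ)) (ageCylinder Ω T) := by
  obtain ⟨C, hC⟩ := hk.bounded_above_of_compact_support hc
  obtain ⟨S, hS⟩ := (hc.isCompact.image continuous_fst).bddAbove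
  refine integrableOn_ageCylinder_of_age_le (S := S + 1) ?_ fun z hz => ?_
  · refine ((hH (S + 1)).norm.mul_const C).mono' ((hH (S + 1)).1.inner hk.aestronglyMeasurable)
      (Eventually.of_forall fun z => ?_)
    exact (norm_inner_le_norm _ _).trans (mul_le_mul_of_nonneg_left (hC z) (norm_nonneg _))
  · have hz0 : k z = 0 := by
      by_contra hne
      have := hS ⟨z, subset_tsupport _ hne, rfl⟩
      linarith
    rw [hz0, inner_zero_right]

/-- Both solutions have the same data at t = 0 and at s = 0, so the right sides cancel, while the
test tensors still need not vanish there: the difference has zero data. The pairings of each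
solution have to be integrable for the integrals to be subtracted. -/
lemma weakTransport_sub {We : ℝ} {Gold : ℝ → Vec d → Ten d} {u₁ u₂ : ℝ → Vec d → Vec d}
    {Du₁ Du₂ : ℝ → Vec d → Ten d} {G₁ G₂ : ℝ → ℝ → Vec d → Ten d}
    {DG₁ DG₂ : ℝ → ℝ → Vec d → EuclideanSpace ℝ (Fin d × (Fin d × Fin d))}
    (hG₁ : ∀ S, IntegrableOn (fun z : ℝ × ℝ × Vec d => G₁ z.1 z.2.1 z.2.2)
      (Ioo 0 S ×ˢ (Ioo 0 T ×ˢ (Ω : Set (Vec d)))))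
    (hG₂ : ∀ S, IntegrableOn (fun z : ℝ × ℝ × Vec d => G₂ z.1 z.2.1 z.2.2)
      (Ioo 0 S ×ˢ (Ioo 0 T ×ˢ (Ω : Set (Vec d)))))
    (hN₁ : ∀ S, IntegrableOn (fun z : ℝ × ℝ × Vec d => advect (u₁ z.2.1 z.2.2)
      (DG₁ z.1 z.2.1 z.2.2) - tenMul (G₁ z.1 z.2.1 z.2.2) (Du₁ z.2.1 z.2.2))
      (Ioo 0 S ×ˢ (Ioo 0 T ×ˢ (Ω : Set (Vec d)))))
    (hN₂ : ∀ S, IntegrableOn (fun z : ℝ × ℝ × Vec d => advect (u₂ z.2.1 z.2.2)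
      (DG₂ z.1 z.2.1 z.2.2) - tenMul (G₂ z.1 z.2.1 z.2.2) (Du₂ z.2.1 z.2.2))
      (Ioo 0 S ×ˢ (Ioo 0 T ×ˢ (Ω : Set (Vec d)))))
    (h₁ : WeakTransport Ω T We Gold u₁ Du₁ G₁ DG₁) (h₂ : WeakTransport Ω T We Gold u₂ Du₂ G₂ DG₂)
    (ψ : 𝓓(ageTestDomain Ω T, Ten d)) :
    ∫ z in ageCylinder Ω T, (-inner ℝ (G₁ z.1 z.2.1 z.2.2 - G₂ z.1 z.2.1 z.2.2)
      (deriv (fun r => ψ (z.1, r, z.2.2)) z.2.1 +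
        (1 / We) • deriv (fun r => ψ (r, z.2.1, z.2.2)) z.1) +
      inner ℝ ((advect (u₁ z.2.1 z.2.2) (DG₁ z.1 z.2.1 z.2.2) -
        tenMul (G₁ z.1 z.2.1 z.2.2) (Du₁ z.2.1 z.2.2)) -
        (advect (u₂ z.2.1 z.2.2) (DG₂ z.1 z.2.1 z.2.2) -
        tenMul (G₂ z.1 z.2.1 z.2.2) (Du₂ z.2.1 z.2.2))) (ψ z)) = 0 := by
  have e1 := h₁ ψ
  have e2 := h₂ ψ
  have hψ : Differentiable ℝ ψ := ψ.contDiff.differentiable (by simp)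
  simp only [deriv_time_add_deriv_age hψ] at e1 e2 ⊢
  have hk : Continuous fun z => fderiv ℝ ψ z (charDir d We) :=
    (ψ.contDiff.continuous_fderiv (by simp)).clm_apply continuous_const
  have hkc : HasCompactSupport fun z => fderiv ℝ ψ z (charDir d We) :=
    ψ.hasCompactSupport.fderiv_apply ℝ _
  have i1 := (integrableOn_inner_ageCylinder hG₁ hk hkc).neg.add
    (integrableOn_inner_ageCylinder hN₁ ψ.continuous ψ.hasCompactSupport)
  have i2 := (integrableOn_inner_ageCylinder hG₂ hk hkc).neg.add
    (integrableOn_inner_ageCylinder hN₂ ψ.continuous ψ.hasCompactSupport)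
  have e3 := integral_sub i1 i2
  simp only [Pi.add_apply, Pi.neg_apply] at e3
  rw [e1, e2, sub_self] at e3
  refine Eq.trans (integral_congr_ae (Eventually.of_forall fun z => ?_)) e3
  simp only [inner_sub_left]
  ring

variable {u₁ u₂ : ℝ → Vec d → Vec d} {Du₁ Du₂ : ℝ → Vec d → Ten d}
  {G₁ G₂ : ℝ → ℝ → Vec d → Ten d}
  {DG₁ DG₂ : ℝ → ℝ → Vec d → EuclideanSpace ℝ (Fin d × (Fin d × Fin d))}

lemma integrableOn_dissipation (hu₁ : VelocityClass Ω T u₁ Du₁) (hu₂ : VelocityClass Ω T u₂ Du₂) :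
    IntegrableOn (fun t => ∫ x in Ω, ‖Du₁ t x - Du₂ t x‖ ^ 2) (Ioo 0 T) := by
  have h := (hu₁.memLp_grad.sub hu₂.memLp_grad).integrable_norm_pow (by norm_num)
  exact h.integral_prod_left

/-- The essential supremum over all ages of `∫ |G₁ - G₂|²` and its integral inequality. -/
lemma exists_deformation_difference (hd : 2 ≤ d) (hΩ : Bornology.IsBounded (Ω : Set (Vec d)))
    {We : ℝ} {Gold : ℝ → Vec d → Ten d}
    (hu₁ : VelocityClass Ω T u₁ Du₁) (hu₂ : VelocityClass Ω T u₂ Du₂)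
    (hs₁ : SolenoidalNoSlip Ω T u₁ Du₁) (hs₂ : SolenoidalNoSlip Ω T u₂ Du₂)
    (hG₁ : DeformationClass Ω T G₁ DG₁) (hG₂ : DeformationClass Ω T G₂ DG₂)
    (hb₁ : EssBounded Ω T G₁) (hb₂ : EssBounded Ω T G₂)
    (h₁ : WeakTransport Ω T We Gold u₁ Du₁ G₁ DG₁)
    (h₂ : WeakTransport Ω T We Gold u₂ Du₂ G₂ DG₂) :
    ∃ (Z : ℝ → ℝ) (C K : ℝ), 0 ≤ C ∧ 0 ≤ K ∧ (∀ t, 0 ≤ Z t) ∧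
      AEStronglyMeasurable Z (volume.restrict (Ioo 0 T)) ∧
      (∀ᵐ t ∂volume.restrict (Ioo 0 T), Z t ≤ K) ∧
      (∀ᵐ r ∂volume.restrict (Ioi (0 : ℝ) ×ˢ Ioo 0 T),
        ∫ x in Ω, ‖G₁ r.1 r.2 x - G₂ r.1 r.2 x‖ ^ 2 ≤ Z r.2) ∧
      ∀ n : ℕ, 2 ≤ n → ∀ᵐ t ∂volume.restrict (Ioo 0 T),
        Z t ≤ ∫ r in Ioo 0 t, ((∫ x in Ω, ‖Du₁ r x - Du₂ r x‖ ^ 2) +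
          C * n * Z r ^ (1 - 1 / (n : ℝ)) +
          (2 * (eLpNorm (Du₁ r) ∞ (volume.restrict (Ω : Set (Vec d)))).toReal + C) * Z r) := by
  have hfin : IsFiniteMeasure (volume.restrict (Ω : Set (Vec d))) := ⟨by
    rw [Measure.restrict_apply_univ]; exact hΩ.measure_lt_top⟩
  obtain ⟨M, hM₁, hM₂, hMd⟩ : ∃ M : ℝ≥0,
      (∀ᵐ z ∂volume.restrict (ageCylinder Ω T), ‖G₁ z.1 z.2.1 z.2.2‖ ≤ M) ∧
      (∀ᵐ z ∂volume.restrict (ageCylinder Ω T), ‖G₂ z.1 z.2.1 z.2.2‖ ≤ M) ∧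
      ∀ᵐ r ∂volume.restrict (Ioi (0 : ℝ) ×ˢ Ioo 0 T), ∫⁻ x in Ω, ‖DG₂ r.1 r.2 x‖ₑ ^ d ≤ M := by
    obtain ⟨M₁, h1⟩ := hb₁
    obtain ⟨M₂, h2⟩ := hb₂
    obtain ⟨M₃, h3⟩ := hG₂.lintegral_grad_rpow_le hd
    refine ⟨M₁.toNNReal + M₂.toNNReal + M₃, h1.mono fun z hz => ?_, h2.mono fun z hz => ?_,
      h3.mono fun r hr => hr.trans (by norm_cast; exact le_add_self)⟩
    · push_cast
      linarith [le_max_left M₁ 0, Real.coe_toNNReal' M₁, M₂.toNNReal.coe_nonneg, M₃.coe_nonneg]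
    · push_cast
      linarith [le_max_left M₂ 0, Real.coe_toNNReal' M₂, M₁.toNNReal.coe_nonneg, M₃.coe_nonneg]
  obtain ⟨C, hC0, hC⟩ := exists_transport_slice_bound (Ω := Ω) hd hΩ M
  let G : ℝ × ℝ × Vec d → Ten d := fun z => G₁ z.1 z.2.1 z.2.2 - G₂ z.1 z.2.1 z.2.2
  let N : ℝ × ℝ × Vec d → Ten d := fun z => (advect (u₁ z.2.1 z.2.2) (DG₁ z.1 z.2.1 z.2.2) -
        tenMul (G₁ z.1 z.2.1 z.2.2) (Du₁ z.2.1 z.2.2)) -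
        (advect (u₂ z.2.1 z.2.2) (DG₂ z.1 z.2.1 z.2.2) -
        tenMul (G₂ z.1 z.2.1 z.2.2) (Du₂ z.2.1 z.2.2))
  have hGm : AEStronglyMeasurable G (volume.restrict (ageCylinder Ω T)) := hG₁.meas.sub hG₂.meas
  have hGM : ∀ᵐ z ∂volume.restrict (ageCylinder Ω T), ‖G z‖ ≤ 2 * M := by
    filter_upwards [hM₁, hM₂] with z h1 h2
    exact (norm_sub_le _ _).trans (by linarith)
  have hN₁ := fun S => hG₁.integrableOn_transport hb₁ hu₁ hd hΩ S
  have hN₂ := fun S => hG₂.integrableOn_transport hb₂ hu₂ hd hΩ S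
  have hGi₁ := fun S => hG₁.integrableOn hb₁ hΩ S
  have hGi₂ := fun S => hG₂.integrableOn hb₂ hΩ S
  have hGi : ∀ S, IntegrableOn G (Ioo 0 S ×ˢ (Ioo 0 T ×ˢ (Ω : Set (Vec d)))) :=
    fun S => (hGi₁ S).sub (hGi₂ S)
  have hNi : ∀ S, IntegrableOn N (Ioo 0 S ×ˢ (Ioo 0 T ×ˢ (Ω : Set (Vec d)))) :=
    fun S => (hN₁ S).sub (hN₂ S)
  have hsq := weak_transport_norm_sq hGm hGM hGi hNi
    (weakTransport_sub hGi₁ hGi₂ hN₁ hN₂ h₁ h₂)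
  have hsub : ∀ S, Ioo 0 S ×ˢ (Ioo 0 T ×ˢ (Ω : Set (Vec d))) ⊆ ageCylinder Ω T := fun S =>
    prod_mono Ioo_subset_Ioi_self subset_rfl
  have hAi : ∀ S, IntegrableOn (fun z => ‖G z‖ ^ 2) (Ioo 0 S ×ˢ (Ioo 0 T ×ˢ (Ω : Set (Vec d)))) := by
    intro S
    have h3 : IntegrableOn (fun z => ‖G z‖ * ‖G z‖)
        (Ioo 0 S ×ˢ (Ioo 0 T ×ˢ (Ω : Set (Vec d)))) :=
      (hGi S).norm.mul_bdd (hGi S).1.norm (c := 2 * M) (by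
        filter_upwards [ae_restrict_of_ae_restrict_of_subset (hsub S) hGM] with z hz
        rwa [norm_norm])
    simpa only [← sq] using h3
  have hPi : ∀ S, IntegrableOn (fun z => (inner ℝ (N z) (G z) : ℝ))
      (Ioo 0 S ×ˢ (Ioo 0 T ×ˢ (Ω : Set (Vec d)))) := by
    intro S
    refine ((hNi S).norm.mul_const (2 * M)).mono' ((hNi S).1.inner (hGi S).1) ?_
    filter_upwards [ae_restrict_of_ae_restrict_of_subset (hsub S) hGM] with z hz
    exact (norm_inner_le_norm _ _).trans (mul_le_mul_of_nonneg_left hz (norm_nonneg _))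
  let z : ℝ × ℝ → ℝ := fun r => ∫ x in Ω, ‖G (r.1, r.2, x)‖ ^ 2
  let ρ : ℝ × ℝ → ℝ := fun r => ∫ x in Ω, (inner ℝ (N (r.1, r.2, x)) (G (r.1, r.2, x)) : ℝ)
  have hzi : ∀ S, IntegrableOn z (Ioo 0 S ×ˢ Ioo 0 T) := fun S =>
    (integrable_assoc (hAi S)).integral_prod_left
  have hρi : ∀ S, IntegrableOn ρ (Ioo 0 S ×ˢ Ioo 0 T) := fun S =>
    (integrable_assoc (hPi S)).integral_prod_left
  have hzm : AEStronglyMeasurable z (volume.restrict (Ioi (0 : ℝ) ×ˢ Ioo 0 T)) :=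
    ((aestronglyMeasurable_comp_assoc hGm).norm.aemeasurable.pow_const
      2).aestronglyMeasurable.integral_prod_right'
  have hz0 : ∀ r, 0 ≤ z r := fun r => integral_nonneg fun x => by positivity
  set K : ℝ := (2 * M) ^ 2 * (volume.restrict (Ω : Set (Vec d))).real univ with hK
  have hK0 : 0 ≤ K := by positivity
  have hzK : ∀ᵐ r ∂volume.restrict (Ioi (0 : ℝ) ×ˢ Ioo 0 T), z r ≤ K := by
    filter_upwards [ae_ae_of_ae_ageCylinder hGM] with r hr
    have h3 := norm_integral_le_of_norm_le_const (μ := volume.restrict (Ω : Set (Vec d)))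
      (f := fun x => ‖G (r.1, r.2, x)‖ ^ 2) (C := (2 * M) ^ 2) (by
        filter_upwards [hr] with x hx
        rw [norm_pow, norm_norm]
        exact pow_le_pow_left₀ (norm_nonneg _) hx 2)
    exact (le_abs_self _).trans h3
  -- the supremum over all ages
  have hswap : AEStronglyMeasurable (fun q : ℝ × ℝ => z q.swap)
      ((volume.restrict (Ioo 0 T)).prod (volume.restrict (Ioi (0 : ℝ)))) := by
    rw [Measure.volume_eq_prod, ← Measure.prod_restrict] at hzm
    exact hzm.prod_swap
  have hzK' := Measure.ae_ae_of_ae_prod (ae_setProd_iff_swap.1 hzK)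
  -- The age changes along a characteristic, so the growth rate has to be bounded by a function of
  -- time alone. The supremum over all ages provides one.
  let Z : ℝ → ℝ := fun t => (eLpNorm (fun s => z (s, t)) ∞ (volume.restrict (Ioi (0 : ℝ)))).toReal
  have hZle : ∀ {t B : ℝ}, 0 ≤ B → (∀ᵐ s ∂volume.restrict (Ioi (0 : ℝ)), z (s, t) ≤ B) →
      eLpNorm (fun s => z (s, t)) ∞ (volume.restrict (Ioi (0 : ℝ))) ≤ ENNReal.ofReal B := by
    intro t B hB h
    rw [eLpNorm_exponent_top]
    refine eLpNormEssSup_le_of_ae_bound ?_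
    filter_upwards [h] with s hs
    rwa [Real.norm_of_nonneg (hz0 _)]
  have hZB : ∀ {t B : ℝ}, 0 ≤ B → (∀ᵐ s ∂volume.restrict (Ioi (0 : ℝ)), z (s, t) ≤ B) →
      Z t ≤ B := fun hB h => ENNReal.toReal_le_of_le_ofReal hB (hZle hB h)
  have hZm : AEMeasurable Z (volume.restrict (Ioo 0 T)) :=
    (aemeasurable_eLpNorm_top hswap).ennreal_toReal
  have hZK : ∀ᵐ t ∂volume.restrict (Ioo 0 T), Z t ≤ K := hzK'.mono fun t ht => hZB hK0 ht
  have hZ0 : ∀ t, 0 ≤ Z t := fun t => ENNReal.toReal_nonneg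
  have hzZ : ∀ᵐ r ∂volume.restrict (Ioi (0 : ℝ) ×ˢ Ioo 0 T), z r ≤ Z r.2 := by
    rw [ae_setProd_iff_swap]
    refine ae_prod_le_of_ae_ae_le hswap.aemeasurable hZm.comp_fst ?_
    filter_upwards [hzK'] with t ht
    have h3 := ae_le_eLpNormEssSup (f := fun s => z (s, t)) (μ := volume.restrict (Ioi (0 : ℝ)))
    filter_upwards [h3] with s hs
    rw [← eLpNorm_exponent_top, Real.enorm_eq_ofReal (hz0 _)] at hs
    exact (ENNReal.ofReal_le_iff_le_toReal
      ((hZle hK0 ht).trans_lt ENNReal.ofReal_lt_top).ne).1 hs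
  refine ⟨Z, max C (2 * M ^ 2), K, le_max_of_le_left hC0, hK0, hZ0, hZm.aestronglyMeasurable, hZK,
    hzZ, ?_⟩
  intro n hn
  have hn1 : 0 ≤ 1 - 1 / (n : ℝ) := by
    rw [sub_nonneg, div_le_one (by positivity)]; exact_mod_cast (by omega : 1 ≤ n)
  let a : ℝ → ℝ := fun t => (eLpNorm (Du₁ t) ∞ (volume.restrict (Ω : Set (Vec d)))).toReal
  have ha : IntegrableOn a (Ioo 0 T) := integrable_toReal_of_lintegral_ne_top
    hu₁.aemeasurable_eLpNorm_top_grad hu₁.lintegral_eLpNorm_top_lt_top.ne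
  set C' := max C (2 * (M : ℝ) ^ 2) with hC'
  let ψ : ℝ → ℝ := fun r => (∫ x in Ω, ‖Du₁ r x - Du₂ r x‖ ^ 2) +
          C' * n * Z r ^ (1 - 1 / (n : ℝ)) + (2 * a r + C') * Z r
  have hC'0 : 0 ≤ C' := le_max_of_le_left hC0
  have hψi : IntegrableOn ψ (Ioo 0 T) := by
    refine ((integrableOn_dissipation hu₁ hu₂).add (Integrable.const_mul ?_ _)).add
      (Integrable.mul_bdd (c := K) ((ha.const_mul 2).add (integrable_const C'))
        hZm.aestronglyMeasurable ?_)
    · refine Integrable.of_bound (hZm.pow_const _).aestronglyMeasurable (K ^ (1 - 1 / (n : ℝ))) ?_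
      filter_upwards [hZK] with t ht
      rw [Real.norm_of_nonneg (by have := hZ0 t; positivity)]
      exact Real.rpow_le_rpow (hZ0 t) ht hn1
    · filter_upwards [hZK] with t ht
      rwa [Real.norm_of_nonneg (hZ0 t)]
  have hψ0 : ∀ t, 0 ≤ ψ t := fun t => by
    have h3 : 0 ≤ ∫ x in Ω, ‖Du₁ t x - Du₂ t x‖ ^ 2 := integral_nonneg fun x => by positivity
    have h4 := hZ0 t
    have h5 : 0 ≤ a t := ENNReal.toReal_nonneg
    positivity
  have htime : ∀ {p : ℝ → Prop}, (∀ᵐ t ∂volume.restrict (Ioo 0 T), p t) →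
      ∀ᵐ r ∂volume.restrict (Ioi (0 : ℝ) ×ˢ Ioo 0 T), p r.2 := by
    intro p hp
    rw [Measure.volume_eq_prod, ← Measure.prod_restrict]
    exact Measure.quasiMeasurePreserving_snd.ae hp
  obtain ⟨L₁, hL₁⟩ := hG₁.eLpNorm_two_grad_le hd hΩ
  obtain ⟨L₂, hL₂⟩ := hG₂.eLpNorm_two_grad_le hd hΩ
  have hle : ∀ᵐ r ∂volume.restrict (Ioi (0 : ℝ) ×ˢ Ioo 0 T), -(2 * ρ r) ≤ ψ r.2 := by
    filter_upwards [htime hs₁, htime hs₂, hG₁.weakGrad, hG₂.weakGrad,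
      (aestronglyMeasurable_comp_assoc hG₁.meas).prodMk_left,
      (aestronglyMeasurable_comp_assoc hG₂.meas).prodMk_left,
      (aestronglyMeasurable_comp_assoc hG₁.meas_grad).prodMk_left,
      (aestronglyMeasurable_comp_assoc hG₂.meas_grad).prodMk_left,
      ae_ae_of_ae_ageCylinder hM₁, ae_ae_of_ae_ageCylinder hM₂, hL₁, hL₂, hMd,
      htime hu₁.eLpNorm_top_grad_lt_top, hzZ] with r k1 k2 k3 k4 k5 k6 k7 k8 k9 k10 k11 k12 k13 k14 k15
    refine (hC k1 k2 k3 k4 k5 k6 k9 k10 ⟨k7, k11.trans_lt ENNReal.coe_lt_top⟩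
      ⟨k8, k12.trans_lt ENNReal.coe_lt_top⟩ k13 k14 n hn).trans ?_
    have h5 : 0 ≤ a r.2 := ENNReal.toReal_nonneg
    have h6 : z r ^ (1 - 1 / (n : ℝ)) ≤ Z r.2 ^ (1 - 1 / (n : ℝ)) :=
      Real.rpow_le_rpow (hz0 r) k15 hn1
    have h7 : C * n * z r ^ (1 - 1 / (n : ℝ)) ≤ C' * n * Z r.2 ^ (1 - 1 / (n : ℝ)) :=
      mul_le_mul (mul_le_mul_of_nonneg_right (le_max_left _ _) n.cast_nonneg) h6
        (Real.rpow_nonneg (hz0 r) _) (by positivity)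
    have h8 : (2 * a r.2 + 2 * (M : ℝ) ^ 2) * z r ≤ (2 * a r.2 + C') * Z r.2 :=
      mul_le_mul (by linarith [le_max_right C (2 * (M : ℝ) ^ 2)]) k15 (hz0 r) (by positivity)
    exact add_le_add (add_le_add le_rfl h7) h8
  -- The resulting bound for z(s,t) does not depend on s, so it is inherited by the supremum Z(t),
  -- and the inequality for Z is closed apart from the dissipation.
  have hfinal := le_primitive_of_transport (We := We) hzm.aemeasurable hzi hρi hψi hψ0 hle
    fun α h3 h4 h5 => transport_reduction hAi hPi hsq h3 h4 h5
  have h6 := Measure.ae_ae_of_ae_prod (ae_setProd_iff_swap.1 hfinal)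
  filter_upwards [h6] with t ht
  exact hZB (integral_nonneg hψ0) ht

end TransportDifference

end

noncomputable section

/-! ### The stress -/

section Stress

open Filter Topology

variable {d : ℕ} {Ω : Opens (Vec d)} {T : ℝ}

lemma measurePreserving_swap_ageCylinder (Ω : Opens (Vec d)) (T : ℝ) :
    MeasurePreserving (Prod.swap : (ℝ × Vec d) × ℝ → ℝ × ℝ × Vec d)
      (((volume.restrict (Ioo 0 T)).prod (volume.restrict (Ω : Set (Vec d)))).prod
        (volume.restrict (Ioi (0 : ℝ)))) (volume.restrict (ageCylinder Ω T)) := by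
  have h : (volume.restrict (ageCylinder Ω T) : Measure (ℝ × ℝ × Vec d)) =
      (volume.restrict (Ioi (0 : ℝ))).prod
        ((volume.restrict (Ioo 0 T)).prod (volume.restrict (Ω : Set (Vec d)))) := by
    rw [Measure.prod_restrict, Measure.prod_restrict]; rfl
  rw [h]
  exact Measure.measurePreserving_swap

lemma exists_lipschitz_of_contDiff {E F : Type*} [NormedAddCommGroup E] [NormedSpace ℝ E]
    [FiniteDimensional ℝ E] [NormedAddCommGroup F] [NormedSpace ℝ F] {S : E → F}
    (hS : ContDiff ℝ 1 S) (M : ℝ) :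
    ∃ L : ℝ≥0, LipschitzOnWith L S (Metric.closedBall 0 M) := by
  have hproper : ProperSpace E := FiniteDimensional.proper ℝ E
  obtain ⟨L, hL⟩ := (isCompact_closedBall (0 : E) M).exists_bound_of_continuousOn
    (hS.continuous_fderiv (by simp)).continuousOn
  refine ⟨L.toNNReal, (convex_closedBall 0 M).lipschitzOnWith_of_nnnorm_fderiv_le
    (fun x _ => (hS.differentiable (by simp)).differentiableAt) fun x hx => ?_⟩
  rw [← NNReal.coe_le_coe, coe_nnnorm]
  exact (hL x hx).trans (Real.le_coe_toNNReal L)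

variable {We ω : ℝ} {m : ℝ → ℝ} {S : Ten d → Ten d} {τ : ℝ → Vec d → Ten d}
  {G : ℝ → ℝ → Vec d → Ten d}

/-- No measurability of τ is part of the notion of solution; it is inherited from the integral over
the ages, with which τ agrees almost everywhere. -/
lemma IntegralLaw.aestronglyMeasurable (h : IntegralLaw Ω T We ω m S τ G) (hm : IsMemory m)
    (hS : Continuous S) (hG : AEStronglyMeasurable (fun z : ℝ × ℝ × Vec d => G z.1 z.2.1 z.2.2)
      (volume.restrict (ageCylinder Ω T))) :
    AEStronglyMeasurable (fun z : ℝ × Vec d => τ z.1 z.2)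
      ((volume.restrict (Ioo 0 T)).prod (volume.restrict (Ω : Set (Vec d)))) := by
  rw [IntegralLaw, volume_restrict_spaceTime] at h
  have h1 : AEStronglyMeasurable (fun p : (ℝ × Vec d) × ℝ => m p.2 • S (G p.2 p.1.1 p.1.2))
      (((volume.restrict (Ioo 0 T)).prod (volume.restrict (Ω : Set (Vec d)))).prod
        (volume.restrict (Ioi (0 : ℝ)))) :=
    hm.integrable.1.comp_snd.smul (hS.comp_aestronglyMeasurable
      (hG.comp_measurePreserving (measurePreserving_swap_ageCylinder Ω T)))
  exact (h1.integral_prod_right'.const_smul (ω / We)).congr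
    (h.mono fun z hz => hz.2.symm)

lemma IntegralLaw.bounded (h : IntegralLaw Ω T We ω m S τ G) (hm : IsMemory m)
    (hS : Continuous S) (hG : EssBounded Ω T G) :
    ∃ K : ℝ, ∀ᵐ z ∂(volume.restrict (Ioo 0 T)).prod (volume.restrict (Ω : Set (Vec d))),
      ‖τ z.1 z.2‖ ≤ K := by
  rw [IntegralLaw, volume_restrict_spaceTime] at h
  obtain ⟨M, hM⟩ := hG
  obtain ⟨L, hL⟩ := (isCompact_closedBall (0 : Ten d) M).exists_bound_of_continuousOn
    hS.continuousOn
  refine ⟨|ω / We| * L, ?_⟩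
  have h1 := Measure.ae_ae_of_ae_prod
    ((measurePreserving_swap_ageCylinder Ω T).quasiMeasurePreserving.ae hM)
  filter_upwards [h, h1] with z hz h2
  rw [hz.2, norm_smul, Real.norm_eq_abs]
  refine mul_le_mul_of_nonneg_left ?_ (abs_nonneg _)
  calc ‖∫ s in Ioi 0, m s • S (G s z.1 z.2)‖ ≤ ∫ s in Ioi 0, m s * L := by
        refine norm_integral_le_of_norm_le (hm.integrable.mul_const L) ?_
        filter_upwards [h2, ae_restrict_mem measurableSet_Ioi] with s h3 h4
        rw [norm_smul, Real.norm_of_nonneg (hm.nonneg s h4)]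
        exact mul_le_mul_of_nonneg_left (hL _ (mem_closedBall_zero_iff.2 h3)) (hm.nonneg s h4)
    _ = L := by rw [integral_mul_const, hm.integral_eq_one, one_mul]

/-- Jensen's inequality for the probability measure m(s) ds, from the nonnegativity of ∫ m (g - J)²
with J the mean of g. -/
lemma IsMemory.sq_integral_le (hm : IsMemory m) {g : ℝ → ℝ} {K : ℝ}
    (hg : AEStronglyMeasurable g (volume.restrict (Ioi (0 : ℝ))))
    (hK : ∀ᵐ s ∂volume.restrict (Ioi (0 : ℝ)), ‖g s‖ ≤ K) :
    (∫ s in Ioi 0, m s * g s) ^ 2 ≤ ∫ s in Ioi 0, m s * g s ^ 2 := by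
  have i1 : IntegrableOn (fun s => m s * g s) (Ioi 0) := hm.integrable.mul_bdd hg hK
  have i2 : IntegrableOn (fun s => m s * g s ^ 2) (Ioi 0) := by
    have := i1.mul_bdd hg hK
    simp only [mul_assoc, ← sq] at this
    exact this
  set J := ∫ s in Ioi 0, m s * g s with hJ
  have h : ∫ s in Ioi 0, (2 * J * (m s * g s) - J ^ 2 * m s) ≤ ∫ s in Ioi 0, m s * g s ^ 2 := by
    refine integral_mono_ae ((i1.const_mul _).sub (hm.integrable.const_mul _)) i2 ?_
    filter_upwards [ae_restrict_mem measurableSet_Ioi] with s hs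
    nlinarith [mul_nonneg (hm.nonneg s hs) (sq_nonneg (g s - J))]
  rw [integral_sub (i1.const_mul _) (hm.integrable.const_mul _), integral_const_mul,
    integral_const_mul, hm.integral_eq_one, ← hJ] at h
  linarith

/-- The stress depends Lipschitz continuously, in `L²`, on the deformation gradient. -/
lemma exists_stress_difference_bound (hΩ : Bornology.IsBounded (Ω : Set (Vec d)))
    (hm : IsMemory m) (hS : ContDiff ℝ 1 S) {τ₁ τ₂ : ℝ → Vec d → Ten d}
    {G₁ G₂ : ℝ → ℝ → Vec d → Ten d}
    (h₁ : IntegralLaw Ω T We ω m S τ₁ G₁) (h₂ : IntegralLaw Ω T We ω m S τ₂ G₂)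
    (hm₁ : AEStronglyMeasurable (fun z : ℝ × ℝ × Vec d => G₁ z.1 z.2.1 z.2.2)
      (volume.restrict (ageCylinder Ω T)))
    (hm₂ : AEStronglyMeasurable (fun z : ℝ × ℝ × Vec d => G₂ z.1 z.2.1 z.2.2)
      (volume.restrict (ageCylinder Ω T)))
    (hb₁ : EssBounded Ω T G₁) (hb₂ : EssBounded Ω T G₂) :
    ∃ C : ℝ, 0 ≤ C ∧ ∀ {Z : ℝ → ℝ}, (∀ t, 0 ≤ Z t) →
      (∀ᵐ r ∂volume.restrict (Ioi (0 : ℝ) ×ˢ Ioo 0 T),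
        ∫ x in Ω, ‖G₁ r.1 r.2 x - G₂ r.1 r.2 x‖ ^ 2 ≤ Z r.2) →
      ∀ᵐ t ∂volume.restrict (Ioo 0 T), ∫ x in Ω, ‖τ₁ t x - τ₂ t x‖ ^ 2 ≤ C * Z t := by
  have hfin : IsFiniteMeasure (volume.restrict (Ω : Set (Vec d))) := ⟨by
    rw [Measure.restrict_apply_univ]; exact hΩ.measure_lt_top⟩
  have hτ₁ := h₁.aestronglyMeasurable hm hS.continuous hm₁
  have hτ₂ := h₂.aestronglyMeasurable hm hS.continuous hm₂
  rw [IntegralLaw, volume_restrict_spaceTime] at h₁ h₂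
  obtain ⟨M, hM⟩ : ∃ M : ℝ, ∀ᵐ z ∂volume.restrict (ageCylinder Ω T),
      ‖G₁ z.1 z.2.1 z.2.2‖ ≤ M ∧ ‖G₂ z.1 z.2.1 z.2.2‖ ≤ M := by
    obtain ⟨M₁, h1⟩ := hb₁
    obtain ⟨M₂, h2⟩ := hb₂
    refine ⟨max M₁ M₂, ?_⟩
    filter_upwards [h1, h2] with z k1 k2 using ⟨k1.trans (le_max_left _ _), k2.trans (le_max_right _ _)⟩
  -- Both deformation gradients take values in one ball almost everywhere, so the local Lipschitz
  -- constant of a C¹ map is enough.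
  obtain ⟨L, hL⟩ := exists_lipschitz_of_contDiff hS M
  set c : ℝ := |ω / We| * L with hc
  refine ⟨c ^ 2, by positivity, ?_⟩
  intro Z hZ0 hZ
  have hgm : AEStronglyMeasurable (fun z : ℝ × ℝ × Vec d => G₁ z.1 z.2.1 z.2.2 - G₂ z.1 z.2.1 z.2.2)
      (volume.restrict (ageCylinder Ω T)) := hm₁.sub hm₂
  have hgs := hgm.comp_measurePreserving (measurePreserving_swap_ageCylinder Ω T)
  -- the pointwise estimate
  have hpt : ∀ᵐ z ∂(volume.restrict (Ioo 0 T)).prod (volume.restrict (Ω : Set (Vec d))),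
      ‖τ₁ z.1 z.2 - τ₂ z.1 z.2‖ₑ ^ 2 ≤ ENNReal.ofReal (c ^ 2) * ∫⁻ s in Ioi 0,
        ENNReal.ofReal (m s) * ‖G₁ s z.1 z.2 - G₂ s z.1 z.2‖ₑ ^ 2 := by
    filter_upwards [h₁, h₂, Measure.ae_ae_of_ae_prod
      ((measurePreserving_swap_ageCylinder Ω T).quasiMeasurePreserving.ae hM), hgs.prodMk_left]
      with z k1 k2 k3 k4
    have hgb : ∀ᵐ s ∂volume.restrict (Ioi (0 : ℝ)),
        ‖‖G₁ s z.1 z.2 - G₂ s z.1 z.2‖‖ ≤ M + M := by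
      filter_upwards [k3] with s hs
      rw [norm_norm]
      exact (norm_sub_le _ _).trans (add_le_add hs.1 hs.2)
    have hgn : AEStronglyMeasurable (fun s => ‖G₁ s z.1 z.2 - G₂ s z.1 z.2‖)
        (volume.restrict (Ioi (0 : ℝ))) := k4.norm
    have i1 : IntegrableOn (fun s => m s * ‖G₁ s z.1 z.2 - G₂ s z.1 z.2‖) (Ioi 0) :=
      hm.integrable.mul_bdd hgn hgb
    have i2 : IntegrableOn (fun s => m s * ‖G₁ s z.1 z.2 - G₂ s z.1 z.2‖ ^ 2) (Ioi 0) := by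
      have := i1.mul_bdd hgn hgb
      simp only [mul_assoc, ← sq] at this
      exact this
    have hn : ‖τ₁ z.1 z.2 - τ₂ z.1 z.2‖ ≤ c * ∫ s in Ioi 0, m s * ‖G₁ s z.1 z.2 - G₂ s z.1 z.2‖ := by
      rw [k1.2, k2.2, ← smul_sub, ← integral_sub k1.1 k2.1, norm_smul, Real.norm_eq_abs, hc,
        mul_assoc]
      refine mul_le_mul_of_nonneg_left ?_ (abs_nonneg _)
      rw [← integral_const_mul]
      refine norm_integral_le_of_norm_le (i1.const_mul _) ?_
      filter_upwards [k3, ae_restrict_mem measurableSet_Ioi] with s hs hs0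
      rw [← smul_sub, norm_smul, Real.norm_of_nonneg (hm.nonneg s hs0)]
      have := hL.norm_sub_le (mem_closedBall_zero_iff.2 hs.1) (mem_closedBall_zero_iff.2 hs.2)
      calc m s * _ ≤ m s * (L * ‖G₁ s z.1 z.2 - G₂ s z.1 z.2‖) :=
            mul_le_mul_of_nonneg_left this (hm.nonneg s hs0)
        _ = _ := by ring
    have hsq : ‖τ₁ z.1 z.2 - τ₂ z.1 z.2‖ ^ 2 ≤
        c ^ 2 * ∫ s in Ioi 0, m s * ‖G₁ s z.1 z.2 - G₂ s z.1 z.2‖ ^ 2 := by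
      refine (pow_le_pow_left₀ (norm_nonneg _) hn 2).trans ?_
      rw [mul_pow]
      exact mul_le_mul_of_nonneg_left (hm.sq_integral_le hgn hgb) (sq_nonneg _)
    have h5 := ENNReal.ofReal_le_ofReal hsq
    rw [ENNReal.ofReal_mul (sq_nonneg _), ENNReal.ofReal_pow (norm_nonneg _), ofReal_norm,
      ofReal_integral_eq_lintegral_ofReal i2 (by
        filter_upwards [ae_restrict_mem measurableSet_Ioi] with s hs0
        exact mul_nonneg (hm.nonneg s hs0) (sq_nonneg _))] at h5
    refine h5.trans_eq ?_
    congr 1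
    refine setLIntegral_congr_fun measurableSet_Ioi fun s hs => ?_
    rw [ENNReal.ofReal_mul (hm.nonneg s hs), ENNReal.ofReal_pow (norm_nonneg _), ofReal_norm]
  have hassoc := hgs.comp_measurePreserving
    (measurePreserving_prodAssoc (volume.restrict (Ioo 0 T)) (volume.restrict (Ω : Set (Vec d)))
      (volume.restrict (Ioi (0 : ℝ)))).symm
  filter_upwards [Measure.ae_ae_of_ae_prod hpt, Measure.ae_ae_of_ae_prod (ae_setProd_iff_swap.1 hZ),
    hassoc.prodMk_left, (hτ₁.sub hτ₂).prodMk_left,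
    Measure.ae_ae_of_ae_prod (ae_setProd_iff_swap.1 (ae_ae_of_ae_ageCylinder hM)),
    Measure.ae_ae_of_ae_prod (ae_setProd_iff_swap.1
      (aestronglyMeasurable_comp_assoc hgm).prodMk_left)] with t k1 k2 k3 k4 k5 k6
  have k3' : AEStronglyMeasurable (fun q : Vec d × ℝ => G₁ q.2 t q.1 - G₂ q.2 t q.1)
      ((volume.restrict (Ω : Set (Vec d))).prod (volume.restrict (Ioi (0 : ℝ)))) := k3
  have k4' : AEStronglyMeasurable (fun x => τ₁ t x - τ₂ t x) (volume.restrict (Ω : Set (Vec d))) := k4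
  rw [← toReal_lintegral_enorm_sq k4']
  refine ENNReal.toReal_le_of_le_ofReal (mul_nonneg (sq_nonneg _) (hZ0 t)) ?_
  calc ∫⁻ x in Ω, ‖τ₁ t x - τ₂ t x‖ₑ ^ 2
      ≤ ∫⁻ x in Ω, ENNReal.ofReal (c ^ 2) * ∫⁻ s in Ioi 0,
        ENNReal.ofReal (m s) * ‖G₁ s t x - G₂ s t x‖ₑ ^ 2 := lintegral_mono_ae k1
    _ = ENNReal.ofReal (c ^ 2) * ∫⁻ x in Ω, ∫⁻ s in Ioi 0,
        ENNReal.ofReal (m s) * ‖G₁ s t x - G₂ s t x‖ₑ ^ 2 :=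
      lintegral_const_mul' _ _ ENNReal.ofReal_ne_top
    _ = ENNReal.ofReal (c ^ 2) * ∫⁻ s in Ioi 0, ∫⁻ x in Ω,
        ENNReal.ofReal (m s) * ‖G₁ s t x - G₂ s t x‖ₑ ^ 2 := by
      rw [lintegral_lintegral_swap]
      exact (hm.integrable.1.aemeasurable.comp_snd.ennreal_ofReal).mul (k3'.enorm.pow_const 2)
    _ ≤ ENNReal.ofReal (c ^ 2) * ∫⁻ s in Ioi 0, ENNReal.ofReal (m s) * ENNReal.ofReal (Z t) := by
      gcongr ENNReal.ofReal (c ^ 2) * ?_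
      refine lintegral_mono_ae ?_
      filter_upwards [k2, k5, k6] with s l1 l2 l3
      rw [lintegral_const_mul' _ _ ENNReal.ofReal_ne_top]
      gcongr
      have l3' : AEStronglyMeasurable (fun x => G₁ s t x - G₂ s t x)
        (volume.restrict (Ω : Set (Vec d))) := l3
      have l4 : MemLp (fun x => G₁ s t x - G₂ s t x) 2 (volume.restrict (Ω : Set (Vec d))) :=
        MemLp.of_bound l3' (M + M) (by
          filter_upwards [l2] with x hx
          exact (norm_sub_le _ _).trans (add_le_add hx.1 hx.2))
      have l5 : ∫⁻ x in Ω, ‖G₁ s t x - G₂ s t x‖ₑ ^ 2 ≠ ∞ := by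
        have := l4.2
        rw [eLpNorm_two_eq] at this
        exact ((ENNReal.rpow_lt_top_iff_of_pos (by norm_num)).1 this).ne
      rw [← ENNReal.ofReal_toReal l5, toReal_lintegral_enorm_sq l3']
      exact ENNReal.ofReal_le_ofReal l1
    _ = ENNReal.ofReal (c ^ 2 * Z t) := by
      rw [lintegral_mul_const' _ _ ENNReal.ofReal_ne_top,
        ← ofReal_integral_eq_lintegral_ofReal hm.integrable (by
          filter_upwards [ae_restrict_mem measurableSet_Ioi] with s hs0 using hm.nonneg s hs0),
        hm.integral_eq_one, ENNReal.ofReal_one, one_mul, ← ENNReal.ofReal_mul (sq_nonneg _)]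

end Stress

end

noncomputable section

/-! ### The difference of two velocities -/

section MomentumDifference

open Filter Topology

variable {d : ℕ} {Ω : Opens (Vec d)} {T : ℝ}

lemma ae_norm_le_toReal_eLpNorm_top {α E : Type*} [MeasurableSpace α] [NormedAddCommGroup E]
    {μ : Measure α} {f : α → E} (hf : eLpNorm f ∞ μ < ∞) :
    ∀ᵐ x ∂μ, ‖f x‖ ≤ (eLpNorm f ∞ μ).toReal := by
  have h := ae_le_eLpNormEssSup (f := f) (μ := μ)
  filter_upwards [h] with x hx
  rw [← eLpNorm_exponent_top, ← ofReal_norm] at hx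
  exact (ENNReal.ofReal_le_iff_le_toReal hf.ne).1 hx

lemma H10val_sub_ae {v₁ v₂ : H10 Ω} {u₁ u₂ : Vec d → Vec d}
    (h₁ : H10val v₁ =ᵐ[volume.restrict (Ω : Set (Vec d))] u₁)
    (h₂ : H10val v₂ =ᵐ[volume.restrict (Ω : Set (Vec d))] u₂) :
    H10val (v₁ - v₂) =ᵐ[volume.restrict (Ω : Set (Vec d))] fun x => u₁ x - u₂ x := by
  have h := Lp.coeFn_sub v₁.1.fst v₂.1.fst
  filter_upwards [h, h₁, h₂] with x h1 h2 h3
  rw [← h2, ← h3]; exact h1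

lemma H10grad_sub_ae {v₁ v₂ : H10 Ω} {u₁ u₂ : Vec d → Ten d}
    (h₁ : H10grad v₁ =ᵐ[volume.restrict (Ω : Set (Vec d))] u₁)
    (h₂ : H10grad v₂ =ᵐ[volume.restrict (Ω : Set (Vec d))] u₂) :
    H10grad (v₁ - v₂) =ᵐ[volume.restrict (Ω : Set (Vec d))] fun x => u₁ x - u₂ x := by
  have h := Lp.coeFn_sub v₁.1.snd v₂.1.snd
  filter_upwards [h, h₁, h₂] with x h1 h2 h3
  rw [← h2, ← h3]; exact h1

lemma integrable_inner_advect_of_bounded {α : Type*} [MeasurableSpace α] {μ : Measure α}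
    {a c : α → Vec d} {B : α → Ten d} {M : ℝ} (ha : MemLp a 2 μ)
    (hB : AEStronglyMeasurable B μ) (hM : ∀ᵐ x ∂μ, ‖B x‖ ≤ M) (hc : MemLp c 2 μ) :
    Integrable (fun x => (inner ℝ (advect (a x) (B x)) (c x) : ℝ)) μ := by
  refine ((ha.norm.integrable_mul hc.norm).mul_const M).mono'
    ((AEStronglyMeasurable.advect ha.1 hB).inner hc.1) ?_
  filter_upwards [hM] with x hx
  refine (norm_inner_le_norm _ _).trans ?_
  refine (mul_le_mul_of_nonneg_right ((norm_advect_le _ _).trans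
    (mul_le_mul_of_nonneg_left hx (norm_nonneg _))) (norm_nonneg _)).trans_eq ?_
  simp only [Pi.mul_apply]; ring

lemma integrable_inner_bounded_advect {α : Type*} [MeasurableSpace α] {μ : Measure α}
    {a c : α → Vec d} {B : α → Ten d} {M : ℝ} (ha : AEStronglyMeasurable a μ)
    (hM : ∀ᵐ x ∂μ, ‖a x‖ ≤ M) (hB : MemLp B 2 μ) (hc : MemLp c 2 μ) :
    Integrable (fun x => (inner ℝ (advect (a x) (B x)) (c x) : ℝ)) μ := by
  refine ((hB.norm.integrable_mul hc.norm).const_mul M).mono'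
    ((AEStronglyMeasurable.advect ha hB.1).inner hc.1) ?_
  filter_upwards [hM] with x hx
  refine (norm_inner_le_norm _ _).trans ?_
  refine (mul_le_mul_of_nonneg_right ((norm_advect_le _ _).trans
    (mul_le_mul_of_nonneg_right hx (norm_nonneg _))) (norm_nonneg _)).trans_eq ?_
  simp only [Pi.mul_apply]; ring

/-- The growth of `Re ∫ |u₁ - u₂|²` at fixed time. -/
lemma momentum_slice_bound {Re ω : ℝ} (hRe : 0 ≤ Re) (hω : ω < 1) {u₁ u₂ : Vec d → Vec d}
    {Du₁ Du₂ τ₁ τ₂ : Vec d → Ten d}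
    (h₁ : ∃ v ∈ V Ω, H10val v =ᵐ[volume.restrict (Ω : Set (Vec d))] u₁ ∧
        H10grad v =ᵐ[volume.restrict (Ω : Set (Vec d))] Du₁)
    (h₂ : ∃ v ∈ V Ω, H10val v =ᵐ[volume.restrict (Ω : Set (Vec d))] u₂ ∧
        H10grad v =ᵐ[volume.restrict (Ω : Set (Vec d))] Du₂)
    (hw : HasWeakGrad Ω u₁ Du₁) (hu : eLpNorm u₁ ∞ (volume.restrict (Ω : Set (Vec d))) < ∞)
    (hDu : eLpNorm Du₂ ∞ (volume.restrict (Ω : Set (Vec d))) < ∞)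
    (hτ₁ : MemLp τ₁ 2 (volume.restrict (Ω : Set (Vec d))))
    (hτ₂ : MemLp τ₂ 2 (volume.restrict (Ω : Set (Vec d)))) :
    -2 * ((∫ x in Ω, (inner ℝ (Re • (advect (u₁ x) (Du₁ x) - advect (u₂ x) (Du₂ x)))
        (u₁ x - u₂ x) : ℝ)) +
      ∫ x in Ω, (inner ℝ ((1 - ω) • (Du₁ x - Du₂ x) + (τ₁ x - τ₂ x)) (Du₁ x - Du₂ x) : ℝ)) ≤
    2 * Re * (eLpNorm Du₂ ∞ (volume.restrict (Ω : Set (Vec d)))).toReal *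
        (∫ x in Ω, ‖u₁ x - u₂ x‖ ^ 2) - (1 - ω) * (∫ x in Ω, ‖Du₁ x - Du₂ x‖ ^ 2) +
      1 / (1 - ω) * ∫ x in Ω, ‖τ₁ x - τ₂ x‖ ^ 2 := by
  obtain ⟨v₁, hv₁, e₁, f₁⟩ := h₁
  obtain ⟨v₂, hv₂, e₂, f₂⟩ := h₂
  have hval := H10val_sub_ae e₁ e₂
  have hgrad := H10grad_sub_ae f₁ f₂
  have l1 := (memLp_H10val v₁).ae_eq e₁
  have m2 := (memLp_H10grad v₂).ae_eq f₂
  have l : MemLp (fun x => u₁ x - u₂ x) 2 (volume.restrict (Ω : Set (Vec d))) :=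
    (memLp_H10val (v₁ - v₂)).ae_eq hval
  have m : MemLp (fun x => Du₁ x - Du₂ x) 2 (volume.restrict (Ω : Set (Vec d))) :=
    (memLp_H10grad (v₁ - v₂)).ae_eq hgrad
  have hω' : 0 < 1 - ω := by linarith
  have hub := ae_norm_le_toReal_eLpNorm_top hu
  have hDb := ae_norm_le_toReal_eLpNorm_top hDu
  set b := (eLpNorm Du₂ ∞ (volume.restrict (Ω : Set (Vec d)))).toReal with hb
  have hdiv : ∀ᵐ x ∂volume.restrict (Ω : Set (Vec d)), ∑ i, Du₁ x (i, i) = 0 := by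
    have : ∀ᵐ x ∂volume.restrict (Ω : Set (Vec d)), ∑ i, H10grad v₁ x (i, i) = 0 := hv₁
    filter_upwards [this, f₁] with x h1 h2
    rw [← h2]; exact h1
  -- The convection difference is u₁·∇(u₁-u₂) + (u₁-u₂)·∇u₂. The first part vanishes when tested
  -- with u₁ - u₂; the second is controlled by ‖∇u₂‖_∞.
  have hzero : ∫ x in Ω, (inner ℝ (advect (u₁ x) (Du₁ x - Du₂ x)) (u₁ x - u₂ x) : ℝ) = 0 := by
    refine Eq.trans (integral_congr_ae ?_) (integral_inner_advect_H10grad_eq_zero hw hdiv l1.1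
      (K := (eLpNorm u₁ ∞ (volume.restrict (Ω : Set (Vec d)))).toNNReal) ?_ (v₁ - v₂))
    · filter_upwards [hval, hgrad] with x h1 h2
      simp only [h1, h2]
    · filter_upwards [ae_le_eLpNormEssSup (f := u₁) (μ := volume.restrict (Ω : Set (Vec d)))]
        with x hx
      rw [ENNReal.coe_toNNReal hu.ne, eLpNorm_exponent_top]
      exact hx
  have i1 := integrable_inner_bounded_advect l1.1 hub m l
  have i2 := integrable_inner_advect_of_bounded l m2.1 hDb l
  have iU : IntegrableOn (fun x => ‖u₁ x - u₂ x‖ ^ 2) Ω := l.integrable_norm_pow (by norm_num)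
  have iD : IntegrableOn (fun x => ‖Du₁ x - Du₂ x‖ ^ 2) Ω := m.integrable_norm_pow (by norm_num)
  have iτ : IntegrableOn (fun x => ‖τ₁ x - τ₂ x‖ ^ 2) Ω :=
    (hτ₁.sub hτ₂).integrable_norm_pow (by norm_num)
  have hn : ∫ x in Ω, (inner ℝ (Re • (advect (u₁ x) (Du₁ x) - advect (u₂ x) (Du₂ x)))
        (u₁ x - u₂ x) : ℝ) =
      Re * ∫ x in Ω, (inner ℝ (advect (u₁ x - u₂ x) (Du₂ x)) (u₁ x - u₂ x) : ℝ) := by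
    have h3 : ∫ x in Ω, (inner ℝ (Re • (advect (u₁ x) (Du₁ x) - advect (u₂ x) (Du₂ x)))
        (u₁ x - u₂ x) : ℝ) = ∫ x in Ω,
        Re * ((inner ℝ (advect (u₁ x) (Du₁ x - Du₂ x)) (u₁ x - u₂ x) : ℝ) +
          inner ℝ (advect (u₁ x - u₂ x) (Du₂ x)) (u₁ x - u₂ x)) := by
      refine integral_congr_ae (Eventually.of_forall fun x => ?_)
      simp only [advect_sub_right, advect_sub_left, inner_smul_left, inner_sub_left]
      simp
    rw [h3, integral_const_mul, integral_add i1 i2, hzero, zero_add]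
  have h4 : -(∫ x in Ω, (inner ℝ (advect (u₁ x - u₂ x) (Du₂ x)) (u₁ x - u₂ x) : ℝ)) ≤
      b * ∫ x in Ω, ‖u₁ x - u₂ x‖ ^ 2 := by
    rw [← integral_neg, ← integral_const_mul]
    refine integral_mono_ae i2.neg (iU.const_mul b) ?_
    filter_upwards [hDb] with x hx
    refine (neg_le_abs _).trans ((abs_real_inner_le_norm _ _).trans ?_)
    refine (mul_le_mul_of_nonneg_right ((norm_advect_le _ _).trans
      (mul_le_mul_of_nonneg_left hx (norm_nonneg _))) (norm_nonneg _)).trans_eq ?_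
    ring
  have iB : IntegrableOn (fun x => (inner ℝ ((1 - ω) • (Du₁ x - Du₂ x) + (τ₁ x - τ₂ x))
      (Du₁ x - Du₂ x) : ℝ)) Ω :=
    integrable_inner_of_memLp_two ((m.const_smul (1 - ω)).add (hτ₁.sub hτ₂)) m
  have h5 : -2 * ∫ x in Ω, (inner ℝ ((1 - ω) • (Du₁ x - Du₂ x) + (τ₁ x - τ₂ x))
      (Du₁ x - Du₂ x) : ℝ) ≤ -(1 - ω) * (∫ x in Ω, ‖Du₁ x - Du₂ x‖ ^ 2) +
        1 / (1 - ω) * ∫ x in Ω, ‖τ₁ x - τ₂ x‖ ^ 2 := by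
    rw [← integral_const_mul, ← integral_const_mul, ← integral_const_mul,
      ← integral_add (iD.const_mul _) (iτ.const_mul _)]
    refine integral_mono (iB.const_mul _) ((iD.const_mul _).add (iτ.const_mul _)) fun x => ?_
    simp only [inner_add_left, inner_smul_left, real_inner_self_eq_norm_sq]
    have h6 := neg_le_of_abs_le (abs_real_inner_le_norm (τ₁ x - τ₂ x) (Du₁ x - Du₂ x))
    -- The weight 1 - ω in Young's inequality consumes half of the viscous term 2 (1-ω) |∇u₁-∇u₂|²;
    -- the other half is kept for the transport inequality.
    have h7 : 2 * (‖τ₁ x - τ₂ x‖ * ‖Du₁ x - Du₂ x‖) ≤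
        (1 - ω) * ‖Du₁ x - Du₂ x‖ ^ 2 + 1 / (1 - ω) * ‖τ₁ x - τ₂ x‖ ^ 2 := by
      have h8 : (1 - ω) * ‖Du₁ x - Du₂ x‖ ^ 2 + 1 / (1 - ω) * ‖τ₁ x - τ₂ x‖ ^ 2 -
          2 * (‖τ₁ x - τ₂ x‖ * ‖Du₁ x - Du₂ x‖) =
          (1 - ω) * (‖Du₁ x - Du₂ x‖ - 1 / (1 - ω) * ‖τ₁ x - τ₂ x‖) ^ 2 := by
        field_simp; ring
      have h9 : 0 ≤ (1 - ω) * (‖Du₁ x - Du₂ x‖ - 1 / (1 - ω) * ‖τ₁ x - τ₂ x‖) ^ 2 := by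
        positivity
      linarith
    simp only [conj_trivial]
    linarith
  rw [hn]
  have h10 := mul_le_mul_of_nonneg_left h4 hRe
  nlinarith

/-- The time integrals of the weak momentum equation exist. -/
lemma integrableOn_momentum {ω Re : ℝ} {u : ℝ → Vec d → Vec d} {Du τ : ℝ → Vec d → Ten d}
    (hu : VelocityClass Ω T u Du)
    (hτ : MemLp (fun z : ℝ × Vec d => τ z.1 z.2) 2
      ((volume.restrict (Ioo 0 T)).prod (volume.restrict (Ω : Set (Vec d)))))
    (v : V Ω) (θ : 𝓓(timeBefore T, ℝ)) :
    IntegrableOn (fun t => -(Re * deriv θ t * ∫ x in Ω, (inner ℝ (u t x) (H10val v.1 x) : ℝ)) +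
        θ t * ((Re * ∫ x in Ω, (inner ℝ (advect (u t x) (Du t x)) (H10val v.1 x) : ℝ)) +
          ((1 - ω) * ∫ x in Ω, (inner ℝ (Du t x) (H10grad v.1 x) : ℝ)) +
          ∫ x in Ω, (inner ℝ (τ t x) (H10grad v.1 x) : ℝ))) (Ioo 0 T) := by
  have hT : IsFiniteMeasure (volume.restrict (Ioo 0 T)) := inferInstance
  obtain ⟨C₁, hC₁⟩ := θ.continuous.bounded_above_of_compact_support θ.hasCompactSupport
  have hθ'c : Continuous (deriv θ) := θ.contDiff.continuous_deriv (by simp)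
  obtain ⟨C₂, hC₂⟩ := hθ'c.bounded_above_of_compact_support θ.hasCompactSupport.deriv
  have i1 := integrable_integral_inner (a := u) hu.aestronglyMeasurable
    (lintegral_eLpNorm_two_lt_top (a := fun z : ℝ × Vec d => u z.1 z.2) hu.memLp) (memLp_H10val v.1)
  have i2 := integrable_integral_inner (a := fun t x => advect (u t x) (Du t x))
    (AEStronglyMeasurable.advect hu.aestronglyMeasurable
    hu.aestronglyMeasurable_grad) hu.lintegral_eLpNorm_advect_lt_top (memLp_H10val v.1)
  have i3 := integrable_integral_inner (a := Du) hu.aestronglyMeasurable_grad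
    (lintegral_eLpNorm_two_lt_top (a := fun z : ℝ × Vec d => Du z.1 z.2) hu.memLp_grad) (memLp_H10grad v.1)
  have i4 := integrable_integral_inner (a := τ) hτ.1
    (lintegral_eLpNorm_two_lt_top (a := fun z : ℝ × Vec d => τ z.1 z.2) hτ) (memLp_H10grad v.1)
  refine Integrable.add (Integrable.neg ?_) ?_
  · have := (i1.bdd_mul hθ'c.aestronglyMeasurable (Eventually.of_forall hC₂)).const_mul Re
    exact this.congr (Eventually.of_forall fun t => by simp only; ring)
  · exact ((i2.const_mul Re).add (i3.const_mul (1 - ω)) |>.add i4).bdd_mul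
      θ.continuous.aestronglyMeasurable (Eventually.of_forall hC₁)

end MomentumDifference

end

noncomputable section

/-! ### The energy inequality for the difference of two velocities -/

section EnergyDifference

open Filter Topology

variable {d : ℕ} {Ω : Opens (Vec d)} {T : ℝ}

lemma ae_memLp_two {E : Type*} [NormedAddCommGroup E] [InnerProductSpace ℝ E]
    {a : ℝ → Vec d → E}
    (ha : AEStronglyMeasurable (fun z : ℝ × Vec d => a z.1 z.2)
      ((volume.restrict (Ioo 0 T)).prod (volume.restrict (Ω : Set (Vec d)))))
    (h : ∫⁻ t in Ioo 0 T, eLpNorm (a t) 2 (volume.restrict (Ω : Set (Vec d))) < ∞) :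
    ∀ᵐ t ∂volume.restrict (Ioo 0 T), MemLp (a t) 2 (volume.restrict (Ω : Set (Vec d))) := by
  have h1 := aemeasurable_eLpNorm_two (a := fun z : ℝ × Vec d => a z.1 z.2) ha
  filter_upwards [ae_lt_top' h1 h.ne, ha.prodMk_left] with t h2 h3 using ⟨h3, h2⟩

lemma ae_memLp_two_of_memLp {E : Type*} [NormedAddCommGroup E] [InnerProductSpace ℝ E]
    {a : ℝ → Vec d → E} (ha : MemLp (fun z : ℝ × Vec d => a z.1 z.2) 2
      ((volume.restrict (Ioo 0 T)).prod (volume.restrict (Ω : Set (Vec d))))) :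
    ∀ᵐ t ∂volume.restrict (Ioo 0 T), MemLp (a t) 2 (volume.restrict (Ω : Set (Vec d))) :=
  ae_memLp_two ha.1 (lintegral_eLpNorm_two_lt_top (a := fun z : ℝ × Vec d => a z.1 z.2) ha)

lemma integrable_integral_inner_of_bound {E : Type*} [NormedAddCommGroup E]
    [InnerProductSpace ℝ E] {a b : ℝ → Vec d → E}
    (ha : AEStronglyMeasurable (fun z : ℝ × Vec d => a z.1 z.2)
      ((volume.restrict (Ioo 0 T)).prod (volume.restrict (Ω : Set (Vec d)))))
    (ha1 : ∫⁻ t in Ioo 0 T, eLpNorm (a t) 2 (volume.restrict (Ω : Set (Vec d))) < ∞)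
    (hb : AEStronglyMeasurable (fun z : ℝ × Vec d => b z.1 z.2)
      ((volume.restrict (Ioo 0 T)).prod (volume.restrict (Ω : Set (Vec d))))) {M : ℝ≥0}
    (hM : ∀ᵐ t ∂volume.restrict (Ioo 0 T),
      eLpNorm (b t) 2 (volume.restrict (Ω : Set (Vec d))) ≤ M) :
    IntegrableOn (fun t => ∫ x in Ω, (inner ℝ (a t x) (b t x) : ℝ)) (Ioo 0 T) := by
  have hm : AEStronglyMeasurable (fun z : ℝ × Vec d => (inner ℝ (a z.1 z.2) (b z.1 z.2) : ℝ))
      ((volume.restrict (Ioo 0 T)).prod (volume.restrict (Ω : Set (Vec d)))) := ha.inner hb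
  refine ⟨hm.integral_prod_right', ?_⟩
  calc ∫⁻ t in Ioo 0 T, ‖∫ x in Ω, (inner ℝ (a t x) (b t x) : ℝ)‖ₑ
      ≤ ∫⁻ t in Ioo 0 T, eLpNorm (a t) 2 (volume.restrict (Ω : Set (Vec d))) * M := by
        refine lintegral_mono_ae ?_
        filter_upwards [ha.prodMk_left, hb.prodMk_left, hM] with t h1 h2 h3
        exact (enorm_integral_inner_le h1 h2).trans (by gcongr)
    _ = (∫⁻ t in Ioo 0 T, eLpNorm (a t) 2 (volume.restrict (Ω : Set (Vec d)))) * M :=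
        lintegral_mul_const' _ _ ENNReal.coe_ne_top
    _ < ∞ := ENNReal.mul_lt_top ha1 ENNReal.coe_lt_top

variable {u₁ u₂ : ℝ → Vec d → Vec d} {Du₁ Du₂ τ₁ τ₂ : ℝ → Vec d → Ten d}

lemma SolenoidalNoSlip.sub (h₁ : SolenoidalNoSlip Ω T u₁ Du₁) (h₂ : SolenoidalNoSlip Ω T u₂ Du₂) :
    SolenoidalNoSlip Ω T (fun t x => u₁ t x - u₂ t x) (fun t x => Du₁ t x - Du₂ t x) := by
  filter_upwards [h₁, h₂] with t ⟨v₁, hv₁, e₁, f₁⟩ ⟨v₂, hv₂, e₂, f₂⟩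
  exact ⟨v₁ - v₂, (V Ω).sub_mem hv₁ hv₂, H10val_sub_ae e₁ e₂, H10grad_sub_ae f₁ f₂⟩

lemma momentum_slice_sub {Re ω θ θ' : ℝ} {u₁ u₂ n₁ n₂ : Vec d → Vec d}
    {D₁ D₂ τ₁ τ₂ : Vec d → Ten d} {w : Vec d → Vec d} {W : Vec d → Ten d}
    (k1 : MemLp u₁ 2 (volume.restrict (Ω : Set (Vec d))))
    (k2 : MemLp u₂ 2 (volume.restrict (Ω : Set (Vec d))))
    (k3 : MemLp D₁ 2 (volume.restrict (Ω : Set (Vec d))))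
    (k4 : MemLp D₂ 2 (volume.restrict (Ω : Set (Vec d))))
    (k5 : MemLp τ₁ 2 (volume.restrict (Ω : Set (Vec d))))
    (k6 : MemLp τ₂ 2 (volume.restrict (Ω : Set (Vec d))))
    (k7 : MemLp n₁ 2 (volume.restrict (Ω : Set (Vec d))))
    (k8 : MemLp n₂ 2 (volume.restrict (Ω : Set (Vec d))))
    (hv : MemLp w 2 (volume.restrict (Ω : Set (Vec d))))
    (hg : MemLp W 2 (volume.restrict (Ω : Set (Vec d)))) :
    -(Re * θ' * ∫ x in Ω, (inner ℝ (u₁ x - u₂ x) (w x) : ℝ)) +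
        θ * ((∫ x in Ω, (inner ℝ (Re • (n₁ x - n₂ x)) (w x) : ℝ)) +
          ∫ x in Ω, (inner ℝ ((1 - ω) • (D₁ x - D₂ x) + (τ₁ x - τ₂ x)) (W x) : ℝ)) =
      (-(Re * θ' * ∫ x in Ω, (inner ℝ (u₁ x) (w x) : ℝ)) +
        θ * ((Re * ∫ x in Ω, (inner ℝ (n₁ x) (w x) : ℝ)) +
          ((1 - ω) * ∫ x in Ω, (inner ℝ (D₁ x) (W x) : ℝ)) +
          ∫ x in Ω, (inner ℝ (τ₁ x) (W x) : ℝ))) -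
      (-(Re * θ' * ∫ x in Ω, (inner ℝ (u₂ x) (w x) : ℝ)) +
        θ * ((Re * ∫ x in Ω, (inner ℝ (n₂ x) (w x) : ℝ)) +
          ((1 - ω) * ∫ x in Ω, (inner ℝ (D₂ x) (W x) : ℝ)) +
          ∫ x in Ω, (inner ℝ (τ₂ x) (W x) : ℝ))) := by
  have j1 := integral_sub (integrable_inner_of_memLp_two k1 hv) (integrable_inner_of_memLp_two k2 hv)
  have j2 := integral_sub (integrable_inner_of_memLp_two k7 hv) (integrable_inner_of_memLp_two k8 hv)
  have j3 := integral_sub (integrable_inner_of_memLp_two k3 hg) (integrable_inner_of_memLp_two k4 hg)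
  have j4 := integral_sub (integrable_inner_of_memLp_two k5 hg) (integrable_inner_of_memLp_two k6 hg)
  have j5 := integral_add (((integrable_inner_of_memLp_two k3 hg).sub
    (integrable_inner_of_memLp_two k4 hg)).const_mul (1 - ω))
    ((integrable_inner_of_memLp_two k5 hg).sub (integrable_inner_of_memLp_two k6 hg))
  simp only [Pi.sub_apply] at j5
  rw [integral_const_mul, j3, j4] at j5
  simp only [inner_add_left, inner_smul_left, inner_sub_left, conj_trivial, integral_const_mul]
  rw [j1, j2, j5]
  ring

/-- The force and the initial value are common to both solutions and disappear. The two time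
integrals may be subtracted because each exists, by `integrableOn_momentum`. -/
lemma weakMomentum_sub {Re ω : ℝ} {u₀ : Vec d → Vec d} {f : ℝ → StrongDual ℝ (V Ω)}
    (hu₁ : VelocityClass Ω T u₁ Du₁) (hu₂ : VelocityClass Ω T u₂ Du₂)
    (hτ₁ : MemLp (fun z : ℝ × Vec d => τ₁ z.1 z.2) 2
      ((volume.restrict (Ioo 0 T)).prod (volume.restrict (Ω : Set (Vec d)))))
    (hτ₂ : MemLp (fun z : ℝ × Vec d => τ₂ z.1 z.2) 2
      ((volume.restrict (Ioo 0 T)).prod (volume.restrict (Ω : Set (Vec d)))))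
    (h₁ : WeakMomentum Ω T Re ω u₀ f u₁ Du₁ τ₁) (h₂ : WeakMomentum Ω T Re ω u₀ f u₂ Du₂ τ₂)
    (v : V Ω) (θ : 𝓓(timeBefore T, ℝ)) :
    ∫ t in Ioo 0 T, (-(Re * deriv θ t * ∫ x in Ω, inner ℝ (u₁ t x - u₂ t x) (H10val v.1 x)) +
        θ t * ((∫ x in Ω, inner ℝ (Re • (advect (u₁ t x) (Du₁ t x) - advect (u₂ t x) (Du₂ t x)))
            (H10val v.1 x)) +
          ∫ x in Ω, inner ℝ ((1 - ω) • (Du₁ t x - Du₂ t x) + (τ₁ t x - τ₂ t x))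
            (H10grad v.1 x))) = 0 := by
  have e := (integral_sub (integrableOn_momentum (ω := ω) (Re := Re) hu₁ hτ₁ v θ)
    (integrableOn_momentum (ω := ω) (Re := Re) hu₂ hτ₂ v θ)).trans
    ((congrArg₂ HSub.hSub (h₁ v θ) (h₂ v θ)).trans (sub_self _))
  have ha₁ : AEStronglyMeasurable (fun z : ℝ × Vec d => advect (u₁ z.1 z.2) (Du₁ z.1 z.2))
      ((volume.restrict (Ioo 0 T)).prod (volume.restrict (Ω : Set (Vec d)))) :=
    AEStronglyMeasurable.advect hu₁.aestronglyMeasurable hu₁.aestronglyMeasurable_grad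
  have ha₂ : AEStronglyMeasurable (fun z : ℝ × Vec d => advect (u₂ z.1 z.2) (Du₂ z.1 z.2))
      ((volume.restrict (Ioo 0 T)).prod (volume.restrict (Ω : Set (Vec d)))) :=
    AEStronglyMeasurable.advect hu₂.aestronglyMeasurable hu₂.aestronglyMeasurable_grad
  refine Eq.trans (integral_congr_ae ?_) e
  filter_upwards [ae_memLp_two_of_memLp (a := u₁) hu₁.memLp, ae_memLp_two_of_memLp (a := u₂) hu₂.memLp,
    ae_memLp_two_of_memLp (a := Du₁) hu₁.memLp_grad, ae_memLp_two_of_memLp (a := Du₂) hu₂.memLp_grad,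
    ae_memLp_two_of_memLp (a := τ₁) hτ₁, ae_memLp_two_of_memLp (a := τ₂) hτ₂,
    ae_memLp_two (a := fun t x => advect (u₁ t x) (Du₁ t x)) ha₁
      hu₁.lintegral_eLpNorm_advect_lt_top,
    ae_memLp_two (a := fun t x => advect (u₂ t x) (Du₂ t x)) ha₂
      hu₂.lintegral_eLpNorm_advect_lt_top]
    with t k1 k2 k3 k4 k5 k6 k7 k8
  exact momentum_slice_sub k1 k2 k3 k4 k5 k6 k7 k8 (memLp_H10val v.1) (memLp_H10grad v.1)

/-- The energy identity is applied to u₁ - u₂, with the convection difference as the lower order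
term and viscous plus elastic stress as the flux; `momentum_slice_bound` is then inserted under the
time integral. The dissipation keeps its negative sign, since it will compensate the one produced by
the transport equation. -/
lemma energy_difference {Re ω : ℝ} {u₀ : Vec d → Vec d} {f : ℝ → StrongDual ℝ (V Ω)}
    (hRe : 0 ≤ Re) (hω : ω < 1)
    (hu₁ : VelocityClass Ω T u₁ Du₁) (hu₂ : VelocityClass Ω T u₂ Du₂)
    (hs₁ : SolenoidalNoSlip Ω T u₁ Du₁) (hs₂ : SolenoidalNoSlip Ω T u₂ Du₂)
    (hτ₁ : MemLp (fun z : ℝ × Vec d => τ₁ z.1 z.2) 2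
      ((volume.restrict (Ioo 0 T)).prod (volume.restrict (Ω : Set (Vec d)))))
    (hτ₂ : MemLp (fun z : ℝ × Vec d => τ₂ z.1 z.2) 2
      ((volume.restrict (Ioo 0 T)).prod (volume.restrict (Ω : Set (Vec d)))))
    (h₁ : WeakMomentum Ω T Re ω u₀ f u₁ Du₁ τ₁) (h₂ : WeakMomentum Ω T Re ω u₀ f u₂ Du₂ τ₂) :
    ∃ K : ℝ, (∀ᵐ t ∂volume.restrict (Ioo 0 T), ∫ x in Ω, ‖u₁ t x - u₂ t x‖ ^ 2 ≤ K) ∧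
    IntegrableOn (fun r => 2 * Re * (eLpNorm (Du₂ r) ∞
        (volume.restrict (Ω : Set (Vec d)))).toReal * (∫ x in Ω, ‖u₁ r x - u₂ r x‖ ^ 2) -
        (1 - ω) * (∫ x in Ω, ‖Du₁ r x - Du₂ r x‖ ^ 2) +
        1 / (1 - ω) * ∫ x in Ω, ‖τ₁ r x - τ₂ r x‖ ^ 2) (Ioo 0 T) ∧
    ∀ᵐ t ∂volume.restrict (Ioo 0 T), Re * ∫ x in Ω, ‖u₁ t x - u₂ t x‖ ^ 2 ≤
      ∫ r in Ioo 0 t, (2 * Re * (eLpNorm (Du₂ r) ∞ (volume.restrict (Ω : Set (Vec d)))).toReal *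
        (∫ x in Ω, ‖u₁ r x - u₂ r x‖ ^ 2) - (1 - ω) * (∫ x in Ω, ‖Du₁ r x - Du₂ r x‖ ^ 2) +
        1 / (1 - ω) * ∫ x in Ω, ‖τ₁ r x - τ₂ r x‖ ^ 2) := by
  obtain ⟨M₁, hM₁⟩ := hu₁.linf_l2
  obtain ⟨M₂, hM₂⟩ := hu₂.linf_l2
  let u : ℝ → Vec d → Vec d := fun t x => u₁ t x - u₂ t x
  let Du : ℝ → Vec d → Ten d := fun t x => Du₁ t x - Du₂ t x
  let n : ℝ → Vec d → Vec d :=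
    fun t x => Re • (advect (u₁ t x) (Du₁ t x) - advect (u₂ t x) (Du₂ t x))
  let B : ℝ → Vec d → Ten d := fun t x => (1 - ω) • (Du₁ t x - Du₂ t x) + (τ₁ t x - τ₂ t x)
  have hum : AEStronglyMeasurable (fun z : ℝ × Vec d => u z.1 z.2)
      ((volume.restrict (Ioo 0 T)).prod (volume.restrict (Ω : Set (Vec d)))) :=
    hu₁.aestronglyMeasurable.sub hu₂.aestronglyMeasurable
  have huL : MemLp (fun z : ℝ × Vec d => u z.1 z.2) 2
      ((volume.restrict (Ioo 0 T)).prod (volume.restrict (Ω : Set (Vec d)))) :=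
    hu₁.memLp.sub hu₂.memLp
  have hDu : MemLp (fun z : ℝ × Vec d => Du z.1 z.2) 2
      ((volume.restrict (Ioo 0 T)).prod (volume.restrict (Ω : Set (Vec d)))) :=
    hu₁.memLp_grad.sub hu₂.memLp_grad
  have hB : MemLp (fun z : ℝ × Vec d => B z.1 z.2) 2
      ((volume.restrict (Ioo 0 T)).prod (volume.restrict (Ω : Set (Vec d)))) :=
    (hDu.const_smul (1 - ω)).add (hτ₁.sub hτ₂)
  have ha₁ := AEStronglyMeasurable.advect hu₁.aestronglyMeasurable hu₁.aestronglyMeasurable_grad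
  have ha₂ := AEStronglyMeasurable.advect hu₂.aestronglyMeasurable hu₂.aestronglyMeasurable_grad
  have hn : AEStronglyMeasurable (fun z : ℝ × Vec d => n z.1 z.2)
      ((volume.restrict (Ioo 0 T)).prod (volume.restrict (Ω : Set (Vec d)))) :=
    (ha₁.sub ha₂).const_smul Re
  have huM : ∀ᵐ t ∂volume.restrict (Ioo 0 T),
      eLpNorm (u t) 2 (volume.restrict (Ω : Set (Vec d))) ≤ ((M₁ + M₂ : ℝ≥0) : ℝ≥0∞) := by
    filter_upwards [hM₁, hM₂, hu₁.aestronglyMeasurable.prodMk_left,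
      hu₂.aestronglyMeasurable.prodMk_left] with t k1 k2 k3 k4
    exact (eLpNorm_sub_le k3 k4 (by norm_num)).trans (by push_cast; gcongr)
  have hn1 : ∫⁻ t in Ioo 0 T, eLpNorm (n t) 2 (volume.restrict (Ω : Set (Vec d))) < ∞ := by
    calc ∫⁻ t in Ioo 0 T, eLpNorm (n t) 2 (volume.restrict (Ω : Set (Vec d)))
        ≤ ∫⁻ t in Ioo 0 T, ‖Re‖ₑ * (eLpNorm (fun x => advect (u₁ t x) (Du₁ t x)) 2
            (volume.restrict (Ω : Set (Vec d))) + eLpNorm (fun x => advect (u₂ t x) (Du₂ t x)) 2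
            (volume.restrict (Ω : Set (Vec d)))) := by
          refine lintegral_mono_ae ?_
          filter_upwards [ha₁.prodMk_left, ha₂.prodMk_left] with t k1 k2
          refine (eLpNorm_const_smul_le (c := Re)).trans ?_
          gcongr
          exact eLpNorm_sub_le k1 k2 (by norm_num)
      _ < ∞ := by
          rw [lintegral_const_mul' _ _ (by finiteness), lintegral_add_left'
            (aemeasurable_eLpNorm_two (a := fun z : ℝ × Vec d =>
              advect (u₁ z.1 z.2) (Du₁ z.1 z.2)) ha₁)]
          exact ENNReal.mul_lt_top (by finiteness)
            (ENNReal.add_lt_top.2 ⟨hu₁.lintegral_eLpNorm_advect_lt_top,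
              hu₂.lintegral_eLpNorm_advect_lt_top⟩)
  have henergy := energy_identity (κ := Re) (u := u) (n := n) (Du := Du) (B := B) hum huM hDu hB hn
    hn1 (hs₁.sub hs₂) (weakMomentum_sub hu₁ hu₂ hτ₁ hτ₂ h₁ h₂)
  have hUi : IntegrableOn (fun t => ∫ x in Ω, ‖u₁ t x - u₂ t x‖ ^ 2) (Ioo 0 T) :=
    (huL.integrable_norm_pow (by norm_num)).integral_prod_left
  have hτi : IntegrableOn (fun t => ∫ x in Ω, ‖τ₁ t x - τ₂ t x‖ ^ 2) (Ioo 0 T) :=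
    ((hτ₁.sub hτ₂).integrable_norm_pow (by norm_num)).integral_prod_left
  have hUM : ∀ᵐ t ∂volume.restrict (Ioo 0 T),
      ∫ x in Ω, ‖u₁ t x - u₂ t x‖ ^ 2 ≤ ((M₁ + M₂ : ℝ≥0) : ℝ) ^ 2 := by
    filter_upwards [huM, hum.prodMk_left] with t k1 k2
    have k2' : AEStronglyMeasurable (fun x => u₁ t x - u₂ t x) (volume.restrict (Ω : Set (Vec d))) := k2
    rw [← toReal_lintegral_enorm_sq k2']
    refine ENNReal.toReal_le_of_le_ofReal (by positivity) ?_
    rw [eLpNorm_two_eq] at k1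
    have k3 := pow_le_pow_left' k1 2
    rw [← ENNReal.rpow_natCast, ← ENNReal.rpow_mul, show (1 / 2 : ℝ) * (2 : ℕ) = 1 by norm_num,
      ENNReal.rpow_one] at k3
    rwa [ENNReal.ofReal_pow (by positivity), ENNReal.ofReal_coe_nnreal]
  have hU0 : ∀ t, 0 ≤ ∫ x in Ω, ‖u₁ t x - u₂ t x‖ ^ 2 := fun t => integral_nonneg fun x => by positivity
  have hb : IntegrableOn (fun r => (eLpNorm (Du₂ r) ∞ (volume.restrict (Ω : Set (Vec d)))).toReal)
      (Ioo 0 T) := integrable_toReal_of_lintegral_ne_top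
    hu₂.aemeasurable_eLpNorm_top_grad hu₂.lintegral_eLpNorm_top_lt_top.ne
  have hR : IntegrableOn (fun r => 2 * Re * (eLpNorm (Du₂ r) ∞
        (volume.restrict (Ω : Set (Vec d)))).toReal * (∫ x in Ω, ‖u₁ r x - u₂ r x‖ ^ 2) -
        (1 - ω) * (∫ x in Ω, ‖Du₁ r x - Du₂ r x‖ ^ 2) +
        1 / (1 - ω) * ∫ x in Ω, ‖τ₁ r x - τ₂ r x‖ ^ 2) (Ioo 0 T) := by
    refine (((hb.const_mul (2 * Re)).mul_bdd (c := ((M₁ + M₂ : ℝ≥0) : ℝ) ^ 2) hUi.1 ?_).sub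
      ((integrableOn_dissipation hu₁ hu₂).const_mul (1 - ω))).add (hτi.const_mul _)
    filter_upwards [hUM] with t ht
    rwa [Real.norm_of_nonneg (hU0 t)]
  refine ⟨_, hUM, hR, ?_⟩
  have hL : IntegrableOn (fun r => -2 * ((∫ x in Ω, (inner ℝ (n r x) (u r x) : ℝ)) +
        ∫ x in Ω, (inner ℝ (B r x) (Du r x) : ℝ))) (Ioo 0 T) :=
    ((integrable_integral_inner_of_bound (a := n) (b := u) hn hn1 hum huM).add
      (integrable_inner_of_memLp_two hB hDu).integral_prod_left).const_mul (-2)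
  have hle : ∀ᵐ r ∂volume.restrict (Ioo 0 T), -2 * ((∫ x in Ω, (inner ℝ (n r x) (u r x) : ℝ)) +
        ∫ x in Ω, (inner ℝ (B r x) (Du r x) : ℝ)) ≤
      2 * Re * (eLpNorm (Du₂ r) ∞ (volume.restrict (Ω : Set (Vec d)))).toReal *
        (∫ x in Ω, ‖u₁ r x - u₂ r x‖ ^ 2) - (1 - ω) * (∫ x in Ω, ‖Du₁ r x - Du₂ r x‖ ^ 2) +
        1 / (1 - ω) * ∫ x in Ω, ‖τ₁ r x - τ₂ r x‖ ^ 2 := by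
    filter_upwards [hs₁, hs₂, hu₁.weakGrad, hu₁.eLpNorm_top_lt_top, hu₂.eLpNorm_top_grad_lt_top,
      ae_memLp_two_of_memLp (a := τ₁) hτ₁, ae_memLp_two_of_memLp (a := τ₂) hτ₂] with r k1 k2 k3 k4 k5 k6 k7
    exact momentum_slice_bound hRe hω k1 k2 k3 k4 k5 k6 k7
  filter_upwards [henergy, ae_restrict_mem measurableSet_Ioo] with t k1 k2
  have hsub : Ioo 0 t ⊆ Ioo 0 T := Ioo_subset_Ioo_right k2.2.le
  simp only [real_inner_self_eq_norm_sq] at k1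
  rw [show (Re * ∫ x in Ω, ‖u₁ t x - u₂ t x‖ ^ 2) = Re * ∫ x in Ω, ‖u t x‖ ^ 2 from rfl, k1]
  exact integral_mono_ae (hL.mono_set hsub) (hR.mono_set hsub)
    (ae_restrict_of_ae_restrict_of_subset hsub hle)

end EnergyDifference

end

noncomputable section

/-! ### Uniqueness of velocity, stress and deformation gradient -/

section Uniqueness

open Filter Topology

variable {d : ℕ} {Ω : Opens (Vec d)} {T : ℝ}

/-- The gradients are carried as separate functions and occur in the pressure equation, so the
equality of the velocities has to be passed on to them. This is the fundamental lemma of the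
calculus of variations, component by component. -/
lemma HasWeakGrad.grad_ae_eq_zero {ι : Type} [Fintype ι] {g : Vec d → EuclideanSpace ℝ ι}
    {Dg : Vec d → EuclideanSpace ℝ (Fin d × ι)} (h : HasWeakGrad Ω g Dg)
    (h0 : ∀ᵐ x ∂volume.restrict (Ω : Set (Vec d)), g x = 0) :
    ∀ᵐ x ∂volume.restrict (Ω : Set (Vec d)), Dg x = 0 := by
  have hik : ∀ (i : Fin d) (k : ι), ∀ᵐ x ∂volume.restrict (Ω : Set (Vec d)), Dg x (i, k) = 0 := by
    intro i k
    rw [ae_restrict_iff' Ω.isOpen.measurableSet]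
    refine Ω.isOpen.ae_eq_zero_of_integral_contDiff_smul_eq_zero
      (locallyIntegrableOn_apply h.locInt_grad (i, k)) fun φ hφ hc hs => ?_
    let ψ : 𝓓(Ω, ℝ) := ⟨φ, hφ, hc, hs⟩
    have h1 : ∫ x in Ω, Dg x (i, k) * φ x = 0 := by
      have h2 := h.integral_eq ψ i k
      have h3 : ∫ x in Ω, g x k * fderiv ℝ ψ x (EuclideanSpace.single i 1) = 0 := by
        refine integral_eq_zero_of_ae (h0.mono fun x hx => ?_)
        simp [hx]
      rw [h3] at h2
      exact neg_eq_zero.1 h2.symm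
    rw [← setIntegral_eq_integral_of_forall_compl_eq_zero (s := (Ω : Set (Vec d)))]
    · simpa only [smul_eq_mul, mul_comm] using h1
    · intro x hx
      rw [image_eq_zero_of_notMem_tsupport fun hm => hx (hs hm), zero_smul]
  have hall := ae_all_iff.2 fun i => ae_all_iff.2 (hik i)
  filter_upwards [hall] with x hx
  ext ⟨i, k⟩
  exact hx i k

lemma ae_eq_zero_of_integral_norm_sq {α E : Type*} [MeasurableSpace α] [NormedAddCommGroup E]
    {μ : Measure α} {f : α → E} (hf : MemLp f 2 μ) (h : ∫ x, ‖f x‖ ^ 2 ∂μ ≤ 0) :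
    ∀ᵐ x ∂μ, f x = 0 := by
  have h1 : ∫ x, ‖f x‖ ^ 2 ∂μ = 0 := le_antisymm h (integral_nonneg fun x => by positivity)
  rw [integral_eq_zero_iff_of_nonneg (fun x => by positivity)
    (hf.integrable_norm_pow (by norm_num))] at h1
  filter_upwards [h1] with x hx
  simpa using hx

lemma ae_prod_eq_zero_of_ae_ae {α β E : Type*} [MeasurableSpace α] [MeasurableSpace β]
    [NormedAddCommGroup E] {μ : Measure α} {ν : Measure β} [SFinite μ] [SFinite ν] {f : α × β → E}
    (hf : AEStronglyMeasurable f (μ.prod ν)) (h : ∀ᵐ x ∂μ, ∀ᵐ y ∂ν, f (x, y) = 0) :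
    ∀ᵐ z ∂μ.prod ν, f z = 0 := by
  have h1 := ae_prod_le_of_ae_ae_le (g := fun _ => (0 : ℝ)) hf.norm.aemeasurable
    aemeasurable_const (by
      filter_upwards [h] with x hx
      filter_upwards [hx] with y hy
      rw [hy, norm_zero])
  filter_upwards [h1] with z hz
  exact norm_le_zero_iff.1 hz

variable {u₁ u₂ : ℝ → Vec d → Vec d} {Du₁ Du₂ τ₁ τ₂ : ℝ → Vec d → Ten d}
  {G₁ G₂ : ℝ → ℝ → Vec d → Ten d}
  {DG₁ DG₂ : ℝ → ℝ → Vec d → EuclideanSpace ℝ (Fin d × (Fin d × Fin d))}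

lemma integrableOn_growth {c Y : ℝ → ℝ} {A p K : ℝ} (hp : 0 ≤ p) (hc : IntegrableOn c (Ioo 0 T))
    (hY0 : ∀ t, 0 ≤ Y t) (hYm : AEStronglyMeasurable Y (volume.restrict (Ioo 0 T)))
    (hYK : ∀ᵐ t ∂volume.restrict (Ioo 0 T), Y t ≤ K) :
    IntegrableOn (fun t => c t * Y t + A * Y t ^ p) (Ioo 0 T) := by
  refine Integrable.add (hc.mul_bdd (c := K) hYm ?_) (Integrable.const_mul ?_ _)
  · filter_upwards [hYK] with t ht
    rwa [Real.norm_of_nonneg (hY0 t)]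
  · refine Integrable.of_bound (hYm.aemeasurable.pow_const _).aestronglyMeasurable (K ^ p) ?_
    filter_upwards [hYK] with t ht
    rw [Real.norm_of_nonneg (by have := hY0 t; positivity)]
    exact Real.rpow_le_rpow (hY0 t) ht hp

/-- Two energy functionals `U` and `Z` with the coupled integral inequalities vanish. -/
lemma eq_zero_of_coupled_inequalities {Re ω A C K K' : ℝ} (hRe : 0 < Re) (hω : 0 ≤ ω) (hω' : ω < 1)
    (hA : 0 ≤ A) (hC : 0 ≤ C) {U Z D E a b : ℝ → ℝ} (hU0 : ∀ t, 0 ≤ U t) (hZ0 : ∀ t, 0 ≤ Z t)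
    (ha0 : ∀ t, 0 ≤ a t) (hb0 : ∀ t, 0 ≤ b t)
    (hUm : AEStronglyMeasurable U (volume.restrict (Ioo 0 T)))
    (hZm : AEStronglyMeasurable Z (volume.restrict (Ioo 0 T)))
    (hUK : ∀ᵐ t ∂volume.restrict (Ioo 0 T), U t ≤ K)
    (hZK : ∀ᵐ t ∂volume.restrict (Ioo 0 T), Z t ≤ K')
    (ha : IntegrableOn a (Ioo 0 T)) (hb : IntegrableOn b (Ioo 0 T)) (hD : IntegrableOn D (Ioo 0 T))
    (hE : ∀ᵐ t ∂volume.restrict (Ioo 0 T), E t ≤ A * Z t)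
    (hi : IntegrableOn (fun r => 2 * Re * b r * U r - (1 - ω) * D r + 1 / (1 - ω) * E r) (Ioo 0 T))
    (hU : ∀ᵐ t ∂volume.restrict (Ioo 0 T), Re * U t ≤
      ∫ r in Ioo 0 t, (2 * Re * b r * U r - (1 - ω) * D r + 1 / (1 - ω) * E r))
    (hZ : ∀ n : ℕ, 2 ≤ n → ∀ᵐ t ∂volume.restrict (Ioo 0 T),
      Z t ≤ ∫ r in Ioo 0 t, (D r + C * n * Z r ^ (1 - 1 / (n : ℝ)) + (2 * a r + C) * Z r)) :
    ∀ᵐ t ∂volume.restrict (Ioo 0 T), U t = 0 ∧ Z t = 0 := by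
  have hω1 : 0 < 1 - ω := by linarith
  -- The weight 1 - ω is the one for which the dissipation D cancels between the two inequalities.
  -- The stress term E/(1-ω) ≤ A Z/(1-ω), expressed through (1-ω) Z, gives the summand A/(1-ω)² of
  -- c.
  let Y : ℝ → ℝ := fun t => Re * U t + (1 - ω) * Z t
  let c : ℝ → ℝ := fun t => 2 * b t + A / (1 - ω) ^ 2 + 2 * a t + C
  have hY0 : ∀ t, 0 ≤ Y t := fun t =>
    add_nonneg (mul_nonneg hRe.le (hU0 t)) (mul_nonneg hω1.le (hZ0 t))
  have hc0 : ∀ t, 0 ≤ c t := fun t => by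
    have h1 := ha0 t
    have h2 := hb0 t
    positivity
  have hYm : AEStronglyMeasurable Y (volume.restrict (Ioo 0 T)) :=
    (hUm.const_mul _).add (hZm.const_mul _)
  have hYK : ∀ᵐ t ∂volume.restrict (Ioo 0 T), Y t ≤ Re * K + (1 - ω) * K' := by
    filter_upwards [hUK, hZK] with t h1 h2
    exact add_le_add (mul_le_mul_of_nonneg_left h1 hRe.le) (mul_le_mul_of_nonneg_left h2 hω1.le)
  have hc : IntegrableOn c (Ioo 0 T) :=
    (((hb.const_mul 2).add (integrable_const _)).add (ha.const_mul 2)).add (integrable_const _)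
  have hY : ∀ᵐ t ∂volume.restrict (Ioo 0 T), Y t = 0 := by
    refine eq_zero_of_osgood hC hY0 hc0 hYm hYK hc fun n hn => ?_
    have hn0 : (0 : ℝ) ≤ 1 / n := by positivity
    have hn1 : 0 ≤ 1 - 1 / (n : ℝ) := by
      rw [sub_nonneg, div_le_one (by positivity)]; exact_mod_cast (by omega : 1 ≤ n)
    have hψ : IntegrableOn (fun r => D r + C * n * Z r ^ (1 - 1 / (n : ℝ)) + (2 * a r + C) * Z r)
        (Ioo 0 T) := by
      refine (hD.add (integrableOn_growth (c := fun r => 2 * a r + C) (A := C * n) hn1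
        ((ha.const_mul 2).add (integrable_const C)) hZ0 hZm hZK)).congr
        (Eventually.of_forall fun t => ?_)
      simp only [Pi.add_apply]; ring
    have hle : ∀ᵐ r ∂volume.restrict (Ioo 0 T),
        (2 * Re * b r * U r - (1 - ω) * D r + 1 / (1 - ω) * E r) +
          (1 - ω) * (D r + C * n * Z r ^ (1 - 1 / (n : ℝ)) + (2 * a r + C) * Z r) ≤
        c r * Y r + C * n * Y r ^ (1 - 1 / (n : ℝ)) := by
      filter_upwards [hE] with r hr
      -- Because 0 < 1 - ω ≤ 1, this factor is at most its power 1 - 1/n and can be drawn inside the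
      -- power; here ω ≥ 0 enters.
      have k1 : (1 - ω) * Z r ^ (1 - 1 / (n : ℝ)) ≤ Y r ^ (1 - 1 / (n : ℝ)) := by
        calc (1 - ω) * Z r ^ (1 - 1 / (n : ℝ))
            ≤ (1 - ω) ^ (1 - 1 / (n : ℝ)) * Z r ^ (1 - 1 / (n : ℝ)) := by
              refine mul_le_mul_of_nonneg_right ?_ (Real.rpow_nonneg (hZ0 r) _)
              exact Real.self_le_rpow_of_le_one hω1.le (by linarith) (by linarith)
          _ = ((1 - ω) * Z r) ^ (1 - 1 / (n : ℝ)) := (Real.mul_rpow hω1.le (hZ0 r)).symm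
          _ ≤ Y r ^ (1 - 1 / (n : ℝ)) := by
              refine Real.rpow_le_rpow (mul_nonneg hω1.le (hZ0 r)) ?_ hn1
              exact le_add_of_nonneg_left (mul_nonneg hRe.le (hU0 r))
      have k2 : 1 / (1 - ω) * E r ≤ A / (1 - ω) ^ 2 * ((1 - ω) * Z r) := by
        refine (mul_le_mul_of_nonneg_left hr (by positivity)).trans_eq ?_
        field_simp
      have k3 := mul_le_mul_of_nonneg_left k1 (mul_nonneg hC n.cast_nonneg)
      have k4 : 0 ≤ Re * U r := mul_nonneg hRe.le (hU0 r)
      have k5 : 0 ≤ (1 - ω) * Z r := mul_nonneg hω1.le (hZ0 r)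
      have k6 : 0 ≤ 2 * b r * ((1 - ω) * Z r) := mul_nonneg (by linarith [hb0 r]) k5
      have k7 : 0 ≤ (A / (1 - ω) ^ 2 + 2 * a r + C) * (Re * U r) :=
        mul_nonneg (by have := ha0 r; positivity) k4
      have k8 : c r * Y r = 2 * b r * (Re * U r) + 2 * b r * ((1 - ω) * Z r) +
          (A / (1 - ω) ^ 2 + 2 * a r + C) * (Re * U r) +
          A / (1 - ω) ^ 2 * ((1 - ω) * Z r) + (2 * a r + C) * ((1 - ω) * Z r) := by
        simp only [c, Y]; ring
      rw [k8]
      linarith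
    filter_upwards [hU, hZ n hn, ae_restrict_mem measurableSet_Ioo] with t h1 h2 h3
    have hsub : Ioo 0 t ⊆ Ioo 0 T := Ioo_subset_Ioo_right h3.2.le
    calc Y t ≤ (∫ r in Ioo 0 t, (2 * Re * b r * U r - (1 - ω) * D r + 1 / (1 - ω) * E r)) +
          (1 - ω) * ∫ r in Ioo 0 t, (D r + C * n * Z r ^ (1 - 1 / (n : ℝ)) + (2 * a r + C) * Z r) :=
        add_le_add h1 (mul_le_mul_of_nonneg_left h2 hω1.le)
      _ = ∫ r in Ioo 0 t, ((2 * Re * b r * U r - (1 - ω) * D r + 1 / (1 - ω) * E r) +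
          (1 - ω) * (D r + C * n * Z r ^ (1 - 1 / (n : ℝ)) + (2 * a r + C) * Z r)) := by
        rw [← integral_const_mul, ← integral_add (hi.mono_set hsub)
          ((hψ.mono_set hsub).const_mul (1 - ω))]
      _ ≤ _ := integral_mono_ae ((hi.mono_set hsub).add ((hψ.mono_set hsub).const_mul (1 - ω)))
          ((integrableOn_growth hn1 hc hY0 hYm hYK).mono_set hsub)
          (ae_restrict_of_ae_restrict_of_subset hsub hle)
  filter_upwards [hY] with t ht
  have h1 : 0 ≤ Re * U t := mul_nonneg hRe.le (hU0 t)
  have h2 : 0 ≤ (1 - ω) * Z t := mul_nonneg hω1.le (hZ0 t)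
  have ht' : Re * U t + (1 - ω) * Z t = 0 := ht
  constructor
  · exact (mul_eq_zero.1 (by linarith : Re * U t = 0)).resolve_left hRe.ne'
  · exact (mul_eq_zero.1 (by linarith : (1 - ω) * Z t = 0)).resolve_left hω1.ne'

/-- Combines the transport, stress and momentum inequalities. The first conclusion is stated on time
slices and includes the gradients, which is the form in which the pressure equation consumes it. -/
lemma uniqueness_of_weak_solution (hd : 2 ≤ d) (hΩ : Bornology.IsBounded (Ω : Set (Vec d)))
    {Re We ω : ℝ} (hRe : 0 < Re) (hω : 0 ≤ ω) (hω' : ω < 1) {m : ℝ → ℝ} (hm : IsMemory m)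
    {S : Ten d → Ten d} (hS : ContDiff ℝ 1 S) {u₀ : Vec d → Vec d} {Gold : ℝ → Vec d → Ten d}
    {f : ℝ → StrongDual ℝ (V Ω)} {F : ℝ → StrongDual ℝ (H10 Ω)} {p₁ p₂ : 𝓓'(spaceTime Ω T, ℝ)}
    (hu₁ : VelocityClass Ω T u₁ Du₁) (hu₂ : VelocityClass Ω T u₂ Du₂)
    (hG₁ : DeformationClass Ω T G₁ DG₁) (hG₂ : DeformationClass Ω T G₂ DG₂)
    (hb₁ : EssBounded Ω T G₁) (hb₂ : EssBounded Ω T G₂)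
    (h₁ : IsWeakSolution Ω T Re We ω m S u₀ Gold f F u₁ Du₁ p₁ τ₁ G₁ DG₁)
    (h₂ : IsWeakSolution Ω T Re We ω m S u₀ Gold f F u₂ Du₂ p₂ τ₂ G₂ DG₂) :
    (∀ᵐ t ∂volume.restrict (Ioo 0 T), ∀ᵐ x ∂volume.restrict (Ω : Set (Vec d)),
      u₁ t x = u₂ t x ∧ Du₁ t x = Du₂ t x ∧ τ₁ t x = τ₂ t x) ∧
    (∀ᵐ z ∂volume.restrict (spaceTime Ω T : Set (ℝ × Vec d)), u₁ z.1 z.2 = u₂ z.1 z.2) ∧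
    (∀ᵐ z ∂volume.restrict (spaceTime Ω T : Set (ℝ × Vec d)), τ₁ z.1 z.2 = τ₂ z.1 z.2) ∧
    (∀ᵐ z ∂volume.restrict (ageCylinder Ω T), G₁ z.1 z.2.1 z.2.2 = G₂ z.1 z.2.1 z.2.2) := by
  have hfin : IsFiniteMeasure (volume.restrict (Ω : Set (Vec d))) := ⟨by
    rw [Measure.restrict_apply_univ]; exact hΩ.measure_lt_top⟩
  have hτm₁ := h₁.law.aestronglyMeasurable hm hS.continuous hG₁.meas
  have hτm₂ := h₂.law.aestronglyMeasurable hm hS.continuous hG₂.meas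
  obtain ⟨K₁, hK₁⟩ := h₁.law.bounded hm hS.continuous hb₁
  obtain ⟨K₂, hK₂⟩ := h₂.law.bounded hm hS.continuous hb₂
  have hτ₁ : MemLp (fun z : ℝ × Vec d => τ₁ z.1 z.2) 2
      ((volume.restrict (Ioo 0 T)).prod (volume.restrict (Ω : Set (Vec d)))) :=
    MemLp.of_bound hτm₁ K₁ hK₁
  have hτ₂ : MemLp (fun z : ℝ × Vec d => τ₂ z.1 z.2) 2
      ((volume.restrict (Ioo 0 T)).prod (volume.restrict (Ω : Set (Vec d)))) :=
    MemLp.of_bound hτm₂ K₂ hK₂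
  obtain ⟨Z, C, K', hC0, hK', hZ0, hZm, hZK, hzZ, hZ⟩ := exists_deformation_difference hd hΩ hu₁ hu₂
    h₁.solenoidal h₂.solenoidal hG₁ hG₂ hb₁ hb₂ h₁.transport h₂.transport
  obtain ⟨A, hA0, hA⟩ := exists_stress_difference_bound hΩ hm hS h₁.law h₂.law hG₁.meas hG₂.meas
    hb₁ hb₂
  obtain ⟨K, hUK, hi, hU⟩ := energy_difference hRe.le hω' hu₁ hu₂ h₁.solenoidal h₂.solenoidal
    hτ₁ hτ₂ h₁.momentum h₂.momentum
  have hE := hA hZ0 hzZ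
  have huL : MemLp (fun z : ℝ × Vec d => u₁ z.1 z.2 - u₂ z.1 z.2) 2
      ((volume.restrict (Ioo 0 T)).prod (volume.restrict (Ω : Set (Vec d)))) :=
    hu₁.memLp.sub hu₂.memLp
  have hτL : MemLp (fun z : ℝ × Vec d => τ₁ z.1 z.2 - τ₂ z.1 z.2) 2
      ((volume.restrict (Ioo 0 T)).prod (volume.restrict (Ω : Set (Vec d)))) := hτ₁.sub hτ₂
  have hUm : AEStronglyMeasurable (fun t => ∫ x in Ω, ‖u₁ t x - u₂ t x‖ ^ 2)
      (volume.restrict (Ioo 0 T)) :=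
    (huL.integrable_norm_pow (by norm_num)).integral_prod_left.1
  have hzero := eq_zero_of_coupled_inequalities hRe hω hω' hA0 hC0
    (fun t => integral_nonneg fun x => by positivity) hZ0 (fun t => ENNReal.toReal_nonneg)
    (fun t => ENNReal.toReal_nonneg) hUm hZm hUK hZK
    (integrable_toReal_of_lintegral_ne_top hu₁.aemeasurable_eLpNorm_top_grad
      hu₁.lintegral_eLpNorm_top_lt_top.ne)
    (integrable_toReal_of_lintegral_ne_top hu₂.aemeasurable_eLpNorm_top_grad
      hu₂.lintegral_eLpNorm_top_lt_top.ne)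
    (integrableOn_dissipation hu₁ hu₂) hE hi hU hZ
  have hu : ∀ᵐ t ∂volume.restrict (Ioo 0 T), ∀ᵐ x ∂volume.restrict (Ω : Set (Vec d)),
      u₁ t x - u₂ t x = 0 := by
    filter_upwards [hzero, ae_memLp_two_of_memLp (a := fun t x => u₁ t x - u₂ t x) huL] with t k1 k2
    exact ae_eq_zero_of_integral_norm_sq k2 k1.1.le
  have hτ : ∀ᵐ t ∂volume.restrict (Ioo 0 T), ∀ᵐ x ∂volume.restrict (Ω : Set (Vec d)),
      τ₁ t x - τ₂ t x = 0 := by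
    filter_upwards [hzero, hE, ae_memLp_two_of_memLp (a := fun t x => τ₁ t x - τ₂ t x) hτL]
      with t k1 k2 k3
    rw [k1.2, mul_zero] at k2
    exact ae_eq_zero_of_integral_norm_sq k3 k2
  have hGm := aestronglyMeasurable_comp_assoc (hG₁.meas.sub hG₂.meas)
  obtain ⟨M₁, hM₁⟩ := hb₁
  obtain ⟨M₂, hM₂⟩ := hb₂
  have hG : ∀ᵐ r ∂volume.restrict (Ioi (0 : ℝ) ×ˢ Ioo 0 T),
      ∀ᵐ x ∂volume.restrict (Ω : Set (Vec d)), G₁ r.1 r.2 x - G₂ r.1 r.2 x = 0 := by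
    have hzero' : ∀ᵐ r ∂volume.restrict (Ioi (0 : ℝ) ×ˢ Ioo 0 T), Z r.2 = 0 := by
      rw [Measure.volume_eq_prod, ← Measure.prod_restrict]
      exact Measure.quasiMeasurePreserving_snd.ae (hzero.mono fun t ht => ht.2)
    filter_upwards [hzero', hzZ, hGm.prodMk_left, ae_ae_of_ae_ageCylinder hM₁,
      ae_ae_of_ae_ageCylinder hM₂] with r k1 k2 k3 k4 k5
    rw [k1] at k2
    refine ae_eq_zero_of_integral_norm_sq (MemLp.of_bound k3 (M₁ + M₂) ?_) k2
    filter_upwards [k4, k5] with x l1 l2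
    exact (norm_sub_le _ _).trans (add_le_add l1 l2)
  refine ⟨?_, ?_, ?_, ?_⟩
  · filter_upwards [hu, hτ, hu₁.weakGrad, hu₂.weakGrad] with t k1 k2 k3 k4
    filter_upwards [k1, k2, (k3.sub k4).grad_ae_eq_zero k1] with x l1 l2 l3
    exact ⟨sub_eq_zero.1 l1, sub_eq_zero.1 l3, sub_eq_zero.1 l2⟩
  · rw [volume_restrict_spaceTime]
    filter_upwards [ae_prod_eq_zero_of_ae_ae huL.1 hu] with z hz using sub_eq_zero.1 hz
  · rw [volume_restrict_spaceTime]
    filter_upwards [ae_prod_eq_zero_of_ae_ae hτL.1 hτ] with z hz using sub_eq_zero.1 hz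
  · have h3 := ae_prod_eq_zero_of_ae_ae hGm hG
    have h4 := (measurePreserving_ageCylinder Ω T).symm.quasiMeasurePreserving.ae h3
    filter_upwards [h4] with z hz using sub_eq_zero.1 hz

end Uniqueness

end

noncomputable section

/-! ### Integrals of smooth functions with a parameter -/

section Parameter

open Filter Topology

variable {P W : Type} [NormedAddCommGroup P] [NormedSpace ℝ P] [FiniteDimensional ℝ P]
  [NormedAddCommGroup W] [NormedSpace ℝ W] [FiniteDimensional ℝ W] [MeasurableSpace W]
  [BorelSpace W] {μ : Measure W} [IsFiniteMeasureOnCompacts μ]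

lemma hasFDerivAt_setIntegral_param {E : Type} [NormedAddCommGroup E] [NormedSpace ℝ E]
    {G : P × W → E} (hG : ContDiff ℝ 1 G) {k : Set W} (hk : IsCompact k) (p : P) :
    HasFDerivAt (fun p => ∫ w in k, G (p, w) ∂μ)
      (∫ w in k, (fderiv ℝ G (p, w)).comp (ContinuousLinearMap.inl ℝ P W) ∂μ) p := by
  have hproper : ProperSpace P := FiniteDimensional.proper ℝ P
  have hfin : IsFiniteMeasure (μ.restrict k) := ⟨by
    rw [Measure.restrict_apply_univ]; exact hk.measure_lt_top⟩
  have hD : Continuous fun q : P × W => (fderiv ℝ G q).comp (ContinuousLinearMap.inl ℝ P W) :=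
    (hG.continuous_fderiv (by simp)).clm_comp continuous_const
  have hsl : ∀ p : P, Continuous fun w : W => (p, w) := fun p => by fun_prop
  obtain ⟨C, hC⟩ := ((isCompact_closedBall p 1).prod hk).exists_bound_of_continuousOn hD.continuousOn
  refine hasFDerivAt_integral_of_dominated_of_fderiv_le (bound := fun _ => C)
    (F' := fun p w => (fderiv ℝ G (p, w)).comp (ContinuousLinearMap.inl ℝ P W))
    (Metric.ball_mem_nhds p one_pos) (Eventually.of_forall fun q =>
      (hG.continuous.comp (hsl q)).aestronglyMeasurable) ?_
    (hD.comp (hsl p)).aestronglyMeasurable ?_ (integrable_const C) ?_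
  · exact (hG.continuous.comp (hsl p)).continuousOn.integrableOn_compact hk
  · filter_upwards [ae_restrict_mem hk.measurableSet] with w hw q hq
    exact hC (q, w) ⟨Metric.ball_subset_closedBall hq, hw⟩
  · refine Eventually.of_forall fun w q _ => ?_
    have h1 : HasFDerivAt (fun p : P => (p, w)) (ContinuousLinearMap.inl ℝ P W) q :=
      hasFDerivAt_prodMk_left q w
    exact ((hG.differentiable (by simp)) (q, w)).hasFDerivAt.comp q h1

/-- Induction on the order of differentiability with the target space generalised: the derivative in
the parameter is an integral of the same kind, with values in the linear maps from P to E. -/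
lemma contDiff_setIntegral_param {E : Type} [NormedAddCommGroup E] [NormedSpace ℝ E]
    {G : P × W → E} (hG : ContDiff ℝ ((⊤ : ℕ∞) : WithTop ℕ∞) G) {k : Set W} (hk : IsCompact k) :
    ContDiff ℝ ((⊤ : ℕ∞) : WithTop ℕ∞) fun p => ∫ w in k, G (p, w) ∂μ := by
  have main : ∀ (n : ℕ) (E : Type) [NormedAddCommGroup E] [NormedSpace ℝ E] (G : P × W → E),
      ContDiff ℝ ((⊤ : ℕ∞) : WithTop ℕ∞) G → ContDiff ℝ n fun p => ∫ w in k, G (p, w) ∂μ := by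
    intro n
    induction n with
    | zero =>
      intro E _ _ G hG
      rw [Nat.cast_zero, contDiff_zero]
      exact continuous_iff_continuousAt.2 fun p =>
        (hasFDerivAt_setIntegral_param (hG.of_le (by norm_num)) hk p).continuousAt
    | succ n ih =>
      intro E _ _ G hG
      rw [Nat.cast_succ, contDiff_succ_iff_hasFDerivAt]
      · refine ⟨_, ih (P →L[ℝ] E)
          (fun q => (fderiv ℝ G q).comp (ContinuousLinearMap.inl ℝ P W)) ?_, fun p =>
          hasFDerivAt_setIntegral_param (hG.of_le (by norm_num)) hk p⟩
        exact (hG.fderiv_right (by simp)).clm_comp contDiff_const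
  exact contDiff_infty.2 fun n => main n E G hG

end Parameter

/-! ### Divergences of test fields -/

section Divergence

open Filter Topology

variable {d : ℕ} {Ω : Opens (Vec d)} {T : ℝ}

/-- The divergence in `x` as a continuous linear form of the derivative. -/
def divForm (d : ℕ) : ((ℝ × Vec d) →L[ℝ] Vec d) →L[ℝ] ℝ :=
  ∑ i : Fin d, (EuclideanSpace.proj i : Vec d →L[ℝ] ℝ).comp
    (ContinuousLinearMap.apply ℝ (Vec d) ((0, EuclideanSpace.single i 1) : ℝ × Vec d))

lemma divForm_apply (A : (ℝ × Vec d) →L[ℝ] Vec d) :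
    divForm d A = ∑ i : Fin d, A (0, EuclideanSpace.single i 1) i := by
  simp [divForm]

lemma divForm_smulRight (l : (ℝ × Vec d) →L[ℝ] ℝ) (a : Vec d) :
    divForm d (l.smulRight a) = l (0, a) := by
  rw [divForm_apply]
  have h : ((0, a) : ℝ × Vec d) = ∑ i, a i • ((0, EuclideanSpace.single i 1) : ℝ × Vec d) := by
    have h1 : a = ∑ i, a i • (EuclideanSpace.single i 1 : Vec d) := by
      conv_lhs => rw [← (EuclideanSpace.basisFun (Fin d) ℝ).sum_repr a]
      simp
    refine Prod.ext ?_ ?_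
    · simp [Prod.fst_sum]
    · rw [Prod.snd_sum]; exact h1
  rw [h, map_sum]
  refine Finset.sum_congr rfl fun i _ => ?_
  rw [map_smul, ContinuousLinearMap.smulRight_apply, PiLp.smul_apply, smul_eq_mul, smul_eq_mul,
    mul_comm]

/-- The field is F(t,x) = ∫∫ g(t, x - s(w-b), w) (w-b) dw ds with s in [0,1]. It moves the mass g(t,
x, w) from x to x + (w-b) along a segment. The divergence of the integrand is minus its derivative
in s, apart from the vector factor, so the integral in s leaves the two end points. The hypothesis
`hs` says that the segments stay in the cylinder. -/
lemma exists_divX_eq_integral {g : ℝ × Vec d × Vec d → ℝ}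
    (hg : ContDiff ℝ ((⊤ : ℕ∞) : WithTop ℕ∞) g) (hc : HasCompactSupport g) (b : Vec d)
    (hs : ∀ z ∈ tsupport g, ∀ s ∈ Icc (0 : ℝ) 1,
      (z.1, z.2.1 + s • (z.2.2 - b)) ∈ spaceTime Ω T) :
    ∃ φ : 𝓓(spaceTime Ω T, Vec d), ∀ t x,
      divX φ (t, x) = ∫ w, (g (t, x, w) - g (t, x - (w - b), w)) := by
  obtain ⟨R, hR⟩ := (hc.isCompact.image (f := fun z : ℝ × Vec d × Vec d => z.2.2)
    (by fun_prop)).isBounded.subset_closedBall (0 : Vec d)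
  have hg0 : ∀ t x w, w ∉ Metric.closedBall (0 : Vec d) R → g (t, x, w) = 0 := by
    intro t x w hw
    by_contra hne
    exact hw (hR ⟨(t, x, w), subset_tsupport _ hne, rfl⟩)
  set k : Set (ℝ × Vec d) := Icc 0 1 ×ˢ Metric.closedBall 0 R with hk
  have hkc : IsCompact k := isCompact_Icc.prod (isCompact_closedBall 0 R)
  let h : (ℝ × Vec d) × (ℝ × Vec d) → ℝ :=
    fun q => g (q.1.1, q.1.2 - q.2.1 • (q.2.2 - b), q.2.2)
  have hh : ContDiff ℝ ((⊤ : ℕ∞) : WithTop ℕ∞) h := hg.comp (by fun_prop)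
  let G : (ℝ × Vec d) × (ℝ × Vec d) → Vec d := fun q => h q • (q.2.2 - b)
  have hG : ContDiff ℝ ((⊤ : ℕ∞) : WithTop ℕ∞) G := hh.smul (by fun_prop)
  let F : ℝ × Vec d → Vec d := fun p => ∫ w in k, G (p, w)
  have hF : ContDiff ℝ ((⊤ : ℕ∞) : WithTop ℕ∞) F := contDiff_setIntegral_param hG hkc
  have hKc : IsCompact ((fun q : ℝ × (ℝ × Vec d × Vec d) =>
      (q.2.1, q.2.2.1 + q.1 • (q.2.2.2 - b))) '' (Icc 0 1 ×ˢ tsupport g)) :=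
    (isCompact_Icc.prod hc.isCompact).image (by fun_prop)
  have hsupp : Function.support F ⊆ (fun q : ℝ × (ℝ × Vec d × Vec d) =>
      (q.2.1, q.2.2.1 + q.1 • (q.2.2.2 - b))) '' (Icc 0 1 ×ˢ tsupport g) := by
    intro p hp
    by_contra hne
    refine hp (setIntegral_eq_zero_of_forall_eq_zero fun w hw => ?_)
    have : h (p, w) = 0 := by
      by_contra h1
      exact hne ⟨(w.1, (p.1, p.2 - w.1 • (w.2 - b), w.2)), ⟨hw.1, subset_tsupport _ h1⟩, by simp⟩
    simp only [G, this, zero_smul]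
  refine ⟨⟨F, hF, HasCompactSupport.of_support_subset_isCompact hKc hsupp, ?_⟩, fun t x => ?_⟩
  · refine (closure_minimal hsupp hKc.isClosed).trans ?_
    rintro _ ⟨q, hq, rfl⟩
    exact hs q.2 hq.2 q.1 hq.1
  · have h1 := hasFDerivAt_setIntegral_param (μ := volume) (hG.of_le (by norm_num)) hkc (t, x)
    have hint : IntegrableOn (fun w => (fderiv ℝ G ((t, x), w)).comp
        (ContinuousLinearMap.inl ℝ (ℝ × Vec d) (ℝ × Vec d))) k := by
      refine ContinuousOn.integrableOn_compact hkc ?_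
      exact (((hG.continuous_fderiv (by simp)).comp (by fun_prop)).clm_comp
        continuous_const).continuousOn
    have hpt : ∀ w : ℝ × Vec d, divForm d ((fderiv ℝ G ((t, x), w)).comp
        (ContinuousLinearMap.inl ℝ (ℝ × Vec d) (ℝ × Vec d))) =
        -deriv (fun s => g (t, x - s • (w.2 - b), w.2)) w.1 := by
      intro w
      have hgd := (hg.differentiable (by simp)) (t, x - w.1 • (w.2 - b), w.2)
      have e1 : HasFDerivAt (fun p : ℝ × Vec d => (p.1, p.2 - w.1 • (w.2 - b), w.2))
          ((ContinuousLinearMap.fst ℝ ℝ (Vec d)).prod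
            ((ContinuousLinearMap.snd ℝ ℝ (Vec d)).prod 0)) (t, x) :=
        hasFDerivAt_fst.prodMk ((hasFDerivAt_snd.sub_const _).prodMk (hasFDerivAt_const _ _))
      have e2 := (hgd.hasFDerivAt.comp (t, x) e1).smul_const (w.2 - b)
      have e3 := ((hG.differentiable (by simp)) ((t, x), w)).hasFDerivAt.comp (t, x)
        (hasFDerivAt_prodMk_left (𝕜 := ℝ) (t, x) w)
      rw [HasFDerivAt.unique e3 e2, divForm_smulRight]
      have e4 : HasDerivAt (fun s : ℝ => (t, x - s • (w.2 - b), w.2))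
          ((0 : ℝ), -(w.2 - b), (0 : Vec d)) w.1 := by
        refine (hasDerivAt_const _ _).prodMk (HasDerivAt.prodMk ?_ (hasDerivAt_const _ _))
        simpa using ((hasDerivAt_id w.1).smul_const (w.2 - b)).const_sub x
      have e5 := (hgd.hasFDerivAt.comp_hasDerivAt w.1 e4).deriv
      have e6 : ((0 : ℝ), -(w.2 - b), (0 : Vec d)) = -((0 : ℝ), w.2 - b, (0 : Vec d)) := by simp
      rw [e6, map_neg] at e5
      refine Eq.trans ?_ (congrArg Neg.neg e5.symm)
      rw [neg_neg]
      rfl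
    have hdiv : ∫ w in k, -deriv (fun s => g (t, x - s • (w.2 - b), w.2)) w.1 =
        ∫ w, (g (t, x, w) - g (t, x - (w - b), w)) := by
      have hd1 : ∀ w : Vec d, ContDiff ℝ 1 fun s : ℝ => g (t, x - s • (w - b), w) := fun w =>
        (hg.of_le (by norm_num)).comp (by fun_prop)
      have hcont : Continuous fun w : ℝ × Vec d =>
          -deriv (fun s => g (t, x - s • (w.2 - b), w.2)) w.1 := by
        simp_rw [← hpt]
        exact (divForm d).continuous.comp
          (((hG.continuous_fderiv (by simp)).comp (by fun_prop)).clm_comp continuous_const)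
      have hi := hcont.continuousOn.integrableOn_compact hkc (μ := volume)
      rw [IntegrableOn, hk, Measure.volume_eq_prod, ← Measure.prod_restrict] at hi
      rw [hk, Measure.volume_eq_prod, ← Measure.prod_restrict, integral_prod_symm _ hi]
      refine Eq.trans ?_ (setIntegral_eq_integral_of_forall_compl_eq_zero
        (s := Metric.closedBall (0 : Vec d) R) ?_)
      · refine integral_congr_ae (Eventually.of_forall fun w => ?_)
        simp only
        rw [integral_neg, integral_Icc_eq_integral_Ioc, ← intervalIntegral.integral_of_le zero_le_one,
          intervalIntegral.integral_deriv_eq_sub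
            (fun s _ => ((hd1 w).differentiable (by simp)).differentiableAt)
            (((hd1 w).continuous_deriv (by simp)).intervalIntegrable _ _)]
        simp
      · intro w hw
        rw [hg0 t x w hw, hg0 t _ w hw, sub_zero]
    change ∑ i : Fin d, fderiv ℝ F (t, x) (0, EuclideanSpace.single i 1) i = _
    rw [← divForm_apply, h1.fderiv, ← ContinuousLinearMap.integral_comp_comm _ hint, ← hdiv]
    exact integral_congr_ae (Eventually.of_forall hpt)

end Divergence

end

noncomputable section

/-! ### Products of test functions and means over the domain -/

section Tensor

open Filter Topology

variable {d : ℕ} {Ω : Opens (Vec d)} {T : ℝ}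

lemma tsupport_tensor_subset (ψ : ℝ → ℝ) (ρ : Vec d → ℝ) :
    tsupport (fun z : ℝ × Vec d => ψ z.1 * ρ z.2) ⊆ tsupport ψ ×ˢ tsupport ρ :=
  closure_minimal (fun _ hz => ⟨subset_tsupport _ fun h => hz (by simp [h]),
    subset_tsupport _ fun h => hz (by simp [h])⟩)
    ((isClosed_tsupport ψ).prod (isClosed_tsupport ρ))

/-- The test function `(t, x) ↦ ψ(t) ρ(x)`. -/
def testTensor (ψ : 𝓓(timeInterval T, ℝ)) (ρ : 𝓓(Ω, ℝ)) : 𝓓(spaceTime Ω T, ℝ) where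
  toFun z := ψ z.1 * ρ z.2
  contDiff' := (ψ.contDiff.comp contDiff_fst).mul (ρ.contDiff.comp contDiff_snd)
  hasCompactSupport' := HasCompactSupport.of_support_subset_isCompact
    (ψ.hasCompactSupport.isCompact.prod ρ.hasCompactSupport.isCompact)
    ((subset_tsupport _).trans (tsupport_tensor_subset ψ ρ))
  tsupport_subset' := (tsupport_tensor_subset ψ ρ).trans
    (prod_mono ψ.tsupport_subset ρ.tsupport_subset)

lemma testTensor_apply (ψ : 𝓓(timeInterval T, ℝ)) (ρ : 𝓓(Ω, ℝ)) (z : ℝ × Vec d) :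
    testTensor ψ ρ z = ψ z.1 * ρ z.2 := rfl

lemma norm_iteratedFDeriv_comp_fst_le {g : ℝ → ℝ} (hg : ContDiff ℝ ((⊤ : ℕ∞) : WithTop ℕ∞) g)
    (i : ℕ) (z : ℝ × Vec d) :
    ‖iteratedFDeriv ℝ i (fun z : ℝ × Vec d => g z.1) z‖ ≤ ‖iteratedFDeriv ℝ i g z.1‖ := by
  have h := (ContinuousLinearMap.fst ℝ ℝ (Vec d)).iteratedFDeriv_comp_right hg z (i := i)
    (by exact_mod_cast le_top)
  change ‖iteratedFDeriv ℝ i (g ∘ ContinuousLinearMap.fst ℝ ℝ (Vec d)) z‖ ≤ _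
  rw [h]
  refine (ContinuousMultilinearMap.norm_compContinuousLinearMap_le _ _).trans ?_
  refine mul_le_of_le_one_right (norm_nonneg _) ?_
  exact Finset.prod_le_one (fun _ _ => norm_nonneg _)
    fun _ _ => ContinuousLinearMap.norm_fst_le ℝ ℝ (Vec d)

/-- The continuous linear map `ψ ↦ ψ ⊗ ρ`. -/
def tensorCLM (ρ : 𝓓(Ω, ℝ)) : 𝓓(timeInterval T, ℝ) →L[ℝ] 𝓓(spaceTime Ω T, ℝ) :=
  TestFunction.mkCLM ℝ (fun ψ => testTensor ψ ρ)
    (fun f g => by ext z; simp [testTensor_apply, add_mul])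
    (fun c f => by ext z; simp [testTensor_apply, mul_assoc])
    (fun K hK => by
      let K' : Compacts (ℝ × Vec d) :=
        ⟨(K : Set ℝ) ×ˢ tsupport ρ, K.isCompact.prod ρ.hasCompactSupport.isCompact⟩
      have hK' : (K' : Set (ℝ × Vec d)) ⊆ spaceTime Ω T := prod_mono hK ρ.tsupport_subset
      let Φ : 𝓓^{(⊤ : ℕ∞)}_{K}(ℝ, ℝ) →ₗ[ℝ] 𝓓^{(⊤ : ℕ∞)}_{K'}(ℝ × Vec d, ℝ) :=
        { toFun := fun f => ⟨fun z => f z.1 * ρ z.2,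
            (f.contDiff.comp contDiff_fst).mul (ρ.contDiff.comp contDiff_snd), fun z hz => by
              by_cases h1 : z.1 ∈ (K : Set ℝ)
              · have : z.2 ∉ tsupport ρ := fun h2 => hz ⟨h1, h2⟩
                simp [image_eq_zero_of_notMem_tsupport this]
              · have : f z.1 = 0 := f.zero_on_compl h1
                simp [this]⟩
          map_add' := fun f g => by ext z; exact add_mul (f z.1) (g z.1) (ρ z.2)
          map_smul' := fun c f => by ext z; exact mul_assoc c (f z.1) (ρ z.2) }
      have hΦ : Continuous Φ := by
        -- By the Leibniz rule a derivative of the product is a sum of derivatives of f, estimated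
        -- by its seminorms, times derivatives of ρ, which are bounded on the compact set K'.
        refine WithSeminorms.continuous_of_isBounded
          (ContDiffMapSupportedIn.withSeminorms ℝ ..) (ContDiffMapSupportedIn.withSeminorms ℝ ..) _
          (.of_real fun n => ?_)
        have hρs : ContDiff ℝ ((⊤ : ℕ∞) : WithTop ℕ∞) fun z : ℝ × Vec d => ρ z.2 :=
          ρ.contDiff.comp contDiff_snd
        have hb : ∀ j : ℕ, ∃ C, ∀ z ∈ (K' : Set (ℝ × Vec d)),
            ‖iteratedFDeriv ℝ j (fun z : ℝ × Vec d => ρ z.2) z‖ ≤ C := fun j =>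
          K'.isCompact.exists_bound_of_continuousOn
            (hρs.continuous_iteratedFDeriv (by exact_mod_cast le_top)).continuousOn
        choose C hC using hb
        refine ⟨Finset.range (n + 1),
          ∑ i ∈ Finset.range (n + 1), (n.choose i : ℝ) * |C (n - i)|, fun f => ?_⟩
        set s := (Finset.range (n + 1)).sup
          fun j => ContDiffMapSupportedIn.seminorm ℝ ℝ ℝ (⊤ : ℕ∞) K j with hs
        have h0 : 0 ≤ (∑ i ∈ Finset.range (n + 1), (n.choose i : ℝ) * |C (n - i)|) * s f :=
          mul_nonneg (Finset.sum_nonneg fun i _ => by positivity) (apply_nonneg _ _)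
        refine (ContDiffMapSupportedIn.seminorm_le_iff ℝ h0 n (Φ f)).2 fun _ z hz => ?_
        refine (norm_iteratedFDeriv_mul_le (n := n) (f.contDiff.comp contDiff_fst) hρs z
          (by exact_mod_cast le_top)).trans ?_
        rw [Finset.sum_mul]
        refine Finset.sum_le_sum fun i hi => ?_
        have h1 : ‖iteratedFDeriv ℝ i (fun z : ℝ × Vec d => f z.1) z‖ ≤ s f :=
          (norm_iteratedFDeriv_comp_fst_le f.contDiff i z).trans
            ((ContDiffMapSupportedIn.norm_iteratedFDeriv_apply_le_seminorm_top ℝ).trans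
              (Seminorm.le_finset_sup_apply hi))
        have h2 := (hC (n - i) z hz).trans (le_abs_self _)
        calc _ ≤ (n.choose i : ℝ) * s f * |C (n - i)| := by
              gcongr
              exact h1
          _ = _ := by ring
      exact (TestFunction.continuous_ofSupportedIn hK').comp hΦ)

lemma tensorCLM_apply (ρ : 𝓓(Ω, ℝ)) (ψ : 𝓓(timeInterval T, ℝ)) :
    tensorCLM ρ ψ = testTensor ψ ρ := rfl

/-- The test function `t ↦ ∫ χ(t, x) dx`. -/
def timeMean (χ : 𝓓(spaceTime Ω T, ℝ)) : 𝓓(timeInterval T, ℝ) where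
  -- Integration over the compact projection of the support, and not over Ω, makes
  -- `contDiff_setIntegral_param` applicable.
  toFun t := ∫ x in Prod.snd '' tsupport χ, χ (t, x)
  contDiff' := contDiff_setIntegral_param χ.contDiff
    (χ.hasCompactSupport.isCompact.image continuous_snd)
  hasCompactSupport' := by
    refine HasCompactSupport.intro (χ.hasCompactSupport.isCompact.image continuous_fst)
      fun t ht => setIntegral_eq_zero_of_forall_eq_zero fun x _ => ?_
    by_contra h
    exact ht ⟨(t, x), subset_tsupport _ h, rfl⟩
  tsupport_subset' := by
    refine Subset.trans (b := Prod.fst '' tsupport χ) (closure_minimal (fun t ht => ?_)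
      (χ.hasCompactSupport.isCompact.image continuous_fst).isClosed) ?_
    · by_contra hne
      refine ht (setIntegral_eq_zero_of_forall_eq_zero fun x _ => ?_)
      by_contra h
      exact hne ⟨(t, x), subset_tsupport _ h, rfl⟩
    · rintro _ ⟨z, hz, rfl⟩
      exact (χ.tsupport_subset hz).1

lemma timeMean_apply (χ : 𝓓(spaceTime Ω T, ℝ)) (t : ℝ) : timeMean χ t = ∫ x, χ (t, x) := by
  refine setIntegral_eq_integral_of_forall_compl_eq_zero fun x hx => ?_
  by_contra h
  exact hx ⟨(t, x), subset_tsupport _ h, rfl⟩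

lemma timeMean_apply_eq_setIntegral (χ : 𝓓(spaceTime Ω T, ℝ)) (t : ℝ) :
    timeMean χ t = ∫ x in Ω, χ (t, x) := by
  rw [timeMean_apply]
  refine (setIntegral_eq_integral_of_forall_compl_eq_zero fun x hx => ?_).symm
  by_contra h
  exact hx (χ.tsupport_subset (subset_tsupport _ h)).2

lemma integrable_test_slice (χ : 𝓓(spaceTime Ω T, ℝ)) (t : ℝ) : Integrable fun x => χ (t, x) := by
  have h : Continuous fun x => χ (t, x) := χ.continuous.comp (by fun_prop)
  refine h.integrable_of_hasCompactSupport ?_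
  refine HasCompactSupport.intro (χ.hasCompactSupport.isCompact.image continuous_snd) fun x hx => ?_
  by_contra h
  exact hx ⟨(t, x), subset_tsupport _ h, rfl⟩

lemma timeMean_sum {ι : Type} (s : Finset ι) (χ : ι → 𝓓(spaceTime Ω T, ℝ)) :
    timeMean (∑ i ∈ s, χ i) = ∑ i ∈ s, timeMean (χ i) := by
  ext t
  have h : ∀ z, (∑ i ∈ s, χ i) z = ∑ i ∈ s, χ i z := fun z => by simp
  rw [timeMean_apply, show (∑ i ∈ s, timeMean (χ i)) t = ∑ i ∈ s, timeMean (χ i) t by simp]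
  simp_rw [h, timeMean_apply]
  exact integral_finsetSum _ fun i _ => integrable_test_slice (χ i) t

lemma timeMean_testTensor (ψ : 𝓓(timeInterval T, ℝ)) (ρ : 𝓓(Ω, ℝ)) (hρ : ∫ x, ρ x = 1) :
    timeMean (testTensor ψ ρ) = ψ := by
  ext t
  simp_rw [timeMean_apply, testTensor_apply]
  rw [integral_const_mul, hρ, mul_one]

end Tensor

end

noncomputable section

/-! ### Distributions that vanish on divergences -/

section VanishOnDivergence

open Filter Topology Metric

variable {d : ℕ} {Ω : Opens (Vec d)} {T : ℝ}

lemma exists_test_integral_eq_one {y : Vec d} {r : ℝ} (hr : 0 < r)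
    (hΩ : closedBall y r ⊆ (Ω : Set (Vec d))) :
    ∃ ρ : 𝓓(Ω, ℝ), ∫ x, ρ x = 1 ∧ tsupport ρ ⊆ closedBall y r := by
  let ρ : Vec d → ℝ := fun x => (bumpOfRadius (E := Vec d) hr).normed volume (x - y)
  have hs : tsupport ρ ⊆ closedBall y r := by
    refine closure_minimal (fun x hx => ?_) isClosed_closedBall
    have h := subset_tsupport _ (show x - y ∈ Function.support
      ((bumpOfRadius (E := Vec d) hr).normed volume) from hx)
    rw [ContDiffBump.tsupport_normed_eq, mem_closedBall_zero_iff] at h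
    rw [mem_closedBall, dist_eq_norm]
    exact h
  refine ⟨⟨ρ, (ContDiffBump.contDiff_normed _).comp (by fun_prop),
    HasCompactSupport.of_support_subset_isCompact (isCompact_closedBall y r)
      ((subset_tsupport _).trans hs), hs.trans hΩ⟩, ?_, hs⟩
  exact (integral_sub_right_eq_self _ y).trans (ContDiffBump.integral_normed _)

/-- A distribution that vanishes on divergences takes the same value at a test function supported
near `y` and at the product of its mean with a bump function at `y`. -/
lemma apply_eq_apply_testTensor {q : 𝓓'(spaceTime Ω T, ℝ)}
    (hq : ∀ φ : 𝓓(spaceTime Ω T, Vec d), q (divX φ) = 0) {y : Vec d} {r ε : ℝ}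
    (hΩ : closedBall y (r + ε) ⊆ (Ω : Set (Vec d))) (ρ : 𝓓(Ω, ℝ))
    (hρ : ∫ x, ρ x = 1) (hρs : tsupport ρ ⊆ closedBall y ε) (χ : 𝓓(spaceTime Ω T, ℝ))
    (hχ : ∀ z ∈ tsupport χ, z.2 ∈ closedBall y r) :
    q χ = q (testTensor (timeMean χ) ρ) := by
  have hsm : ∀ s ∈ Icc (0 : ℝ) 1, ∀ v : Vec d, ‖s • v‖ ≤ ‖v‖ := fun s hs v => by
    rw [norm_smul, Real.norm_of_nonneg hs.1]
    exact mul_le_of_le_one_left (norm_nonneg _) hs.2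
  have hsub : ∀ {g : ℝ × Vec d × Vec d → ℝ} {k : Set (ℝ × Vec d × Vec d)}, IsCompact k →
      Function.support g ⊆ k → HasCompactSupport g ∧ tsupport g ⊆ k := fun hk h =>
    ⟨HasCompactSupport.of_support_subset_isCompact hk h, closure_minimal h hk.isClosed⟩
  obtain ⟨hA1, hA2⟩ := hsub (g := fun z => χ (z.1, z.2.1) * ρ z.2.2)
    (k := (fun p : (ℝ × Vec d) × Vec d => (p.1.1, p.1.2, p.2)) '' (tsupport χ ×ˢ tsupport ρ))
    ((χ.hasCompactSupport.isCompact.prod ρ.hasCompactSupport.isCompact).image (by fun_prop))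
    (fun z hz => ⟨((z.1, z.2.1), z.2.2), ⟨subset_tsupport _ fun h => hz (by simp [h]),
      subset_tsupport _ fun h => hz (by simp [h])⟩, rfl⟩)
  obtain ⟨hB1, hB2⟩ := hsub (g := fun z => ρ z.2.1 * χ (z.1, z.2.2))
    (k := (fun p : (ℝ × Vec d) × Vec d => (p.1.1, p.2, p.1.2)) '' (tsupport χ ×ˢ tsupport ρ))
    ((χ.hasCompactSupport.isCompact.prod ρ.hasCompactSupport.isCompact).image (by fun_prop))
    (fun z hz => ⟨((z.1, z.2.2), z.2.1), ⟨subset_tsupport _ fun h => hz (by simp [h]),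
      subset_tsupport _ fun h => hz (by simp [h])⟩, rfl⟩)
  have hmem : ∀ p ∈ tsupport χ ×ˢ tsupport ρ, ‖p.1.2 - y‖ ≤ r ∧ ‖p.2 - y‖ ≤ ε := fun p hp => by
    rw [← dist_eq_norm, ← dist_eq_norm]
    exact ⟨hχ p.1 hp.1, hρs hp.2⟩
  -- Two fields are used, one with density χ(t,x) ρ(w) and one with the roles of χ and ρ exchanged.
  -- Their divergences are χ and (mean of χ) ρ, each minus an integral; both integrals are the same
  -- convolution of χ and ρ recentred at y. Hence χ minus its mean times ρ is a difference of two
  -- divergences. The displaced points lie in the ball of radius r + ε.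
  obtain ⟨φ, hφ⟩ := exists_divX_eq_integral (Ω := Ω) (T := T)
    (g := fun z => χ (z.1, z.2.1) * ρ z.2.2)
    ((χ.contDiff.comp (by fun_prop)).mul (ρ.contDiff.comp (by fun_prop))) hA1 y (by
      intro z hz s hs
      obtain ⟨p, hp, rfl⟩ := hA2 hz
      refine ⟨(χ.tsupport_subset hp.1).1, hΩ ?_⟩
      rw [mem_closedBall, dist_eq_norm,
        show p.1.2 + s • (p.2 - y) - y = (p.1.2 - y) + s • (p.2 - y) by abel]
      exact (norm_add_le _ _).trans (add_le_add (hmem p hp).1 ((hsm s hs _).trans (hmem p hp).2)))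
  obtain ⟨φ', hφ'⟩ := exists_divX_eq_integral (Ω := Ω) (T := T)
    (g := fun z => ρ z.2.1 * χ (z.1, z.2.2))
    ((ρ.contDiff.comp (by fun_prop)).mul (χ.contDiff.comp (by fun_prop))) hB1 y (by
      intro z hz s hs
      obtain ⟨p, hp, rfl⟩ := hB2 hz
      refine ⟨(χ.tsupport_subset hp.1).1, hΩ ?_⟩
      rw [mem_closedBall, dist_eq_norm,
        show p.2 + s • (p.1.2 - y) - y = s • (p.1.2 - y) + (p.2 - y) by abel]
      exact (norm_add_le _ _).trans (add_le_add ((hsm s hs _).trans (hmem p hp).1) (hmem p hp).2))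
  have hρi : Integrable ρ := ρ.continuous.integrable_of_hasCompactSupport ρ.hasCompactSupport
  obtain ⟨C, hC⟩ := ρ.continuous.bounded_above_of_compact_support ρ.hasCompactSupport
  have key : χ - testTensor (timeMean χ) ρ = divX φ - divX φ' := by
    ext ⟨t, x⟩
    have i1 : Integrable fun w => χ (t, x) * ρ w := hρi.const_mul _
    have i2 : Integrable fun w => ρ x * χ (t, w) := (integrable_test_slice χ t).const_mul _
    have i3 : Integrable fun w => ρ (x - (w - y)) * χ (t, w) :=
      (integrable_test_slice χ t).bdd_mul
        (ρ.continuous.comp (by fun_prop)).aestronglyMeasurable (Eventually.of_forall fun w => hC _)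
    have i4 : Integrable fun w => χ (t, x - (w - y)) * ρ w := by
      have := (i3.comp_sub_left (x + y))
      refine this.congr (Eventually.of_forall fun w => ?_)
      simp only
      rw [show x - (x + y - w - y) = w by abel, show x + y - w = x - (w - y) by abel, mul_comm]
    have e4 : ∫ w, χ (t, x - (w - y)) * ρ w = ∫ w, ρ (x - (w - y)) * χ (t, w) := by
      rw [← integral_sub_left_eq_self (fun w => ρ (x - (w - y)) * χ (t, w)) volume (x + y)]
      refine integral_congr_ae (Eventually.of_forall fun w => ?_)
      simp only
      rw [show x - (x + y - w - y) = w by abel, show x + y - w = x - (w - y) by abel, mul_comm]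
    change χ (t, x) - timeMean χ t * ρ x = divX φ (t, x) - divX φ' (t, x)
    rw [hφ, hφ']
    simp only
    rw [integral_sub i1 i4, integral_sub i2 i3, e4, integral_const_mul, integral_const_mul, hρ,
      timeMean_apply]
    ring
  have h := congrArg q key
  rw [map_sub, map_sub, hq, hq, sub_zero] at h
  exact sub_eq_zero.1 h

/-- Both values equal the value at the common mean times one auxiliary bump. The doubled ball leaves
room for sums of two displacements of length at most r. -/
lemma apply_eq_apply_of_timeMean_eq {q : 𝓓'(spaceTime Ω T, ℝ)}
    (hq : ∀ φ : 𝓓(spaceTime Ω T, Vec d), q (divX φ) = 0) {y : Vec d} {r : ℝ} (hr : 0 < r)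
    (hΩ : closedBall y (2 * r) ⊆ (Ω : Set (Vec d))) {χ₁ χ₂ : 𝓓(spaceTime Ω T, ℝ)}
    (h₁ : ∀ z ∈ tsupport χ₁, z.2 ∈ closedBall y r) (h₂ : ∀ z ∈ tsupport χ₂, z.2 ∈ closedBall y r)
    (h : timeMean χ₁ = timeMean χ₂) : q χ₁ = q χ₂ := by
  obtain ⟨ρ, hρ, hρs⟩ := exists_test_integral_eq_one hr
    ((closedBall_subset_closedBall (by linarith)).trans hΩ)
  rw [two_mul] at hΩ
  rw [apply_eq_apply_testTensor hq hΩ ρ hρ hρs χ₁ h₁,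
    apply_eq_apply_testTensor hq hΩ ρ hρ hρs χ₂ h₂, h]

lemma mem_of_mem_tsupport_testTensor {ψ : 𝓓(timeInterval T, ℝ)} {ρ : 𝓓(Ω, ℝ)} {s : Set (Vec d)}
    (hs : tsupport ρ ⊆ s) : ∀ z ∈ tsupport (testTensor ψ ρ), z.2 ∈ s :=
  fun _ hz => hs (tsupport_tensor_subset ψ ρ hz).2

/-- On a connected open set, a distribution that vanishes on the divergences is locally determined
by the means of the test functions. -/
lemma exists_ball_apply_eq_of_isConnected {q : 𝓓'(spaceTime Ω T, ℝ)}
    (hq : ∀ φ : 𝓓(spaceTime Ω T, Vec d), q (divX φ) = 0)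
    (hconn : IsConnected (Ω : Set (Vec d))) :
    ∃ ρ : 𝓓(Ω, ℝ), ∫ x, ρ x = 1 ∧ ∀ y ∈ Ω, ∃ r > 0, ∀ χ : 𝓓(spaceTime Ω T, ℝ),
      (∀ z ∈ tsupport χ, z.2 ∈ ball y r) → q χ = q (testTensor (timeMean χ) ρ) := by
  have hball : ∀ y ∈ Ω, ∃ r > 0, closedBall y (2 * r) ⊆ (Ω : Set (Vec d)) := fun y hy => by
    obtain ⟨R, hR, h⟩ := nhds_basis_closedBall.mem_iff.1 (Ω.isOpen.mem_nhds hy)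
    exact ⟨R / 2, by positivity, by rwa [mul_div_cancel₀ _ two_ne_zero]⟩
  obtain ⟨x₀, hx₀⟩ := hconn.nonempty
  obtain ⟨r₀, hr₀, hr₀Ω⟩ := hball x₀ hx₀
  obtain ⟨ρ, hρ, hρs⟩ := exists_test_integral_eq_one hr₀
    ((closedBall_subset_closedBall (by linarith)).trans hr₀Ω)
  refine ⟨ρ, hρ, ?_⟩
  -- A is open and contains the reference point x₀. It remains to see that it is closed relative to
  -- Ω; connectedness then gives all of Ω.
  let A : Set (Vec d) := {y | ∃ r > 0, ∀ χ : 𝓓(spaceTime Ω T, ℝ),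
    (∀ z ∈ tsupport χ, z.2 ∈ ball y r) → q χ = q (testTensor (timeMean χ) ρ)}
  have hA : IsOpen A := by
    refine Metric.isOpen_iff.2 fun y ⟨r, hr, h⟩ => ⟨r, hr, fun y' hy' => ?_⟩
    refine ⟨r - dist y' y, sub_pos.2 hy', fun χ hχ => h χ fun z hz => ?_⟩
    exact ball_subset (by simp) (hχ z hz)
  have hx₀A : x₀ ∈ A := ⟨r₀, hr₀, fun χ hχ =>
    apply_eq_apply_of_timeMean_eq hq hr₀ hr₀Ω (fun z hz => ball_subset_closedBall (hχ z hz))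
      (mem_of_mem_tsupport_testTensor hρs) (timeMean_testTensor _ _ hρ).symm⟩
  refine fun y hy => hconn.isPreconnected.subset_of_closure_inter_subset hA ⟨x₀, hx₀, hx₀A⟩ ?_ hy
  rintro y ⟨hyA, hyΩ⟩
  obtain ⟨R, hR, hRΩ⟩ := hball y hyΩ
  obtain ⟨y', ⟨r', hr', h'⟩, hyy'⟩ := Metric.mem_closure_iff.1 hyA R hR
  obtain ⟨s, hs, hsR, hsr⟩ : ∃ s > 0, s ≤ R - dist y y' ∧ s < r' :=
    ⟨min (R - dist y y') (r' / 2), lt_min (sub_pos.2 hyy') (by positivity), min_le_left _ _,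
      (min_le_right _ _).trans_lt (half_lt_self hr')⟩
  have hsub : closedBall y' s ⊆ closedBall y R :=
    closedBall_subset_closedBall' (by rw [dist_comm]; linarith)
  -- A bump ρ' supported both near y and in the ball around y' ∈ A. Near y the test function is
  -- exchanged for its mean times ρ' by the local statement; near y' this product is exchanged for
  -- the mean times ρ.
  obtain ⟨ρ', hρ', hρs'⟩ := exists_test_integral_eq_one hs
    ((hsub.trans (closedBall_subset_closedBall (by linarith))).trans hRΩ)
  refine ⟨R, hR, fun χ hχ => ?_⟩
  rw [apply_eq_apply_of_timeMean_eq hq hR hRΩ (fun z hz => ball_subset_closedBall (hχ z hz))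
    (mem_of_mem_tsupport_testTensor (hρs'.trans hsub)) (timeMean_testTensor _ _ hρ').symm,
    h' _ (mem_of_mem_tsupport_testTensor (hρs'.trans (closedBall_subset_ball hsr))),
    timeMean_testTensor _ _ hρ']

/-- The product of a test function with a smooth function of the position. -/
def smulTest (f : Vec d → ℝ) (hf : ContDiff ℝ ((⊤ : ℕ∞) : WithTop ℕ∞) f)
    (χ : 𝓓(spaceTime Ω T, ℝ)) : 𝓓(spaceTime Ω T, ℝ) where
  toFun z := f z.2 * χ z
  contDiff' := (hf.comp contDiff_snd).mul χ.contDiff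
  hasCompactSupport' := χ.hasCompactSupport.mul_left
  tsupport_subset' := (tsupport_mul_subset_right).trans χ.tsupport_subset

/-- A partition of unity in x on the projection of the support cuts χ into finitely many pieces,
each supported over one of the balls. The pieces are then added up, since both the mean and ψ ↦ ψ ⊗
ρ are additive. -/
lemma exists_apply_eq_testTensor {q : 𝓓'(spaceTime Ω T, ℝ)}
    (hq : ∀ φ : 𝓓(spaceTime Ω T, Vec d), q (divX φ) = 0)
    (hconn : IsConnected (Ω : Set (Vec d))) :
    ∃ ρ : 𝓓(Ω, ℝ), ∀ χ : 𝓓(spaceTime Ω T, ℝ), q χ = q (testTensor (timeMean χ) ρ) := by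
  obtain ⟨ρ, -, h⟩ := exists_ball_apply_eq_of_isConnected hq hconn
  refine ⟨ρ, fun χ => ?_⟩
  choose! r hr h using h
  have hK : IsCompact (Prod.snd '' tsupport χ) :=
    χ.hasCompactSupport.isCompact.image continuous_snd
  have hKΩ : Prod.snd '' tsupport χ ⊆ (Ω : Set (Vec d)) := by
    rintro _ ⟨z, hz, rfl⟩
    exact (χ.tsupport_subset hz).2
  obtain ⟨s, hs, hsK⟩ := hK.elim_nhds_subcover (fun y => ball y (r y))
    fun y hy => ball_mem_nhds y (hr y (hKΩ hy))
  obtain ⟨f, hf⟩ := SmoothPartitionOfUnity.exists_isSubordinate (modelWithCornersSelf ℝ (Vec d))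
    hK.isClosed (fun y : s => ball (y : Vec d) (r y)) (fun _ => isOpen_ball)
    (fun x hx => by
      obtain ⟨y, hy, hxy⟩ := mem_iUnion₂.1 (hsK hx)
      exact mem_iUnion.2 ⟨⟨y, hy⟩, hxy⟩)
  have hsum : χ = ∑ i, smulTest (f i) (f i).contMDiff.contDiff χ := by
    ext z
    have h1 : (∑ i, smulTest (f i) (f i).contMDiff.contDiff χ) z = ∑ i, f i z.2 * χ z := by
      simp [smulTest]
    rw [h1, ← Finset.sum_mul]
    by_cases hz : z ∈ tsupport χ
    · have h2 := f.sum_eq_one ⟨z, hz, rfl⟩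
      rw [finsum_eq_sum_of_fintype] at h2
      rw [h2, one_mul]
    · rw [image_eq_zero_of_notMem_tsupport hz, mul_zero]
  have hi : ∀ i, q (smulTest (f i) (f i).contMDiff.contDiff χ) =
      q (testTensor (timeMean (smulTest (f i) (f i).contMDiff.contDiff χ)) ρ) := fun i => by
    refine h i (hKΩ (hs i i.2)) _ fun z hz => hf i ?_
    have h1 : Function.support (smulTest (f i) (f i).contMDiff.contDiff χ) ⊆
        Prod.snd ⁻¹' tsupport (f i) := fun z hz => subset_tsupport _ fun h0 => hz (by
      change f i z.2 * χ z = 0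
      rw [h0, zero_mul])
    exact closure_minimal h1 ((isClosed_tsupport (f i)).preimage continuous_snd) hz
  conv_rhs => rw [hsum, timeMean_sum, ← tensorCLM_apply, map_sum, map_sum]
  conv_lhs => rw [hsum, map_sum]
  exact Finset.sum_congr rfl fun i _ => hi i

/-- A distribution on `(0, T) × Ω` whose spatial gradient vanishes depends on time only. -/
theorem dependsOnTimeOnly_of_apply_divX_eq_zero {q : 𝓓'(spaceTime Ω T, ℝ)}
    (hq : ∀ φ : 𝓓(spaceTime Ω T, Vec d), q (divX φ) = 0)
    (hconn : IsConnected (Ω : Set (Vec d))) : DependsOnTimeOnly q := by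
  obtain ⟨ρ, h⟩ := exists_apply_eq_testTensor hq hconn
  -- The distribution in time is c(ψ) = q(ψ ⊗ ρ); its continuity is that of `tensorCLM`.
  refine ⟨(q : 𝓓(spaceTime Ω T, ℝ) →L[ℝ] ℝ).comp (tensorCLM ρ), fun χ ψ hψ => ?_⟩
  have : ψ = timeMean χ := by
    ext t
    rw [hψ, timeMean_apply_eq_setIntegral]
  rw [h χ, this]
  rfl

end VanishOnDivergence

end

noncomputable section

/-! ### The pressure -/

section Pressure

open Filter Topology

variable {d : ℕ} {Ω : Opens (Vec d)} {T : ℝ}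

lemma locallyIntegrableOn_comp_fst {c : ℝ → ℝ} (hc : LocallyIntegrableOn c (Ioo 0 T)) :
    LocallyIntegrableOn (fun z : ℝ × Vec d => c z.1) (spaceTime Ω T : Set (ℝ × Vec d)) := by
  refine (locallyIntegrableOn_iff (spaceTime Ω T).isOpen.isLocallyClosed).2 fun k hk hkc => ?_
  have h1 : IntegrableOn c (Prod.fst '' k) := by
    refine hc.integrableOn_compact_subset ?_ (hkc.image continuous_fst)
    rintro _ ⟨z, hz, rfl⟩
    exact (hk hz).1
  have h2 : IsFiniteMeasure (volume.restrict (Prod.snd '' k) : Measure (Vec d)) :=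
    ⟨by rw [Measure.restrict_apply_univ]; exact (hkc.image continuous_snd).measure_lt_top⟩
  have h3 : Integrable (fun z : ℝ × Vec d => c z.1)
      ((volume.restrict (Prod.fst '' k)).prod (volume.restrict (Prod.snd '' k))) :=
    Integrable.comp_fst h1 _
  rw [Measure.prod_restrict] at h3
  exact IntegrableOn.mono_set h3 fun z hz => ⟨⟨z, hz, rfl⟩, ⟨z, hz, rfl⟩⟩

lemma locallyIntegrableOn_setIntegral {Q : ℝ → Vec d → ℝ}
    (hQ : LocallyIntegrableOn (fun z : ℝ × Vec d => Q z.1 z.2) (spaceTime Ω T : Set (ℝ × Vec d)))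
    (ρ : 𝓓(Ω, ℝ)) : LocallyIntegrableOn (fun t => ∫ x in Ω, Q t x * ρ x) (Ioo 0 T) := by
  refine (locallyIntegrableOn_iff isOpen_Ioo.isLocallyClosed).2 fun k hk hkc => ?_
  have h1 := hQ.integrableOn_compact_subset (prod_mono hk ρ.tsupport_subset)
    (hkc.prod ρ.hasCompactSupport.isCompact)
  obtain ⟨C, hC⟩ := ρ.continuous.bounded_above_of_compact_support ρ.hasCompactSupport
  have h2 : IntegrableOn (fun z : ℝ × Vec d => Q z.1 z.2 * ρ z.2) (k ×ˢ tsupport ρ) :=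
    Integrable.mul_bdd h1 (ρ.continuous.comp continuous_snd).aestronglyMeasurable
      (Eventually.of_forall fun z => hC z.2)
  rw [IntegrableOn, Measure.volume_eq_prod, ← Measure.prod_restrict] at h2
  refine h2.integral_prod_left.congr (Eventually.of_forall fun t => ?_)
  simp only
  have h0 : ∀ x ∉ tsupport ρ, Q t x * ρ x = 0 := fun x hx => by
    rw [image_eq_zero_of_notMem_tsupport hx, mul_zero]
  rw [setIntegral_eq_integral_of_forall_compl_eq_zero h0,
    setIntegral_eq_integral_of_forall_compl_eq_zero fun x hx =>
      h0 x fun h => hx (ρ.tsupport_subset h)]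

lemma IsFunction.sub {p₁ p₂ : 𝓓'(spaceTime Ω T, ℝ)} {P₁ P₂ : ℝ → Vec d → ℝ}
    (h₁ : IsFunction p₁ P₁) (h₂ : IsFunction p₂ P₂) :
    IsFunction (p₁ - p₂) fun t x => P₁ t x - P₂ t x := by
  refine ⟨h₁.1.sub h₂.1, fun χ => ?_⟩
  have h := fun {P : ℝ → Vec d → ℝ} (hP : LocallyIntegrableOn (fun z : ℝ × Vec d => P z.1 z.2)
    (spaceTime Ω T : Set (ℝ × Vec d))) => integrableOn_mul_of_hasCompactSupport hP χ.continuous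
      χ.hasCompactSupport χ.tsupport_subset
  change p₁ χ - p₂ χ = _
  rw [h₁.2 χ, h₂.2 χ, ← integral_sub (h h₁.1) (h h₂.1)]
  simp only [sub_mul]

lemma integral_spaceTime_eq {g : ℝ × Vec d → ℝ}
    (hg : IntegrableOn g (spaceTime Ω T : Set (ℝ × Vec d))) :
    ∫ z in (spaceTime Ω T : Set (ℝ × Vec d)), g z = ∫ t in Ioo 0 T, ∫ x in Ω, g (t, x) := by
  rw [IntegrableOn, volume_restrict_spaceTime] at hg
  rw [volume_restrict_spaceTime, integral_prod _ hg]

/-- The function c(t) = ∫ Q(t,x) ρ(x) dx represents ψ ↦ q(ψ ⊗ ρ). By Fubini, Q and c have the same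
integral against every test function, and the fundamental lemma of the calculus of variations gives
equality almost everywhere. -/
lemma exists_ae_eq_of_apply_divX_eq_zero {q : 𝓓'(spaceTime Ω T, ℝ)}
    (hq : ∀ φ : 𝓓(spaceTime Ω T, Vec d), q (divX φ) = 0)
    (hconn : IsConnected (Ω : Set (Vec d))) {Q : ℝ → Vec d → ℝ} (hQ : IsFunction q Q) :
    ∃ c : ℝ → ℝ, LocallyIntegrableOn c (Ioo 0 T) ∧
      ∀ᵐ z ∂volume.restrict (spaceTime Ω T : Set (ℝ × Vec d)), Q z.1 z.2 = c z.1 := by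
  obtain ⟨ρ, h⟩ := exists_apply_eq_testTensor hq hconn
  have hc := locallyIntegrableOn_setIntegral hQ.1 ρ
  refine ⟨_, hc, ?_⟩
  have hcl := locallyIntegrableOn_comp_fst (Ω := Ω) hc
  have hint := fun {P : ℝ × Vec d → ℝ} (hP : LocallyIntegrableOn P
    (spaceTime Ω T : Set (ℝ × Vec d))) (χ : 𝓓(spaceTime Ω T, ℝ)) =>
      integrableOn_mul_of_hasCompactSupport hP χ.continuous χ.hasCompactSupport χ.tsupport_subset
  have h0 : ∀ᵐ z, z ∈ (spaceTime Ω T : Set (ℝ × Vec d)) →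
      Q z.1 z.2 - ∫ x in Ω, Q z.1 x * ρ x = 0 := by
    refine (spaceTime Ω T).isOpen.ae_eq_zero_of_integral_contDiff_smul_eq_zero
      (hQ.1.sub hcl) fun φ hφ hφc hφs => ?_
    let χ : 𝓓(spaceTime Ω T, ℝ) := ⟨φ, hφ, hφc, hφs⟩
    have e1 : ∫ z in (spaceTime Ω T : Set (ℝ × Vec d)), Q z.1 z.2 * χ z =
        ∫ t in Ioo 0 T, timeMean χ t * ∫ x in Ω, Q t x * ρ x := by
      rw [← hQ.2, h χ, hQ.2, integral_spaceTime_eq (hint hQ.1 _)]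
      refine integral_congr_ae (Eventually.of_forall fun t => ?_)
      simp only [testTensor_apply]
      rw [← integral_const_mul]
      refine integral_congr_ae (Eventually.of_forall fun x => ?_)
      simp only
      ring
    have e2 : ∫ z in (spaceTime Ω T : Set (ℝ × Vec d)), (∫ x in Ω, Q z.1 x * ρ x) * χ z =
        ∫ t in Ioo 0 T, timeMean χ t * ∫ x in Ω, Q t x * ρ x := by
      rw [integral_spaceTime_eq (hint hcl χ)]
      refine integral_congr_ae (Eventually.of_forall fun t => ?_)
      simp only
      rw [integral_const_mul, timeMean_apply_eq_setIntegral, mul_comm]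
    have e3 := integral_sub (hint hQ.1 χ) (hint hcl χ)
    rw [e1, e2, sub_self] at e3
    rw [← setIntegral_eq_integral_of_forall_compl_eq_zero
      (s := (spaceTime Ω T : Set (ℝ × Vec d)))]
    · refine Eq.trans (integral_congr_ae (Eventually.of_forall fun z => ?_)) e3
      change φ z * (Q z.1 z.2 - ∫ x in Ω, Q z.1 x * ρ x) =
        Q z.1 z.2 * φ z - (∫ x in Ω, Q z.1 x * ρ x) * φ z
      ring
    · intro z hz
      rw [image_eq_zero_of_notMem_tsupport fun hm => hz (hφs hm), zero_smul]
  rw [ae_restrict_iff' (spaceTime Ω T).isOpen.measurableSet]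
  filter_upwards [h0] with z hz hzΩ using sub_eq_zero.1 (hz hzΩ)

/-- All terms other than the pressure agree: the represented force F is the same, and the iterated
integrals coincide because their integrands agree for almost every t and almost every x. -/
lemma apply_divX_eq_of_pressureEquation {Re ω : ℝ} {F : ℝ → StrongDual ℝ (H10 Ω)}
    {u₁ u₂ : ℝ → Vec d → Vec d} {Du₁ Du₂ : ℝ → Vec d → Ten d} {p₁ p₂ : 𝓓'(spaceTime Ω T, ℝ)}
    {τ₁ τ₂ : ℝ → Vec d → Ten d}
    (h : ∀ᵐ t ∂volume.restrict (Ioo 0 T), ∀ᵐ x ∂volume.restrict (Ω : Set (Vec d)),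
      u₁ t x = u₂ t x ∧ Du₁ t x = Du₂ t x ∧ τ₁ t x = τ₂ t x)
    (h₁ : PressureEquation Ω T Re ω F u₁ Du₁ p₁ τ₁)
    (h₂ : PressureEquation Ω T Re ω F u₂ Du₂ p₂ τ₂) (φ : 𝓓(spaceTime Ω T, Vec d)) :
    p₁ (divX φ) = p₂ (divX φ) := by
  have h3 := (h₁ φ).trans (h₂ φ).symm
  refine sub_right_injective (h3.trans (congrArg (fun r => r - p₂ (divX φ)) ?_))
  refine integral_congr_ae (h.mono fun t ht => integral_congr_ae (ht.mono fun x hx => ?_))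
  simp only [hx.1, hx.2.1, hx.2.2]

end Pressure

end

/-! ### The uniqueness theorem -/

theorem mainTheorem2 {d : ℕ} (hd : 2 ≤ d) (Ω : Opens (Vec d))
    (hΩ_bdd : Bornology.IsBounded (Ω : Set (Vec d))) (hΩ_conn : IsConnected (Ω : Set (Vec d)))
    (hΩ_lip : HasLipschitzBoundary (Ω : Set (Vec d)))
    (T Re We ω : ℝ) (hT : 0 < T) (hRe : 0 < Re) (hWe : 0 < We) (hω : 0 ≤ ω) (hω' : ω < 1)
    (m : ℝ → ℝ) (hm : IsMemory m) (S : Ten d → Ten d) (hS : ContDiff ℝ 1 S)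
    (u₀ : Vec d → Vec d) (hu₀ : MemH Ω u₀)
    (Gold : ℝ → Vec d → Ten d) (hGold : PastClass Ω Gold)
    (f : ℝ → StrongDual ℝ (V Ω)) (hf : ForceClass Ω T f)
    (F : ℝ → StrongDual ℝ (H10 Ω)) (hF : RepresentsForce Ω T f F)
    (u₁ u₂ : ℝ → Vec d → Vec d) (Du₁ Du₂ : ℝ → Vec d → Ten d)
    (p₁ p₂ : 𝓓'(spaceTime Ω T, ℝ)) (τ₁ τ₂ : ℝ → Vec d → Ten d)
    (G₁ G₂ : ℝ → ℝ → Vec d → Ten d)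
    (DG₁ DG₂ : ℝ → ℝ → Vec d → EuclideanSpace ℝ (Fin d × (Fin d × Fin d)))
    (hu₁ : VelocityClass Ω T u₁ Du₁) (hu₂ : VelocityClass Ω T u₂ Du₂)
    (hG₁ : DeformationClass Ω T G₁ DG₁) (hG₂ : DeformationClass Ω T G₂ DG₂)
    (hG₁_bdd : EssBounded Ω T G₁) (hG₂_bdd : EssBounded Ω T G₂)
    (h₁ : IsWeakSolution Ω T Re We ω m S u₀ Gold f F u₁ Du₁ p₁ τ₁ G₁ DG₁)
    (h₂ : IsWeakSolution Ω T Re We ω m S u₀ Gold f F u₂ Du₂ p₂ τ₂ G₂ DG₂) :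
    (∀ᵐ z ∂volume.restrict (spaceTime Ω T : Set (ℝ × Vec d)), u₁ z.1 z.2 = u₂ z.1 z.2) ∧
    (∀ᵐ z ∂volume.restrict (spaceTime Ω T : Set (ℝ × Vec d)), τ₁ z.1 z.2 = τ₂ z.1 z.2) ∧
    (∀ᵐ z ∂volume.restrict (ageCylinder Ω T), G₁ z.1 z.2.1 z.2.2 = G₂ z.1 z.2.1 z.2.2) ∧
    DependsOnTimeOnly (p₁ - p₂) ∧
    (∀ P₁ P₂ : ℝ → Vec d → ℝ, IsFunction p₁ P₁ → IsFunction p₂ P₂ →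
      ∃ c : ℝ → ℝ, LocallyIntegrableOn c (Ioo 0 T) ∧
        ∀ᵐ z ∂volume.restrict (spaceTime Ω T : Set (ℝ × Vec d)),
          P₁ z.1 z.2 - P₂ z.1 z.2 = c z.1) := by
  obtain ⟨hae, hu, hτ, hG⟩ := uniqueness_of_weak_solution hd hΩ_bdd hRe hω hω' hm hS hu₁ hu₂
    hG₁ hG₂ hG₁_bdd hG₂_bdd h₁ h₂
  have hq : ∀ φ : 𝓓(spaceTime Ω T, Vec d), (p₁ - p₂) (divX φ) = 0 := fun φ =>
    sub_eq_zero.2 (apply_divX_eq_of_pressureEquation hae h₁.pressure h₂.pressure φ)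
  refine ⟨hu, hτ, hG, dependsOnTimeOnly_of_apply_divX_eq_zero hq hΩ_conn, fun P₁ P₂ hP₁ hP₂ => ?_⟩
  exact exists_ae_eq_of_apply_divX_eq_zero hq hΩ_conn (hP₁.sub hP₂)
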